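/- Let $\Sigma$ be a $d\times d$ correlation matrix (positive semidefinite, unit diagonal), let $f_1,\dots,f_d:\mathbb R\to\mathbb R$ be strictly increasing, and let $Y_1,\dots,Y_n$ ($n\ge 2$) be i.i.d. copies of $(f_1(X_1),\dots,f_d(X_d))^T$, where $(X_1,\dots,X_d)^T\sim N(0,\Sigma)$ (Gaussian copula model). Let $\widehat T=(\hat\tau_{jk})$ and $\widehat R=(\hat\rho_{jk})$, where $$\hat\tau_{jk}=\frac{2}{n(n-1)}\sum_{1\le i<i'\le n}\operatorname{sgn}(Y_{ij}-Y_{i'j})\operatorname{sgn}(Y_{ik}-Y_{i'k}),$$ $$\hat\rho_{jk}=\frac{\sum_i (r_{ij}-\frac{n+1}2)(r_{ik}-\frac{n+1}2)}{\sqrt{\sum_i (r_{ij}-\frac{n+1}2)^2\,\sum_i (r_{ik}-\frac{n+1}2)^2}},$$ and $r_{ij}$ is the rank of $Y_{ij}$ among $Y_{1j},\dots,Y_{nj}$. Let $T=(\tau_{jk})$, $R=(\rho_{jk})$ be the population versions, $$\tau_{jk}=E\operatorname{sgn}(Y_{1j}-Y_{2j})\operatorname{sgn}(Y_{1k}-Y_{2k}),\qquad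 \rho_{jk}=3\,E\operatorname{sgn}(Y_{1j}-Y_{2j})\operatorname{sgn}(Y_{1k}-Y_{3k}),$$ where $Y_1,Y_2,Y_3$ here denote independent copies, and let $$\widehat\Sigma^\tau=\big(\sin(\tfrac{\pi}{2}\hat\tau_{jk})\big),\qquad \widehat\Sigma^\rho=\big(2\sin(\tfrac{\pi}{6}\hat\rho_{jk})\big).$$ Write $\|\cdot\|_S$ and $\|\cdot\|_F$ for the spectral and Frobenius norms, $x_+=\max(x,0)$, $n_2=2\lfloor n/2\rfloor$, $n_3=3\lfloor n/3\rfloor$. Then the expectations below are finite, and there is a numerical constant $C_0$ (not depending on $n,d,\Sigma,f_1,\dots,f_d$) such that, for both $\widehat\Sigma=\widehat\Sigma^\tau$ and $\widehat\Sigma=\widehat\Sigma^\rho$, $$E\|\widehat\Sigma-\Sigma\|_S+E\|\widehat T-T\|_S+E\|\widehat R-R\|_S\le C_0\|\Sigma\|_S\Big(\sqrt{d/n}+d/n\Big).$$ In particular, for Kendall's tau, $$E\|\widehat T-T\|_S\le\sqrt{\frac{2d(d-2n)_+}{n(n-1)}+\frac{4(2/\pi+1)^2\|\Sigma\|_F^2}{n}}+10\|\Sigma\|_S\Big(\sqrt{\tfrac{d+1}{3n}}+\tfrac{d+1}{n}\Big),$$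 $$E\|\widehat\Sigma^\tau-\Sigma\|_S\le\frac{\pi}{2}E\|\widehat T-T\|_S+\frac{\pi}{2}\sqrt{\frac{\|\Sigma\|_F^2-d}{n_2}}+\frac{\pi^2\sqrt3\,d}{8n_2},$$ and, for Spearman's rho, $$E\|\widehat R-R\|_S\le\sqrt{\frac{6d(d-2n)}{n(n-1)}+\frac{9(1+\sqrt8/\pi)^2\|\Sigma\|_F^2}{n}}+15\|\Sigma\|_S\Big(\sqrt{\tfrac{d+1}{3n}}+\tfrac{d+1}{n}\Big)+\frac{\|\Sigma\|_F}{n},$$ and, if $n\ge 3$, $$E\|\widehat\Sigma^\rho-\Sigma\|_S\le\frac{\pi}{3}E\|\widehat R-R\|_S+\frac{\pi}{9}\sqrt{\frac{\|\Sigma\|_F^2-d}{n_3}}+\frac{\pi^2\sqrt3\,d}{36\,n_3}+\frac{2\pi\|\Sigma\|_F}{3n}.$$ -/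

import Mathlib

open MeasureTheory ProbabilityTheory

noncomputable section

namespace GaussianCopula

variable {n d : ℕ}

/-- The spectral (`ℓ₂ → ℓ₂` operator) norm of a real square matrix. -/
def specNorm (A : Matrix (Fin d) (Fin d) ℝ) : ℝ :=
  ‖Matrix.toEuclideanCLM (n := Fin d) (𝕜 := ℝ) A‖

/-- The Frobenius norm `√(trace (Aᵀ A))`. -/
def frobNorm (A : Matrix (Fin d) (Fin d) ℝ) : ℝ :=
  √(Matrix.trace (A.transpose * A))

/-- Correlation matrices: positive semidefinite (possibly singular) with unit diagonal. -/
structure IsCorrelationMatrix (S : Matrix (Fin d) (Fin d) ℝ) : Prop where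
  posSemidef : S.PosSemidef
  diag_eq_one : ∀ j, S j j = 1

/-- The law of `(f₁(X₁), …, f_d(X_d))` where `(X₁, …, X_d) ∼ N(0, S)`. -/
def copulaLaw (S : Matrix (Fin d) (Fin d) ℝ) (f : Fin d → ℝ → ℝ) : Measure (Fin d → ℝ) :=
  (multivariateGaussian (0 : EuclideanSpace ℝ (Fin d)) S).map (fun x j => f j (x j))

/-- The Gaussian copula model: `Y₁, …, Y_n` are i.i.d. copies of `(f₁(X₁), …, f_d(X_d))`, where
`(X₁, …, X_d) ∼ N(0, S)` has standard normal marginals and every `f_j` is strictly increasing. -/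
structure IsCopulaSample {Ω : Type*} [MeasurableSpace Ω] (P : Measure Ω)
    (S : Matrix (Fin d) (Fin d) ℝ) (f : Fin d → ℝ → ℝ) (Y : Fin n → Ω → Fin d → ℝ) : Prop where
  corr : IsCorrelationMatrix S
  strictMono : ∀ j, StrictMono (f j)
  indep : iIndepFun Y P
  law : ∀ i, HasLaw (Y i) (copulaLaw S f) P

/-- Kendall's tau matrix of the data `y` (row `i` is the `i`-th observation). -/
def tauHat (y : Fin n → Fin d → ℝ) : Matrix (Fin d) (Fin d) ℝ :=
  Matrix.of fun j k =>
    2 / ((n : ℝ) * ((n : ℝ) - 1)) *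
      ∑ i : Fin n, ∑ i' ∈ Finset.Ioi i, Real.sign (y i j - y i' j) * Real.sign (y i k - y i' k)

/-- The rank of `y i j` among `y 1 j, …, y n j`. -/
def rank (y : Fin n → Fin d → ℝ) (i : Fin n) (j : Fin d) : ℕ :=
  (Finset.univ.filter fun l : Fin n => y l j ≤ y i j).card

/-- The centred rank `r_{ij} - (n + 1) / 2`. -/
def centredRank (y : Fin n → Fin d → ℝ) (i : Fin n) (j : Fin d) : ℝ :=
  (rank y i j : ℝ) - ((n : ℝ) + 1) / 2

/-- Spearman's rho matrix of the data `y`. -/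
def rhoHat (y : Fin n → Fin d → ℝ) : Matrix (Fin d) (Fin d) ℝ :=
  Matrix.of fun j k =>
    (∑ i, centredRank y i j * centredRank y i k) /
      √((∑ i, centredRank y i j ^ 2) * ∑ i, centredRank y i k ^ 2)

/-- Population Kendall's tau `E sgn(Y₁ⱼ - Y₂ⱼ) sgn(Y₁ₖ - Y₂ₖ)`, with `Y₁, Y₂` i.i.d. of law `μ`. -/
def popTau (μ : Measure (Fin d → ℝ)) : Matrix (Fin d) (Fin d) ℝ :=
  Matrix.of fun j k =>
    ∫ p : (Fin d → ℝ) × (Fin d → ℝ),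
      Real.sign (p.1 j - p.2 j) * Real.sign (p.1 k - p.2 k) ∂(μ.prod μ)

/-- Population Spearman's rho `3 E sgn(Y₁ⱼ - Y₂ⱼ) sgn(Y₁ₖ - Y₃ₖ)`, with `Y₁, Y₂, Y₃` i.i.d. of
law `μ`. -/
def popRho (μ : Measure (Fin d → ℝ)) : Matrix (Fin d) (Fin d) ℝ :=
  Matrix.of fun j k =>
    3 * ∫ p : (Fin d → ℝ) × (Fin d → ℝ) × (Fin d → ℝ),
      Real.sign (p.1 j - p.2.1 j) * Real.sign (p.1 k - p.2.2 k) ∂(μ.prod (μ.prod μ))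

/-- The correlation matrix estimator `sin(π τ̂_{jk} / 2)`. -/
def sigmaTau (y : Fin n → Fin d → ℝ) : Matrix (Fin d) (Fin d) ℝ :=
  Matrix.of fun j k => Real.sin (Real.pi / 2 * tauHat y j k)

/-- The correlation matrix estimator `2 sin(π ρ̂_{jk} / 6)`. -/
def sigmaRho (y : Fin n → Fin d → ℝ) : Matrix (Fin d) (Fin d) ℝ :=
  Matrix.of fun j k => 2 * Real.sin (Real.pi / 6 * rhoHat y j k)

/-- The spectral error `‖T̂ - T‖` of the Kendall's tau matrix. -/
def errTau (μ : Measure (Fin d → ℝ)) (y : Fin n → Fin d → ℝ) : ℝ :=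
  specNorm (tauHat y - popTau μ)

/-- The spectral error `‖R̂ - R‖` of the Spearman's rho matrix. -/
def errRho (μ : Measure (Fin d → ℝ)) (y : Fin n → Fin d → ℝ) : ℝ :=
  specNorm (rhoHat y - popRho μ)

/-- The spectral error of the Kendall's tau estimator of `S`. -/
def errSigmaTau (S : Matrix (Fin d) (Fin d) ℝ) (y : Fin n → Fin d → ℝ) : ℝ :=
  specNorm (sigmaTau y - S)

/-- The spectral error of the Spearman's rho estimator of `S`. -/
def errSigmaRho (S : Matrix (Fin d) (Fin d) ℝ) (y : Fin n → Fin d → ℝ) : ℝ :=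
  specNorm (sigmaRho y - S)

end GaussianCopula

end

/-!
# Spectral error of rank correlation matrices in the Gaussian copula model

The signs of differences, and hence the rank statistics and their population versions, are invariant
under strictly increasing transformations of the coordinates. So the sample may be taken from the
centred Gaussian law `normalLaw S` itself (`IsCopulaSample.integral_eq`). There the population
values are explicit, by Sheppard's formula `integral_bivGauss_sign_mul_sign`: the entries are
`(2 / π) arcsin S` for Kendall's tau and `(6 / π) arcsin (S / 2)` for Spearman's rho, so that the sine
transforms of the population values return `S`.

*Hoeffding decomposition.* Kendall's tau is a U-statistic of order two, and without ties Spearman's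
rho is a convex combination of a U-statistic of order three and Kendall's tau (`tauHat_eq_uStat`,
`rhoHat_eq`). Let `u = gaussSign = 2 Φ - 1`. The first Hoeffding projection of either kernel at `x`
is, up to an error of at most `|S j k|`, the product `u (x j) u (x k)`. This is the bound
`abs_integral_bivGauss_sub_le` for the covariance of two signs, which follows from Plackett's
identity `integral_sign_mul_deriv`. Thus both matrices of errors are multiples of `signCov`, the
centred empirical second moment matrix of the transformed observations `u (x j)`, plus a remainder
whose entries have second moments of order `S j k ^ 2 / n + 1 / n ^ 2`
(`integral_tauHat_remainder_le`, `integral_rhoU_remainder_le`). The remainder is bounded in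
Frobenius norm; it contributes the square roots in the two bounds.

*The projected covariance.* For a unit vector `v`, the projection `∑ v j u (x j)` is a Lipschitz
function of a standard Gaussian vector, with squared Lipschitz constant `(2 / π) ‖S‖`. A Gaussian
version of the Prékopa–Leindler inequality (`gaussian_prekopaLeindler`) gives exponential moments of
squares of Lipschitz functions with explicit constants (`integral_exp_sq_sub_le`); the density is
log-concave, and no logarithmic Sobolev inequality is needed. A union bound over a `1/4`-net of the
sphere (`exists_net_sphere`, `integral_specNorm_le`) then yields the terms in `√((d + 1) / (3 n))`
and `(d + 1) / n` (`IsCorrelationMatrix.integral_specNorm_signCov_le`).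

*Sine transforms.* Let `sinDefect x = x - sin x`. The error of the sine transform is a multiple of
the error of the rank correlation matrix, minus an increment of `sinDefect`. The latter is expanded
to second order (`abs_sinDefect_sub_le_quadratic`). The required second and fourth moments come from
writing a U-statistic of order `k` as an average of means over `n / k` disjoint blocks
(`integral_uStat_sub_mean_pow_le`); this is the origin of the largest multiples of two and three up
to `n`. Minkowski's inequality over the entries (`IsCorrelationMatrix.sqrt_sum_le`) gives the
Frobenius bound, in which the diagonal does not take part, since it has no fluctuation. For
Spearman's rho the statistic is biased, and the bias contributes a further term of order `1 / n`.

The uniform constant follows from the four explicit bounds, since `1 ≤ ‖S‖` and `‖S‖_F ^ 2 ≤ d ‖S‖`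
for a correlation matrix.
-/

/-! ### Prékopa–Leindler inequality on the line -/

noncomputable section

namespace GaussianCopula

theorem volume_add_le_of_forall_isCompact {A : Set ℝ} (hA : MeasurableSet A) (hne : A.Nonempty)
    {c r : ENNReal} (h : ∀ K ⊆ A, IsCompact K → K.Nonempty → volume K + c ≤ r) :
    volume A + c ≤ r := by
  obtain ⟨x, hx⟩ := hne
  have hc : c ≤ r := by
    simpa using h {x} (by simpa using hx) isCompact_singleton (by simp)
  rw [hA.measure_eq_iSup_isCompact, ENNReal.iSup_add]
  refine iSup_le fun K => ?_
  rcases em (K ⊆ A ∧ IsCompact K ∧ K.Nonempty) with ⟨h1, h2, h3⟩ | hK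
  · simpa [h1, h2] using h K h1 h2 h3
  · have : ⨆ (_ : K ⊆ A), ⨆ (_ : IsCompact K), volume K = 0 := by
      simp only [ENNReal.iSup_eq_zero]
      intro h1 h2
      rcases K.eq_empty_or_nonempty with h3 | h3
      · simp [h3]
      · exact absurd ⟨h1, h2, h3⟩ hK
    rw [this, zero_add]
    exact hc

/-- The Brunn–Minkowski inequality on the real line, for a set `C` containing `A + B`. -/
theorem volume_add_le_of_add_mem {A B C : Set ℝ} (hA : MeasurableSet A) (hB : MeasurableSet B)
    (hAne : A.Nonempty) (hBne : B.Nonempty) (hC : ∀ x ∈ A, ∀ y ∈ B, x + y ∈ C) :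
    volume A + volume B ≤ volume C := by
  refine volume_add_le_of_forall_isCompact hA hAne fun K hKA hK hKne => ?_
  rw [add_comm]
  refine volume_add_le_of_forall_isCompact hB hBne fun K' hKB hK' hKne' => ?_
  rw [add_comm]
  obtain ⟨p, hpK, hp⟩ := hK.exists_isGreatest hKne
  obtain ⟨q, hqK, hq⟩ := hK'.exists_isLeast hKne'
  -- the translates `q + K` and `p + K'` lie in `C` and share at most the point `p + q`
  set K₁ : Set ℝ := (fun z => -q + z) ⁻¹' K with hK₁
  set K₂ : Set ℝ := (fun z => -p + z) ⁻¹' K' with hK₂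
  have h1 : volume K₁ = volume K := measure_preimage_add volume (-q) K
  have h2 : volume K₂ = volume K' := measure_preimage_add volume (-p) K'
  have hm2 : MeasurableSet K₂ := hK'.measurableSet.preimage (by fun_prop)
  have hdis : AEDisjoint volume K₁ K₂ := by
    refine measure_mono_null (t := {p + q}) ?_ (by simp)
    rintro z ⟨hz1, hz2⟩
    have e1 := hp hz1
    have e2 := hq hz2
    simp only [Set.mem_singleton_iff]
    linarith
  rw [← h1, ← h2, ← measure_union₀ hm2.nullMeasurableSet hdis]
  refine measure_mono ?_
  rintro z (hz | hz)
  · simpa using hC _ (hKA hz) q (hKB hqK)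
  · simpa using hC p (hKA hpK) _ (hKB hz)

theorem volume_weighted_add_le {a b : ℝ} (ha : 0 < a) (hb : 0 < b) {A B C : Set ℝ}
    (hA : MeasurableSet A) (hB : MeasurableSet B)
    (hAne : A.Nonempty) (hBne : B.Nonempty) (hC : ∀ x ∈ A, ∀ y ∈ B, a * x + b * y ∈ C) :
    ENNReal.ofReal a * volume A + ENNReal.ofReal b * volume B ≤ volume C := by
  have hs : ∀ {c : ℝ}, 0 < c → ∀ s : Set ℝ,
      volume ((fun x => c⁻¹ * x) ⁻¹' s) = ENNReal.ofReal c * volume s := by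
    intro c hc s
    rw [Real.volume_preimage_mul_left (inv_ne_zero hc.ne') s, inv_inv, abs_of_pos hc]
  rw [← hs ha, ← hs hb]
  refine volume_add_le_of_add_mem (hA.preimage (by fun_prop)) (hB.preimage (by fun_prop)) ?_ ?_ ?_
  · obtain ⟨x, hx⟩ := hAne
    exact ⟨a * x, by simpa [ha.ne'] using hx⟩
  · obtain ⟨x, hx⟩ := hBne
    exact ⟨b * x, by simpa [hb.ne'] using hx⟩
  · intro x hx y hy
    have := hC _ hx _ hy
    simpa [ha.ne', hb.ne'] using this

/-- The Prékopa–Leindler inequality on the line, for functions whose suprema are both one: there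
the arithmetic mean of the integrals is already a lower bound. -/
theorem prekopaLeindler_of_sup_eq_one {a b : ℝ} (ha : 0 < a) (hb : 0 < b) (hab : a + b = 1)
    {f g h : ℝ → ℝ} (hf : Integrable f) (hg : Integrable g) (hh : Integrable h)
    (mf : Measurable f) (mg : Measurable g)
    (f0 : ∀ x, 0 ≤ f x) (g0 : ∀ x, 0 ≤ g x) (h0 : ∀ x, 0 ≤ h x)
    (f1 : ∀ x, f x ≤ 1) (g1 : ∀ x, g x ≤ 1)
    (fs : ∀ t < 1, ∃ x, t < f x) (gs : ∀ t < 1, ∃ x, t < g x)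
    (H : ∀ x y, f x ^ a * g y ^ b ≤ h (a * x + b * y)) :
    a * (∫ x, f x) + b * (∫ x, g x) ≤ ∫ x, h x := by
  have key : ∀ t ∈ Set.Ioi (0 : ℝ), ENNReal.ofReal a * volume {x | t < f x} +
      ENNReal.ofReal b * volume {x | t < g x} ≤ volume {x | t < h x} := by
    intro t ht
    rcases lt_or_ge t 1 with h1 | h1
    · refine volume_weighted_add_le ha hb (measurableSet_lt measurable_const mf)
        (measurableSet_lt measurable_const mg) (fs t h1) (gs t h1) ?_
      intro x hx y hy
      refine lt_of_lt_of_le ?_ (H x y)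
      have ht : (0 : ℝ) < t := ht
      calc t = t ^ a * t ^ b := by rw [← Real.rpow_add ht, hab, Real.rpow_one]
        _ < f x ^ a * g y ^ b := by
          apply mul_lt_mul'' (Real.rpow_lt_rpow ht.le hx ha) (Real.rpow_lt_rpow ht.le hy hb) <;>
          positivity
    · have e1 : {x | t < f x} = ∅ := by
        ext x; simpa using (f1 x).trans h1
      have e2 : {x | t < g x} = ∅ := by
        ext x; simpa using (g1 x).trans h1
      simp [e1, e2]
  have lf := lintegral_eq_lintegral_meas_lt volume (Filter.Eventually.of_forall f0) mf.aemeasurable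
  have lg := lintegral_eq_lintegral_meas_lt volume (Filter.Eventually.of_forall g0) mg.aemeasurable
  have lh := lintegral_eq_lintegral_meas_lt volume (Filter.Eventually.of_forall h0) hh.aemeasurable
  rw [← ofReal_integral_eq_lintegral_ofReal hf (Filter.Eventually.of_forall f0)] at lf
  rw [← ofReal_integral_eq_lintegral_ofReal hg (Filter.Eventually.of_forall g0)] at lg
  rw [← ofReal_integral_eq_lintegral_ofReal hh (Filter.Eventually.of_forall h0)] at lh
  have If : 0 ≤ ∫ x, f x := integral_nonneg f0
  have Ig : 0 ≤ ∫ x, g x := integral_nonneg g0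
  have Ih : 0 ≤ ∫ x, h x := integral_nonneg h0
  rw [← ENNReal.ofReal_le_ofReal_iff Ih, ENNReal.ofReal_add (by positivity) (by positivity),
    ENNReal.ofReal_mul ha.le, ENNReal.ofReal_mul hb.le, lf, lg, lh,
    ← lintegral_const_mul' _ _ ENNReal.ofReal_ne_top,
    ← lintegral_const_mul' _ _ ENNReal.ofReal_ne_top]
  exact (le_lintegral_add _ _).trans (setLIntegral_mono' measurableSet_Ioi key)

theorem prekopaLeindler {a b : ℝ} (ha : 0 < a) (hb : 0 < b) (hab : a + b = 1)
    {f g h : ℝ → ℝ} (hf : Integrable f) (hg : Integrable g) (hh : Integrable h)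
    (mf : Measurable f) (mg : Measurable g)
    (f0 : ∀ x, 0 ≤ f x) (g0 : ∀ x, 0 ≤ g x) (h0 : ∀ x, 0 ≤ h x)
    (fb : BddAbove (Set.range f)) (gb : BddAbove (Set.range g))
    (H : ∀ x y, f x ^ a * g y ^ b ≤ h (a * x + b * y)) :
    (∫ x, f x) ^ a * (∫ x, g x) ^ b ≤ ∫ x, h x := by
  set M := ⨆ x, f x with hM
  set N := ⨆ x, g x with hN
  have fM : ∀ x, f x ≤ M := fun x => le_ciSup fb x
  have gN : ∀ x, g x ≤ N := fun x => le_ciSup gb x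
  have Ih : 0 ≤ ∫ x, h x := integral_nonneg h0
  have If : 0 ≤ ∫ x, f x := integral_nonneg f0
  have Ig : 0 ≤ ∫ x, g x := integral_nonneg g0
  rcases ((f0 0).trans (fM 0)).eq_or_lt with hM0 | hM0
  · have : f = 0 := funext fun x => le_antisymm ((fM x).trans hM0.symm.le) (f0 x)
    simpa [this, Real.zero_rpow ha.ne'] using Ih
  rcases ((g0 0).trans (gN 0)).eq_or_lt with hN0 | hN0
  · have : g = 0 := funext fun x => le_antisymm ((gN x).trans hN0.symm.le) (g0 x)
    simpa [this, Real.zero_rpow hb.ne'] using Ih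
  have hP : 0 < M ^ a * N ^ b := by positivity
  have key := prekopaLeindler_of_sup_eq_one ha hb hab (hf.div_const M) (hg.div_const N)
    (hh.div_const (M ^ a * N ^ b)) (mf.div_const M) (mg.div_const N)
    (fun x => div_nonneg (f0 x) hM0.le) (fun x => div_nonneg (g0 x) hN0.le)
    (fun x => div_nonneg (h0 x) hP.le)
    (fun x => (div_le_one hM0).2 (fM x)) (fun x => (div_le_one hN0).2 (gN x))
    (fun t ht => by
      obtain ⟨x, hx⟩ := exists_lt_of_lt_ciSup (f := f) (b := t * M) (by
        rw [← hM]; nlinarith)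
      exact ⟨x, (lt_div_iff₀ hM0).2 hx⟩)
    (fun t ht => by
      obtain ⟨x, hx⟩ := exists_lt_of_lt_ciSup (f := g) (b := t * N) (by
        rw [← hN]; nlinarith)
      exact ⟨x, (lt_div_iff₀ hN0).2 hx⟩)
    (fun x y => by
      rw [Real.div_rpow (f0 x) hM0.le, Real.div_rpow (g0 y) hN0.le, div_mul_div_comm]
      exact div_le_div_of_nonneg_right (H x y) hP.le)
  simp only [integral_div] at key
  have am := Real.geom_mean_le_arith_mean2_weighted ha.le hb.le (div_nonneg If hM0.le)
    (div_nonneg Ig hN0.le) hab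
  have := am.trans key
  rw [Real.div_rpow If hM0.le, Real.div_rpow Ig hN0.le, div_mul_div_comm,
    div_le_div_iff_of_pos_right hP] at this
  exact this

end GaussianCopula

end

/-! ### Gaussian concentration for squares of Lipschitz functions -/

noncomputable section

namespace GaussianCopula

theorem integrable_of_bounded {α : Type*} [MeasurableSpace α] {μ : Measure α} [IsFiniteMeasure μ]
    {f : α → ℝ} (hf : Measurable f) {C : ℝ} (hC : ∀ x, |f x| ≤ C) : Integrable f μ :=
  Integrable.of_bound hf.aestronglyMeasurable C (Filter.Eventually.of_forall hC)

/-- A Gaussian form of the Prékopa–Leindler inequality on the line, with the strong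
log-concavity of the Gaussian density absorbed into the hypothesis. -/
theorem gaussian_prekopaLeindler_one {a b : ℝ} (ha : 0 < a) (hb : 0 < b) (hab : a + b = 1)
    {F G : ℝ → ℝ} (mF : Measurable F) (mG : Measurable G) {C : ℝ}
    (F0 : ∀ x, 0 ≤ F x) (G0 : ∀ x, 0 ≤ G x) (FC : ∀ x, F x ≤ C) (GC : ∀ x, G x ≤ C)
    (H : ∀ x y, F x ^ a * G y ^ b ≤ Real.exp (a * b * ((x - y) ^ 2 / 2))) :
    (∫ x, F x ∂(gaussianReal 0 1)) ^ a * (∫ x, G x ∂(gaussianReal 0 1)) ^ b ≤ 1 := by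
  set φ : ℝ → ℝ := gaussianPDFReal 0 1 with hφ
  have φdef : ∀ x, φ x = (√(2 * Real.pi))⁻¹ * Real.exp (-x ^ 2 / 2) := by
    intro x; simp [hφ, gaussianPDFReal]
  have mφ : Measurable φ := measurable_gaussianPDFReal 0 1
  have φ0 : ∀ x, 0 ≤ φ x := fun x => gaussianPDFReal_nonneg 0 1 x
  have iφ : Integrable φ := integrable_gaussianPDFReal 0 1
  have φ1 : ∀ x, φ x ≤ (√(2 * Real.pi))⁻¹ := by
    intro x
    rw [φdef]
    refine mul_le_of_le_one_right (by positivity) (Real.exp_le_one_iff.2 ?_)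
    have := sq_nonneg x
    linarith
  have hC : 0 ≤ C := (F0 0).trans (FC 0)
  have hi : ∀ {f : ℝ → ℝ}, Measurable f → (∀ x, 0 ≤ f x) → (∀ x, f x ≤ C) →
      Integrable (fun x => φ x * f x) := by
    intro f mf f0 fC
    refine iφ.mul_bdd (c := C) mf.aestronglyMeasurable (Filter.Eventually.of_forall fun x => ?_)
    rw [Real.norm_eq_abs, abs_of_nonneg (f0 x)]
    exact fC x
  have hbd : ∀ {f : ℝ → ℝ}, (∀ x, 0 ≤ f x) → (∀ x, f x ≤ C) →
      BddAbove (Set.range fun x => φ x * f x) := by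
    intro f f0 fC
    refine ⟨(√(2 * Real.pi))⁻¹ * C, ?_⟩
    rintro _ ⟨x, rfl⟩
    exact mul_le_mul (φ1 x) (fC x) (f0 x) (by positivity)
  have key := prekopaLeindler ha hb hab (hi mF F0 FC) (hi mG G0 GC) iφ (mφ.mul mF) (mφ.mul mG)
    (fun x => mul_nonneg (φ0 x) (F0 x)) (fun x => mul_nonneg (φ0 x) (G0 x)) φ0
    (hbd F0 FC) (hbd G0 GC) (fun x y => by
      rw [Real.mul_rpow (φ0 x) (F0 x), Real.mul_rpow (φ0 y) (G0 y)]
      have e1 : φ x ^ a * φ y ^ b * Real.exp (a * b * ((x - y) ^ 2 / 2)) = φ (a * x + b * y) := by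
        simp only [φdef]
        rw [Real.mul_rpow (by positivity) (by positivity),
          Real.mul_rpow (by positivity) (by positivity), ← Real.exp_mul, ← Real.exp_mul]
        have hp : 0 < (√(2 * Real.pi))⁻¹ := by positivity
        have e2 : (√(2 * Real.pi))⁻¹ ^ a * (√(2 * Real.pi))⁻¹ ^ b = (√(2 * Real.pi))⁻¹ := by
          rw [← Real.rpow_add hp, hab, Real.rpow_one]
        calc _ = ((√(2 * Real.pi))⁻¹ ^ a * (√(2 * Real.pi))⁻¹ ^ b) *
              (Real.exp (-x ^ 2 / 2 * a) * Real.exp (-y ^ 2 / 2 * b) *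
                Real.exp (a * b * ((x - y) ^ 2 / 2))) := by ring
          _ = _ := by
            rw [e2, ← Real.exp_add, ← Real.exp_add]
            congr 2
            have : a = 1 - b := by linarith
            subst this
            ring
      calc φ x ^ a * F x ^ a * (φ y ^ b * G y ^ b)
          = φ x ^ a * φ y ^ b * (F x ^ a * G y ^ b) := by ring
        _ ≤ φ x ^ a * φ y ^ b * Real.exp (a * b * ((x - y) ^ 2 / 2)) := by
          refine mul_le_mul_of_nonneg_left (H x y) ?_
          have := φ0 x
          have := φ0 y
          positivity
        _ = _ := e1)
  rw [integral_gaussianReal_eq_integral_smul one_ne_zero,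
    integral_gaussianReal_eq_integral_smul one_ne_zero]
  simpa [smul_eq_mul, hφ, integral_gaussianPDFReal_eq_one] using key

/-- Integration against a power of `μ`, split into the first coordinate and the rest. -/
theorem integral_pi_succ {E : Type*} [MeasurableSpace E] (μ : Measure E) [IsProbabilityMeasure μ]
    {d : ℕ} {F : (Fin (d + 1) → E) → ℝ} (mF : Measurable F) {C : ℝ} (hC : ∀ x, |F x| ≤ C) :
    ∫ x, F x ∂(Measure.pi fun _ : Fin (d + 1) => μ) =
      ∫ t, ∫ x, F (Fin.cons t x) ∂(Measure.pi fun _ : Fin d => μ) ∂μ := by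
  have hmp := (measurePreserving_piFinSuccAbove (fun _ : Fin (d + 1) => μ) 0).symm
  rw [← hmp.integral_comp (MeasurableEquiv.measurableEmbedding _), integral_prod]
  · simp only [MeasurableEquiv.piFinSuccAbove, Fin.insertNthEquiv_zero]
    rfl
  · exact integrable_of_bounded (mF.comp (MeasurableEquiv.measurable _)) (fun x => hC _)

/-- The Gaussian form of the Prékopa–Leindler inequality in `ℝᵈ`, by tensorization. -/
theorem gaussian_prekopaLeindler {a b : ℝ} (ha : 0 < a) (hb : 0 < b) (hab : a + b = 1) {C : ℝ} :
    ∀ {d : ℕ} {F G : (Fin d → ℝ) → ℝ}, Measurable F → Measurable G →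
    (∀ x, 0 ≤ F x) → (∀ x, 0 ≤ G x) → (∀ x, F x ≤ C) → (∀ x, G x ≤ C) →
    (∀ x y, F x ^ a * G y ^ b ≤ Real.exp (a * b * ((∑ i, (x i - y i) ^ 2) / 2))) →
    (∫ x, F x ∂(Measure.pi fun _ : Fin d => gaussianReal 0 1)) ^ a *
      (∫ x, G x ∂(Measure.pi fun _ : Fin d => gaussianReal 0 1)) ^ b ≤ 1 := by
  intro d
  induction d with
  | zero =>
    intro F G mF mG F0 G0 FC GC H
    have e : ∀ f : (Fin 0 → ℝ) → ℝ, f = fun _ => f 0 := fun f => funext fun x => by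
      rw [Subsingleton.elim x 0]
    rw [e F, e G]
    simpa using H 0 0
  | succ d ih =>
    intro F G mF mG F0 G0 FC GC H
    have ab : ∀ {f : (Fin (d + 1) → ℝ) → ℝ}, (∀ x, 0 ≤ f x) → (∀ x, f x ≤ C) → ∀ x, |f x| ≤ C :=
      fun f0 fC x => by rw [abs_of_nonneg (f0 x)]; exact fC x
    rw [integral_pi_succ _ mF (ab F0 FC), integral_pi_succ _ mG (ab G0 GC)]
    have mc : Measurable fun p : ℝ × (Fin d → ℝ) => (Fin.cons p.1 p.2 : Fin (d + 1) → ℝ) := by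
      refine measurable_pi_lambda _ fun i => ?_
      refine Fin.cases ?_ (fun i => ?_) i
      · simpa using measurable_fst
      · simp only [Fin.cons_succ]; fun_prop
    have mI : ∀ {f : (Fin (d + 1) → ℝ) → ℝ}, Measurable f → Measurable fun t =>
        ∫ x, f (Fin.cons t x) ∂(Measure.pi fun _ : Fin d => gaussianReal 0 1) := by
      intro f mf
      exact (StronglyMeasurable.integral_prod_right (f := fun t x => f (Fin.cons t x))
        (mf.comp mc).stronglyMeasurable).measurable
    have bI : ∀ {f : (Fin (d + 1) → ℝ) → ℝ}, Measurable f → (∀ x, 0 ≤ f x) → (∀ x, f x ≤ C) →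
        ∀ t, ∫ x, f (Fin.cons t x) ∂(Measure.pi fun _ : Fin d => gaussianReal 0 1) ≤ C := by
      intro f mf f0 fC t
      have hi : Integrable (fun x => f (Fin.cons t x))
          (Measure.pi fun _ : Fin d => gaussianReal 0 1) :=
        integrable_of_bounded (mf.comp (mc.comp (measurable_const.prodMk measurable_id)))
          (fun x => ab f0 fC _)
      calc _ ≤ ∫ x, C ∂(Measure.pi fun _ : Fin d => gaussianReal 0 1) :=
            integral_mono hi (integrable_const _) (fun x => fC _)
        _ = C := by simp
    refine gaussian_prekopaLeindler_one ha hb hab (mI mF) (mI mG) (C := C)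
      (fun t => integral_nonneg fun x => F0 _) (fun t => integral_nonneg fun x => G0 _)
      (bI mF F0 FC) (bI mG G0 GC) ?_
    intro s t
    -- rescale the sections so that the hypothesis in dimension `d` holds for them
    set c : ℝ := (s - t) ^ 2 / 2 with hc
    have hsec := ih (F := fun x => F (Fin.cons s x) * Real.exp (-(b * c)))
      (G := fun x => G (Fin.cons t x))
      ((mF.comp (mc.comp (measurable_const.prodMk measurable_id))).mul_const _)
      (mG.comp (mc.comp (measurable_const.prodMk measurable_id)))
      (fun x => mul_nonneg (F0 _) (Real.exp_pos _).le) (fun x => G0 _)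
      (fun x => by
        have h1 : Real.exp (-(b * c)) ≤ 1 := Real.exp_le_one_iff.2 (by
          have : 0 ≤ b * c := by positivity
          linarith)
        exact (mul_le_of_le_one_right (F0 _) h1).trans (FC _)) (fun x => GC _)
      (fun x y => by
        have := H (Fin.cons s x) (Fin.cons t y)
        simp only [Fin.sum_univ_succ, Fin.cons_zero, Fin.cons_succ] at this
        rw [Real.mul_rpow (F0 _) (Real.exp_pos _).le, ← Real.exp_mul]
        have e : Real.exp (a * b * ((∑ i, (x i - y i) ^ 2) / 2)) =
            Real.exp (a * b * (((s - t) ^ 2 + ∑ i, (x i - y i) ^ 2) / 2)) *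
              Real.exp (-(b * c) * a) := by
          rw [← Real.exp_add]
          congr 1
          rw [hc]; ring
        rw [e]
        calc _ = F (Fin.cons s x) ^ a * G (Fin.cons t y) ^ b * Real.exp (-(b * c) * a) := by ring
          _ ≤ _ := mul_le_mul_of_nonneg_right this (Real.exp_pos _).le)
    rw [integral_mul_const, Real.mul_rpow (integral_nonneg fun x => F0 _) (Real.exp_pos _).le,
      ← Real.exp_mul] at hsec
    have e : Real.exp (a * b * c) * Real.exp (-(b * c) * a) = 1 := by
      rw [← Real.exp_add, Real.exp_eq_one_iff]; ring
    have hp := Real.exp_pos (-(b * c) * a)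
    refine le_of_mul_le_mul_right ?_ hp
    rw [e]
    linarith [hsec]

/-- Jensen's inequality for the exponential function. -/
theorem exp_integral_le_integral_exp {α : Type*} [MeasurableSpace α] {μ : Measure α}
    [IsProbabilityMeasure μ] {f : α → ℝ} (hf : Integrable f μ)
    (he : Integrable (fun x => Real.exp (f x)) μ) :
    Real.exp (∫ x, f x ∂μ) ≤ ∫ x, Real.exp (f x) ∂μ := by
  set m := ∫ x, f x ∂μ with hm
  have h1 : ∫ x, Real.exp m * (f x - m + 1) ∂μ ≤ ∫ x, Real.exp (f x) ∂μ := by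
    refine integral_mono (((hf.sub (integrable_const _)).add (integrable_const _)).const_mul _) he
      fun x => ?_
    have := Real.add_one_le_exp (f x - m)
    calc Real.exp m * (f x - m + 1) ≤ Real.exp m * Real.exp (f x - m) :=
          mul_le_mul_of_nonneg_left this (Real.exp_pos _).le
      _ = Real.exp (f x) := by rw [← Real.exp_add]; congr 1; ring
  have h2 : ∫ x, (f x - m + 1) ∂μ = 1 := by
    have e : ∀ x, f x - m + 1 = f x + (1 - m) := fun x => by ring
    simp_rw [e]
    rw [integral_add hf (integrable_const _), ← hm]
    simp
  rwa [integral_const_mul, h2, mul_one] at h1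

/-- A concentration bound for the square of a Lipschitz function of a standard Gaussian vector.
The weights `3/4` and `1/4` are used in the Prékopa–Leindler inequality; a first weight tending to
one would replace `8/3` by `2`. -/
theorem integral_exp_sq_sub_le {d : ℕ} {w : (Fin d → ℝ) → ℝ} (mw : Measurable w) {B κ : ℝ}
    (hB : ∀ x, |w x| ≤ B) (hκ : 0 < κ) (hw : ∀ x y, (w x - w y) ^ 2 ≤ κ * ∑ i, (x i - y i) ^ 2)
    {m : ℝ} (hm : ∫ x, w x ^ 2 ∂(Measure.pi fun _ : Fin d => gaussianReal 0 1) = m)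
    {t : ℝ} (ht : 8 / 3 * κ * |t| < 1) :
    ∫ x, Real.exp (t * (w x ^ 2 - m)) ∂(Measure.pi fun _ : Fin d => gaussianReal 0 1) ≤
      Real.exp (8 / 3 * κ * m * t ^ 2 / (1 - 8 / 3 * κ * |t|)) := by
  set P : Measure (Fin d → ℝ) := Measure.pi fun _ : Fin d => gaussianReal 0 1 with hP
  have hden : 0 < 1 - 8 / 3 * κ * t := by
    have := le_abs_self t
    have : 8 / 3 * κ * t ≤ 8 / 3 * κ * |t| := by gcongr
    linarith
  -- the parameter for which the infimal convolution of `l * w ^ 2` dominates `(4 t / 3) * w ^ 2`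
  set l : ℝ := 4 / 3 * t / (1 - 8 / 3 * κ * t) with hl
  have hne := hden.ne'
  have hl2 : l * (1 - 8 / 3 * κ * t) = 4 / 3 * t := by rw [hl, div_mul_cancel₀ _ hne]
  have hl1 : 1 + 2 * κ * l = (1 - 8 / 3 * κ * t)⁻¹ := by
    rw [← one_div, eq_div_iff hne]
    linear_combination 2 * κ * hl2
  have hlt : 4 / 3 * t * (1 + 2 * κ * l) = l := by
    rw [hl1, hl]; rfl
  have hl0 : 0 < 1 + 2 * κ * l := by rw [hl1]; positivity
  have hB2 : ∀ x, w x ^ 2 ≤ B ^ 2 := fun x => sq_le_sq.2 ((hB x).trans (le_abs_self B))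
  have hbound : ∀ c : ℝ, ∀ x, Real.exp (c * w x ^ 2) ≤ Real.exp (|c| * B ^ 2) := by
    intro c x
    refine Real.exp_le_exp.2 ?_
    calc c * w x ^ 2 ≤ |c| * w x ^ 2 := by gcongr; exact le_abs_self c
      _ ≤ |c| * B ^ 2 := mul_le_mul_of_nonneg_left (hB2 x) (abs_nonneg c)
  have hmeas : ∀ c : ℝ, Measurable fun x => Real.exp (c * w x ^ 2) := fun c => by fun_prop
  have hint : ∀ c : ℝ, Integrable (fun x => Real.exp (c * w x ^ 2)) P := fun c =>
    integrable_of_bounded (hmeas c) (fun x => by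
      rw [abs_of_pos (Real.exp_pos _)]; exact hbound c x)
  have hint2 : Integrable (fun x => w x ^ 2) P :=
    integrable_of_bounded (mw.pow_const 2) (C := B ^ 2) (fun x => by
      rw [abs_of_nonneg (sq_nonneg _)]; exact hB2 x)
  have key := gaussian_prekopaLeindler (a := 1 / 4) (b := 3 / 4) (by norm_num) (by norm_num)
    (by norm_num) (C := max (Real.exp (|t| * B ^ 2)) (Real.exp (|-(1 / 4 * l)| * B ^ 2)))
    (F := fun x => Real.exp (t * w x ^ 2))
    (G := fun x => Real.exp (-(1 / 4 * l) * w x ^ 2))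
    (hmeas _) (hmeas _) (fun x => (Real.exp_pos _).le) (fun x => (Real.exp_pos _).le)
    (fun x => (hbound _ x).trans (le_max_left _ _))
    (fun x => (hbound _ x).trans (le_max_right _ _)) (fun x y => by
      rw [← Real.exp_mul, ← Real.exp_mul, ← Real.exp_add]
      refine Real.exp_le_exp.2 ?_
      set r := ∑ i, (x i - y i) ^ 2 with hr
      have h1 : (w x - w y) ^ 2 ≤ κ * r := hw x y
      have h2 : 4 / 3 * t * w x ^ 2 - l * w y ^ 2 ≤ r / 2 := by
        have h3 : l * w x ^ 2 - (1 + 2 * κ * l) * l * w y ^ 2 ≤ (1 + 2 * κ * l) * (r / 2) := by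
          have h4 : 0 ≤ ((1 + 2 * κ * l) * w y - w x) ^ 2 := sq_nonneg _
          have h5 : (w x - w y) ^ 2 * (1 + 2 * κ * l) ≤ κ * r * (1 + 2 * κ * l) := by gcongr
          have h6 : 2 * κ * (l * w x ^ 2 - (1 + 2 * κ * l) * l * w y ^ 2) ≤
              2 * κ * ((1 + 2 * κ * l) * (r / 2)) := by nlinarith
          exact le_of_mul_le_mul_left h6 (by positivity)
        refine le_of_mul_le_mul_left ?_ hl0
        calc _ = (4 / 3 * t * (1 + 2 * κ * l)) * w x ^ 2 - (1 + 2 * κ * l) * l * w y ^ 2 := by ring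
          _ ≤ _ := by rw [hlt]; exact h3
      linarith)
  have hm0 : 0 ≤ m := hm ▸ integral_nonneg fun x => sq_nonneg _
  set X := ∫ x, Real.exp (t * w x ^ 2) ∂P with hX
  set Y := ∫ x, Real.exp (-(1 / 4 * l) * w x ^ 2) ∂P with hY
  have hX0 : 0 ≤ X := integral_nonneg fun x => (Real.exp_pos _).le
  have hY1 : Real.exp (-(1 / 4 * l) * m) ≤ Y := by
    have := exp_integral_le_integral_exp (hint2.const_mul (-(1 / 4 * l))) (hint (-(1 / 4 * l)))
    rwa [integral_const_mul, hm] at this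
  have hX1 : X ≤ Real.exp (3 / 4 * l * m) := by
    have h1 : X ^ (1 / 4 : ℝ) * Real.exp (-(1 / 4 * l) * m) ^ (3 / 4 : ℝ) ≤ 1 := by
      refine le_trans ?_ key
      gcongr
    rw [← Real.exp_mul] at h1
    have h2 : X ^ (1 / 4 : ℝ) ≤ Real.exp (3 / 16 * l * m) := by
      have e : Real.exp (-(1 / 4 * l) * m * (3 / 4)) * Real.exp (3 / 16 * l * m) = 1 := by
        rw [← Real.exp_add, Real.exp_eq_one_iff]; ring
      refine le_of_mul_le_mul_right ?_ (Real.exp_pos (-(1 / 4 * l) * m * (3 / 4)))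
      linarith
    calc X = (X ^ (1 / 4 : ℝ)) ^ (4 : ℝ) := by
          rw [← Real.rpow_mul hX0]; norm_num
      _ ≤ (Real.exp (3 / 16 * l * m)) ^ (4 : ℝ) := by gcongr
      _ = _ := by rw [← Real.exp_mul]; congr 1; ring
  calc ∫ x, Real.exp (t * (w x ^ 2 - m)) ∂P = X * Real.exp (-(t * m)) := by
        rw [hX, ← integral_mul_const]
        refine integral_congr_ae (Filter.Eventually.of_forall fun x => ?_)
        simp only
        rw [← Real.exp_add]; congr 1; ring
    _ ≤ Real.exp (3 / 4 * l * m) * Real.exp (-(t * m)) := by gcongr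
    _ ≤ _ := by
      rw [← Real.exp_add]
      refine Real.exp_le_exp.2 ?_
      have e : 3 / 4 * l * m + -(t * m) = 8 / 3 * κ * m * t ^ 2 / (1 - 8 / 3 * κ * t) := by
        rw [eq_div_iff hne]
        linear_combination 3 / 4 * m * hl2
      rw [e]
      have h1 : 0 < 1 - 8 / 3 * κ * |t| := by linarith
      gcongr
      exact le_abs_self t

end GaussianCopula

end

/-! ### Nets and the spectral norm of random matrices -/

noncomputable section

namespace GaussianCopula

/-- A `1/4`-separated subset of the unit ball has at most `9 ^ dim` points, because the balls of
radius `1/8` around them are disjoint and lie in the ball of radius `9/8`. -/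
theorem card_mul_pow_le_of_separated {E : Type*} [NormedAddCommGroup E] [NormedSpace ℝ E]
    [FiniteDimensional ℝ E] (s : Finset E) (hs : ∀ c ∈ s, ‖c‖ ≤ 1)
    (h : ∀ c ∈ s, ∀ d ∈ s, c ≠ d → 1 / 4 ≤ ‖c - d‖) : s.card ≤ 9 ^ Module.finrank ℝ E := by
  borelize E
  let μ : Measure E := Measure.addHaar
  set A := ⋃ c ∈ s, Metric.ball (c : E) (1 / 8) with hA
  have D : Set.Pairwise (s : Set E)
      (Function.onFun Disjoint fun c => Metric.ball (c : E) (1 / 8)) := by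
    rintro c hc d hd hcd
    apply Metric.ball_disjoint_ball
    rw [dist_eq_norm]
    have := h c hc d hd hcd
    linarith
  have A_subset : A ⊆ Metric.ball (0 : E) (9 / 8) := by
    refine Set.iUnion₂_subset fun x hx => ?_
    apply Metric.ball_subset_ball'
    have := hs x hx
    rw [dist_zero_right]
    linarith
  have I : (s.card : ENNReal) * ENNReal.ofReal ((1 / 8 : ℝ) ^ Module.finrank ℝ E) *
      μ (Metric.ball 0 1) ≤
      ENNReal.ofReal ((9 / 8 : ℝ) ^ Module.finrank ℝ E) * μ (Metric.ball 0 1) :=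
    calc
      _ = μ A := by
        rw [hA, measure_biUnion_finset D fun c _ => measurableSet_ball]
        simp only [μ.addHaar_ball_of_pos _ (show (0 : ℝ) < 1 / 8 by norm_num)]
        simp only [Finset.sum_const, nsmul_eq_mul, mul_assoc]
      _ ≤ μ (Metric.ball (0 : E) (9 / 8)) := measure_mono A_subset
      _ = _ := by
        simp only [μ.addHaar_ball_of_pos _ (show (0 : ℝ) < 9 / 8 by norm_num)]
  have J : (s.card : ENNReal) * ENNReal.ofReal ((1 / 8 : ℝ) ^ Module.finrank ℝ E) ≤
      ENNReal.ofReal ((9 / 8 : ℝ) ^ Module.finrank ℝ E) :=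
    (ENNReal.mul_le_mul_iff_left (Metric.measure_ball_pos _ _ zero_lt_one).ne'
      measure_ball_lt_top.ne).1 I
  have K : (s.card : ℝ) ≤ (9 : ℝ) ^ Module.finrank ℝ E := by
    have := ENNReal.toReal_le_of_le_ofReal (by positivity) J
    rw [ENNReal.toReal_mul, ENNReal.toReal_natCast, ENNReal.toReal_ofReal (by positivity),
      div_pow, div_pow, one_pow, mul_one_div,
      div_le_div_iff_of_pos_right (by positivity)] at this
    exact this
  exact mod_cast K

/-- The unit sphere of a Euclidean space has a `1/4`-net with at most `9 ^ d` points. -/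
theorem exists_net_sphere (d : ℕ) : ∃ N : Finset (EuclideanSpace ℝ (Fin d)),
    (∀ x ∈ N, ‖x‖ = 1) ∧ N.card ≤ 9 ^ d ∧ ∀ v, ‖v‖ = 1 → ∃ x ∈ N, ‖x - v‖ ≤ 1 / 4 := by
  classical
  let p : Finset (EuclideanSpace ℝ (Fin d)) → Prop := fun s =>
    (∀ x ∈ s, ‖x‖ = 1) ∧ ∀ c ∈ s, ∀ d ∈ s, c ≠ d → 1 / 4 ≤ ‖c - d‖
  have hcard : ∀ s, p s → s.card ≤ 9 ^ d := by
    intro s hs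
    simpa using card_mul_pow_le_of_separated s (fun c hc => (hs.1 c hc).le) hs.2
  let q : ℕ → Prop := fun k => ∃ s, p s ∧ s.card = k
  have hq : q (Nat.findGreatest q (9 ^ d)) :=
    Nat.findGreatest_spec (P := q) (Nat.zero_le _) ⟨∅, ⟨by simp, by simp⟩, rfl⟩
  obtain ⟨N, hN, hNc⟩ := hq
  refine ⟨N, hN.1, hcard N hN, fun v hv => ?_⟩
  by_contra! hcon
  have hv' : v ∉ N := fun hmem => by
    have := hcon v hmem
    norm_num at this
  have hp : p (insert v N) := by
    refine ⟨?_, ?_⟩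
    · intro x hx
      rcases Finset.mem_insert.1 hx with rfl | hx
      · exact hv
      · exact hN.1 x hx
    · intro x hx y hy hxy
      rcases Finset.mem_insert.1 hx with hx | hx <;> rcases Finset.mem_insert.1 hy with hy | hy
      · exact absurd (hx.trans hy.symm) hxy
      · rw [hx, norm_sub_rev]; exact (hcon y hy).le
      · rw [hy]; exact (hcon x hx).le
      · exact hN.2 x hx y hy hxy
  have h1 := Nat.le_findGreatest (P := q) (hcard _ hp) ⟨_, hp, rfl⟩
  rw [Finset.card_insert_of_notMem hv', hNc] at h1
  omega

variable {d : ℕ}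

theorem specNorm_nonneg (A : Matrix (Fin d) (Fin d) ℝ) : 0 ≤ specNorm A := norm_nonneg _

theorem specNorm_add_le (A B : Matrix (Fin d) (Fin d) ℝ) :
    specNorm (A + B) ≤ specNorm A + specNorm B := by
  unfold specNorm; rw [map_add]; exact norm_add_le _ _

theorem specNorm_smul (c : ℝ) (A : Matrix (Fin d) (Fin d) ℝ) :
    specNorm (c • A) = |c| * specNorm A := by
  unfold specNorm; rw [map_smul, norm_smul, Real.norm_eq_abs]

theorem continuous_specNorm : Continuous (specNorm (d := d)) := by
  unfold specNorm
  exact continuous_norm.comp (LinearMap.continuous_of_finiteDimensional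
    (Matrix.toEuclideanCLM (n := Fin d) (𝕜 := ℝ)).toAlgEquiv.toLinearMap)

theorem frobNorm_sq (A : Matrix (Fin d) (Fin d) ℝ) : frobNorm A ^ 2 = ∑ j, ∑ k, A j k ^ 2 := by
  have e : Matrix.trace (A.transpose * A) = ∑ j, ∑ k, A j k ^ 2 := by
    rw [Finset.sum_comm]
    simp [Matrix.trace, Matrix.mul_apply, sq]
  rw [frobNorm, Real.sq_sqrt, e]
  rw [e]; positivity

theorem frobNorm_nonneg (A : Matrix (Fin d) (Fin d) ℝ) : 0 ≤ frobNorm A := Real.sqrt_nonneg _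

theorem frobNorm_eq (A : Matrix (Fin d) (Fin d) ℝ) : frobNorm A = √(∑ j, ∑ k, A j k ^ 2) := by
  rw [← frobNorm_sq, Real.sqrt_sq (frobNorm_nonneg A)]

theorem inner_toEuclideanCLM_eq_sum (A : Matrix (Fin d) (Fin d) ℝ)
    (x y : EuclideanSpace ℝ (Fin d)) :
    inner ℝ x (Matrix.toEuclideanCLM (n := Fin d) (𝕜 := ℝ) A y) = ∑ j, ∑ k, x j * A j k * y k := by
  rw [Matrix.inner_toEuclideanCLM]
  simp [dotProduct, Matrix.mulVec, Finset.mul_sum, mul_assoc]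

theorem specNorm_le_frobNorm (A : Matrix (Fin d) (Fin d) ℝ) : specNorm A ≤ frobNorm A := by
  refine ContinuousLinearMap.opNorm_le_bound _ (frobNorm_nonneg A) fun x => ?_
  rw [← sq_le_sq₀ (norm_nonneg _) (mul_nonneg (frobNorm_nonneg A) (norm_nonneg _)), mul_pow,
    frobNorm_sq, EuclideanSpace.real_norm_sq_eq, EuclideanSpace.real_norm_sq_eq, Finset.sum_mul]
  refine Finset.sum_le_sum fun j _ => ?_
  have : (Matrix.toEuclideanCLM (n := Fin d) (𝕜 := ℝ) A x) j = ∑ k, A j k * x k := by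
    rw [Matrix.ofLp_toEuclideanCLM]; rfl
  rw [this]
  exact Finset.sum_mul_sq_le_sq_mul_sq _ _ _

theorem measurable_specNorm {α : Type*} [MeasurableSpace α] {W : α → Matrix (Fin d) (Fin d) ℝ}
    (mW : ∀ j k, Measurable fun ω => W ω j k) : Measurable fun ω => specNorm (W ω) := by
  have hc : Continuous fun w : Fin d → Fin d → ℝ => specNorm (Matrix.of w) :=
    continuous_specNorm.comp continuous_id
  exact hc.measurable.comp
    (measurable_pi_lambda _ fun j => measurable_pi_lambda _ fun k => mW j k)

theorem specNorm_le_of_forall_abs_le {A : Matrix (Fin d) (Fin d) ℝ} {B : ℝ} (hB0 : 0 ≤ B)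
    (hB : ∀ j k, |A j k| ≤ B) : specNorm A ≤ d * B := by
  refine (specNorm_le_frobNorm A).trans ?_
  rw [frobNorm_eq]
  refine Real.sqrt_le_iff.2 ⟨by positivity, ?_⟩
  calc ∑ j, ∑ k, A j k ^ 2 ≤ ∑ j : Fin d, ∑ k : Fin d, B ^ 2 :=
        Finset.sum_le_sum fun j _ => Finset.sum_le_sum fun k _ =>
          sq_le_sq.2 ((hB j k).trans (le_abs_self B))
    _ = (d * B) ^ 2 := by simp; ring

theorem sum_mul_le_specNorm (A : Matrix (Fin d) (Fin d) ℝ) (x : EuclideanSpace ℝ (Fin d)) :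
    ∑ j, ∑ k, x j * A j k * x k ≤ specNorm A * ‖x‖ ^ 2 := by
  rw [← inner_toEuclideanCLM_eq_sum]
  calc _ ≤ ‖x‖ * ‖Matrix.toEuclideanCLM (n := Fin d) (𝕜 := ℝ) A x‖ := real_inner_le_norm _ _
    _ ≤ ‖x‖ * (specNorm A * ‖x‖) := by gcongr; exact ContinuousLinearMap.le_opNorm _ _
    _ = _ := by ring

theorem specNorm_eq_zero_of_dim_zero (A : Matrix (Fin 0) (Fin 0) ℝ) : specNorm A = 0 := by
  rw [Subsingleton.elim A 0, specNorm, map_zero, norm_zero]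

/-- A symmetric matrix has a unit eigenvector whose eigenvalue is `± specNorm`. -/
theorem exists_eigenvector_specNorm {A : Matrix (Fin (d + 1)) (Fin (d + 1)) ℝ} (hA : A.IsSymm) :
    ∃ (v : EuclideanSpace ℝ (Fin (d + 1))) (l : ℝ), ‖v‖ = 1 ∧ |l| = specNorm A ∧
      Matrix.toEuclideanCLM (n := Fin (d + 1)) (𝕜 := ℝ) A v = l • v := by
  set T := Matrix.toEuclideanCLM (n := Fin (d + 1)) (𝕜 := ℝ) A with hT
  have hsym : T.toLinearMap.IsSymmetric := by
    intro x y
    change inner ℝ (T x) y = inner ℝ x (T y)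
    rw [real_inner_comm, hT, inner_toEuclideanCLM_eq_sum, inner_toEuclideanCLM_eq_sum,
      Finset.sum_comm]
    refine Finset.sum_congr rfl fun j _ => Finset.sum_congr rfl fun k _ => ?_
    rw [hA.apply]; ring
  have hn : Module.finrank ℝ (EuclideanSpace ℝ (Fin (d + 1))) = d + 1 := by simp
  obtain ⟨i, -, hi⟩ := Finset.exists_max_image Finset.univ (fun i => |hsym.eigenvalues hn i|)
    ⟨0, Finset.mem_univ _⟩
  set b := hsym.eigenvectorBasis hn with hb
  have hbi : T (b i) = hsym.eigenvalues hn i • b i := hsym.apply_eigenvectorBasis hn i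
  have hbn : ‖b i‖ = 1 := b.norm_eq_one i
  refine ⟨b i, hsym.eigenvalues hn i, hbn, le_antisymm ?_ ?_, hbi⟩
  · have := T.le_opNorm (b i)
    rw [hbi, norm_smul, hbn, mul_one, mul_one] at this
    exact this
  · refine ContinuousLinearMap.opNorm_le_bound _ (abs_nonneg _) fun x => ?_
    rw [← sq_le_sq₀ (norm_nonneg _) (by positivity), mul_pow, ← b.sum_sq_norm_inner_right,
      ← b.sum_sq_norm_inner_right x, Finset.mul_sum]
    refine Finset.sum_le_sum fun j _ => ?_
    have e : inner ℝ (b j) (T x) = hsym.eigenvalues hn j * inner ℝ (b j) x := by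
      have h1 : inner ℝ (b j) (T x) = inner ℝ (T (b j)) x := (hsym (b j) x).symm
      have h2 : T (b j) = hsym.eigenvalues hn j • b j := hsym.apply_eigenvectorBasis hn j
      rw [h1, h2, real_inner_smul_left]
    rw [e, norm_mul, mul_pow, Real.norm_eq_abs]
    have := hi j (Finset.mem_univ _)
    gcongr

/-- For a net of mesh `1/4`, a net point near an eigenvector loses only twice the squared mesh. -/
theorem specNorm_le_of_net {A : Matrix (Fin (d + 1)) (Fin (d + 1)) ℝ} (hA : A.IsSymm)
    {N : Finset (EuclideanSpace ℝ (Fin (d + 1)))} (hN1 : ∀ x ∈ N, ‖x‖ = 1)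
    (hN : ∀ v, ‖v‖ = 1 → ∃ x ∈ N, ‖x - v‖ ≤ 1 / 4) :
    ∃ x ∈ N, 7 / 8 * specNorm A ≤ |∑ j, ∑ k, x j * A j k * x k| := by
  obtain ⟨v, l, hv, hl, hTv⟩ := exists_eigenvector_specNorm hA
  obtain ⟨x, hx, hxv⟩ := hN v hv
  refine ⟨x, hx, ?_⟩
  rw [← inner_toEuclideanCLM_eq_sum]
  set T := Matrix.toEuclideanCLM (n := Fin (d + 1)) (𝕜 := ℝ) A with hT
  have hsym : ∀ x y, inner ℝ (T x) y = inner ℝ x (T y) := by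
    intro x y
    rw [real_inner_comm, hT, inner_toEuclideanCLM_eq_sum, inner_toEuclideanCLM_eq_sum,
      Finset.sum_comm]
    refine Finset.sum_congr rfl fun j _ => Finset.sum_congr rfl fun k _ => ?_
    rw [hA.apply]; ring
  set z := x - v with hz
  have hxz : x = v + z := by rw [hz]; abel
  have hvz : 2 * inner ℝ v z = -‖z‖ ^ 2 := by
    have h1 : ‖v + z‖ ^ 2 = ‖v‖ ^ 2 + 2 * inner ℝ v z + ‖z‖ ^ 2 := norm_add_sq_real v z
    rw [← hxz, hN1 x hx, hv] at h1
    linarith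
  have e : inner ℝ x (T x) = l - l * ‖z‖ ^ 2 + inner ℝ z (T z) := by
    have h2 : inner ℝ v (T z) = l * inner ℝ v z := by
      rw [← hsym, hTv, real_inner_smul_left]
    rw [hxz, map_add, inner_add_left, inner_add_right, inner_add_right, hTv, h2,
      real_inner_smul_right, real_inner_smul_right, real_inner_self_eq_norm_sq, hv,
      real_inner_comm v z]
    linear_combination l * hvz
  have hz2 : ‖z‖ ^ 2 ≤ 1 / 16 := by
    have := pow_le_pow_left₀ (norm_nonneg z) hxv 2
    norm_num at this ⊢
    exact this
  have hzT : |inner ℝ z (T z)| ≤ specNorm A * ‖z‖ ^ 2 := by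
    calc _ ≤ ‖z‖ * ‖T z‖ := abs_real_inner_le_norm _ _
      _ ≤ ‖z‖ * (specNorm A * ‖z‖) := by gcongr; exact ContinuousLinearMap.le_opNorm _ _
      _ = _ := by ring
  have h3 : |l| - |l| * ‖z‖ ^ 2 - |inner ℝ z (T z)| ≤ |inner ℝ x (T x)| := by
    rw [e]
    have a1 := abs_sub_abs_le_abs_sub (l - l * ‖z‖ ^ 2) (-inner ℝ z (T z))
    rw [sub_neg_eq_add, abs_neg] at a1
    have a2 : |l - l * ‖z‖ ^ 2| = |l| - |l| * ‖z‖ ^ 2 := by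
      rw [show l - l * ‖z‖ ^ 2 = l * (1 - ‖z‖ ^ 2) by ring, abs_mul,
        abs_of_nonneg (by linarith : 0 ≤ 1 - ‖z‖ ^ 2)]
      ring
    linarith
  rw [hl] at h3
  have h0 := specNorm_nonneg A
  nlinarith

/-- The expected spectral norm of a random symmetric matrix whose quadratic form has a controlled
moment generating function in every direction, by a union bound over a net. -/
theorem integral_specNorm_le {α : Type*} [MeasurableSpace α] {P : Measure α}
    [IsProbabilityMeasure P] {W : α → Matrix (Fin d) (Fin d) ℝ} (hsym : ∀ ω, (W ω).IsSymm)
    (mW : ∀ j k, Measurable fun ω => W ω j k) {B : ℝ} (hB : ∀ ω j k, |W ω j k| ≤ B)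
    {t ψ : ℝ} (ht : 0 < t) (hψ : 0 ≤ ψ)
    (hmgf : ∀ x : EuclideanSpace ℝ (Fin d), ‖x‖ = 1 → ∀ σ : ℝ, |σ| = 1 →
      ∫ ω, Real.exp (σ * t * ∑ j, ∑ k, x j * W ω j k * x k) ∂P ≤ Real.exp ψ) :
    ∫ ω, specNorm (W ω) ∂P ≤ 8 / 7 * ((11 / 5 * (d + 1) + ψ) / t) := by
  rcases d with _ | d
  · simp_rw [specNorm_eq_zero_of_dim_zero]
    simp only [integral_zero]
    positivity
  obtain ⟨N, hN1, hNc, hN⟩ := exists_net_sphere (d + 1)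
  set q : EuclideanSpace ℝ (Fin (d + 1)) → α → ℝ := fun x ω => ∑ j, ∑ k, x j * W ω j k * x k with hq
  have mq : ∀ x, Measurable (q x) := fun x =>
    Finset.measurable_sum _ fun j _ => Finset.measurable_sum _ fun k _ =>
      ((mW j k).const_mul _).mul_const _
  have bq : ∀ x ω, |q x ω| ≤ ∑ j, ∑ k, |x j| * B * |x k| := by
    intro x ω
    refine (Finset.abs_sum_le_sum_abs _ _).trans (Finset.sum_le_sum fun j _ => ?_)
    refine (Finset.abs_sum_le_sum_abs _ _).trans (Finset.sum_le_sum fun k _ => ?_)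
    rw [abs_mul, abs_mul]
    gcongr
    exact hB ω j k
  have mS : Measurable fun ω => specNorm (W ω) := measurable_specNorm mW
  have bS : ∀ ω, |specNorm (W ω)| ≤ (d + 1 : ℕ) * |B| := by
    intro ω
    rw [abs_of_nonneg (specNorm_nonneg _)]
    exact specNorm_le_of_forall_abs_le (abs_nonneg B)
      fun j k => (hB ω j k).trans (le_abs_self B)
  have iS : Integrable (fun ω => specNorm (W ω)) P := integrable_of_bounded mS bS
  have iE : ∀ x (c : ℝ), Integrable (fun ω => Real.exp (c * q x ω)) P := by
    intro x c
    refine integrable_of_bounded (by have := mq x; fun_prop)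
      (C := Real.exp (|c| * ∑ j, ∑ k, |x j| * B * |x k|)) fun ω => ?_
    rw [abs_of_pos (Real.exp_pos _)]
    refine Real.exp_le_exp.2 ((le_abs_self _).trans ?_)
    rw [abs_mul]
    gcongr
    exact bq x ω
  have hpt : ∀ ω, Real.exp (7 / 8 * t * specNorm (W ω)) ≤
      ∑ x ∈ N, (Real.exp (t * q x ω) + Real.exp (-t * q x ω)) := by
    intro ω
    obtain ⟨x, hx, hle⟩ := specNorm_le_of_net (hsym ω) hN1 hN
    refine le_trans ?_ (Finset.single_le_sum (f := fun x => Real.exp (t * q x ω) +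
      Real.exp (-t * q x ω)) (fun y _ => by positivity) hx)
    have h1 : 7 / 8 * t * specNorm (W ω) ≤ t * |q x ω| := by
      have := mul_le_mul_of_nonneg_left hle ht.le
      linarith
    rcases abs_cases (q x ω) with ⟨h, -⟩ | ⟨h, -⟩
    · rw [h] at h1
      exact (Real.exp_le_exp.2 h1).trans (le_add_of_nonneg_right (Real.exp_pos _).le)
    · rw [h] at h1
      refine (Real.exp_le_exp.2 ?_).trans (le_add_of_nonneg_left (Real.exp_pos _).le)
      linarith
  have iL : Integrable (fun ω => Real.exp (7 / 8 * t * specNorm (W ω))) P := by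
    refine integrable_of_bounded (by fun_prop)
      (C := Real.exp (7 / 8 * t * ((d + 1 : ℕ) * |B|))) fun ω => ?_
    rw [abs_of_pos (Real.exp_pos _)]
    refine Real.exp_le_exp.2 ?_
    gcongr
    exact (le_abs_self _).trans (bS ω)
  have h1 : ∫ ω, Real.exp (7 / 8 * t * specNorm (W ω)) ∂P ≤
      (9 : ℝ) ^ (d + 1) * (2 * Real.exp ψ) := by
    have iE2 : ∀ x ∈ N, Integrable
        (fun ω => Real.exp (t * q x ω) + Real.exp (-t * q x ω)) P :=
      fun x _ => (iE x t).add (iE x (-t))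
    calc _ ≤ ∫ ω, ∑ x ∈ N, (Real.exp (t * q x ω) + Real.exp (-t * q x ω)) ∂P :=
          integral_mono iL (integrable_finsetSum _ iE2) hpt
      _ = ∑ x ∈ N, (∫ ω, Real.exp (t * q x ω) ∂P + ∫ ω, Real.exp (-t * q x ω) ∂P) := by
          rw [integral_finsetSum _ iE2]
          exact Finset.sum_congr rfl fun x _ => integral_add (iE x t) (iE x (-t))
      _ ≤ ∑ x ∈ N, (2 * Real.exp ψ) := by
          refine Finset.sum_le_sum fun x hx => ?_
          have a1 := hmgf x (hN1 x hx) 1 (by simp)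
          have a2 := hmgf x (hN1 x hx) (-1) (by simp)
          simp only [one_mul, neg_mul] at a1 a2 ⊢
          linarith
      _ = (N.card : ℝ) * (2 * Real.exp ψ) := by rw [Finset.sum_const, nsmul_eq_mul]
      _ ≤ _ := by
          gcongr
          exact_mod_cast hNc
  have h2 := exp_integral_le_integral_exp (iS.const_mul (7 / 8 * t)) iL
  rw [integral_const_mul] at h2
  have h9 : (9 : ℝ) ≤ Real.exp (11 / 5) := by
    have e1 : Real.exp (11 / 5) ^ 5 = Real.exp 1 ^ 11 := by
      rw [← Real.exp_nat_mul, ← Real.exp_nat_mul]; norm_num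
    have e2 : (2.718 : ℝ) ^ 11 ≤ Real.exp 1 ^ 11 := by
      gcongr; linarith [Real.exp_one_gt_d9]
    refine le_of_pow_le_pow_left₀ (n := 5) (by norm_num) (Real.exp_pos _).le ?_
    rw [e1]
    refine le_trans ?_ e2
    norm_num
  have h3 : (9 : ℝ) ^ (d + 1) * (2 * Real.exp ψ) ≤ Real.exp (11 / 5 * ((d + 1 : ℕ) + 1) + ψ) := by
    calc (9 : ℝ) ^ (d + 1) * (2 * Real.exp ψ)
        ≤ Real.exp (11 / 5) ^ (d + 1) * (Real.exp (11 / 5) * Real.exp ψ) := by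
          gcongr; linarith
      _ = _ := by
          rw [← Real.exp_nat_mul, ← Real.exp_add, ← Real.exp_add]
          congr 1; ring
  have h4 := Real.exp_le_exp.1 (h2.trans (h1.trans h3))
  have h5 : ∫ ω, specNorm (W ω) ∂P ≤ (11 / 5 * ((d + 1 : ℕ) + 1) + ψ) / t * (8 / 7) := by
    rw [div_mul_eq_mul_div, le_div_iff₀ ht]
    linarith
  linarith

end GaussianCopula

end

/-! ### Signs of correlated normal variables -/

noncomputable section

namespace GaussianCopula

theorem measurable_sign : Measurable Real.sign := by
  unfold Real.sign
  exact Measurable.ite measurableSet_Iio measurable_const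
    (Measurable.ite measurableSet_Ioi measurable_const measurable_const)

theorem abs_sign_le_one (x : ℝ) : |Real.sign x| ≤ 1 := by
  rcases Real.sign_apply_eq x with h | h | h <;> simp [h]

theorem sign_mul_of_pos {c : ℝ} (hc : 0 < c) (x : ℝ) : Real.sign (c * x) = Real.sign x := by
  rcases lt_trichotomy x 0 with h | h | h
  · rw [Real.sign_of_neg h, Real.sign_of_neg (mul_neg_of_pos_of_neg hc h)]
  · simp [h]
  · rw [Real.sign_of_pos h, Real.sign_of_pos (mul_pos hc h)]

theorem abs_sign_mul_sign_le_one (x y : ℝ) : |Real.sign x * Real.sign y| ≤ 1 := by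
  rw [abs_mul]
  exact mul_le_one₀ (abs_sign_le_one x) (abs_nonneg _) (abs_sign_le_one y)

/-- The function `x ↦ E sgn (x - Z)` with `Z` standard normal, that is `2 Φ(x) - 1`. -/
def gaussSign (x : ℝ) : ℝ := ∫ z, Real.sign (x - z) ∂(gaussianReal 0 1)

theorem abs_gaussSign_le_one (x : ℝ) : |gaussSign x| ≤ 1 := by
  have := norm_integral_le_of_norm_le_const (μ := gaussianReal 0 1) (C := 1)
    (f := fun z => Real.sign (x - z)) (Filter.Eventually.of_forall fun z => abs_sign_le_one _)
  simpa [gaussSign] using this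

theorem gaussSign_eq (x : ℝ) :
    gaussSign x = 2 * (∫ z in Set.Iic x, gaussianPDFReal 0 1 z) - 1 := by
  have h1 : gaussSign x = ∫ z, (2 * (Set.Iic x).indicator (fun _ => (1 : ℝ)) z - 1)
      ∂(gaussianReal 0 1) := by
    have := nullSingletonClass_gaussianReal (μ := 0) (v := 1) one_ne_zero
    refine integral_congr_ae ?_
    have hx : ∀ᵐ z ∂(gaussianReal 0 1), z ≠ x := by
      simp [ae_iff]
    filter_upwards [hx] with z hz
    rcases lt_or_gt_of_ne hz with h | h
    · rw [Real.sign_of_pos (by linarith), Set.indicator_of_mem (by exact h.le)]; norm_num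
    · rw [Real.sign_of_neg (by linarith), Set.indicator_of_notMem (by simpa using h)]; norm_num
  rw [h1, integral_sub ((integrable_const _).indicator measurableSet_Iic |>.const_mul _)
    (integrable_const _), integral_const_mul,
    integral_gaussianReal_eq_integral_smul one_ne_zero]
  congr 2
  · rw [← integral_indicator measurableSet_Iic]
    congr 1
    ext z
    by_cases h : z ∈ Set.Iic x <;> simp [h]
  · simp

theorem continuous_stdPDF : Continuous (gaussianPDFReal 0 1) := by
  unfold gaussianPDFReal
  fun_prop

theorem hasDerivAt_gaussSign (x : ℝ) : HasDerivAt gaussSign (2 * gaussianPDFReal 0 1 x) x := by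
  have hi : Integrable (gaussianPDFReal 0 1) := integrable_gaussianPDFReal 0 1
  have e : gaussSign = fun y => 2 * ((∫ z in Set.Iic x, gaussianPDFReal 0 1 z) +
      ∫ z in x..y, gaussianPDFReal 0 1 z) - 1 := by
    ext y
    rw [gaussSign_eq, ← intervalIntegral.integral_Iic_sub_Iic hi.integrableOn hi.integrableOn]
    ring
  rw [e]
  have := intervalIntegral.integral_hasDerivAt_right (a := x) (b := x)
    (f := gaussianPDFReal 0 1) (by simp)
    continuous_stdPDF.stronglyMeasurable.stronglyMeasurableAtFilter continuous_stdPDF.continuousAt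
  simpa using ((this.const_add _).const_mul 2).sub_const 1

theorem continuous_gaussSign : Continuous gaussSign :=
  continuous_iff_continuousAt.2 fun x => (hasDerivAt_gaussSign x).continuousAt

theorem measurable_gaussSign : Measurable gaussSign := continuous_gaussSign.measurable

theorem stdPDF_eq (x : ℝ) :
    gaussianPDFReal 0 1 x = (√(2 * Real.pi))⁻¹ * Real.exp (-x ^ 2 / 2) := by
  simp [gaussianPDFReal]

theorem stdPDF_le (x : ℝ) : gaussianPDFReal 0 1 x ≤ (√(2 * Real.pi))⁻¹ := by
  rw [stdPDF_eq]
  refine mul_le_of_le_one_right (by positivity) (Real.exp_le_one_iff.2 ?_)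
  have := sq_nonneg x
  linarith

theorem inv_sqrt_two_pi_sq : (√(2 * Real.pi))⁻¹ * (√(2 * Real.pi))⁻¹ = 1 / (2 * Real.pi) := by
  rw [← mul_inv, Real.mul_self_sqrt (by positivity), one_div]

/-- The Lipschitz constant of `gaussSign` is `√(2 / π)`, twice the maximum of the Gaussian density.
-/
theorem gaussSign_sub_sq_le (x y : ℝ) :
    (gaussSign x - gaussSign y) ^ 2 ≤ 2 / Real.pi * (x - y) ^ 2 := by
  have h := Convex.norm_image_sub_le_of_norm_hasDerivWithin_le (s := Set.univ) (f := gaussSign)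
    (C := 2 * (√(2 * Real.pi))⁻¹) (x := y) (y := x)
    (fun z _ => (hasDerivAt_gaussSign z).hasDerivWithinAt) (fun z _ => by
      rw [Real.norm_eq_abs, abs_of_nonneg (by have := gaussianPDFReal_nonneg 0 1 z; positivity)]
      have := stdPDF_le z
      linarith) convex_univ trivial trivial
  simp only [Real.norm_eq_abs] at h
  have h2 := pow_le_pow_left₀ (abs_nonneg _) h 2
  rw [sq_abs, mul_pow, sq_abs] at h2
  refine h2.trans (le_of_eq ?_)
  congr 1
  rw [mul_pow, sq (√(2 * Real.pi))⁻¹, inv_sqrt_two_pi_sq]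
  ring

theorem gaussSign_zero : gaussSign 0 = 0 := by
  have h : gaussSign 0 = -gaussSign 0 := by
    have e : (gaussianReal 0 1).map (fun x => -x) = gaussianReal 0 1 := by
      rw [gaussianReal_map_neg, neg_zero]
    conv_lhs => rw [gaussSign, ← e]
    have hm : Measurable fun z : ℝ => Real.sign (0 - z) := measurable_sign.comp (by fun_prop)
    rw [integral_map (by fun_prop) hm.aestronglyMeasurable, gaussSign, ← integral_neg]
    congr 1
    ext z
    rw [← Real.sign_neg]
    congr 1
    ring
  linarith

theorem integral_sign_sub_mul (b : ℝ) {c : ℝ} (hc : 0 < c) :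
    ∫ z, Real.sign (b - c * z) ∂(gaussianReal 0 1) = gaussSign (b / c) := by
  rw [gaussSign]
  congr 1
  ext z
  rw [← sign_mul_of_pos hc (b / c - z)]
  congr 1
  field_simp

/-- The quadrant-type expectation `E sgn (a - X) sgn (b - Y)` for standard normal `X`, `Y` with
correlation `sin θ`, written as an integral over `X`. -/
def signCorr (a b θ : ℝ) : ℝ :=
  ∫ x, Real.sign (a - x) * gaussSign ((b - x * Real.sin θ) / Real.cos θ) ∂(gaussianReal 0 1)

/-- Plackett's identity. With `s = sin θ` and `c = cos θ`, the left side is the integral of the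
derivative in `θ` of the integrand of `signCorr`, and the right side is `4 c` times the density at
`(a, b)` of the pair with correlation `s`. -/
theorem integral_sign_mul_deriv (a b : ℝ) {s c : ℝ} (hc : 0 < c) (hsc : s ^ 2 + c ^ 2 = 1) :
    ∫ x, Real.sign (a - x) * (2 * gaussianPDFReal 0 1 ((b - x * s) / c) * ((b * s - x) / c ^ 2))
      ∂(gaussianReal 0 1) =
    4 * gaussianPDFReal 0 1 b * gaussianPDFReal 0 1 ((a - b * s) / c) := by
  -- by the symmetry of the bivariate density the integrand is `± G'` with
  -- `G x = 2 φ(b) φ((x - b s) / c)`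
  set φ := gaussianPDFReal 0 1 with hφ
  set G : ℝ → ℝ := fun x => 2 * φ b * φ ((x - b * s) / c) with hG
  set G' : ℝ → ℝ := fun x => 2 * φ b * φ ((x - b * s) / c) * ((b * s - x) / c ^ 2) with hG'
  have hd : ∀ x, HasDerivAt G (G' x) x := by
    intro x
    have h1 : HasDerivAt (fun x => (x - b * s) / c) (1 / c) x :=
      ((hasDerivAt_id x).sub_const _).div_const c
    have h2 : HasDerivAt (fun x => Real.exp (-((x - b * s) / c) ^ 2 / 2))
        (Real.exp (-((x - b * s) / c) ^ 2 / 2) * ((b * s - x) / c ^ 2)) x := by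
      have h5 : HasDerivAt (fun x => -((x - b * s) / c) ^ 2 / 2) ((b * s - x) / c ^ 2) x := by
        refine ((h1.fun_pow 2).fun_neg.div_const 2).congr_deriv ?_
        push_cast
        field_simp
        ring
      exact h5.exp
    have h3 := (h2.const_mul (√(2 * Real.pi))⁻¹).const_mul (2 * φ b)
    refine (h3.congr_deriv ?_).congr_of_eventuallyEq (Filter.Eventually.of_forall fun y => ?_)
    · simp only [hG', hφ, stdPDF_eq]; ring
    · simp only [hG, hφ, stdPDF_eq]
  have hprod : ∀ x, φ x * φ ((b - x * s) / c) = φ b * φ ((x - b * s) / c) := by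
    intro x
    simp only [hφ, stdPDF_eq]
    rw [mul_mul_mul_comm, mul_mul_mul_comm _ (Real.exp (-b ^ 2 / 2)), ← Real.exp_add,
      ← Real.exp_add]
    congr 2
    have hc2 : c ^ 2 = 1 - s ^ 2 := by linarith
    have : 1 - s ^ 2 ≠ 0 := by rw [← hc2]; positivity
    rw [div_pow, div_pow, hc2]
    field_simp
    ring
  have hint : Integrable G' := by
    have h1 : Integrable fun x : ℝ => x * Real.exp (-(1 / 2) * x ^ 2) :=
      integrable_mul_exp_neg_mul_sq (by norm_num)
    have h2 : Integrable fun x : ℝ => ((x + -(b * s)) / c) *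
        Real.exp (-(1 / 2) * ((x + -(b * s)) / c) ^ 2) :=
      (h1.comp_div hc.ne').comp_add_right (-(b * s))
    refine (h2.const_mul (-(2 * φ b * (√(2 * Real.pi))⁻¹ / c))).congr
      (Filter.Eventually.of_forall fun x => ?_)
    simp only [hG', hφ, stdPDF_eq]
    have e : -(1 / 2) * ((x + -(b * s)) / c) ^ 2 = -((x - b * s) / c) ^ 2 / 2 := by ring
    rw [e]
    field_simp
    ring
  have hexp : Filter.Tendsto (fun y : ℝ => Real.exp (-y ^ 2 / 2)) (Filter.cocompact ℝ)
      (nhds 0) := by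
    refine Real.tendsto_exp_atBot.comp ?_
    have h1 : Filter.Tendsto (fun y : ℝ => ‖y‖ ^ 2) (Filter.cocompact ℝ) Filter.atTop :=
      (Filter.tendsto_pow_atTop two_ne_zero).comp tendsto_norm_cocompact_atTop
    have h2 := (h1.atTop_div_const (show (0 : ℝ) < 2 by norm_num))
    refine (Filter.tendsto_neg_atTop_atBot.comp h2).congr fun y => ?_
    simp only [Function.comp_apply, Real.norm_eq_abs, sq_abs]
    ring
  have hlim : ∀ l : Filter ℝ, Filter.Tendsto (fun x => (x - b * s) / c) l (Filter.cocompact ℝ) →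
      Filter.Tendsto G l (nhds 0) := by
    intro l hl
    have := ((hexp.comp hl).const_mul (√(2 * Real.pi))⁻¹).const_mul (2 * φ b)
    simp only [mul_zero] at this
    refine this.congr fun y => ?_
    simp only [hG, hφ, stdPDF_eq, Function.comp_apply]
  have htop : Filter.Tendsto G Filter.atTop (nhds 0) :=
    hlim _ (((Filter.tendsto_atTop_add_const_right _ (-(b * s)) Filter.tendsto_id).atTop_div_const
      hc).mono_right atTop_le_cocompact)
  have hbot : Filter.Tendsto G Filter.atBot (nhds 0) :=
    hlim _ (((Filter.tendsto_atBot_add_const_right _ (-(b * s)) Filter.tendsto_id).atBot_div_const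
      hc).mono_right atBot_le_cocompact)
  have i1 := integral_Iic_of_hasDerivAt_of_tendsto' (a := a) (fun x _ => hd x)
    hint.integrableOn hbot
  have i2 := integral_Ioi_of_hasDerivAt_of_tendsto' (a := a) (fun x _ => hd x)
    hint.integrableOn htop
  rw [integral_gaussianReal_eq_integral_smul one_ne_zero]
  have e : ∀ x, φ x • (Real.sign (a - x) * (2 * φ ((b - x * s) / c) * ((b * s - x) / c ^ 2))) =
      Real.sign (a - x) * G' x := by
    intro x
    simp only [hG', smul_eq_mul]
    linear_combination 2 * Real.sign (a - x) * ((b * s - x) / c ^ 2) * hprod x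
  rw [integral_congr_ae (Filter.Eventually.of_forall e)]
  have hi' : Integrable fun x => Real.sign (a - x) * G' x :=
    hint.bdd_mul (c := 1)
      (measurable_sign.comp (by fun_prop : Measurable fun x : ℝ => a - x)).aestronglyMeasurable
      (Filter.Eventually.of_forall fun x => abs_sign_le_one _)
  rw [← intervalIntegral.integral_Iic_add_Ioi hi'.integrableOn hi'.integrableOn (b := a),
    integral_Iic_eq_integral_Iio]
  have e1 : ∫ x in Set.Iio a, Real.sign (a - x) * G' x = ∫ x in Set.Iio a, G' x :=
    setIntegral_congr_fun measurableSet_Iio fun x hx => by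
      have : 0 < a - x := sub_pos.2 hx
      simp [Real.sign_of_pos this]
  have e2 : ∫ x in Set.Ioi a, Real.sign (a - x) * G' x = ∫ x in Set.Ioi a, -G' x :=
    setIntegral_congr_fun measurableSet_Ioi fun x hx => by
      have : a - x < 0 := sub_neg.2 hx
      simp [Real.sign_of_neg this]
  rw [e1, e2, integral_neg, ← integral_Iic_eq_integral_Iio, i1, i2]
  simp only [hG]
  ring

/-- In the angle `θ` of the correlation `sin θ`, the derivative of the expectation of the product of
signs is nonnegative and at most `2 / π`, and equal to `2 / π` for `a = b = 0`. -/
theorem hasDerivAt_signCorr (a b : ℝ) {θ : ℝ} (h : 0 < Real.cos θ) :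
    HasDerivAt (signCorr a b)
      (4 * gaussianPDFReal 0 1 b * gaussianPDFReal 0 1 ((a - b * Real.sin θ) / Real.cos θ)) θ := by
  set c₀ := Real.cos θ / 2 with hc₀
  have hc₀pos : 0 < c₀ := by positivity
  have hs : {t | c₀ < Real.cos t} ∈ nhds θ :=
    (isOpen_lt continuous_const Real.continuous_cos).mem_nhds (by
      simp only [Set.mem_ofPred_eq]; linarith)
  have hm : ∀ t, Measurable fun x : ℝ => Real.sign (a - x) *
      gaussSign ((b - x * Real.sin t) / Real.cos t) := fun t =>
    (measurable_sign.comp (by fun_prop)).mul (measurable_gaussSign.comp (by fun_prop))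
  have key := hasDerivAt_integral_of_dominated_loc_of_deriv_le (μ := gaussianReal 0 1)
    (F := fun t x => Real.sign (a - x) * gaussSign ((b - x * Real.sin t) / Real.cos t))
    (F' := fun t x => Real.sign (a - x) * (2 * gaussianPDFReal 0 1 ((b - x * Real.sin t) /
      Real.cos t) * ((b * Real.sin t - x) / Real.cos t ^ 2)))
    (x₀ := θ) (s := {t | c₀ < Real.cos t})
    (bound := fun x => 2 * (√(2 * Real.pi))⁻¹ * ((|b| + |x|) / c₀ ^ 2)) hs
    (Filter.Eventually.of_forall fun t => (hm t).aestronglyMeasurable)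
    (integrable_of_bounded (hm θ) (C := 1) fun x => by
      rw [abs_mul]
      exact mul_le_one₀ (abs_sign_le_one _) (abs_nonneg _) (abs_gaussSign_le_one _))
    (by
      refine Measurable.aestronglyMeasurable ((measurable_sign.comp (by fun_prop)).mul ?_)
      have := measurable_gaussianPDFReal 0 1
      fun_prop)
    (Filter.Eventually.of_forall fun x t ht => by
      have ht : c₀ < Real.cos t := ht
      have hp := gaussianPDFReal_nonneg 0 1 ((b - x * Real.sin t) / Real.cos t)
      have hp1 := stdPDF_le ((b - x * Real.sin t) / Real.cos t)
      rw [norm_mul, norm_mul, norm_mul, norm_div]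
      simp only [Real.norm_eq_abs]
      rw [abs_of_nonneg hp, abs_of_nonneg (sq_nonneg (Real.cos t)), abs_two]
      have h1 : |b * Real.sin t - x| ≤ |b| + |x| := by
        refine (abs_sub _ _).trans ?_
        rw [abs_mul]
        have := mul_le_of_le_one_right (abs_nonneg b) (Real.abs_sin_le_one t)
        linarith
      refine (mul_le_of_le_one_left (by positivity) (abs_sign_le_one _)).trans ?_
      have hct : 0 < Real.cos t := hc₀pos.trans ht
      gcongr)
    (by
      have hx : Integrable (fun x : ℝ => |x|) (gaussianReal 0 1) := by
        have : Integrable (fun x : ℝ => x) (gaussianReal 0 1) := IsGaussian.integrable_fun_id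
        exact this.abs
      exact (((integrable_const _).add hx).div_const _).const_mul _)
    (Filter.Eventually.of_forall fun x t ht => by
      have hct : 0 < Real.cos t := hc₀pos.trans ht
      have h1 : HasDerivAt (fun t => (b - x * Real.sin t) / Real.cos t)
          ((b * Real.sin t - x) / Real.cos t ^ 2) t := by
        refine ((((Real.hasDerivAt_sin t).const_mul x).const_sub b).div (Real.hasDerivAt_cos t)
          hct.ne').congr_deriv ?_
        congr 1
        linear_combination -x * Real.sin_sq_add_cos_sq t
      exact ((hasDerivAt_gaussSign _).comp t h1).const_mul _)
  refine key.2.congr_deriv ?_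
  exact integral_sign_mul_deriv a b h (Real.sin_sq_add_cos_sq θ)

theorem signCorr_zero (a b : ℝ) : signCorr a b 0 = gaussSign a * gaussSign b := by
  simp only [signCorr, Real.sin_zero, Real.cos_zero, mul_zero, sub_zero, div_one]
  rw [integral_mul_const]; rfl

theorem abs_signCorr_sub_le (a b : ℝ) {θ : ℝ} (hθ : θ ∈ Set.Ioo (-(Real.pi / 2)) (Real.pi / 2)) :
    |signCorr a b θ - gaussSign a * gaussSign b| ≤ 2 / Real.pi * |θ| := by
  have h := Convex.norm_image_sub_le_of_norm_hasDerivWithin_le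
    (s := Set.Ioo (-(Real.pi / 2)) (Real.pi / 2)) (f := signCorr a b)
    (C := 2 / Real.pi) (x := 0) (y := θ)
    (fun t ht => (hasDerivAt_signCorr a b (Real.cos_pos_of_mem_Ioo ht)).hasDerivWithinAt)
    (fun t ht => by
      have h1 := gaussianPDFReal_nonneg 0 1 b
      have h2 := gaussianPDFReal_nonneg 0 1 ((a - b * Real.sin t) / Real.cos t)
      have h3 := stdPDF_le b
      have h4 := stdPDF_le ((a - b * Real.sin t) / Real.cos t)
      rw [Real.norm_eq_abs, abs_of_nonneg (by positivity), mul_assoc]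
      calc _ ≤ 4 * ((√(2 * Real.pi))⁻¹ * (√(2 * Real.pi))⁻¹) := by gcongr
        _ = _ := by rw [inv_sqrt_two_pi_sq]; ring) (convex_Ioo _ _)
    ⟨by have := Real.pi_pos; linarith, by have := Real.pi_pos; linarith⟩ hθ
  rwa [signCorr_zero, sub_zero] at h

theorem signCorr_zero_zero {θ : ℝ} (hθ : θ ∈ Set.Ioo (-(Real.pi / 2)) (Real.pi / 2)) :
    signCorr 0 0 θ = 2 / Real.pi * θ := by
  have h := Convex.norm_image_sub_le_of_norm_hasDerivWithin_le
    (s := Set.Ioo (-(Real.pi / 2)) (Real.pi / 2)) (f := fun t => signCorr 0 0 t - 2 / Real.pi * t)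
    (C := 0) (x := 0) (y := θ)
    (fun t ht => ((hasDerivAt_signCorr 0 0 (Real.cos_pos_of_mem_Ioo ht)).sub
      ((hasDerivAt_id t).const_mul (2 / Real.pi))).hasDerivWithinAt)
    (fun t ht => by
      refine le_of_eq ?_
      rw [norm_eq_zero]
      simp only [zero_mul, sub_zero, zero_div, stdPDF_eq]
      have := inv_sqrt_two_pi_sq
      simp only [ne_eq, OfNat.ofNat_ne_zero, not_false_eq_true, zero_pow, neg_zero, zero_div,
        Real.exp_zero, mul_one]
      linear_combination 4 * this) (convex_Ioo _ _)
    ⟨by have := Real.pi_pos; linarith, by have := Real.pi_pos; linarith⟩ hθ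
  rw [signCorr_zero, gaussSign_zero] at h
  simp only [mul_zero, sub_zero, zero_mul, norm_le_zero_iff] at h
  linarith

end GaussianCopula

end

/-! ### The bivariate normal law -/

noncomputable section

namespace GaussianCopula

theorem two_div_pi_mul_arcsin_le {r : ℝ} (h0 : 0 ≤ r) (h1 : r ≤ 1) :
    2 / Real.pi * Real.arcsin r ≤ r := by
  have := Real.mul_le_sin (Real.arcsin_nonneg.2 h0) (Real.arcsin_le_pi_div_two r)
  rwa [Real.sin_arcsin (by linarith) h1] at this

/-- The concavity of `sin` on `[0, α]`, in terms of `arcsin`. -/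
theorem arcsin_le_of_le_sin {α y : ℝ} (hα : 0 < α) (hα' : α ≤ Real.pi / 2) (h0 : 0 ≤ y)
    (hy : y ≤ Real.sin α) : Real.sin α * Real.arcsin y ≤ α * y := by
  have hpi := Real.pi_pos
  have hy1 : y ≤ 1 := hy.trans (Real.sin_le_one α)
  have hθ0 : 0 ≤ Real.arcsin y := Real.arcsin_nonneg.2 h0
  have hθα : Real.arcsin y ≤ α := by
    have := Real.arcsin_le_arcsin hy
    rwa [Real.arcsin_sin (by linarith) hα'] at this
  have w1 : 0 ≤ 1 - Real.arcsin y / α := by rw [sub_nonneg, div_le_one hα]; exact hθα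
  have w2 : 0 ≤ Real.arcsin y / α := by positivity
  have hc := strictConcaveOn_sin_Icc.concaveOn.2
    (⟨le_rfl, hpi.le⟩ : (0 : ℝ) ∈ Set.Icc 0 Real.pi)
    (⟨hα.le, by linarith⟩ : α ∈ Set.Icc 0 Real.pi) w1 w2 (by ring)
  simp only [smul_eq_mul, mul_zero, Real.sin_zero, zero_add, div_mul_cancel₀ _ hα.ne',
    Real.sin_arcsin (by linarith : -1 ≤ y) hy1] at hc
  rw [div_mul_eq_mul_div, div_le_iff₀ hα] at hc
  linarith

/-- The law of a pair of standard normal variables with correlation `r`. -/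
def bivGauss (r : ℝ) : Measure (ℝ × ℝ) :=
  ((gaussianReal 0 1).prod (gaussianReal 0 1)).map fun p => (p.1, r * p.1 + √(1 - r ^ 2) * p.2)

instance (r : ℝ) : IsProbabilityMeasure (bivGauss r) :=
  Measure.isProbabilityMeasure_map (by fun_prop)

theorem measurable_sign_mul_sign {α : Type*} [MeasurableSpace α] {f g : α → ℝ} (hf : Measurable f)
    (hg : Measurable g) : Measurable fun x => Real.sign (f x) * Real.sign (g x) :=
  (measurable_sign.comp hf).mul (measurable_sign.comp hg)

theorem integral_bivGauss_sign (a b r : ℝ) :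
    ∫ p, Real.sign (a - p.1) * Real.sign (b - p.2) ∂(bivGauss r) =
      ∫ x, Real.sign (a - x) * ∫ z, Real.sign ((b - r * x) - √(1 - r ^ 2) * z) ∂(gaussianReal 0 1)
        ∂(gaussianReal 0 1) := by
  have hm : Measurable fun p : ℝ × ℝ => Real.sign (a - p.1) * Real.sign (b - p.2) :=
    measurable_sign_mul_sign (by fun_prop) (by fun_prop)
  have hm2 : Measurable fun p : ℝ × ℝ =>
      Real.sign (a - p.1) * Real.sign (b - (r * p.1 + √(1 - r ^ 2) * p.2)) :=
    measurable_sign_mul_sign (by fun_prop) (by fun_prop)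
  rw [bivGauss, integral_map (by fun_prop) hm.aestronglyMeasurable, integral_prod]
  · congr 1
    ext x
    rw [← integral_const_mul]
    congr 1
    ext z
    congr 2
    ring
  · exact integrable_of_bounded hm2 (C := 1) fun _ => abs_sign_mul_sign_le_one _ _

/-- The expectation of a product of signs for the correlation `r = sin θ`, `|r| < 1`, is `signCorr`
at `θ = arcsin r`. -/
theorem integral_bivGauss_eq_signCorr (a b : ℝ) {r : ℝ} (h1 : -1 < r) (h2 : r < 1) :
    ∫ p, Real.sign (a - p.1) * Real.sign (b - p.2) ∂(bivGauss r) =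
      signCorr a b (Real.arcsin r) := by
  rw [integral_bivGauss_sign, signCorr]
  congr 1
  ext x
  rw [Real.sin_arcsin h1.le h2.le, Real.cos_arcsin, integral_sign_sub_mul]
  · rw [mul_comm r x]
  · exact Real.sqrt_pos.2 (by nlinarith)

theorem arcsin_mem_Ioo {r : ℝ} (h1 : -1 < r) (h2 : r < 1) :
    Real.arcsin r ∈ Set.Ioo (-(Real.pi / 2)) (Real.pi / 2) :=
  ⟨Real.neg_pi_div_two_lt_arcsin.2 h1, Real.arcsin_lt_pi_div_two.2 h2⟩

theorem map_neg_stdGaussian : (gaussianReal 0 1).map (fun x => -x) = gaussianReal 0 1 := by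
  rw [gaussianReal_map_neg, neg_zero]

theorem gaussSign_eq_integral_add (b : ℝ) :
    ∫ z, Real.sign (b + z) ∂(gaussianReal 0 1) = gaussSign b := by
  conv_rhs => rw [gaussSign, ← map_neg_stdGaussian]
  have hm : Measurable fun z : ℝ => Real.sign (b - z) := measurable_sign.comp (by fun_prop)
  rw [integral_map (by fun_prop) hm.aestronglyMeasurable]
  simp

/-- The covariance of two functions with values in `[-1, 1]` lies in `[-1, 1]`. -/
theorem abs_integral_mul_sub_le_one {α : Type*} [MeasurableSpace α] {P : Measure α}
    [IsProbabilityMeasure P] {f g : α → ℝ} (mf : Measurable f) (mg : Measurable g)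
    (hf : ∀ x, |f x| ≤ 1) (hg : ∀ x, |g x| ≤ 1) :
    |∫ x, f x * g x ∂P - (∫ x, f x ∂P) * ∫ x, g x ∂P| ≤ 1 := by
  set m := ∫ x, f x ∂P with hm
  set k := ∫ x, g x ∂P with hk
  have If : Integrable f P := integrable_of_bounded mf hf
  have Ig : Integrable g P := integrable_of_bounded mg hg
  have Ifg : Integrable (fun x => f x * g x) P :=
    integrable_of_bounded (mf.mul mg) (C := 1) fun x => by
      rw [abs_mul]; exact mul_le_one₀ (hf x) (abs_nonneg _) (hg x)
  have sq1 : ∀ {y : ℝ}, |y| ≤ 1 → y ^ 2 ≤ 1 := fun h => (sq_le_one_iff_abs_le_one _).2 h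
  -- `2 |cov (f, g)| ≤ var f + var g ≤ 2`
  have key : ∀ σ : ℝ, σ ^ 2 = 1 → σ * (∫ x, f x * g x ∂P - m * k) ≤ 1 := by
    intro σ hσ
    have e : ∫ x, (1 - (m * f x + k * g x - σ * m * g x - σ * k * f x) +
        (m ^ 2 / 2 + k ^ 2 / 2 - σ * m * k) - σ * (f x * g x)) ∂P =
        1 - (m * m + k * k - σ * m * k - σ * k * m) + (m ^ 2 / 2 + k ^ 2 / 2 - σ * m * k) -
          σ * ∫ x, f x * g x ∂P := by
      rw [integral_sub (by fun_prop) (by fun_prop), integral_add (by fun_prop) (by fun_prop),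
        integral_sub (by fun_prop) (by fun_prop), integral_sub (by fun_prop) (by fun_prop),
        integral_sub (by fun_prop) (by fun_prop), integral_add (by fun_prop) (by fun_prop),
        integral_const_mul, integral_const_mul, integral_const_mul, integral_const_mul,
        integral_const_mul]
      simp [← hm, ← hk]
    have h0 : 0 ≤ ∫ x, (1 - (m * f x + k * g x - σ * m * g x - σ * k * f x) +
        (m ^ 2 / 2 + k ^ 2 / 2 - σ * m * k) - σ * (f x * g x)) ∂P := by
      refine integral_nonneg fun x => ?_
      have a1 := sq1 (hf x)
      have a2 := sq1 (hg x)
      have a3 := sq_nonneg ((f x - m) - σ * (g x - k))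
      have a4 : ((f x - m) - σ * (g x - k)) ^ 2 =
        (f x - m) ^ 2 - 2 * σ * (f x - m) * (g x - k) + σ ^ 2 * (g x - k) ^ 2 := by ring
      rw [hσ] at a4
      show 0 ≤ 1 - (m * f x + k * g x - σ * m * g x - σ * k * f x) +
        (m ^ 2 / 2 + k ^ 2 / 2 - σ * m * k) - σ * (f x * g x)
      have a5 := sq_nonneg (f x - m + σ * (g x - k))
      nlinarith
    rw [e] at h0
    nlinarith [sq_nonneg m, sq_nonneg k, sq_nonneg (m - σ * k)]
  rw [abs_le]
  have k1 := key 1 (by norm_num)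
  have k2 := key (-1) (by norm_num)
  constructor <;> linarith

/-- The covariance of two signs of a bivariate normal vector is at most as large as for thresholds
at the medians. -/
theorem abs_integral_bivGauss_sub_le (a b : ℝ) {r : ℝ} (hr : |r| ≤ 1) :
    |∫ p, Real.sign (a - p.1) * Real.sign (b - p.2) ∂(bivGauss r) - gaussSign a * gaussSign b| ≤
      2 / Real.pi * Real.arcsin |r| := by
  rcases lt_or_eq_of_le hr with h | h
  · have h' := abs_lt.1 h
    rw [integral_bivGauss_eq_signCorr a b h'.1 h'.2]
    refine (abs_signCorr_sub_le a b (arcsin_mem_Ioo h'.1 h'.2)).trans (le_of_eq ?_)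
    congr 1
    rcases abs_cases r with ⟨h, h0⟩ | ⟨h, h0⟩
    · rw [h, abs_of_nonneg (Real.arcsin_nonneg.2 h0)]
    · rw [h, Real.arcsin_neg, abs_of_nonpos (Real.arcsin_nonpos.2 h0.le)]
  · have hpi := Real.pi_ne_zero
    have e1 : 2 / Real.pi * (Real.pi / 2) = 1 := by field_simp
    have hsq : √(1 - r ^ 2) = 0 := by rw [← sq_abs, h]; simp
    rw [h, Real.arcsin_one, e1, integral_bivGauss_sign, hsq]
    simp only [zero_mul, sub_zero, integral_const, probReal_univ, one_smul]
    have key := abs_integral_mul_sub_le_one (P := gaussianReal 0 1)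
      (f := fun x => Real.sign (a - x)) (g := fun x => Real.sign (b - r * x))
      (measurable_sign.comp (by fun_prop)) (measurable_sign.comp (by fun_prop))
      (fun x => abs_sign_le_one _) (fun x => abs_sign_le_one _)
    have e2 : ∫ x, Real.sign (b - r * x) ∂(gaussianReal 0 1) = gaussSign b := by
      rcases eq_or_eq_neg_of_abs_eq h with rfl | rfl
      · simp only [one_mul]; rfl
      · simp only [neg_mul, one_mul, sub_neg_eq_add]; exact gaussSign_eq_integral_add b
    rw [e2] at key
    exact key

/-- Sheppard's formula for the orthant probabilities of a bivariate normal vector. -/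
theorem integral_bivGauss_sign_mul_sign {r : ℝ} (hr : |r| ≤ 1) :
    ∫ p, Real.sign p.1 * Real.sign p.2 ∂(bivGauss r) = 2 / Real.pi * Real.arcsin r := by
  have e0 : ∀ p : ℝ × ℝ, Real.sign p.1 * Real.sign p.2 =
      Real.sign (0 - p.1) * Real.sign (0 - p.2) := by
    intro p
    rw [zero_sub, zero_sub, Real.sign_neg, Real.sign_neg]; ring
  simp_rw [e0]
  rcases lt_or_eq_of_le hr with h | h
  · have h' := abs_lt.1 h
    rw [integral_bivGauss_eq_signCorr _ _ h'.1 h'.2, signCorr_zero_zero (arcsin_mem_Ioo h'.1 h'.2)]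
  · have hpi := Real.pi_ne_zero
    have hsq : √(1 - r ^ 2) = 0 := by rw [← sq_abs, h]; simp
    have hne : ∀ᵐ z ∂(gaussianReal 0 1), z ≠ 0 := by
      have := nullSingletonClass_gaussianReal (μ := 0) (v := 1) one_ne_zero
      simp [ae_iff]
    rw [integral_bivGauss_sign, hsq]
    simp only [zero_mul, sub_zero, zero_sub, integral_const, probReal_univ, one_smul]
    have h1 : ∀ z : ℝ, z ≠ 0 → Real.sign z * Real.sign z = 1 := by
      intro z hz
      rcases Real.sign_apply_eq_of_ne_zero z hz with h | h <;> rw [h] <;> norm_num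
    rcases eq_or_eq_neg_of_abs_eq h with rfl | rfl
    · have : ∫ x, Real.sign (-x) * Real.sign (-(1 * x)) ∂(gaussianReal 0 1) =
          ∫ x, (1 : ℝ) ∂(gaussianReal 0 1) := by
        refine integral_congr_ae ?_
        filter_upwards [hne] with z hz
        rw [one_mul, h1 _ (neg_ne_zero.2 hz)]
      rw [this, Real.arcsin_one]; simp
    · have : ∫ x, Real.sign (-x) * Real.sign (-(-1 * x)) ∂(gaussianReal 0 1) =
          ∫ x, (-1 : ℝ) ∂(gaussianReal 0 1) := by
        refine integral_congr_ae ?_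
        filter_upwards [hne] with z hz
        rw [neg_one_mul, neg_neg, Real.sign_neg, neg_mul, h1 _ hz]
      rw [this, Real.arcsin_neg_one]; simp

theorem integral_exp_stdGaussian (s : ℝ) :
    ∫ z : ℝ, Complex.exp ((s * z : ℝ) * Complex.I) ∂(gaussianReal 0 1) =
      Complex.exp ((-(s ^ 2) / 2 : ℝ)) := by
  have := charFun_gaussianReal (μ := 0) (v := 1) s
  rw [charFun_apply_real] at this
  push_cast
  rw [this]
  congr 1
  push_cast
  ring

theorem integral_exp_mul_exp_prod {α β : Type*} [MeasurableSpace α] [MeasurableSpace β]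
    {μ : Measure α} {ν : Measure β} [SFinite μ] [SFinite ν] (f : α → ℝ) (g : β → ℝ) :
    ∫ p, Complex.exp ((f p.1 + g p.2 : ℝ) * Complex.I) ∂(μ.prod ν) =
      (∫ x, Complex.exp ((f x : ℝ) * Complex.I) ∂μ) *
        ∫ y, Complex.exp ((g y : ℝ) * Complex.I) ∂ν := by
  rw [← integral_prod_mul]
  congr 1
  ext p
  rw [← Complex.exp_add]
  congr 1
  push_cast
  ring

theorem integral_exp_bivGauss {r : ℝ} (hr : |r| ≤ 1) (s t : ℝ) :
    ∫ p, Complex.exp ((s * p.1 + t * p.2 : ℝ) * Complex.I) ∂(bivGauss r) =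
      Complex.exp ((-(s ^ 2 + 2 * r * s * t + t ^ 2) / 2 : ℝ)) := by
  rw [bivGauss, integral_map (by fun_prop)
    (Measurable.aestronglyMeasurable (by fun_prop))]
  have e : ∀ p : ℝ × ℝ, s * p.1 + t * (r * p.1 + √(1 - r ^ 2) * p.2) =
      (s + t * r) * p.1 + (t * √(1 - r ^ 2)) * p.2 := fun p => by ring
  simp_rw [e]
  rw [integral_exp_mul_exp_prod (fun x => (s + t * r) * x) (fun y => (t * √(1 - r ^ 2)) * y),
    integral_exp_stdGaussian, integral_exp_stdGaussian, ← Complex.exp_add, ← Complex.ofReal_add]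
  congr 2
  have hr2 : 0 ≤ 1 - r ^ 2 := sub_nonneg.2 ((sq_le_one_iff_abs_le_one r).2 hr)
  rw [mul_pow, Real.sq_sqrt hr2]
  ring

/-- A centred Gaussian pair is determined by its characteristic function. -/
theorem map_eq_bivGauss {α : Type*} [MeasurableSpace α] {P : Measure α} [IsProbabilityMeasure P]
    {X Y : α → ℝ} (hX : Measurable X) (hY : Measurable Y) {r : ℝ} (hr : |r| ≤ 1)
    (h : ∀ s t : ℝ, ∫ ω, Complex.exp ((s * X ω + t * Y ω : ℝ) * Complex.I) ∂P =
      Complex.exp ((-(s ^ 2 + 2 * r * s * t + t ^ 2) / 2 : ℝ))) :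
    P.map (fun ω => (X ω, Y ω)) = bivGauss r := by
  have : IsProbabilityMeasure (P.map fun ω => (X ω, Y ω)) :=
    Measure.isProbabilityMeasure_map (hX.prodMk hY).aemeasurable
  refine Measure.ext_of_charFunDual ?_
  ext L
  rw [charFunDual_apply, charFunDual_apply]
  have hL : ∀ p : ℝ × ℝ, L p = L (1, 0) * p.1 + L (0, 1) * p.2 := by
    intro p
    have e : p = p.1 • ((1 : ℝ), (0 : ℝ)) + p.2 • ((0 : ℝ), (1 : ℝ)) :=
      Prod.ext (by simp) (by simp)
    refine (congrArg L e).trans ?_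
    rw [map_add, map_smul, map_smul, smul_eq_mul, smul_eq_mul]
    ring
  have e : ∀ μ : Measure (ℝ × ℝ), ∫ p, Complex.exp (L p * Complex.I) ∂μ =
      ∫ p, Complex.exp ((L (1, 0) * p.1 + L (0, 1) * p.2 : ℝ) * Complex.I) ∂μ := fun μ => by
    congr 1
    ext p
    rw [hL p]
  rw [e, e, integral_exp_bivGauss hr, integral_map (hX.prodMk hY).aemeasurable
    (Measurable.aestronglyMeasurable (by fun_prop))]
  exact h _ _

end GaussianCopula

end

/-! ### Gaussian vectors with a correlation matrix -/

noncomputable section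

open scoped MatrixOrder

namespace GaussianCopula

/-- The centred Gaussian law with covariance matrix `S`, as a measure on `Fin d → ℝ`. -/
def normalLaw {d : ℕ} (S : Matrix (Fin d) (Fin d) ℝ) : Measure (Fin d → ℝ) :=
  (multivariateGaussian (0 : EuclideanSpace ℝ (Fin d)) S).map fun x j => x j

instance {d : ℕ} (S : Matrix (Fin d) (Fin d) ℝ) : IsProbabilityMeasure (normalLaw S) :=
  Measure.isProbabilityMeasure_map (by fun_prop)

variable {d : ℕ} {S : Matrix (Fin d) (Fin d) ℝ}

theorem copulaLaw_eq_map {f : Fin d → ℝ → ℝ} (hf : ∀ j, StrictMono (f j)) :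
    copulaLaw S f = (normalLaw S).map fun x j => f j (x j) := by
  have mf : Measurable fun (x : Fin d → ℝ) j => f j (x j) :=
    measurable_pi_lambda _ fun j => (hf j).monotone.measurable.comp (measurable_pi_apply j)
  rw [copulaLaw, normalLaw, Measure.map_map mf (by fun_prop)]
  rfl

namespace IsCorrelationMatrix

theorem apply_symm (hS : IsCorrelationMatrix S) (j k : Fin d) : S k j = S j k := by
  have := hS.posSemidef.isHermitian.apply j k
  simpa using this

theorem integral_exp (hS : IsCorrelationMatrix S) (j k : Fin d) (s t : ℝ) :
    ∫ x, Complex.exp ((s * x j + t * x k : ℝ) * Complex.I) ∂(normalLaw S) =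
      Complex.exp ((-(s ^ 2 + 2 * S j k * s * t + t ^ 2) / 2 : ℝ)) := by
  rw [normalLaw, integral_map (by fun_prop) (Measurable.aestronglyMeasurable (by fun_prop))]
  have h := charFun_multivariateGaussian (μ := 0) hS.posSemidef
    (s • EuclideanSpace.single j (1 : ℝ) + t • EuclideanSpace.single k (1 : ℝ))
  rw [charFun_apply] at h
  have e : ∀ x : EuclideanSpace ℝ (Fin d),
      inner ℝ x (s • EuclideanSpace.single j (1 : ℝ) + t • EuclideanSpace.single k (1 : ℝ)) =
        s * x j + t * x k := by
    intro x
    rw [inner_add_right, inner_smul_right, inner_smul_right]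
    simp [EuclideanSpace.inner_single_right]
  simp_rw [e] at h
  rw [h]
  congr 1
  simp [Matrix.mulVec_add, Matrix.mulVec_smul, add_dotProduct, dotProduct_add, hS.diag_eq_one,
    hS.apply_symm j k]
  ring

theorem abs_apply_le_one (hS : IsCorrelationMatrix S) (j k : Fin d) : |S j k| ≤ 1 := by
  have key : ∀ t : ℝ, t ^ 2 = 1 → 0 ≤ 1 + 2 * S j k * t + 1 := by
    intro t ht
    have h := hS.integral_exp j k 1 t
    have h1 : ‖∫ x, Complex.exp ((1 * x j + t * x k : ℝ) * Complex.I) ∂(normalLaw S)‖ ≤ 1 := by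
      refine (norm_integral_le_of_norm_le_const (C := 1) (Filter.Eventually.of_forall fun x =>
        (Complex.norm_exp_ofReal_mul_I _).le)).trans ?_
      simp
    rw [h, Complex.norm_exp, Complex.ofReal_re, Real.exp_le_one_iff, ht] at h1
    linarith
  have k1 := key 1 (by norm_num)
  have k2 := key (-1) (by norm_num)
  rw [abs_le]
  constructor <;> linarith

theorem map_prodMk_normalLaw (hS : IsCorrelationMatrix S) (j k : Fin d) :
    (normalLaw S).map (fun x => (x j, x k)) = bivGauss (S j k) :=
  map_eq_bivGauss (by fun_prop) (by fun_prop) (hS.abs_apply_le_one j k) (hS.integral_exp j k)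

theorem map_eval_normalLaw (hS : IsCorrelationMatrix S) (j : Fin d) :
    (normalLaw S).map (fun x => x j) = gaussianReal 0 1 := by
  have h := (measurePreserving_eval_multivariateGaussian (μ := 0) hS.posSemidef (i := j)).map_eq
  rw [normalLaw, Measure.map_map (measurable_pi_apply j) (by fun_prop)]
  simpa [hS.diag_eq_one, Function.comp_def] using h

theorem integral_comp_eval (hS : IsCorrelationMatrix S) (j : Fin d) {g : ℝ → ℝ}
    (hg : Measurable g) : ∫ x, g (x j) ∂(normalLaw S) = ∫ z, g z ∂(gaussianReal 0 1) := by
  rw [← hS.map_eval_normalLaw j, integral_map (measurable_pi_apply j).aemeasurable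
    hg.aestronglyMeasurable]

theorem integral_sign_sub (hS : IsCorrelationMatrix S) (j : Fin d) (a : ℝ) :
    ∫ x, Real.sign (a - x j) ∂(normalLaw S) = gaussSign a :=
  hS.integral_comp_eval j (g := fun z => Real.sign (a - z)) (measurable_sign.comp (by fun_prop))

theorem ae_ne (hS : IsCorrelationMatrix S) (j : Fin d) (a : ℝ) :
    ∀ᵐ x ∂(normalLaw S), x j ≠ a := by
  have hA : ∀ᵐ z ∂(gaussianReal 0 1), z ≠ a := by
    have := nullSingletonClass_gaussianReal (μ := 0) (v := 1) one_ne_zero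
    simp [ae_iff]
  rw [← hS.map_eval_normalLaw j] at hA
  exact ae_of_ae_map (f := fun x : Fin d → ℝ => x j) (p := fun z => z ≠ a)
    (measurable_pi_apply j).aemeasurable hA

theorem integral_exp_neg (hS : IsCorrelationMatrix S) (j k : Fin d) (s t : ℝ) :
    ∫ x, Complex.exp ((s * -x j + t * -x k : ℝ) * Complex.I) ∂(normalLaw S) =
      Complex.exp ((-(s ^ 2 + 2 * S j k * s * t + t ^ 2) / 2 : ℝ)) := by
  have := hS.integral_exp j k (-s) (-t)
  simp only [neg_mul_comm] at this
  rw [this]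
  congr 2
  ring

/-- The normalised difference of two independent copies has the original law. -/
theorem map_sub_normalLaw (hS : IsCorrelationMatrix S) (j k : Fin d) :
    ((normalLaw S).prod (normalLaw S)).map
      (fun p => ((√2)⁻¹ * (p.1 j - p.2 j), (√2)⁻¹ * (p.1 k - p.2 k))) = bivGauss (S j k) := by
  refine map_eq_bivGauss (by fun_prop) (by fun_prop) (hS.abs_apply_le_one j k) fun s t => ?_
  have e : ∀ p : (Fin d → ℝ) × (Fin d → ℝ),
      s * ((√2)⁻¹ * (p.1 j - p.2 j)) + t * ((√2)⁻¹ * (p.1 k - p.2 k)) =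
        (s * (√2)⁻¹ * p.1 j + t * (√2)⁻¹ * p.1 k) +
          (s * (√2)⁻¹ * -p.2 j + t * (√2)⁻¹ * -p.2 k) := fun p => by ring
  simp_rw [e]
  rw [integral_exp_mul_exp_prod (fun x : Fin d → ℝ => s * (√2)⁻¹ * x j + t * (√2)⁻¹ * x k)
    (fun x : Fin d → ℝ => s * (√2)⁻¹ * -x j + t * (√2)⁻¹ * -x k),
    hS.integral_exp, hS.integral_exp_neg, ← Complex.exp_add, ← Complex.ofReal_add]
  congr 2
  have h2 : (√2 : ℝ)⁻¹ ^ 2 = 1 / 2 := by rw [inv_pow, Real.sq_sqrt (by norm_num)]; norm_num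
  linear_combination (-(s ^ 2 + 2 * S j k * s * t + t ^ 2)) * h2

/-- Kendall's tau of a Gaussian vector. -/
theorem popTau_normalLaw (hS : IsCorrelationMatrix S) (j k : Fin d) :
    popTau (normalLaw S) j k = 2 / Real.pi * Real.arcsin (S j k) := by
  rw [← integral_bivGauss_sign_mul_sign (hS.abs_apply_le_one j k), ← hS.map_sub_normalLaw j k,
    integral_map (by fun_prop)
      (measurable_sign_mul_sign (by fun_prop) (by fun_prop)).aestronglyMeasurable]
  simp only [popTau, Matrix.of_apply]
  congr 1
  ext p
  rw [sign_mul_of_pos (by positivity), sign_mul_of_pos (by positivity)]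

/-- Differences with two independent standard normal variables have variance two and covariance `S j
k`. -/
theorem map_sub_stdGaussian (hS : IsCorrelationMatrix S) (j k : Fin d) :
    ((normalLaw S).prod ((gaussianReal 0 1).prod (gaussianReal 0 1))).map
      (fun p => ((√2)⁻¹ * (p.1 j - p.2.1), (√2)⁻¹ * (p.1 k - p.2.2))) = bivGauss (S j k / 2) := by
  have hle : |S j k / 2| ≤ 1 := by
    rw [abs_div, abs_two]; have := hS.abs_apply_le_one j k; linarith
  refine map_eq_bivGauss (by fun_prop) (by fun_prop) hle fun s t => ?_
  have e : ∀ p : (Fin d → ℝ) × ℝ × ℝ,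
      s * ((√2)⁻¹ * (p.1 j - p.2.1)) + t * ((√2)⁻¹ * (p.1 k - p.2.2)) =
        (s * (√2)⁻¹ * p.1 j + t * (√2)⁻¹ * p.1 k) +
          ((-s * (√2)⁻¹) * p.2.1 + (-t * (√2)⁻¹) * p.2.2) := fun p => by ring
  simp_rw [e]
  rw [integral_exp_mul_exp_prod (fun x : Fin d → ℝ => s * (√2)⁻¹ * x j + t * (√2)⁻¹ * x k)
    (fun x : ℝ × ℝ => (-s * (√2)⁻¹) * x.1 + (-t * (√2)⁻¹) * x.2), hS.integral_exp,
    integral_exp_mul_exp_prod (fun x : ℝ => (-s * (√2)⁻¹) * x) (fun x : ℝ => (-t * (√2)⁻¹) * x),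
    integral_exp_stdGaussian, integral_exp_stdGaussian, ← Complex.exp_add, ← Complex.exp_add,
    ← Complex.ofReal_add, ← Complex.ofReal_add]
  congr 2
  have h2 : (√2 : ℝ)⁻¹ ^ 2 = 1 / 2 := by rw [inv_pow, Real.sq_sqrt (by norm_num)]; norm_num
  linear_combination (-(s ^ 2 + S j k * s * t + t ^ 2)) * h2

theorem map_prodMk_sub_stdGaussian (hS : IsCorrelationMatrix S) (j k : Fin d) :
    ((normalLaw S).prod (gaussianReal 0 1)).map
      (fun p => (p.1 j, (√2)⁻¹ * (p.2 - p.1 k))) = bivGauss (-((√2)⁻¹ * S j k)) := by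
  have h2 : (√2 : ℝ)⁻¹ ^ 2 = 1 / 2 := by rw [inv_pow, Real.sq_sqrt (by norm_num)]; norm_num
  have hle : |-((√2)⁻¹ * S j k)| ≤ 1 := by
    rw [abs_neg, ← sq_le_one_iff_abs_le_one, mul_pow, h2]
    have := (sq_le_one_iff_abs_le_one _).2 (hS.abs_apply_le_one j k)
    linarith
  refine map_eq_bivGauss (by fun_prop) (by fun_prop) hle fun s t => ?_
  have e : ∀ p : (Fin d → ℝ) × ℝ,
      s * p.1 j + t * ((√2)⁻¹ * (p.2 - p.1 k)) =
        (s * p.1 j + (-t * (√2)⁻¹) * p.1 k) + (t * (√2)⁻¹) * p.2 := fun p => by ring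
  simp_rw [e]
  rw [integral_exp_mul_exp_prod (fun x : Fin d → ℝ => s * x j + (-t * (√2)⁻¹) * x k)
    (fun x : ℝ => (t * (√2)⁻¹) * x), hS.integral_exp,
    integral_exp_stdGaussian, ← Complex.exp_add, ← Complex.ofReal_add]
  congr 2
  linear_combination (-t ^ 2) * h2

theorem integral_gaussSign_mul (hS : IsCorrelationMatrix S) (j k : Fin d) :
    ∫ x, gaussSign (x j) * gaussSign (x k) ∂(normalLaw S) =
      2 / Real.pi * Real.arcsin (S j k / 2) := by
  have hle : |S j k / 2| ≤ 1 := by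
    rw [abs_div, abs_two]; have := hS.abs_apply_le_one j k; linarith
  rw [← integral_bivGauss_sign_mul_sign hle, ← hS.map_sub_stdGaussian j k,
    integral_map (by fun_prop)
      (measurable_sign_mul_sign (by fun_prop) (by fun_prop)).aestronglyMeasurable]
  have e : ∀ p : (Fin d → ℝ) × ℝ × ℝ, Real.sign ((√2)⁻¹ * (p.1 j - p.2.1)) *
      Real.sign ((√2)⁻¹ * (p.1 k - p.2.2)) =
        Real.sign (p.1 j - p.2.1) * Real.sign (p.1 k - p.2.2) := fun p => by
    rw [sign_mul_of_pos (by positivity), sign_mul_of_pos (by positivity)]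
  simp_rw [e]
  rw [integral_prod]
  · congr 1
    ext x
    rw [integral_prod_mul (fun z => Real.sign (x j - z)) (fun z => Real.sign (x k - z))]
    rfl
  · exact integrable_of_bounded (measurable_sign_mul_sign (by fun_prop) (by fun_prop)) (C := 1)
      fun _ => abs_sign_mul_sign_le_one _ _

/-- Spearman's rho of a Gaussian vector: differences with two distinct independent copies have half
the correlation. -/
theorem popRho_normalLaw (hS : IsCorrelationMatrix S) (j k : Fin d) :
    popRho (normalLaw S) j k = 3 * (2 / Real.pi * Real.arcsin (S j k / 2)) := by
  rw [← hS.integral_gaussSign_mul j k]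
  simp only [popRho, Matrix.of_apply]
  rw [integral_prod]
  · congr 2
    ext x
    rw [integral_prod_mul (fun z : Fin d → ℝ => Real.sign (x j - z j))
      (fun z : Fin d → ℝ => Real.sign (x k - z k)), hS.integral_sign_sub, hS.integral_sign_sub]
  · exact integrable_of_bounded (measurable_sign_mul_sign (by fun_prop) (by fun_prop)) (C := 1)
      fun _ => abs_sign_mul_sign_le_one _ _

theorem abs_integral_sign_mul_sign_sub_le (hS : IsCorrelationMatrix S) (j k : Fin d) (a b : ℝ) :
    |∫ x, Real.sign (a - x j) * Real.sign (b - x k) ∂(normalLaw S) - gaussSign a * gaussSign b| ≤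
      |S j k| := by
  have h := abs_integral_bivGauss_sub_le a b (hS.abs_apply_le_one j k)
  rw [← hS.map_prodMk_normalLaw j k, integral_map (by fun_prop)
      (measurable_sign_mul_sign (by fun_prop) (by fun_prop)).aestronglyMeasurable] at h
  exact h.trans (two_div_pi_mul_arcsin_le (abs_nonneg _) (hS.abs_apply_le_one j k))

/-- A sign of one coordinate and the transform of another one: the independent variable in
`gaussSign` reduces the correlation by the factor `1 / √2`, and the convexity of `arcsin` on `[0, 1
/ √2]` gives the factor `1 / 2`. -/
theorem abs_integral_sign_mul_gaussSign_le (hS : IsCorrelationMatrix S) (j k : Fin d) (a : ℝ) :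
    |∫ x, Real.sign (a - x j) * gaussSign (x k) ∂(normalLaw S)| ≤ |S j k| / 2 := by
  have h2 : (√2 : ℝ)⁻¹ ^ 2 = 1 / 2 := by rw [inv_pow, Real.sq_sqrt (by norm_num)]; norm_num
  have hS1 := hS.abs_apply_le_one j k
  have hi : (√2 : ℝ)⁻¹ ≤ 1 := by
    refine inv_le_one_of_one_le₀ ?_
    rw [Real.one_le_sqrt]; norm_num
  have habs : |-((√2)⁻¹ * S j k)| = (√2)⁻¹ * |S j k| := by
    rw [abs_neg, abs_mul, abs_of_nonneg (by positivity)]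
  have hle : |-((√2)⁻¹ * S j k)| ≤ 1 := by
    rw [habs]; exact mul_le_one₀ hi (abs_nonneg _) hS1
  have h := abs_integral_bivGauss_sub_le a 0 hle
  rw [gaussSign_zero, mul_zero, sub_zero, habs, ← hS.map_prodMk_sub_stdGaussian j k,
    integral_map (by fun_prop)
      (measurable_sign_mul_sign (by fun_prop) (by fun_prop)).aestronglyMeasurable] at h
  have e : ∀ p : (Fin d → ℝ) × ℝ, Real.sign (a - p.1 j) *
      Real.sign (0 - (√2)⁻¹ * (p.2 - p.1 k)) =
        Real.sign (a - p.1 j) * Real.sign (p.1 k - p.2) := fun p => by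
    rw [← sign_mul_of_pos (show (0 : ℝ) < (√2)⁻¹ by positivity) (p.1 k - p.2)]
    congr 2
    ring
  simp_rw [e] at h
  rw [integral_prod] at h
  · simp_rw [integral_const_mul] at h
    refine h.trans ?_
    have hpi := Real.pi_pos
    have hs4 : Real.sin (Real.pi / 4) = (√2)⁻¹ := by
      rw [Real.sin_pi_div_four]
      rw [div_eq_iff (by norm_num), ← div_eq_inv_mul, Real.div_sqrt]
    -- `arcsin` is convex on `[0, sin (π / 4)]`
    have h3 := arcsin_le_of_le_sin (α := Real.pi / 4) (y := (√2)⁻¹ * |S j k|) (by positivity)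
      (by linarith) (by positivity)
      (by rw [hs4]; exact mul_le_of_le_one_right (by positivity) hS1)
    rw [hs4] at h3
    have h4 : Real.arcsin ((√2)⁻¹ * |S j k|) ≤ Real.pi / 4 * |S j k| := by
      have hpos : (0 : ℝ) < (√2)⁻¹ := by positivity
      have : (√2 : ℝ)⁻¹ * Real.arcsin ((√2)⁻¹ * |S j k|) ≤ (√2)⁻¹ * (Real.pi / 4 * |S j k|) := by
        linarith
      exact le_of_mul_le_mul_left this hpos
    calc 2 / Real.pi * Real.arcsin ((√2)⁻¹ * |S j k|) ≤ 2 / Real.pi * (Real.pi / 4 * |S j k|) := by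
          gcongr
      _ = |S j k| / 2 := by field_simp; norm_num
  · exact integrable_of_bounded (measurable_sign_mul_sign (by fun_prop) (by fun_prop)) (C := 1)
      fun _ => abs_sign_mul_sign_le_one _ _

theorem norm_sqrt_apply_sq (hS : IsCorrelationMatrix S) (h : EuclideanSpace ℝ (Fin d)) :
    ‖Matrix.toEuclideanCLM (n := Fin d) (𝕜 := ℝ) (CFC.sqrt S) h‖ ^ 2 =
      inner ℝ h (Matrix.toEuclideanCLM (n := Fin d) (𝕜 := ℝ) S h) := by
  have hsa : IsSelfAdjoint (Matrix.toEuclideanCLM (n := Fin d) (𝕜 := ℝ) (CFC.sqrt S)) :=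
    (CFC.sqrt_nonneg S).isSelfAdjoint.map _
  have hsq : CFC.sqrt S * CFC.sqrt S = S := CFC.sqrt_mul_sqrt_self _ hS.posSemidef.nonneg
  conv_rhs => rw [← hsq, map_mul, mul_apply_eq_comp,
    ← ContinuousLinearMap.adjoint_inner_left, hsa.adjoint_eq]
  rw [real_inner_self_eq_norm_sq]

theorem norm_sqrt_apply_sq_le (hS : IsCorrelationMatrix S) (h : EuclideanSpace ℝ (Fin d)) :
    ‖Matrix.toEuclideanCLM (n := Fin d) (𝕜 := ℝ) (CFC.sqrt S) h‖ ^ 2 ≤ specNorm S * ‖h‖ ^ 2 := by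
  rw [hS.norm_sqrt_apply_sq, inner_toEuclideanCLM_eq_sum]
  exact sum_mul_le_specNorm S h

/-- The row sums of squares are the diagonal entries of `S * S`, and `S * S ≤ ‖S‖ S`. -/
theorem sum_row_sq_le (hS : IsCorrelationMatrix S) (j : Fin d) :
    ∑ k, S j k ^ 2 ≤ specNorm S := by
  set A := Matrix.toEuclideanCLM (n := Fin d) (𝕜 := ℝ) (CFC.sqrt S) with hA
  set e : EuclideanSpace ℝ (Fin d) := EuclideanSpace.single j 1 with he
  have hsq : CFC.sqrt S * CFC.sqrt S = S := CFC.sqrt_mul_sqrt_self _ hS.posSemidef.nonneg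
  have h1 : A (A e) = Matrix.toEuclideanCLM (n := Fin d) (𝕜 := ℝ) S e := by
    conv_rhs => rw [← hsq, map_mul]
    rfl
  have h2 : ‖A e‖ ^ 2 = 1 := by
    rw [hA, hS.norm_sqrt_apply_sq, inner_toEuclideanCLM_eq_sum, ← hS.diag_eq_one j]
    simp [he]
  have h3 : ∑ k, S j k ^ 2 = ‖A (A e)‖ ^ 2 := by
    rw [h1, EuclideanSpace.real_norm_sq_eq]
    refine Finset.sum_congr rfl fun k _ => ?_
    congr 1
    rw [← hS.apply_symm j k]
    simp [he, Matrix.mulVec_single]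
  rw [h3]
  refine (hS.norm_sqrt_apply_sq_le (A e)).trans ?_
  rw [h2, mul_one]

theorem one_le_specNorm (hS : IsCorrelationMatrix S) (j : Fin d) : 1 ≤ specNorm S := by
  refine le_trans ?_ (hS.sum_row_sq_le j)
  calc (1 : ℝ) = S j j ^ 2 := by rw [hS.diag_eq_one]; norm_num
    _ ≤ _ := Finset.single_le_sum (f := fun k => S j k ^ 2) (fun k _ => sq_nonneg _)
      (Finset.mem_univ j)

theorem card_le_frobNorm_sq (hS : IsCorrelationMatrix S) : (d : ℝ) ≤ frobNorm S ^ 2 := by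
  rw [frobNorm_sq]
  calc (d : ℝ) = ∑ j : Fin d, (1 : ℝ) := by simp
    _ ≤ _ := Finset.sum_le_sum fun j _ => by
      calc (1 : ℝ) = S j j ^ 2 := by rw [hS.diag_eq_one]; norm_num
        _ ≤ _ := Finset.single_le_sum (f := fun k => S j k ^ 2) (fun k _ => sq_nonneg _)
          (Finset.mem_univ j)

theorem frobNorm_sq_le (hS : IsCorrelationMatrix S) : frobNorm S ^ 2 ≤ d * specNorm S := by
  rw [frobNorm_sq]
  refine (Finset.sum_le_sum fun j _ => hS.sum_row_sq_le j).trans ?_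
  simp

/-- A Gaussian vector is the image of a standard one under the square root of its covariance. -/
theorem integral_normalLaw_eq (F : (Fin d → ℝ) → ℝ) (hF : Measurable F) :
    ∫ x, F x ∂(normalLaw S) = ∫ g, F (fun j => Matrix.toEuclideanCLM (n := Fin d) (𝕜 := ℝ)
      (CFC.sqrt S) (WithLp.toLp 2 g) j) ∂(Measure.pi fun _ : Fin d => gaussianReal 0 1) := by
  have hF' : Measurable fun x : EuclideanSpace ℝ (Fin d) => F fun j => x j :=
    hF.comp (by fun_prop)
  rw [normalLaw, integral_map (by fun_prop) hF.aestronglyMeasurable, multivariateGaussian,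
    ← map_pi_eq_stdGaussian, Measure.map_map (by fun_prop) (by fun_prop), integral_map
      (φ := _ ∘ _) (by fun_prop) hF'.aestronglyMeasurable]
  simp

end IsCorrelationMatrix

end GaussianCopula

end

/-! ### Projected covariance matrix -/

noncomputable section

open scoped MatrixOrder

namespace GaussianCopula

variable {n d : ℕ} {S : Matrix (Fin d) (Fin d) ℝ}

/-- The covariance `(2 / π) arcsin (x / 2)` of `gaussSign` of two coordinates is linear in the
correlation `x` up to a quadratic error. -/
theorem abs_arcsin_half_sub_le {x : ℝ} (hx : |x| ≤ 1) :
    |2 / Real.pi * Real.arcsin (x / 2) - x / Real.pi| ≤ 31 / 2000 * x ^ 2 := by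
  have hpi := Real.pi_pos
  have main : ∀ y : ℝ, 0 ≤ y → y ≤ 1 →
      |2 / Real.pi * Real.arcsin (y / 2) - y / Real.pi| ≤ 31 / 2000 * y ^ 2 := by
    intro y h0 h1
    set θ := Real.arcsin (y / 2) with hθ
    have hθ0 : 0 ≤ θ := Real.arcsin_nonneg.2 (by linarith)
    have hsin : Real.sin θ = y / 2 := Real.sin_arcsin (by linarith) (by linarith)
    have h3 := arcsin_le_of_le_sin (α := Real.pi / 6) (y := y / 2) (by positivity)
      (by linarith) (by linarith) (by rw [Real.sin_pi_div_six]; linarith)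
    rw [Real.sin_pi_div_six, ← hθ] at h3
    have h4 : θ ≤ Real.pi / 6 * y := by linarith
    have h5 := Real.sin_ge_sub_cube hθ0
    rw [hsin] at h5
    have h6 := Real.sin_le hθ0
    rw [hsin] at h6
    have e : 2 / Real.pi * θ - y / Real.pi = 2 / Real.pi * (θ - y / 2) := by ring
    rw [e, abs_of_nonneg (mul_nonneg (by positivity) (by linarith))]
    have h7 : θ ^ 3 ≤ (Real.pi / 6 * y) ^ 3 := by gcongr
    have h8 : (Real.pi / 6 * y) ^ 3 ≤ (Real.pi / 6) ^ 3 * y ^ 2 := by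
      rw [mul_pow]
      have : y ^ 3 ≤ y ^ 2 := pow_le_pow_of_le_one h0 h1 (by norm_num)
      gcongr
    calc 2 / Real.pi * (θ - y / 2) ≤ 2 / Real.pi * ((Real.pi / 6) ^ 3 * y ^ 2 / 6) := by
          gcongr; linarith
      _ = Real.pi ^ 2 * (1 / 648) * y ^ 2 := by field_simp; ring
      _ ≤ 31 / 2000 * y ^ 2 := by
          have h9 : Real.pi ^ 2 ≤ 3.15 ^ 2 := by gcongr; exact Real.pi_lt_d2.le
          refine mul_le_mul_of_nonneg_right ?_ (sq_nonneg y)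
          norm_num at h9 ⊢
          linarith
  rcases le_total 0 x with h | h
  · exact main x h (by rwa [abs_of_nonneg h] at hx)
  · have := main (-x) (by linarith) (by rwa [abs_of_nonpos h] at hx)
    rw [neg_div, Real.arcsin_neg, neg_div, neg_sq, ← abs_neg] at this
    convert this using 2
    ring

/-- Schur's test for the entrywise square of a correlation matrix. -/
theorem IsCorrelationMatrix.sum_abs_mul_sq_le (hS : IsCorrelationMatrix S) (v : Fin d → ℝ) :
    ∑ j, ∑ k, |v j| * S j k ^ 2 * |v k| ≤ specNorm S * ∑ j, v j ^ 2 := by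
  have h1 : ∑ j, ∑ k, |v j| * S j k ^ 2 * |v k| ≤
      ∑ j, ∑ k, (v j ^ 2 / 2 * S j k ^ 2 + v k ^ 2 / 2 * S j k ^ 2) := by
    refine Finset.sum_le_sum fun j _ => Finset.sum_le_sum fun k _ => ?_
    have h := two_mul_le_add_sq |v j| |v k|
    rw [sq_abs, sq_abs] at h
    nlinarith [sq_nonneg (S j k)]
  have h2 : ∑ j, ∑ k, v j ^ 2 / 2 * S j k ^ 2 ≤ specNorm S * ∑ j, v j ^ 2 / 2 := by
    rw [Finset.mul_sum]
    refine Finset.sum_le_sum fun j _ => ?_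
    rw [← Finset.mul_sum, mul_comm]
    exact mul_le_mul_of_nonneg_right (hS.sum_row_sq_le j) (by positivity)
  have h3 : ∑ j, ∑ k, v k ^ 2 / 2 * S j k ^ 2 = ∑ j, ∑ k, v j ^ 2 / 2 * S j k ^ 2 := by
    rw [Finset.sum_comm]
    simp_rw [hS.apply_symm]
  simp_rw [Finset.sum_add_distrib] at h1
  rw [h3] at h1
  rw [← Finset.sum_div] at h2
  linarith

/-- The projection of the Gaussian vector transformed by `gaussSign` to a direction `v`. -/
def signForm (v x : Fin d → ℝ) : ℝ := ∑ j, v j * gaussSign (x j)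

theorem measurable_signForm (v : Fin d → ℝ) : Measurable (signForm v) :=
  Finset.measurable_sum _ fun j _ =>
    (measurable_gaussSign.comp (measurable_pi_apply j)).const_mul (v j)

theorem abs_signForm_le (v x : Fin d → ℝ) : |signForm v x| ≤ ∑ j, |v j| := by
  refine (Finset.abs_sum_le_sum_abs _ _).trans (Finset.sum_le_sum fun j _ => ?_)
  rw [abs_mul]
  exact mul_le_of_le_one_right (abs_nonneg _) (abs_gaussSign_le_one _)

theorem signForm_sq (v x : Fin d → ℝ) :
    signForm v x ^ 2 = ∑ j, ∑ k, v j * (gaussSign (x j) * gaussSign (x k)) * v k := by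
  rw [sq, signForm, Finset.sum_mul_sum]
  refine Finset.sum_congr rfl fun j _ => Finset.sum_congr rfl fun k _ => ?_
  ring

theorem measurable_gaussSign_mul (j k : Fin d) :
    Measurable fun x : Fin d → ℝ => gaussSign (x j) * gaussSign (x k) :=
  (measurable_gaussSign.comp (measurable_pi_apply j)).mul
    (measurable_gaussSign.comp (measurable_pi_apply k))

theorem abs_gaussSign_mul_le_one (a b : ℝ) : |gaussSign a * gaussSign b| ≤ 1 := by
  rw [abs_mul]
  exact mul_le_one₀ (abs_gaussSign_le_one a) (abs_nonneg _) (abs_gaussSign_le_one b)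

theorem integral_signForm_sq {μ : Measure (Fin d → ℝ)} [IsProbabilityMeasure μ] (v : Fin d → ℝ) :
    ∫ x, signForm v x ^ 2 ∂μ =
      ∑ j, ∑ k, v j * (∫ x, gaussSign (x j) * gaussSign (x k) ∂μ) * v k := by
  have hI : ∀ j k, Integrable (fun x : Fin d → ℝ =>
      v j * (gaussSign (x j) * gaussSign (x k)) * v k) μ := fun j k =>
    ((integrable_of_bounded (measurable_gaussSign_mul j k)
      fun x => abs_gaussSign_mul_le_one _ _).const_mul _).mul_const _
  simp_rw [signForm_sq]
  rw [integral_finsetSum _ fun j _ => integrable_finsetSum _ fun k _ => hI j k]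
  refine Finset.sum_congr rfl fun j _ => ?_
  rw [integral_finsetSum _ fun k _ => hI j k]
  refine Finset.sum_congr rfl fun k _ => ?_
  rw [integral_mul_const, integral_const_mul]

/-- The second moment of a projection: the linear part of the covariance is bounded by `specNorm S /
π`, the quadratic error by Schur's test. -/
theorem IsCorrelationMatrix.integral_signForm_sq_le (hS : IsCorrelationMatrix S)
    {v : EuclideanSpace ℝ (Fin d)} (hv : ‖v‖ = 1) :
    ∫ x, signForm v x ^ 2 ∂(normalLaw S) ≤ 17 / 50 * specNorm S := by
  have hpi := Real.pi_pos
  have hv2 : ∑ j, v j ^ 2 = 1 := by rw [← EuclideanSpace.real_norm_sq_eq, hv]; norm_num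
  have h1 := sum_mul_le_specNorm S v
  rw [hv] at h1
  have h2 := hS.sum_abs_mul_sq_le v
  rw [hv2] at h2
  have h3 : ∑ j, ∑ k, v j * (∫ x, gaussSign (x j) * gaussSign (x k) ∂(normalLaw S)) * v k ≤
      ∑ j, ∑ k, (1 / Real.pi * (v j * S j k * v k) +
        31 / 2000 * (|v j| * S j k ^ 2 * |v k|)) := by
    refine Finset.sum_le_sum fun j _ => Finset.sum_le_sum fun k _ => ?_
    rw [hS.integral_gaussSign_mul]
    have h4 := abs_arcsin_half_sub_le (hS.abs_apply_le_one j k)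
    have h5 : v j * (2 / Real.pi * Real.arcsin (S j k / 2) - S j k / Real.pi) * v k ≤
        |v j| * (31 / 2000 * S j k ^ 2) * |v k| := by
      refine (le_abs_self _).trans ?_
      rw [abs_mul, abs_mul]
      gcongr
    calc _ = 1 / Real.pi * (v j * S j k * v k) +
        v j * (2 / Real.pi * Real.arcsin (S j k / 2) - S j k / Real.pi) * v k := by ring
      _ ≤ _ := by linarith
  rw [integral_signForm_sq]
  refine h3.trans ?_
  simp_rw [Finset.sum_add_distrib, ← Finset.mul_sum]
  have hpi' : 1 / Real.pi ≤ 0.32 := by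
    rw [div_le_iff₀ hpi]
    have := Real.pi_gt_d2
    norm_num at this ⊢
    linarith
  have hs := specNorm_nonneg S
  calc _ ≤ 1 / Real.pi * (specNorm S * 1 ^ 2) + 31 / 2000 * (specNorm S * 1) := by gcongr
    _ ≤ 0.32 * (specNorm S * 1 ^ 2) + 31 / 2000 * (specNorm S * 1) := by gcongr
    _ ≤ _ := by norm_num; linarith

/-- As a function of the standard Gaussian vector that is mapped to the sample by the square root of
`S`, a projection has squared Lipschitz constant at most `(2 / π) specNorm S`, and `17 / 10` exceeds
`(8 / 3) (2 / π)`. -/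
theorem IsCorrelationMatrix.integral_exp_signForm_le (hS : IsCorrelationMatrix S)
    (hs : 0 < specNorm S) {v : EuclideanSpace ℝ (Fin d)} (hv : ‖v‖ = 1) {m : ℝ}
    (hm : ∫ x, signForm v x ^ 2 ∂(normalLaw S) = m) {t : ℝ}
    (ht : 17 / 10 * specNorm S * |t| < 1) :
    ∫ x, Real.exp (t * (signForm v x ^ 2 - m)) ∂(normalLaw S) ≤
      Real.exp (17 / 10 * specNorm S * m * t ^ 2 / (1 - 17 / 10 * specNorm S * |t|)) := by
  have hpi := Real.pi_pos
  have hv2 : ∑ j, v j ^ 2 = 1 := by rw [← EuclideanSpace.real_norm_sq_eq, hv]; norm_num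
  set A := Matrix.toEuclideanCLM (n := Fin d) (𝕜 := ℝ) (CFC.sqrt S) with hA
  set w : (Fin d → ℝ) → ℝ := fun g => signForm v (fun j => A (WithLp.toLp 2 g) j) with hw
  have mw : Measurable w := (measurable_signForm v).comp (by fun_prop)
  have hlip : ∀ x y, (w x - w y) ^ 2 ≤ 51 / 80 * specNorm S * ∑ i, (x i - y i) ^ 2 := by
    intro x y
    set a := A (WithLp.toLp 2 x) with ha
    set b := A (WithLp.toLp 2 y) with hb
    have e : w x - w y = ∑ j, v j * (gaussSign (a j) - gaussSign (b j)) := by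
      simp only [hw, signForm, ← Finset.sum_sub_distrib, mul_sub]
      rfl
    have h1 : (w x - w y) ^ 2 ≤ 1 * ∑ j, (gaussSign (a j) - gaussSign (b j)) ^ 2 := by
      rw [e, ← hv2]
      exact Finset.sum_mul_sq_le_sq_mul_sq _ _ _
    have h2 : ∑ j, (gaussSign (a j) - gaussSign (b j)) ^ 2 ≤ 2 / Real.pi * ‖a - b‖ ^ 2 := by
      rw [EuclideanSpace.real_norm_sq_eq, Finset.mul_sum]
      exact Finset.sum_le_sum fun j _ => gaussSign_sub_sq_le _ _
    have h3 : ‖a - b‖ ^ 2 ≤ specNorm S * ∑ i, (x i - y i) ^ 2 := by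
      have := hS.norm_sqrt_apply_sq_le (WithLp.toLp 2 x - WithLp.toLp 2 y)
      rw [map_sub, EuclideanSpace.real_norm_sq_eq (WithLp.toLp 2 x - WithLp.toLp 2 y)] at this
      exact this
    have hpi' : 2 / Real.pi ≤ 51 / 80 := by
      rw [div_le_iff₀ hpi]
      have := Real.pi_gt_d4
      norm_num at this ⊢
      linarith
    calc (w x - w y) ^ 2 ≤ 1 * (2 / Real.pi * (specNorm S * ∑ i, (x i - y i) ^ 2)) :=
          h1.trans (by gcongr; exact h2.trans (by gcongr))
      _ ≤ 1 * (51 / 80 * (specNorm S * ∑ i, (x i - y i) ^ 2)) := by gcongr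
      _ = _ := by ring
  have hm' : ∫ x, w x ^ 2 ∂(Measure.pi fun _ : Fin d => gaussianReal 0 1) = m := by
    rw [← hm, IsCorrelationMatrix.integral_normalLaw_eq (fun x => signForm v x ^ 2)
      ((measurable_signForm v).pow_const 2)]
  have e8 : 8 / 3 * (51 / 80 * specNorm S) = 17 / 10 * specNorm S := by ring
  have := integral_exp_sq_sub_le mw (fun x => abs_signForm_le v _)
    (show 0 < 51 / 80 * specNorm S by positivity) hlip hm' (t := t) (by rwa [e8])
  rw [e8] at this
  rw [IsCorrelationMatrix.integral_normalLaw_eq (fun x => Real.exp (t * (signForm v x ^ 2 - m)))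
    (by have := measurable_signForm (v : Fin d → ℝ); fun_prop)]
  exact this

/-- The centred empirical second moment matrix of the observations transformed by `gaussSign`. -/
def signCov (μ : Measure (Fin d → ℝ)) (x : Fin n → Fin d → ℝ) : Matrix (Fin d) (Fin d) ℝ :=
  Matrix.of fun j k => (∑ i, (gaussSign (x i j) * gaussSign (x i k) -
    ∫ y, gaussSign (y j) * gaussSign (y k) ∂μ)) / n

/-- The quadratic form of `signCov` is a centred mean of squared projections. -/
theorem sum_signCov (μ : Measure (Fin d → ℝ)) [IsProbabilityMeasure μ] (x : Fin n → Fin d → ℝ)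
    (v : Fin d → ℝ) :
    ∑ j, ∑ k, v j * signCov μ x j k * v k =
      (∑ i, (signForm v (x i) ^ 2 - ∫ y, signForm v y ^ 2 ∂μ)) / n := by
  simp_rw [integral_signForm_sq, signForm_sq, ← Finset.sum_sub_distrib]
  rw [Finset.sum_comm, Finset.sum_div]
  rw [Finset.sum_comm]
  simp only [signCov, Matrix.of_apply]
  simp_rw [← sub_mul, ← mul_sub, mul_div_assoc', div_mul_eq_mul_div]
  simp_rw [← Finset.sum_div, Finset.mul_sum, Finset.sum_mul]
  congr 1
  rw [Finset.sum_comm' (t' := Finset.univ) (s' := fun _ => Finset.univ) (by simp)]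
  conv_rhs => rw [Finset.sum_comm]
  rw [Finset.sum_comm]
  refine Finset.sum_congr rfl fun j _ => ?_
  rw [Finset.sum_comm]

theorem measurable_signCov (μ : Measure (Fin d → ℝ)) (j k : Fin d) :
    Measurable fun x : Fin n → Fin d → ℝ => signCov μ x j k := by
  have h := measurable_gaussSign_mul j k
  refine (Finset.measurable_sum _ fun i _ => ?_).div_const _
  exact (h.comp (measurable_pi_apply i)).sub_const _

theorem abs_signCov_le (μ : Measure (Fin d → ℝ)) [IsProbabilityMeasure μ]
    (x : Fin n → Fin d → ℝ) (j k : Fin d) : |signCov μ x j k| ≤ 2 := by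
  have hE : |∫ y, gaussSign (y j) * gaussSign (y k) ∂μ| ≤ 1 := by
    have := norm_integral_le_of_norm_le_const (μ := μ) (C := 1)
      (f := fun y => gaussSign (y j) * gaussSign (y k))
      (Filter.Eventually.of_forall fun y => abs_gaussSign_mul_le_one _ _)
    simpa using this
  rw [signCov, Matrix.of_apply, abs_div, Nat.abs_cast]
  refine div_le_of_le_mul₀ (Nat.cast_nonneg _) (by norm_num) ?_
  refine (Finset.abs_sum_le_sum_abs _ _).trans ?_
  calc _ ≤ ∑ i : Fin n, (2 : ℝ) := Finset.sum_le_sum fun i _ => by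
        have h1 := abs_gaussSign_mul_le_one (x i j) (x i k)
        have h2 := abs_sub (gaussSign (x i j) * gaussSign (x i k))
          (∫ y, gaussSign (y j) * gaussSign (y k) ∂μ)
        linarith
    _ = 2 * n := by simp [mul_comm]

/-- The Gaussian concentration of quadratic forms gives the dimension-free rate for `signCov`. -/
theorem IsCorrelationMatrix.integral_specNorm_signCov_le (hS : IsCorrelationMatrix S)
    (hn : 0 < n) :
    ∫ x, specNorm (signCov (n := n) (normalLaw S) x) ∂(Measure.pi fun _ : Fin n => normalLaw S) ≤
      5 * specNorm S * (√(((d : ℝ) + 1) / (3 * n)) + ((d : ℝ) + 1) / n) := by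
  rcases Nat.eq_zero_or_pos d with rfl | hd
  · simp_rw [specNorm_eq_zero_of_dim_zero]
    simp
  have hs : 0 < specNorm S := lt_of_lt_of_le one_pos (hS.one_le_specNorm ⟨0, hd⟩)
  have hn' : (0 : ℝ) < n := by exact_mod_cast hn
  set s := specNorm S with hs_def
  set x : ℝ := ((d : ℝ) + 1) / n with hx
  have hxpos : 0 < x := by positivity
  set α : ℝ := 11 / 5 * (17 / 10 * s) * x with hα
  set M : ℝ := 17 / 50 * s with hM
  have hαpos : 0 < α := by positivity
  have hMpos : 0 < M := by positivity
  set p := √α with hp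
  set q := √M with hq
  have hppos : 0 < p := Real.sqrt_pos.2 hαpos
  have hqpos : 0 < q := Real.sqrt_pos.2 hMpos
  have hp2 : p ^ 2 = α := Real.sq_sqrt hαpos.le
  have hq2 : q ^ 2 = M := Real.sq_sqrt hMpos.le
  -- the parameter that minimises `α / y + M y / (1 - y)`, the bound from the net
  set y := p / (p + q) with hy
  have hypos : 0 < y := by positivity
  have hy1 : 1 - y = q / (p + q) := by rw [hy]; field_simp; ring
  have hy1pos : 0 < 1 - y := by rw [hy1]; positivity
  set K := 17 / 10 * s with hK
  have hKpos : 0 < K := by positivity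
  set t := n * y / K with ht
  have htpos : 0 < t := by positivity
  set ψ := n * (M / K * y ^ 2 / (1 - y)) with hψ
  have hmgf : ∀ v : EuclideanSpace ℝ (Fin d), ‖v‖ = 1 → ∀ σ : ℝ, |σ| = 1 →
      ∫ x, Real.exp (σ * t * ∑ j, ∑ k, v j * signCov (n := n) (normalLaw S) x j k * v k)
        ∂(Measure.pi fun _ : Fin n => normalLaw S) ≤ Real.exp ψ := by
    intro v hv σ hσ
    set m := ∫ y, signForm v y ^ 2 ∂(normalLaw S) with hm
    have habs : |σ * t / n| = y / K := by
      rw [abs_div, abs_mul, hσ, one_mul, abs_of_pos htpos, Nat.abs_cast, ht]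
      field_simp
    have h1 := hS.integral_exp_signForm_le hs hv hm.symm (t := σ * t / n) (by
      rw [habs, mul_div_cancel₀ _ hKpos.ne']; linarith)
    have hsq : (σ * t / n) ^ 2 = (y / K) ^ 2 := by rw [← sq_abs, habs]
    rw [habs, hsq, mul_div_cancel₀ _ hKpos.ne'] at h1
    have e : ∀ x : Fin n → Fin d → ℝ,
        Real.exp (σ * t * ∑ j, ∑ k, v j * signCov (n := n) (normalLaw S) x j k * v k) =
          ∏ i, Real.exp (σ * t / n * (signForm v (x i) ^ 2 - m)) := by
      intro x
      rw [sum_signCov, ← Real.exp_sum, ← Finset.mul_sum]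
      congr 1
      ring
    simp_rw [e]
    rw [integral_fintype_prod_eq_pow (fun x => Real.exp (σ * t / n * (signForm v x ^ 2 - m))),
      Fintype.card_fin]
    refine (pow_le_pow_left₀ (integral_nonneg fun _ => (Real.exp_pos _).le) h1 n).trans ?_
    rw [← Real.exp_nat_mul]
    refine Real.exp_le_exp.2 (mul_le_mul_of_nonneg_left ?_ hn'.le)
    have hmM : m ≤ M := hS.integral_signForm_sq_le hv
    calc K * m * (y / K) ^ 2 / (1 - y) = m / K * y ^ 2 / (1 - y) := by field_simp
      _ ≤ M / K * y ^ 2 / (1 - y) := by gcongr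
  have hsym : ∀ x : Fin n → Fin d → ℝ, (signCov (normalLaw S) x).IsSymm := by
    intro x
    ext j k
    simp only [signCov, Matrix.transpose_apply, Matrix.of_apply]
    simp_rw [mul_comm (gaussSign _) (gaussSign _)]
  have key := integral_specNorm_le hsym (measurable_signCov (normalLaw S))
    (abs_signCov_le (normalLaw S)) htpos (by positivity : 0 ≤ ψ) hmgf
  refine key.trans ?_
  have e1 : (11 / 5 * ((d : ℝ) + 1) + ψ) / t = α / y + M * (y / (1 - y)) := by
    rw [ht, hψ, hα, hx]
    field_simp
  have e2 : α / y = p ^ 2 + p * q := by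
    rw [← hp2, hy]; field_simp
  have e3 : M * (y / (1 - y)) = p * q := by
    rw [← hq2, hy1, hy]; field_simp
  rw [e1, e2, e3, hp2]
  have e4 : p * q ≤ 2 * s * √(((d : ℝ) + 1) / (3 * n)) := by
    rw [hp, hq, ← Real.sqrt_mul hαpos.le]
    refine Real.sqrt_le_iff.2 ⟨by positivity, ?_⟩
    rw [mul_pow, Real.sq_sqrt (by positivity)]
    have : ((d : ℝ) + 1) / (3 * n) = x / 3 := by rw [hx]; field_simp
    rw [this, hα, hM]
    have : 0 ≤ s ^ 2 * x := by positivity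
    nlinarith
  have hr : 0 ≤ √(((d : ℝ) + 1) / (3 * n)) := Real.sqrt_nonneg _
  have hα2 : α = 187 / 50 * (s * x) := by rw [hα]; ring
  rw [hα2]
  have h1 : 0 ≤ s * x := by positivity
  have h2 : 0 ≤ s * √(((d : ℝ) + 1) / (3 * n)) := by positivity
  nlinarith

end GaussianCopula

end

/-! ### U-statistics -/

noncomputable section

namespace GaussianCopula

section Product

variable {α : Type*} [MeasurableSpace α] {μ : Measure α} [IsProbabilityMeasure μ]

/-- A subfamily of an i.i.d. family is i.i.d. -/
theorem measurePreserving_comp_injective {ι κ : Type*} [Fintype ι] [Fintype κ] {φ : κ → ι}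
    (hφ : Function.Injective φ) : MeasurePreserving (fun (x : ι → α) a => x (φ a))
      (Measure.pi fun _ : ι => μ) (Measure.pi fun _ : κ => μ) := by
  refine ⟨measurable_pi_lambda _ fun a => measurable_pi_apply _, ?_⟩
  have h : iIndepFun (fun (i : ι) (x : ι → α) => x i) (Measure.pi fun _ : ι => μ) :=
    iIndepFun_pi (μ := fun _ : ι => μ) (X := fun _ => id) fun _ => aemeasurable_id
  have h2 := h.precomp hφ
  rw [iIndepFun_iff_map_fun_eq_pi_map fun i => (measurable_pi_apply _).aemeasurable] at h2
  rw [h2]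
  congr 1
  ext1 a
  exact (measurePreserving_eval (fun _ : ι => μ) (φ a)).map_eq

/-- Disjoint blocks of an i.i.d. family are i.i.d. -/
theorem measurePreserving_blocks {ι κ κ' : Type*} [Fintype ι] [Fintype κ] [Fintype κ']
    {φ : κ × κ' → ι} (hφ : Function.Injective φ) :
    MeasurePreserving (fun (x : ι → α) b a => x (φ (b, a))) (Measure.pi fun _ : ι => μ)
      (Measure.pi fun _ : κ => Measure.pi fun _ : κ' => μ) := by
  have h := Measure.infinitePi_map_curry (ι := κ) (κ := κ') (fun _ _ => μ)
  simp_rw [Measure.infinitePi_eq_pi] at h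
  have h' : MeasurePreserving (MeasurableEquiv.curry κ κ' α) (Measure.pi fun _ : κ × κ' => μ)
      (Measure.pi fun _ : κ => Measure.pi fun _ : κ' => μ) := ⟨MeasurableEquiv.measurable _, h⟩
  exact h'.comp (measurePreserving_comp_injective hφ)

theorem measurePreserving_update {ι : Type*} [Fintype ι] [DecidableEq ι] (i : ι) :
    MeasurePreserving (fun p : (ι → α) × α => Function.update p.1 i p.2)
      ((Measure.pi fun _ : ι => μ).prod μ) (Measure.pi fun _ : ι => μ) := by
  have hm : Measurable fun p : (ι → α) × α => Function.update p.1 i p.2 := by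
    refine measurable_pi_lambda _ fun j => ?_
    by_cases h : j = i
    · subst h; simpa using measurable_snd
    · simp only [Function.update_of_ne h]
      exact (measurable_pi_apply j).comp measurable_fst
  refine ⟨hm, (Measure.pi_eq fun s hs => ?_).symm⟩
  rw [Measure.map_apply hm (MeasurableSet.univ_pi hs)]
  have e : (fun p : (ι → α) × α => Function.update p.1 i p.2) ⁻¹' Set.univ.pi s =
      (Set.univ.pi (Function.update s i Set.univ)) ×ˢ s i := by
    ext ⟨x, y⟩
    simp only [Set.mem_preimage, Set.mem_univ_pi, Set.mem_prod]
    constructor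
    · intro h
      refine ⟨fun j => ?_, by simpa using h i⟩
      by_cases hj : j = i
      · subst hj; simp
      · simpa [Function.update_of_ne hj] using h j
    · rintro ⟨h1, h2⟩ j
      by_cases hj : j = i
      · subst hj; simpa using h2
      · simpa [Function.update_of_ne hj] using h1 j
  rw [e, Measure.prod_prod, Measure.pi_pi, ← Finset.mul_prod_erase _ _ (Finset.mem_univ i),
    ← Finset.mul_prod_erase (a := i) (f := fun j => μ (s j)) _ (Finset.mem_univ i), mul_comm]
  simp only [Function.update_self, measure_univ, one_mul]
  congr 1
  refine Finset.prod_congr rfl fun j hj => ?_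
  rw [Function.update_of_ne (Finset.ne_of_mem_erase hj)]

/-- A function which integrates to zero in the `i`-th variable is orthogonal to every function
that does not depend on this variable. -/
theorem integral_mul_eq_zero_of_update {ι : Type*} [Fintype ι] [DecidableEq ι] (i : ι)
    {A B : (ι → α) → ℝ} (mA : Measurable A) (mB : Measurable B) {C D : ℝ}
    (hA : ∀ x, |A x| ≤ C) (hB : ∀ x, |B x| ≤ D)
    (hA0 : ∀ x, ∫ y, A (Function.update x i y) ∂μ = 0)
    (hBi : ∀ x y, B (Function.update x i y) = B x) :
    ∫ x, A x * B x ∂(Measure.pi fun _ : ι => μ) = 0 := by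
  have hmp := measurePreserving_update (μ := μ) i
  have mAB : Measurable fun x => A x * B x := mA.mul mB
  rw [← hmp.map_eq, integral_map hmp.measurable.aemeasurable mAB.aestronglyMeasurable,
    integral_prod]
  · simp_rw [hBi, integral_mul_const, hA0]
    simp
  · refine integrable_of_bounded (mAB.comp hmp.measurable) (C := C * D) fun p => ?_
    rw [abs_mul]
    exact mul_le_mul (hA _) (hB _) (abs_nonneg _) ((abs_nonneg _).trans (hA p.1))

end Product

section IID

variable {β : Type*}

theorem abs_sum_apply_le {g : β → ℝ} {C : ℝ} (hg : ∀ z, |g z| ≤ C) {m : ℕ} (z : Fin m → β) :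
    |∑ b, g (z b)| ≤ m * C := by
  refine (Finset.abs_sum_le_sum_abs _ _).trans ?_
  refine (Finset.sum_le_sum fun b _ => hg (z b)).trans ?_
  simp

variable [MeasurableSpace β] {ν : Measure β} [IsProbabilityMeasure ν]

/-- The second and fourth moments of a sum of i.i.d. centred variables. -/
theorem integral_sum_pow {g : β → ℝ} (mg : Measurable g) {C : ℝ} (hg : ∀ z, |g z| ≤ C)
    (h0 : ∫ z, g z ∂ν = 0) (m : ℕ) :
    ∫ z, (∑ b, g (z b)) ∂(Measure.pi fun _ : Fin m => ν) = 0 ∧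
    ∫ z, (∑ b, g (z b)) ^ 2 ∂(Measure.pi fun _ : Fin m => ν) = m * ∫ z, g z ^ 2 ∂ν ∧
    ∫ z, (∑ b, g (z b)) ^ 4 ∂(Measure.pi fun _ : Fin m => ν) =
      m * (∫ z, g z ^ 4 ∂ν) + 3 * m * (m - 1) * (∫ z, g z ^ 2 ∂ν) ^ 2 := by
  have Ig : ∀ p : ℕ, Integrable (fun z => g z ^ p) ν := fun p =>
    integrable_of_bounded (mg.pow_const p) (C := C ^ p) fun z => by
      rw [abs_pow]; exact pow_le_pow_left₀ (abs_nonneg _) (hg z) p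
  have mS : ∀ m : ℕ, Measurable fun z : Fin m → β => ∑ b, g (z b) := fun m =>
    Finset.measurable_sum _ fun b _ => mg.comp (measurable_pi_apply b)
  have IS : ∀ m p : ℕ, Integrable (fun z : Fin m → β => (∑ b, g (z b)) ^ p)
      (Measure.pi fun _ : Fin m => ν) := fun m p =>
    integrable_of_bounded ((mS m).pow_const p) (C := (m * C) ^ p) fun z => by
      rw [abs_pow]; exact pow_le_pow_left₀ (abs_nonneg _) (abs_sum_apply_le hg z) p
  induction m with
  | zero => simp
  | succ m ih =>
    obtain ⟨i1, i2, i3⟩ := ih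
    have hsucc : ∀ p : ℕ, ∫ z, (∑ b, g (z b)) ^ p ∂(Measure.pi fun _ : Fin (m + 1) => ν) =
        ∫ t, ∫ z, (g t + ∑ b, g (z b)) ^ p ∂(Measure.pi fun _ : Fin m => ν) ∂ν := by
      intro p
      rw [integral_pi_succ ν ((mS (m + 1)).pow_const p) (C := ((m + 1 : ℕ) * C) ^ p) fun z => by
        rw [abs_pow]; exact pow_le_pow_left₀ (abs_nonneg _) (abs_sum_apply_le hg z) p]
      simp_rw [Fin.sum_univ_succ, Fin.cons_zero, Fin.cons_succ]
    have S1 := (IS m 1)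
    have S2 := (IS m 2)
    have S3 := (IS m 3)
    have S4 := (IS m 4)
    have g1 := Ig 1
    have g2 := Ig 2
    have g4 := Ig 4
    simp only [pow_one] at S1 g1
    refine ⟨?_, ?_, ?_⟩
    · have := hsucc 1
      simp only [pow_one] at this
      rw [this]
      have e : ∀ t, ∫ z, (g t + ∑ b, g (z b)) ∂(Measure.pi fun _ : Fin m => ν) = g t := by
        intro t
        rw [integral_add (integrable_const _) S1, i1]
        simp
      simp_rw [e, h0]
    · rw [hsucc 2]
      have e : ∀ t, ∫ z, (g t + ∑ b, g (z b)) ^ 2 ∂(Measure.pi fun _ : Fin m => ν) =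
          g t ^ 2 + m * ∫ z, g z ^ 2 ∂ν := by
        intro t
        have e1 : ∀ z : Fin m → β, (g t + ∑ b, g (z b)) ^ 2 =
            g t ^ 2 + (2 * g t * ∑ b, g (z b) + (∑ b, g (z b)) ^ 2) := fun z => by ring
        simp_rw [e1]
        rw [integral_add (by fun_prop) (by fun_prop), integral_add (by fun_prop) (by fun_prop),
          integral_const_mul, i1, i2]
        simp
      simp_rw [e]
      rw [integral_add g2 (integrable_const _)]
      simp
      ring
    · rw [hsucc 4]
      set c := ∫ z, (∑ b, g (z b)) ^ 3 ∂(Measure.pi fun _ : Fin m => ν) with hc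
      set v := ∫ z, g z ^ 2 ∂ν with hv
      have e : ∀ t, ∫ z, (g t + ∑ b, g (z b)) ^ 4 ∂(Measure.pi fun _ : Fin m => ν) =
          g t ^ 4 + 6 * (m * v) * g t ^ 2 + 4 * c * g t +
            (m * (∫ z, g z ^ 4 ∂ν) + 3 * m * (m - 1) * v ^ 2) := by
        intro t
        have e1 : ∀ z : Fin m → β, (g t + ∑ b, g (z b)) ^ 4 =
            g t ^ 4 + (4 * g t ^ 3 * ∑ b, g (z b) + (6 * g t ^ 2 * (∑ b, g (z b)) ^ 2 +
              (4 * g t * (∑ b, g (z b)) ^ 3 + (∑ b, g (z b)) ^ 4))) := fun z => by ring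
        simp_rw [e1]
        rw [integral_add (by fun_prop) (by fun_prop), integral_add (by fun_prop) (by fun_prop),
          integral_add (by fun_prop) (by fun_prop), integral_add (by fun_prop) (by fun_prop),
          integral_const_mul, integral_const_mul,
          integral_const_mul, i1, i2, i3, ← hc]
        simp
        ring
      simp_rw [e]
      rw [integral_add (by fun_prop) (by fun_prop), integral_add (by fun_prop) (by fun_prop),
        integral_add (by fun_prop) (by fun_prop), integral_const_mul, integral_const_mul, h0, ← hv]
      simp
      ring

end IID

section UStat

variable {α : Type*} {n k : ℕ}

/-- The U-statistic of order `k` with kernel `q`: the average of `q (x (e 1), …, x (e k))` over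
all injections `e`. -/
def uStat (q : (Fin k → α) → ℝ) (x : Fin n → α) : ℝ :=
  (∑ e : Fin k ↪ Fin n, q fun a => x (e a)) / Fintype.card (Fin k ↪ Fin n)

theorem card_embedding_pos (hk : k ≤ n) : (0 : ℝ) < Fintype.card (Fin k ↪ Fin n) := by
  rw [Fintype.card_embedding_eq, Fintype.card_fin, Fintype.card_fin]
  exact_mod_cast Nat.descFactorial_pos.2 hk

/-- Averaging over all injections is averaging over the permutations of a single one. -/
theorem sum_perm_eq (hk : k ≤ n) (e₀ : Fin k ↪ Fin n) (F : (Fin k ↪ Fin n) → ℝ) :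
    (∑ π : Equiv.Perm (Fin n), F (e₀.trans π.toEmbedding)) / n.factorial =
      (∑ e, F e) / Fintype.card (Fin k ↪ Fin n) := by
  set A : (Fin k ↪ Fin n) → ℝ := fun e =>
    ∑ π : Equiv.Perm (Fin n), F (e.trans π.toEmbedding) with hA
  have hconst : ∀ e e', A e = A e' := by
    intro e e'
    obtain ⟨σ, rfl⟩ : ∃ σ : Equiv.Perm (Fin n), σ • e = e' :=
      ((Equiv.Perm.isMultiplyPretransitive (Fin n) k).exists_smul_eq e e')
    simp only [hA]
    rw [← Equiv.sum_comp (Equiv.mulRight σ)]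
    rfl
  have hsum : ∑ e, A e = n.factorial * ∑ e, F e := by
    simp only [hA]
    rw [Finset.sum_comm]
    have : ∀ π : Equiv.Perm (Fin n), ∑ e : Fin k ↪ Fin n, F (e.trans π.toEmbedding) =
        ∑ e, F e := by
      intro π
      exact Fintype.sum_equiv ((Equiv.refl _).embeddingCongr π) _ _ fun e => rfl
    simp_rw [this]
    simp [Fintype.card_perm]
  rw [Finset.sum_congr rfl fun e _ => hconst e e₀] at hsum
  have hc := card_embedding_pos hk
  have hn : (0 : ℝ) < n.factorial := by exact_mod_cast n.factorial_pos
  rw [div_eq_div_iff hn.ne' hc.ne']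
  simp only [Finset.sum_const, Finset.card_univ, nsmul_eq_mul] at hsum
  change A e₀ * _ = _
  linarith

theorem uStat_eq_perm (hk : k ≤ n) (e₀ : Fin k ↪ Fin n) (q : (Fin k → α) → ℝ) (x : Fin n → α) :
    uStat q x = (∑ π : Equiv.Perm (Fin n), q fun a => x (π (e₀ a))) / n.factorial :=
  (sum_perm_eq hk e₀ fun e => q fun a => x (e a)).symm

/-- A kernel of lower order may be regarded as a kernel of higher order. -/
theorem uStat_comp {l : ℕ} (hk : k ≤ n) (hl : l ≤ k) (ι : Fin l ↪ Fin k) (q : (Fin l → α) → ℝ)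
    (x : Fin n → α) : uStat (fun z : Fin k → α => q fun a => z (ι a)) x = uStat q x := by
  rw [uStat_eq_perm hk (Fin.castLEEmb hk), uStat_eq_perm (hl.trans hk)
    (ι.trans (Fin.castLEEmb hk))]
  rfl

theorem uStat_add (q r : (Fin k → α) → ℝ) (x : Fin n → α) :
    uStat (fun z => q z + r z) x = uStat q x + uStat r x := by
  simp [uStat, Finset.sum_add_distrib, add_div]

theorem uStat_const_mul (c : ℝ) (q : (Fin k → α) → ℝ) (x : Fin n → α) :
    uStat (fun z => c * q z) x = c * uStat q x := by
  simp [uStat, ← Finset.mul_sum, mul_div_assoc]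

theorem uStat_sum {ι : Type*} (s : Finset ι) (q : ι → (Fin k → α) → ℝ) (x : Fin n → α) :
    uStat (fun z => ∑ i ∈ s, q i z) x = ∑ i ∈ s, uStat (q i) x := by
  simp only [uStat]
  rw [Finset.sum_comm, Finset.sum_div]

theorem uStat_const (hk : k ≤ n) (c : ℝ) (x : Fin n → α) :
    uStat (fun _ : Fin k → α => c) x = c := by
  have := card_embedding_pos hk
  rw [uStat]
  simp only [Finset.sum_const, Finset.card_univ, nsmul_eq_mul]
  field_simp

theorem uStat_one (q : (Fin 1 → α) → ℝ) (x : Fin n → α) :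
    uStat q x = (∑ i, q fun _ => x i) / n := by
  have h : ∑ e : Fin 1 ↪ Fin n, q (fun a => x (e a)) = ∑ i, q fun _ => x i := by
    refine Fintype.sum_equiv (Equiv.uniqueEmbeddingEquivResult (α := Fin 1) (β := Fin n)) _ _
      fun e => ?_
    congr 1
    ext1 a
    rw [Subsingleton.elim a default]
    rfl
  rw [uStat, h, Fintype.card_embedding_eq]
  simp

theorem abs_uStat_le (hk : k ≤ n) {q : (Fin k → α) → ℝ} {C : ℝ} (hq : ∀ z, |q z| ≤ C)
    (x : Fin n → α) : |uStat q x| ≤ C := by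
  have hc := card_embedding_pos hk
  rw [uStat, abs_div, abs_of_pos hc, div_le_iff₀ hc]
  refine (Finset.abs_sum_le_sum_abs _ _).trans ?_
  refine (Finset.sum_le_sum fun e _ => hq _).trans ?_
  simp [mul_comm]

variable [MeasurableSpace α] {μ : Measure α} [IsProbabilityMeasure μ]

theorem measurable_comp_embedding (e : Fin k ↪ Fin n) :
    Measurable fun (x : Fin n → α) a => x (e a) :=
  measurable_pi_lambda _ fun _ => measurable_pi_apply _

theorem measurable_uStat {q : (Fin k → α) → ℝ} (mq : Measurable q) :
    Measurable (uStat (n := n) q) :=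
  (Finset.measurable_sum _ fun e _ => mq.comp (measurable_comp_embedding e)).div_const _

theorem integral_comp_embedding (e : Fin k ↪ Fin n) {q : (Fin k → α) → ℝ} (mq : Measurable q) :
    ∫ x : Fin n → α, q (fun a => x (e a)) ∂(Measure.pi fun _ : Fin n => μ) =
      ∫ z, q z ∂(Measure.pi fun _ : Fin k => μ) := by
  have h := measurePreserving_comp_injective (μ := μ) e.injective
  rw [← h.map_eq, integral_map h.measurable.aemeasurable mq.aestronglyMeasurable]

theorem abs_mul_le_of_abs_le {a b C D : ℝ} (ha : |a| ≤ C) (hb : |b| ≤ D) : |a * b| ≤ C * D := by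
  rw [abs_mul]
  exact mul_le_mul ha hb (abs_nonneg _) ((abs_nonneg _).trans ha)

/-- A kernel is degenerate if it integrates to zero in each of its variables. -/
def Degenerate (μ : Measure α) (q : (Fin k → α) → ℝ) : Prop :=
  ∀ z a, ∫ y, q (Function.update z a y) ∂μ = 0

theorem Degenerate.integral_mul_eq_zero {l : ℕ} {q : (Fin k → α) → ℝ} {r : (Fin l → α) → ℝ}
    (hd : Degenerate μ q) (mq : Measurable q) (mr : Measurable r) {C D : ℝ}
    (hq : ∀ z, |q z| ≤ C) (hr : ∀ z, |r z| ≤ D) (e : Fin k ↪ Fin n) (e' : Fin l ↪ Fin n)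
    {a : Fin k} (ha : e a ∉ Set.range e') :
    ∫ x : Fin n → α, q (fun a => x (e a)) * r (fun a => x (e' a))
      ∂(Measure.pi fun _ : Fin n => μ) = 0 := by
  refine integral_mul_eq_zero_of_update (e a) (mq.comp (measurable_comp_embedding e))
    (mr.comp (measurable_comp_embedding e')) (fun x => hq _) (fun x => hr _) (fun x => ?_)
    fun x y => ?_
  · rw [← hd (fun a => x (e a)) a]
    congr 1
    ext1 y
    congr 1
    exact Function.update_comp_eq_of_injective x e.injective a y
  · congr 1
    exact Function.update_comp_eq_of_notMem_range x y ha

theorem exists_notMem_range {l : ℕ} (hlk : l < k) (e : Fin k ↪ Fin n) (e' : Fin l ↪ Fin n) :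
    ∃ a, e a ∉ Set.range e' := by
  by_contra! h
  choose τ hτ using h
  have hτi : Function.Injective τ := fun a b hab => e.injective (by rw [← hτ, ← hτ, hab])
  have := Fintype.card_le_of_injective τ hτi
  simp only [Fintype.card_fin] at this
  omega

/-- U-statistics of different orders are orthogonal if the one of higher order is degenerate. -/
theorem Degenerate.integral_uStat_mul_uStat {l : ℕ} {q : (Fin k → α) → ℝ} {r : (Fin l → α) → ℝ}
    (hd : Degenerate μ q) (hlk : l < k) (mq : Measurable q) (mr : Measurable r) {C D : ℝ}
    (hq : ∀ z, |q z| ≤ C) (hr : ∀ z, |r z| ≤ D) :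
    ∫ x : Fin n → α, uStat q x * uStat r x ∂(Measure.pi fun _ : Fin n => μ) = 0 := by
  simp_rw [uStat, div_mul_div_comm, Finset.sum_mul_sum]
  have hI : ∀ (e : Fin k ↪ Fin n) (e' : Fin l ↪ Fin n), Integrable (fun x : Fin n → α =>
      q (fun a => x (e a)) * r (fun a => x (e' a))) (Measure.pi fun _ : Fin n => μ) :=
    fun e e' => integrable_of_bounded ((mq.comp (measurable_comp_embedding e)).mul
      (mr.comp (measurable_comp_embedding e'))) fun x => abs_mul_le_of_abs_le (hq _) (hr _)
  rw [integral_div, integral_finsetSum _ fun e _ => integrable_finsetSum _ fun e' _ => hI e e',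
    div_eq_zero_iff]
  left
  refine Finset.sum_eq_zero fun e _ => ?_
  rw [integral_finsetSum _ fun e' _ => hI e e']
  refine Finset.sum_eq_zero fun e' _ => ?_
  obtain ⟨a, ha⟩ := exists_notMem_range hlk e e'
  exact hd.integral_mul_eq_zero mq mr hq hr e e' ha

/-- The variance of a degenerate U-statistic: only injections with the same range are
correlated. -/
theorem Degenerate.integral_uStat_sq_le {q : (Fin k → α) → ℝ} (hd : Degenerate μ q) (hk : k ≤ n)
    (mq : Measurable q) {C : ℝ} (hq : ∀ z, |q z| ≤ C) :
    ∫ x : Fin n → α, uStat q x ^ 2 ∂(Measure.pi fun _ : Fin n => μ) ≤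
      k.factorial / n.descFactorial k * ∫ z, q z ^ 2 ∂(Measure.pi fun _ : Fin k => μ) := by
  classical
  set Q := ∫ z, q z ^ 2 ∂(Measure.pi fun _ : Fin k => μ) with hQ
  have hQ0 : 0 ≤ Q := integral_nonneg fun z => sq_nonneg _
  have hcard : (Fintype.card (Fin k ↪ Fin n) : ℝ) = n.descFactorial k := by
    rw [Fintype.card_embedding_eq, Fintype.card_fin, Fintype.card_fin]
  have hcpos := card_embedding_pos hk
  rw [hcard] at hcpos
  have mqe : ∀ e : Fin k ↪ Fin n, Measurable fun x : Fin n → α => q fun a => x (e a) :=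
    fun e => mq.comp (measurable_comp_embedding e)
  have hI : ∀ (e : Fin k ↪ Fin n) (e' : Fin k ↪ Fin n), Integrable (fun x : Fin n → α =>
      q (fun a => x (e a)) * q (fun a => x (e' a))) (Measure.pi fun _ : Fin n => μ) :=
    fun e e' => integrable_of_bounded ((mqe e).mul (mqe e'))
      fun x => abs_mul_le_of_abs_le (hq _) (hq _)
  have hle : ∀ e e' : Fin k ↪ Fin n, ∫ x : Fin n → α, q (fun a => x (e a)) *
      q (fun a => x (e' a)) ∂(Measure.pi fun _ : Fin n => μ) ≤ Q := by
    intro e e'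
    have hsq : ∀ e : Fin k ↪ Fin n, ∫ x : Fin n → α, q (fun a => x (e a)) ^ 2
        ∂(Measure.pi fun _ : Fin n => μ) = Q := fun e =>
      integral_comp_embedding e (mq.pow_const 2)
    have hIsq : ∀ e : Fin k ↪ Fin n, Integrable (fun x : Fin n → α => q (fun a => x (e a)) ^ 2)
        (Measure.pi fun _ : Fin n => μ) := fun e => by
      simpa only [sq] using hI e e
    calc _ ≤ ∫ x : Fin n → α, (q (fun a => x (e a)) ^ 2 / 2 + q (fun a => x (e' a)) ^ 2 / 2)
          ∂(Measure.pi fun _ : Fin n => μ) := by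
          refine integral_mono (hI e e') (((hIsq e).div_const 2).add ((hIsq e').div_const 2))
            fun x => ?_
          have := two_mul_le_add_sq (q fun a => x (e a)) (q fun a => x (e' a))
          simp only
          linarith
      _ = Q := by
          rw [integral_add ((hIsq e).div_const 2) ((hIsq e').div_const 2), integral_div,
            integral_div, hsq, hsq]
          ring
  have hrow : ∀ e : Fin k ↪ Fin n, ∑ e' : Fin k ↪ Fin n, ∫ x : Fin n → α,
      q (fun a => x (e a)) * q (fun a => x (e' a)) ∂(Measure.pi fun _ : Fin n => μ) ≤
        k.factorial * Q := by
    intro e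
    set N : Finset (Fin k ↪ Fin n) := Finset.univ.image fun σ : Equiv.Perm (Fin k) =>
      σ.toEmbedding.trans e with hN
    have hzero : ∀ e' ∉ N, ∫ x : Fin n → α, q (fun a => x (e a)) * q (fun a => x (e' a))
        ∂(Measure.pi fun _ : Fin n => μ) = 0 := by
      intro e' he'
      have : ∃ a, e a ∉ Set.range e' := by
        by_contra! h
        choose τ hτ using h
        have hτi : Function.Injective τ := fun a b hab => e.injective (by rw [← hτ, ← hτ, hab])
        refine he' (Finset.mem_image.2
          ⟨(Equiv.ofBijective τ (Finite.injective_iff_bijective.1 hτi)).symm,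
            Finset.mem_univ _, ?_⟩)
        ext1 a
        simp only [Function.Embedding.trans_apply, Equiv.coe_toEmbedding]
        rw [← hτ]
        congr 1
        exact (Equiv.ofBijective τ (Finite.injective_iff_bijective.1 hτi)).apply_symm_apply a
      obtain ⟨a, ha⟩ := this
      exact hd.integral_mul_eq_zero mq mq hq hq e e' ha
    rw [← Finset.sum_subset (Finset.subset_univ N) fun e' _ he' => hzero e' he']
    refine (Finset.sum_le_card_nsmul _ _ Q fun e' _ => hle e e').trans ?_
    rw [nsmul_eq_mul]
    refine mul_le_mul_of_nonneg_right ?_ hQ0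
    have := Finset.card_image_le (s := (Finset.univ : Finset (Equiv.Perm (Fin k))))
      (f := fun σ => σ.toEmbedding.trans e)
    rw [Finset.card_univ, Fintype.card_perm, Fintype.card_fin] at this
    exact_mod_cast this
  simp_rw [uStat, div_pow, sq (∑ e : Fin k ↪ Fin n, _), Finset.sum_mul_sum]
  rw [integral_div, integral_finsetSum _ fun e _ => integrable_finsetSum _ fun e' _ => hI e e',
    hcard, div_le_iff₀ (by positivity)]
  calc _ ≤ ∑ e : Fin k ↪ Fin n, k.factorial * Q := by
        refine Finset.sum_le_sum fun e _ => ?_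
        rw [integral_finsetSum _ fun e' _ => hI e e']
        exact hrow e
    _ = _ := by
        rw [Finset.sum_const, Finset.card_univ, nsmul_eq_mul, hcard]
        field_simp

/-- Hoeffding's representation of a U-statistic as an average of means over disjoint blocks. -/
theorem integral_uStat_sub_pow_le {m : ℕ} (hm : 0 < m) (hmk : m * k ≤ n)
    {q : (Fin k → α) → ℝ} (mq : Measurable q) {C : ℝ} (hq : ∀ z, |q z| ≤ C) (θ : ℝ) {p : ℕ}
    (hp : Even p) :
    ∫ x : Fin n → α, (uStat q x - θ) ^ p ∂(Measure.pi fun _ : Fin n => μ) ≤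
      (∫ z, (∑ b, (q (z b) - θ)) ^ p
        ∂(Measure.pi fun _ : Fin m => Measure.pi fun _ : Fin k => μ)) / m ^ p := by
  have hmR : (0 : ℝ) < m := by exact_mod_cast hm
  have hkn : k ≤ n := (Nat.le_mul_of_pos_left k hm).trans hmk
  set φ : Fin m × Fin k → Fin n := fun b => Fin.castLE hmk (finProdFinEquiv b) with hφ
  have hφi : Function.Injective φ :=
    (Fin.castLE_injective hmk).comp finProdFinEquiv.injective
  have hfac : (0 : ℝ) < n.factorial := by exact_mod_cast n.factorial_pos
  -- the block mean
  set G : (Fin n → α) → ℝ := fun x => (∑ b, (q (fun a => x (φ (b, a))) - θ)) / m with hG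
  have mG : Measurable G := by
    refine (Finset.measurable_sum _ fun b _ => ?_).div_const _
    exact (mq.comp (measurable_pi_lambda _ fun a => measurable_pi_apply _)).sub_const _
  have hGb : ∀ x, |G x| ≤ C + |θ| := by
    intro x
    rw [hG]
    simp only
    rw [abs_div, Nat.abs_cast, div_le_iff₀ hmR]
    refine (Finset.abs_sum_le_sum_abs _ _).trans ?_
    refine (Finset.sum_le_sum fun b _ => (abs_sub _ _).trans
      (add_le_add_left (hq _) _)).trans ?_
    simp [mul_comm]; linarith
  have hpt : ∀ x : Fin n → α, uStat q x - θ =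
      ∑ π : Equiv.Perm (Fin n), (n.factorial : ℝ)⁻¹ * G fun i => x (π i) := by
    intro x
    have e1 : ∀ b : Fin m, uStat q x = (∑ π : Equiv.Perm (Fin n),
        q fun a => x (π (φ (b, a)))) / n.factorial := fun b =>
      uStat_eq_perm hkn ⟨fun a => φ (b, a), fun a a' h => by simpa using hφi h⟩ q x
    have e2 : (∑ b : Fin m, uStat q x) = m * uStat q x := by simp
    have e3 : (∑ b : Fin m, uStat q x) = (∑ π : Equiv.Perm (Fin n), ∑ b : Fin m,
        q fun a => x (π (φ (b, a)))) / n.factorial := by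
      rw [Finset.sum_congr rfl fun b _ => e1 b, ← Finset.sum_div, Finset.sum_comm]
    rw [← Finset.mul_sum]
    simp only [hG, Finset.sum_sub_distrib]
    rw [← Finset.sum_div, Finset.sum_sub_distrib]
    simp only [Finset.sum_const, Finset.card_univ, Fintype.card_fin, Fintype.card_perm,
      nsmul_eq_mul]
    rw [eq_div_iff hfac.ne'] at e3
    rw [e2] at e3
    rw [← e3]
    field_simp
  have hIG : ∀ f : (Fin n → α) → (Fin n → α), Measurable f →
      Integrable (fun x => G (f x) ^ p) (Measure.pi fun _ : Fin n => μ) := fun f hf =>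
    integrable_of_bounded ((mG.comp hf).pow_const p) (C := (C + |θ|) ^ p) fun x => by
      rw [abs_pow]; exact pow_le_pow_left₀ (abs_nonneg _) (hGb _) p
  have mperm : ∀ π : Equiv.Perm (Fin n), Measurable fun (x : Fin n → α) i => x (π i) :=
    fun π => measurable_pi_lambda _ fun i => measurable_pi_apply _
  have hperm : ∀ π : Equiv.Perm (Fin n), ∫ x : Fin n → α, G (fun i => x (π i)) ^ p
      ∂(Measure.pi fun _ : Fin n => μ) = ∫ x, G x ^ p ∂(Measure.pi fun _ : Fin n => μ) :=
    fun π => integral_comp_embedding π.toEmbedding (mG.pow_const p)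
  calc _ ≤ ∫ x : Fin n → α, ∑ π : Equiv.Perm (Fin n), (n.factorial : ℝ)⁻¹ *
        G (fun i => x (π i)) ^ p ∂(Measure.pi fun _ : Fin n => μ) := by
        refine integral_mono
          (integrable_of_bounded (((measurable_uStat mq).sub_const θ).pow_const p)
          (C := (C + |θ|) ^ p) fun x => ?_)
          (integrable_finsetSum _ fun π _ => (hIG _ (mperm π)).const_mul _) fun x => ?_
        · rw [abs_pow]
          exact pow_le_pow_left₀ (abs_nonneg _) ((abs_sub _ _).trans
            (add_le_add_left (abs_uStat_le hkn hq x) _)) p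
        · simp only
          rw [hpt x]
          refine Real.pow_arith_mean_le_arith_mean_pow_of_even Finset.univ _ _
            (fun _ _ => by positivity) ?_ hp
          simp only [Finset.sum_const, Finset.card_univ, Fintype.card_perm, Fintype.card_fin,
            nsmul_eq_mul]
          field_simp
    _ = ∫ x, G x ^ p ∂(Measure.pi fun _ : Fin n => μ) := by
        rw [integral_finsetSum _ fun π _ => (hIG _ (mperm π)).const_mul _]
        simp_rw [integral_const_mul, hperm]
        simp only [Finset.sum_const, Finset.card_univ, Fintype.card_perm, Fintype.card_fin,
          nsmul_eq_mul]
        field_simp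
    _ = _ := by
        have h := measurePreserving_blocks (μ := μ) hφi
        have mH : Measurable fun z : Fin m → Fin k → α => (∑ b, (q (z b) - θ)) ^ p :=
          (Finset.measurable_sum _ fun b _ =>
            (mq.comp (measurable_pi_apply b)).sub_const _).pow_const p
        rw [← h.map_eq, integral_map h.measurable.aemeasurable mH.aestronglyMeasurable,
          ← integral_div]
        simp only [hG, div_pow]

end UStat

end GaussianCopula

end

/-! ### Hoeffding decomposition in order two -/

noncomputable section

namespace GaussianCopula

section Hoeffding

variable {α : Type*} [MeasurableSpace α] {μ : Measure α} [IsProbabilityMeasure μ] {n : ℕ}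

theorem measurable_integral_right {β : Type*} [MeasurableSpace β] {f : β → α → ℝ}
    (hf : Measurable fun p : β × α => f p.1 p.2) : Measurable fun b => ∫ a, f b a ∂μ :=
  (hf.stronglyMeasurable.integral_prod_right').measurable

theorem abs_integral_le_of_abs_le {f : α → ℝ} {C : ℝ} (hf : ∀ x, |f x| ≤ C) :
    |∫ x, f x ∂μ| ≤ C := by
  have := norm_integral_le_of_norm_le_const (μ := μ) (f := f) (C := C)
    (Filter.Eventually.of_forall fun x => by simpa using hf x)
  simpa using this

theorem integral_sub_integral_sq_le {f : α → ℝ} (mf : Measurable f) {C : ℝ}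
    (hf : ∀ x, |f x| ≤ C) : ∫ x, (f x - ∫ y, f y ∂μ) ^ 2 ∂μ ≤ ∫ x, f x ^ 2 ∂μ := by
  set c := ∫ y, f y ∂μ with hc
  have I1 : Integrable f μ := integrable_of_bounded mf hf
  have I2 : Integrable (fun x => f x ^ 2) μ :=
    integrable_of_bounded (mf.pow_const 2) (C := C ^ 2) fun x => by
      rw [abs_pow]; exact pow_le_pow_left₀ (abs_nonneg _) (hf x) 2
  have e : ∀ x, (f x - c) ^ 2 = f x ^ 2 - 2 * c * f x + c ^ 2 := fun x => by ring
  simp_rw [e]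
  rw [integral_add (by fun_prop) (by fun_prop), integral_sub (by fun_prop) (by fun_prop),
    integral_const_mul, ← hc]
  simp
  nlinarith [sq_nonneg c]

theorem sq_of_abs_le {a C : ℝ} (h : |a| ≤ C) : |a ^ 2| ≤ C ^ 2 := by
  rw [abs_pow]; exact pow_le_pow_left₀ (abs_nonneg _) h 2

theorem integral_add_sq_of_orthogonal {β : Type*} [MeasurableSpace β] {ν : Measure β}
    [IsProbabilityMeasure ν] {f g : β → ℝ} (mf : Measurable f) (mg : Measurable g) {C D : ℝ}
    (hf : ∀ x, |f x| ≤ C) (hg : ∀ x, |g x| ≤ D) (horth : ∫ x, f x * g x ∂ν = 0) :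
    ∫ x, (f x + g x) ^ 2 ∂ν = (∫ x, f x ^ 2 ∂ν) + ∫ x, g x ^ 2 ∂ν := by
  have I1 : Integrable (fun x => f x * g x) ν :=
    integrable_of_bounded (mf.mul mg) fun x => abs_mul_le_of_abs_le (hf x) (hg x)
  have I2 : Integrable (fun x => f x ^ 2) ν :=  integrable_of_bounded (mf.pow_const 2) fun x =>
    sq_of_abs_le (hf x)
  have I3 : Integrable (fun x => g x ^ 2) ν :=  integrable_of_bounded (mg.pow_const 2) fun x =>
    sq_of_abs_le (hg x)
  have e : ∀ x, (f x + g x) ^ 2 = f x ^ 2 + g x ^ 2 + 2 * (f x * g x) := fun x => by ring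
  simp_rw [e]
  rw [integral_add (by fun_prop) (by fun_prop), integral_add (by fun_prop) (by fun_prop),
    integral_const_mul, horth, mul_zero, add_zero]

/-- Pythagoras' theorem for a finite orthogonal family. -/
theorem integral_sum_sq_of_orthogonal {β : Type*} [MeasurableSpace β] {ν : Measure β}
    [IsProbabilityMeasure ν] {N : ℕ} {f : Fin N → β → ℝ} (mf : ∀ i, Measurable (f i))
    {C : Fin N → ℝ} (hf : ∀ i x, |f i x| ≤ C i) (horth : ∀ i j, i < j → ∫ x, f i x * f j x ∂ν = 0) :
    ∫ x, (∑ i, f i x) ^ 2 ∂ν = ∑ i, ∫ x, f i x ^ 2 ∂ν := by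
  have hI : ∀ i j, Integrable (fun x => f i x * f j x) ν := fun i j =>
    integrable_of_bounded ((mf i).mul (mf j)) fun x => abs_mul_le_of_abs_le (hf i x) (hf j x)
  have horth' : ∀ i j, i ≠ j → ∫ x, f i x * f j x ∂ν = 0 := by
    intro i j hij
    rcases lt_or_gt_of_ne hij with h | h
    · exact horth i j h
    · rw [← horth j i h]; congr 1; ext x; ring
  simp_rw [sq, Finset.sum_mul_sum]
  rw [integral_finsetSum _ fun i _ => integrable_finsetSum _ fun j _ => hI i j]
  refine Finset.sum_congr rfl fun i _ => ?_
  rw [integral_finsetSum _ fun j _ => hI i j]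
  exact Finset.sum_eq_single i (fun j _ hj => horth' i j (Ne.symm hj)) (by simp)

theorem integral_pi_one {f : α → ℝ} (mf : Measurable f) :
    ∫ z, f (z 0) ∂(Measure.pi fun _ : Fin 1 => μ) = ∫ x, f x ∂μ := by
  have h := measurePreserving_eval (fun _ : Fin 1 => μ) 0
  conv_rhs => rw [← h.map_eq]
  rw [integral_map h.measurable.aemeasurable mf.aestronglyMeasurable]

theorem degenerate_one {ν : Measure α} {f : α → ℝ} (hf : ∫ x, f x ∂ν = 0) :
    Degenerate ν fun z : Fin 1 → α => f (z 0) := by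
  intro z a
  fin_cases a
  simpa using hf

/-- The variance of a U-statistic of order two after subtraction of an approximation `g` of its
first projection. -/
theorem integral_uStat_two_sub_sq_le (hn : 2 ≤ n) {q : α → α → ℝ}
    (mq : Measurable fun p : α × α => q p.1 p.2) {C : ℝ} (hq : ∀ x y, |q x y| ≤ C)
    (hsymm : ∀ x y, q y x = q x y) {g : α → ℝ} (mg : Measurable g) {D : ℝ}
    (hg : ∀ x, |g x| ≤ D) :
    ∫ x : Fin n → α, (uStat (fun z : Fin 2 → α => q (z 0) (z 1)) x - (∫ x, ∫ y, q x y ∂μ ∂μ) -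
        2 * ((∑ i, (g (x i) - ∫ y, g y ∂μ)) / n)) ^ 2 ∂(Measure.pi fun _ : Fin n => μ) ≤
      4 / n * (∫ x, ((∫ y, q x y ∂μ) - g x) ^ 2 ∂μ) +
        2 / (n * (n - 1)) *
          ∫ z, q (z 0) (z 1) ^ 2 ∂(Measure.pi fun _ : Fin 2 => μ) := by
  set θ := ∫ x, ∫ y, q x y ∂μ ∂μ with hθ
  set h : α → ℝ := fun x => ∫ y, q x y ∂μ with hh
  have mh : Measurable h := measurable_integral_right mq
  have hhC : ∀ x, |h x| ≤ C := fun x => abs_integral_le_of_abs_le (hq x)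
  have hθC : |θ| ≤ C := abs_integral_le_of_abs_le hhC
  have hθ' : ∫ x, h x ∂μ = θ := rfl
  have hx : ∀ x, ∫ y, q x y ∂μ = h x := fun x => rfl
  have mqx : ∀ x, Measurable fun y => q x y := fun x =>
    mq.comp (f := fun y => (x, y)) (by fun_prop)
  have Iq : ∀ x, Integrable (fun y => q x y) μ := fun x => integrable_of_bounded (mqx x) (hq x)
  have Ih : Integrable h μ := integrable_of_bounded mh hhC
  have Ig : Integrable g μ := integrable_of_bounded mg hg
  set gm := ∫ y, g y ∂μ with hgm
  have hgmD : |gm| ≤ D := abs_integral_le_of_abs_le hg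
  -- the two degenerate components
  set r : α → ℝ := fun x => h x - g x - (θ - gm) with hr
  set t : α → α → ℝ := fun x y => q x y - h x - h y + θ with ht
  have mr : Measurable r := (mh.sub mg).sub_const _
  have mt : Measurable fun z : Fin 2 → α => t (z 0) (z 1) := by
    refine (((mq.comp (f := fun z : Fin 2 → α => (z 0, z 1)) (by fun_prop)).sub
      (mh.comp (measurable_pi_apply 0))).sub (mh.comp (measurable_pi_apply 1))).add_const _
  have hrb : ∀ x, |r x| ≤ (C + D) + (C + D) := fun x =>
    (abs_sub _ _).trans (add_le_add ((abs_sub _ _).trans (add_le_add (hhC x) (hg x)))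
      ((abs_sub _ _).trans (add_le_add hθC hgmD)))
  have htb : ∀ x y, |t x y| ≤ C + C + C + C := fun x y =>
    (abs_add_le _ _).trans (add_le_add ((abs_sub _ _).trans (add_le_add
      ((abs_sub _ _).trans (add_le_add (hq x y) (hhC x))) (hhC y))) hθC)
  have hr0 : ∫ x, r x ∂μ = 0 := by
    simp only [hr]
    rw [integral_sub (by fun_prop) (by fun_prop), integral_sub Ih Ig, hθ', ← hgm]
    simp
  have ht0 : ∀ x, ∫ y, t x y ∂μ = 0 := by
    intro x
    simp only [ht]
    have := Iq x
    rw [integral_add (by fun_prop) (by fun_prop), integral_sub (by fun_prop) (by fun_prop),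
      integral_sub (by fun_prop) (by fun_prop), hx, hθ']
    simp
  have htsymm : ∀ x y, t y x = t x y := fun x y => by simp only [ht]; rw [hsymm]; ring
  have dr : Degenerate μ fun z : Fin 1 → α => r (z 0) := degenerate_one hr0
  have dt : Degenerate μ fun z : Fin 2 → α => t (z 0) (z 1) := by
    intro z a
    fin_cases a
    · simp only [Fin.zero_eta, Function.update_self, ne_eq, one_ne_zero, not_false_eq_true,
        Function.update_of_ne]
      simp_rw [htsymm (z 1)]
      exact ht0 (z 1)
    · simpa using ht0 (z 0)
  have mr1 : Measurable fun z : Fin 1 → α => r (z 0) := mr.comp (measurable_pi_apply 0)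
  -- the decomposition
  have hdec : ∀ x : Fin n → α, uStat (fun z : Fin 2 → α => q (z 0) (z 1)) x - θ -
      2 * ((∑ i, (g (x i) - gm)) / n) =
        uStat (fun z : Fin 2 → α => t (z 0) (z 1)) x +
          2 * uStat (fun z : Fin 1 → α => r (z 0)) x := by
    intro x
    have e0 : (fun z : Fin 2 → α => q (z 0) (z 1)) = fun z : Fin 2 → α =>
        t (z 0) (z 1) + ((r (z 0) + (g (z 0) - gm)) + ((r (z 1) + (g (z 1) - gm)) + θ)) := by
      ext z; simp only [ht, hr]; ring
    have e1 : ∀ a : Fin 2, uStat (fun z : Fin 2 → α => r (z a) + (g (z a) - gm)) x =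
        uStat (fun z : Fin 1 → α => r (z 0)) x + (∑ i, (g (x i) - gm)) / n := by
      intro a
      refine (uStat_comp hn (by norm_num) (⟨fun _ => a, fun _ _ _ => Subsingleton.elim _ _⟩ :
        Fin 1 ↪ Fin 2) (fun z => r (z 0) + (g (z 0) - gm)) x).trans ?_
      rw [uStat_add (fun z : Fin 1 → α => r (z 0)) (fun z => g (z 0) - gm)]
      congr 1
      rw [uStat_one]
    rw [e0, uStat_add, uStat_add (fun z : Fin 2 → α => r (z 0) + (g (z 0) - gm)),
      uStat_add (fun z : Fin 2 → α => r (z 1) + (g (z 1) - gm)), e1, e1, uStat_const hn]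
    ring
  simp_rw [hdec]
  have hn1 : 1 ≤ n := by omega
  have hb1 : ∀ x : Fin n → α, |2 * uStat (fun z : Fin 1 → α => r (z 0)) x| ≤
      2 * ((C + D) + (C + D)) := fun x => by
    rw [abs_mul, abs_two]
    exact mul_le_mul_of_nonneg_left (abs_uStat_le hn1 (fun z => hrb _) x) (by norm_num)
  have hb2 : ∀ x : Fin n → α, |uStat (fun z : Fin 2 → α => t (z 0) (z 1)) x| ≤ C + C + C + C :=
    fun x => abs_uStat_le hn (fun z => htb _ _) x
  rw [integral_add_sq_of_orthogonal (measurable_uStat mt) ((measurable_uStat mr1).const_mul 2)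
    hb2 hb1 (by
      simp_rw [mul_left_comm _ (2 : ℝ), integral_const_mul]
      rw [dt.integral_uStat_mul_uStat (n := n) (by norm_num) mt mr1 (fun z => htb _ _)
        (fun z => hrb _), mul_zero])]
  simp_rw [mul_pow, integral_const_mul]
  have v1 := dr.integral_uStat_sq_le hn1 mr1 (fun z => hrb _)
  have v2 := dt.integral_uStat_sq_le hn mt (fun z => htb _ _)
  rw [integral_pi_one (f := fun x => r x ^ 2) (mr.pow_const 2)] at v1
  have hr2 : ∫ x, r x ^ 2 ∂μ ≤ ∫ x, (h x - g x) ^ 2 ∂μ := by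
    have := integral_sub_integral_sq_le (μ := μ) (mh.sub mg) (C := C + D)
      (fun x => (abs_sub _ _).trans (add_le_add (hhC x) (hg x)))
    simp only [Pi.sub_apply] at this
    rwa [integral_sub Ih Ig] at this
  -- Bessel's inequality for the component of order two
  have hmqz : Measurable fun z : Fin 2 → α => q (z 0) (z 1) :=
    mq.comp (f := fun z : Fin 2 → α => (z 0, z 1)) (by fun_prop)
  have ht2 : ∫ z, t (z 0) (z 1) ^ 2 ∂(Measure.pi fun _ : Fin 2 => μ) ≤
      ∫ z, q (z 0) (z 1) ^ 2 ∂(Measure.pi fun _ : Fin 2 => μ) := by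
    have ho : ∀ a : Fin 2, ∫ z, t (z 0) (z 1) * (h (z a) - θ / 2)
        ∂(Measure.pi fun _ : Fin 2 => μ) = 0 := by
      intro a
      obtain ⟨b, hb⟩ := exists_notMem_range (by norm_num : 1 < 2) (Function.Embedding.refl (Fin 2))
        (⟨fun _ => a, fun _ _ _ => Subsingleton.elim _ _⟩ : Fin 1 ↪ Fin 2)
      exact dt.integral_mul_eq_zero (r := fun z : Fin 1 → α => h (z 0) - θ / 2) mt
        ((mh.comp (measurable_pi_apply 0)).sub_const _) (fun z => htb _ _)
        (fun z => (abs_sub _ _).trans (add_le_add_left (hhC _) _)) _ _ hb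
    have mB : ∀ a : Fin 2, Measurable fun z : Fin 2 → α => h (z a) - θ / 2 := fun a =>
      (mh.comp (measurable_pi_apply a)).sub_const _
    have hB : ∀ (a : Fin 2) (z : Fin 2 → α), |h (z a) - θ / 2| ≤ C + |θ / 2| := fun a z =>
      (abs_sub _ _).trans (add_le_add_left (hhC _) _)
    have IB : ∀ a : Fin 2, Integrable (fun z : Fin 2 → α => t (z 0) (z 1) * (h (z a) - θ / 2))
        (Measure.pi fun _ : Fin 2 => μ) := fun a =>
      integrable_of_bounded (mt.mul (mB a)) fun z => abs_mul_le_of_abs_le (htb _ _) (hB a z)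
    have It : Integrable (fun z : Fin 2 → α => t (z 0) (z 1) ^ 2)
        (Measure.pi fun _ : Fin 2 => μ) :=
      integrable_of_bounded (mt.pow_const 2) fun z => sq_of_abs_le (htb _ _)
    have Iq2 : Integrable (fun z : Fin 2 → α => q (z 0) (z 1) ^ 2)
        (Measure.pi fun _ : Fin 2 => μ) :=
      integrable_of_bounded (hmqz.pow_const 2) fun z => sq_of_abs_le (hq _ _)
    have hle : ∫ z, (t (z 0) (z 1) ^ 2 + 2 * (t (z 0) (z 1) * (h (z 0) - θ / 2)) +
        2 * (t (z 0) (z 1) * (h (z 1) - θ / 2))) ∂(Measure.pi fun _ : Fin 2 => μ) ≤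
        ∫ z, q (z 0) (z 1) ^ 2 ∂(Measure.pi fun _ : Fin 2 => μ) := by
      refine integral_mono ((It.add ((IB 0).const_mul 2)).add ((IB 1).const_mul 2)) Iq2
        fun z => ?_
      simp only [ht]
      nlinarith [sq_nonneg (h (z 0) - θ / 2 + (h (z 1) - θ / 2))]
    have I0 := IB 0
    have I1 := IB 1
    rw [integral_add (by fun_prop) (by fun_prop), integral_add (by fun_prop) (by fun_prop),
      integral_const_mul, integral_const_mul, ho, ho] at hle
    linarith
  have hnR : (2 : ℝ) ≤ n := by exact_mod_cast hn
  have hd2 : ((n.descFactorial 2 : ℕ) : ℝ) = n * (n - 1) := by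
    rw [Nat.descFactorial_succ, Nat.descFactorial_one, Nat.cast_mul, Nat.cast_sub (by omega)]
    push_cast; ring
  rw [hd2] at v2
  simp only [Nat.descFactorial_one, Nat.factorial_one, Nat.cast_one, Nat.factorial_two,
    Nat.cast_ofNat] at v1 v2
  have hpos : (0 : ℝ) < n * (n - 1) := by nlinarith
  calc _ ≤ 2 / ((n : ℝ) * (n - 1)) * (∫ z, q (z 0) (z 1) ^ 2 ∂(Measure.pi fun _ : Fin 2 => μ)) +
        2 ^ 2 * (1 / (n : ℝ) * ∫ x, (h x - g x) ^ 2 ∂μ) := by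
        refine add_le_add (v2.trans ?_) (mul_le_mul_of_nonneg_left (v1.trans ?_) (by norm_num))
        · exact mul_le_mul_of_nonneg_left ht2 (by positivity)
        · exact mul_le_mul_of_nonneg_left hr2 (by positivity)
    _ = _ := by ring

end Hoeffding

end GaussianCopula

end

/-! ### Hoeffding decomposition in order three -/

noncomputable section

namespace GaussianCopula

section Hoeffding

variable {α : Type*} [MeasurableSpace α] {μ : Measure α} [IsProbabilityMeasure μ] {n : ℕ}

theorem integral_sum_mul_sum_eq_zero {β ι κ : Type*} [MeasurableSpace β] {ν : Measure β}
    [IsProbabilityMeasure ν] [Fintype ι] [Fintype κ] {f : ι → β → ℝ} {g : κ → β → ℝ}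
    (mf : ∀ i, Measurable (f i)) (mg : ∀ i, Measurable (g i)) {C D : ℝ} (hf : ∀ i x, |f i x| ≤ C)
    (hg : ∀ i x, |g i x| ≤ D) (h : ∀ i j, ∫ x, f i x * g j x ∂ν = 0) :
    ∫ x, (∑ i, f i x) * (∑ j, g j x) ∂ν = 0 := by
  have hI : ∀ i j, Integrable (fun x => f i x * g j x) ν := fun i j =>
    integrable_of_bounded ((mf i).mul (mg j)) fun x => abs_mul_le_of_abs_le (hf i x) (hg j x)
  simp_rw [Finset.sum_mul_sum]
  rw [integral_finsetSum _ fun i _ => integrable_finsetSum _ fun j _ => hI i j]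
  refine Finset.sum_eq_zero fun i _ => ?_
  rw [integral_finsetSum _ fun j _ => hI i j]
  exact Finset.sum_eq_zero fun j _ => h i j

/-- The inclusion of `Fin 1` in `Fin 3` with value `a`. -/
def pointEmb (a : Fin 3) : Fin 1 ↪ Fin 3 := ⟨fun _ => a, fun _ _ _ => Subsingleton.elim _ _⟩

/-- The inclusion of `Fin 2` in `Fin 3` that omits `a`. -/
def omitEmb (a : Fin 3) : Fin 2 ↪ Fin 3 := ⟨a.succAbove, Fin.succAbove_right_injective⟩

/-- Bessel's inequality for the components of order two and three of a kernel of order three. -/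
theorem integral_sq_add_integral_sq_le {t : α → α → ℝ} {T : α → α → α → ℝ} {h : α → ℝ}
    (mt : Measurable fun z : Fin 2 → α => t (z 0) (z 1))
    (mT : Measurable fun z : Fin 3 → α => T (z 0) (z 1) (z 2)) (mh : Measurable h) {C : ℝ}
    (ht : ∀ x y, |t x y| ≤ C) (hT : ∀ x y z, |T x y z| ≤ C) (hh : ∀ x, |h x| ≤ C)
    (dt : Degenerate μ fun z : Fin 2 → α => t (z 0) (z 1))
    (dT : Degenerate μ fun z : Fin 3 → α => T (z 0) (z 1) (z 2)) :
    3 * (∫ z, t (z 0) (z 1) ^ 2 ∂(Measure.pi fun _ : Fin 2 => μ)) +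
        ∫ z, T (z 0) (z 1) (z 2) ^ 2 ∂(Measure.pi fun _ : Fin 3 => μ) ≤
      ∫ z, (T (z 0) (z 1) (z 2) + (∑ a : Fin 3, t (z (omitEmb a 0)) (z (omitEmb a 1)) +
        ∑ a : Fin 3, h (z a))) ^ 2 ∂(Measure.pi fun _ : Fin 3 => μ) := by
  set π := Measure.pi fun _ : Fin 3 => μ with hπ
  set tt : Fin 3 → (Fin 3 → α) → ℝ := fun a z => t (z (omitEmb a 0)) (z (omitEmb a 1)) with htt
  set hs : Fin 3 → (Fin 3 → α) → ℝ := fun a z => h (z a) with hhs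
  set TT : (Fin 3 → α) → ℝ := fun z => T (z 0) (z 1) (z 2) with hTT
  have mh1 : Measurable fun z : Fin 1 → α => h (z 0) := mh.comp (measurable_pi_apply 0)
  have mtt : ∀ a, Measurable (tt a) := fun a => mt.comp (measurable_comp_embedding (omitEmb a))
  have mhs : ∀ a, Measurable (hs a) := fun a => mh.comp (measurable_pi_apply a)
  have htb : ∀ a z, |tt a z| ≤ C := fun a z => ht _ _
  have hhb : ∀ a z, |hs a z| ≤ C := fun a z => hh _
  have hTb : ∀ z, |TT z| ≤ C := fun z => hT _ _ _
  -- orthogonality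
  have o1 : ∀ a, ∫ z, TT z * tt a z ∂π = 0 := fun a => by
    obtain ⟨b, hb⟩ := exists_notMem_range (by norm_num : 2 < 3) (Function.Embedding.refl (Fin 3))
      (omitEmb a)
    exact dT.integral_mul_eq_zero mT mt (fun z => hT _ _ _) (fun z => ht _ _) _ _ hb
  have o2 : ∀ a, ∫ z, TT z * hs a z ∂π = 0 := fun a => by
    obtain ⟨b, hb⟩ := exists_notMem_range (by norm_num : 1 < 3) (Function.Embedding.refl (Fin 3))
      (pointEmb a)
    exact dT.integral_mul_eq_zero mT mh1 (fun z => hT _ _ _) (fun z => hh _) _ _ hb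
  have o3 : ∀ a b, ∫ z, tt a z * hs b z ∂π = 0 := fun a b => by
    obtain ⟨c, hc⟩ := exists_notMem_range (by norm_num : 1 < 2) (omitEmb a) (pointEmb b)
    exact dt.integral_mul_eq_zero mt mh1 (fun z => ht _ _) (fun z => hh _) _ _ hc
  have o4 : ∀ a b, a < b → ∫ z, tt a z * tt b z ∂π = 0 := fun a b hab => by
    obtain ⟨c, hc⟩ := Fin.exists_succAbove_eq hab.ne'
    refine dt.integral_mul_eq_zero mt mt (fun z => ht _ _) (fun z => ht _ _) (omitEmb a)
      (omitEmb b) (a := c) ?_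
    change a.succAbove c ∉ Set.range b.succAbove
    rw [hc]
    rintro ⟨i, hi⟩
    exact Fin.succAbove_ne b i hi
  have mst : Measurable fun z => ∑ a, tt a z := Finset.measurable_sum _ fun a _ => mtt a
  have msh : Measurable fun z => ∑ a, hs a z := Finset.measurable_sum _ fun a _ => mhs a
  have bst : ∀ z, |∑ a, tt a z| ≤ 3 * C := fun z =>
    (Finset.abs_sum_le_sum_abs _ _).trans ((Finset.sum_le_sum fun a _ => htb a z).trans (by simp))
  have bsh : ∀ z, |∑ a, hs a z| ≤ 3 * C := fun z =>
    (Finset.abs_sum_le_sum_abs _ _).trans ((Finset.sum_le_sum fun a _ => hhb a z).trans (by simp))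
  have O1 : ∫ z, TT z * ∑ a, tt a z ∂π = 0 := by
    have := integral_sum_mul_sum_eq_zero (ν := π) (f := fun _ : Unit => TT) (g := tt)
      (fun _ => mT) mtt (fun _ => hTb) htb fun _ => o1
    simpa using this
  have O2 : ∫ z, TT z * ∑ a, hs a z ∂π = 0 := by
    have := integral_sum_mul_sum_eq_zero (ν := π) (f := fun _ : Unit => TT) (g := hs)
      (fun _ => mT) mhs (fun _ => hTb) hhb fun _ => o2
    simpa using this
  have O3 : ∫ z, (∑ a, tt a z) * ∑ a, hs a z ∂π = 0 :=
    integral_sum_mul_sum_eq_zero mtt mhs htb hhb o3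
  have O12 : ∫ z, TT z * (∑ a, tt a z + ∑ a, hs a z) ∂π = 0 := by
    have J1 : Integrable (fun z => TT z * ∑ a, tt a z) π :=
      integrable_of_bounded (mT.mul mst) fun z => abs_mul_le_of_abs_le (hTb z) (bst z)
    have J2 : Integrable (fun z => TT z * ∑ a, hs a z) π :=
      integrable_of_bounded (mT.mul msh) fun z => abs_mul_le_of_abs_le (hTb z) (bsh z)
    simp_rw [mul_add]
    rw [integral_add J1 J2, O1, O2, add_zero]
  have e1 := integral_add_sq_of_orthogonal (ν := π) mT (mst.add msh) hTb
    (fun z => (abs_add_le _ _).trans (add_le_add (bst z) (bsh z))) O12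
  have e2 := integral_add_sq_of_orthogonal (ν := π) mst msh bst bsh O3
  have e3 := integral_sum_sq_of_orthogonal (ν := π) mtt (C := fun _ => C) htb o4
  have e4 : ∀ a, ∫ z, tt a z ^ 2 ∂π =
      ∫ z, t (z 0) (z 1) ^ 2 ∂(Measure.pi fun _ : Fin 2 => μ) := fun a =>
    integral_comp_embedding (omitEmb a) (mt.pow_const 2)
  simp only [Pi.add_apply] at e1
  rw [e1, e2, e3]
  simp_rw [e4]
  have : 0 ≤ ∫ z, (∑ a, hs a z) ^ 2 ∂π := integral_nonneg fun z => sq_nonneg _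
  simp only [Finset.sum_const, Finset.card_univ, Fintype.card_fin, nsmul_eq_mul, Nat.cast_ofNat]
  linarith

/-- The variance of a combination of degenerate U-statistics of orders three, two and one. -/
theorem integral_uStat_add_sq_le (hn : 3 ≤ n) {t : α → α → ℝ} {T : α → α → α → ℝ} {r : α → ℝ}
    (mt : Measurable fun z : Fin 2 → α => t (z 0) (z 1))
    (mT : Measurable fun z : Fin 3 → α => T (z 0) (z 1) (z 2)) (mr : Measurable r) {C : ℝ}
    (ht : ∀ x y, |t x y| ≤ C) (hT : ∀ x y z, |T x y z| ≤ C) (hr : ∀ x, |r x| ≤ C)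
    (dt : Degenerate μ fun z : Fin 2 → α => t (z 0) (z 1))
    (dT : Degenerate μ fun z : Fin 3 → α => T (z 0) (z 1) (z 2)) (dr : ∫ x, r x ∂μ = 0) :
    ∫ x : Fin n → α, (uStat (fun z : Fin 3 → α => T (z 0) (z 1) (z 2)) x +
        (3 * uStat (fun z : Fin 2 → α => t (z 0) (z 1)) x +
          3 * uStat (fun z : Fin 1 → α => r (z 0)) x)) ^ 2 ∂(Measure.pi fun _ : Fin n => μ) ≤
      9 / n * (∫ x, r x ^ 2 ∂μ) + 6 / (n * (n - 1)) *
        (3 * (∫ z, t (z 0) (z 1) ^ 2 ∂(Measure.pi fun _ : Fin 2 => μ)) +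
          ∫ z, T (z 0) (z 1) (z 2) ^ 2 ∂(Measure.pi fun _ : Fin 3 => μ)) := by
  set π := Measure.pi fun _ : Fin n => μ with hπ
  have mr1 : Measurable fun z : Fin 1 → α => r (z 0) := mr.comp (measurable_pi_apply 0)
  have d1 := degenerate_one dr
  set U1 : (Fin n → α) → ℝ := uStat fun z : Fin 1 → α => r (z 0) with hU1
  set U2 : (Fin n → α) → ℝ := uStat fun z : Fin 2 → α => t (z 0) (z 1) with hU2
  set U3 : (Fin n → α) → ℝ := uStat fun z : Fin 3 → α => T (z 0) (z 1) (z 2) with hU3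
  have m1 : Measurable U1 := measurable_uStat mr1
  have m2 : Measurable U2 := measurable_uStat mt
  have m3 : Measurable U3 := measurable_uStat mT
  have b1 : ∀ x, |U1 x| ≤ C := abs_uStat_le (by omega) fun z => hr _
  have b2 : ∀ x, |U2 x| ≤ C := abs_uStat_le (by omega) fun z => ht _ _
  have b3 : ∀ x, |U3 x| ≤ C := abs_uStat_le hn fun z => hT _ _ _
  have o12 : ∫ x, U2 x * U1 x ∂π = 0 := dt.integral_uStat_mul_uStat (by norm_num) mt mr1
    (fun z => ht _ _) (fun z => hr _)
  have o13 : ∫ x, U3 x * U1 x ∂π = 0 := dT.integral_uStat_mul_uStat (by norm_num) mT mr1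
    (fun z => hT _ _ _) (fun z => hr _)
  have o23 : ∫ x, U3 x * U2 x ∂π = 0 := dT.integral_uStat_mul_uStat (by norm_num) mT mt
    (fun z => hT _ _ _) (fun z => ht _ _)
  have v1 := d1.integral_uStat_sq_le (n := n) (by omega) mr1 (fun z => hr _)
  have v2 := dt.integral_uStat_sq_le (n := n) (by omega) mt (fun z => ht _ _)
  have v3 := dT.integral_uStat_sq_le (n := n) hn mT (fun z => hT _ _ _)
  rw [integral_pi_one (f := fun x => r x ^ 2) (mr.pow_const 2)] at v1
  have bb : ∀ {f : (Fin n → α) → ℝ}, (∀ x, |f x| ≤ C) → ∀ x, |3 * f x| ≤ 3 * C := fun hf x => by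
    rw [abs_mul, abs_of_pos (by norm_num : (0 : ℝ) < 3)]
    exact mul_le_mul_of_nonneg_left (hf x) (by norm_num)
  have I : ∀ {f g : (Fin n → α) → ℝ}, Measurable f → Measurable g → (∀ x, |f x| ≤ C) →
      (∀ x, |g x| ≤ C) → Integrable (fun x => f x * g x) π := fun mf mg hf hg =>
    integrable_of_bounded (mf.mul mg) fun x => abs_mul_le_of_abs_le (hf x) (hg x)
  have O : ∫ x, U3 x * (3 * U2 x + 3 * U1 x) ∂π = 0 := by
    have e : ∀ x, U3 x * (3 * U2 x + 3 * U1 x) = 3 * (U3 x * U2 x) + 3 * (U3 x * U1 x) :=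
      fun x => by ring
    simp_rw [e]
    rw [integral_add ((I m3 m2 b3 b2).const_mul 3) ((I m3 m1 b3 b1).const_mul 3),
      integral_const_mul, integral_const_mul, o23, o13]
    norm_num
  have O' : ∫ x, (3 * U2 x) * (3 * U1 x) ∂π = 0 := by
    have e : ∀ x, (3 * U2 x) * (3 * U1 x) = 9 * (U2 x * U1 x) := fun x => by ring
    simp_rw [e]
    rw [integral_const_mul, o12, mul_zero]
  have e1 := integral_add_sq_of_orthogonal (ν := π) m3 ((m2.const_mul 3).add (m1.const_mul 3)) b3
    (fun x => (abs_add_le _ _).trans (add_le_add (bb b2 x) (bb b1 x))) O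
  simp only [Pi.add_apply] at e1
  rw [e1, integral_add_sq_of_orthogonal (ν := π) (m2.const_mul 3) (m1.const_mul 3) (bb b2) (bb b1)
    O']
  simp_rw [mul_pow, integral_const_mul]
  have hnR : (3 : ℝ) ≤ n := by exact_mod_cast hn
  have hd2 : ((n.descFactorial 2 : ℕ) : ℝ) = n * (n - 1) := by
    rw [Nat.descFactorial_succ, Nat.descFactorial_one, Nat.cast_mul, Nat.cast_sub (by omega)]
    push_cast; ring
  have hd3 : ((n.descFactorial 3 : ℕ) : ℝ) = n * (n - 1) * (n - 2) := by
    rw [Nat.descFactorial_succ, Nat.cast_mul, hd2, Nat.cast_sub (by omega)]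
    push_cast; ring
  have hf3 : ((Nat.factorial 3 : ℕ) : ℝ) = 6 := by norm_num [Nat.factorial]
  rw [hd2] at v2
  rw [hd3, hf3] at v3
  simp only [Nat.descFactorial_one, Nat.factorial_one, Nat.cast_one, Nat.factorial_two,
    Nat.cast_ofNat] at v1 v2
  have hpos : (0 : ℝ) < n * (n - 1) := by nlinarith
  have hT0 : 0 ≤ ∫ z, T (z 0) (z 1) (z 2) ^ 2 ∂(Measure.pi fun _ : Fin 3 => μ) :=
    integral_nonneg fun z => sq_nonneg _
  have hle : 6 / ((n : ℝ) * (n - 1) * (n - 2)) ≤ 6 / (n * (n - 1)) := by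
    refine div_le_div_of_nonneg_left (by norm_num) hpos ?_
    nlinarith
  calc _ ≤ 6 / (n * (n - 1)) * (∫ z, T (z 0) (z 1) (z 2) ^ 2 ∂(Measure.pi fun _ : Fin 3 => μ)) +
        (3 ^ 2 * (2 / (n * (n - 1)) * ∫ z, t (z 0) (z 1) ^ 2 ∂(Measure.pi fun _ : Fin 2 => μ)) +
          3 ^ 2 * (1 / n * ∫ x, r x ^ 2 ∂μ)) := by
        refine add_le_add (v3.trans (mul_le_mul_of_nonneg_right hle hT0)) (add_le_add ?_ ?_)
        · exact mul_le_mul_of_nonneg_left v2 (by norm_num)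
        · exact mul_le_mul_of_nonneg_left v1 (by norm_num)
    _ = _ := by ring

/-- The variance of a U-statistic of order three after subtraction of an approximation `g` of its
first projection. -/
theorem integral_uStat_three_sub_sq_le (hn : 3 ≤ n) {q : α → α → α → ℝ}
    (mq : Measurable fun p : α × α × α => q p.1 p.2.1 p.2.2) {C : ℝ} (hq : ∀ x y z, |q x y z| ≤ C)
    (hs1 : ∀ x y z, q y x z = q x y z) (hs2 : ∀ x y z, q x z y = q x y z) {g : α → ℝ}
    (mg : Measurable g) {D : ℝ} (hg : ∀ x, |g x| ≤ D) :
    ∫ x : Fin n → α, (uStat (fun z : Fin 3 → α => q (z 0) (z 1) (z 2)) x -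
        (∫ x, ∫ y, ∫ z, q x y z ∂μ ∂μ ∂μ) -
        3 * ((∑ i, (g (x i) - ∫ y, g y ∂μ)) / n)) ^ 2 ∂(Measure.pi fun _ : Fin n => μ) ≤
      9 / n * (∫ x, ((∫ y, ∫ z, q x y z ∂μ ∂μ) - g x) ^ 2 ∂μ) +
        6 / (n * (n - 1)) *
          ∫ z, q (z 0) (z 1) (z 2) ^ 2 ∂(Measure.pi fun _ : Fin 3 => μ) := by
  set m : α → α → ℝ := fun x y => ∫ z, q x y z ∂μ with hm
  set h : α → ℝ := fun x => ∫ y, m x y ∂μ with hh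
  set θ := ∫ x, h x ∂μ with hθ
  have mm : Measurable fun p : α × α => m p.1 p.2 :=
    measurable_integral_right (f := fun (p : α × α) z => q p.1 p.2 z)
      (mq.comp (f := fun p : (α × α) × α => (p.1.1, p.1.2, p.2)) (by fun_prop))
  have mh : Measurable h := measurable_integral_right mm
  have hmC : ∀ x y, |m x y| ≤ C := fun x y => abs_integral_le_of_abs_le (hq x y)
  have hhC : ∀ x, |h x| ≤ C := fun x => abs_integral_le_of_abs_le (hmC x)
  have hθC : |θ| ≤ C := abs_integral_le_of_abs_le hhC
  have mqx : ∀ x y, Measurable fun z => q x y z := fun x y =>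
    mq.comp (f := fun z => (x, y, z)) (by fun_prop)
  have mmx : ∀ x, Measurable fun y => m x y := fun x => mm.comp (f := fun y => (x, y)) (by fun_prop)
  have Iq : ∀ x y, Integrable (fun z => q x y z) μ := fun x y =>
    integrable_of_bounded (mqx x y) (hq x y)
  have Im : ∀ x, Integrable (fun y => m x y) μ := fun x => integrable_of_bounded (mmx x) (hmC x)
  have Ih : Integrable h μ := integrable_of_bounded mh hhC
  have Ig : Integrable g μ := integrable_of_bounded mg hg
  set gm := ∫ y, g y ∂μ with hgm
  have hgmD : |gm| ≤ D := abs_integral_le_of_abs_le hg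
  have hqx : ∀ x y, ∫ z, q x y z ∂μ = m x y := fun x y => rfl
  have hmx : ∀ x, ∫ y, m x y ∂μ = h x := fun x => rfl
  have hmsymm : ∀ x y, m y x = m x y := fun x y => by simp only [hm, hs1 x y]
  -- the degenerate components
  set r : α → ℝ := fun x => h x - g x - (θ - gm) with hr
  set t : α → α → ℝ := fun x y => m x y - h x - h y + θ with ht
  set T : α → α → α → ℝ := fun x y z =>
    q x y z - m x y - m x z - m y z + h x + h y + h z - θ with hT
  have mr : Measurable r := (mh.sub mg).sub_const _
  have ez : ∀ a : Fin 3, Measurable fun z : Fin 3 → α => z a := fun a => measurable_pi_apply a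
  have mt : Measurable fun z : Fin 2 → α => t (z 0) (z 1) := by
    have h1 := mm.comp (f := fun z : Fin 2 → α => (z 0, z 1)) (by fun_prop)
    have h2 := mh.comp (measurable_pi_apply (X := fun _ : Fin 2 => α) 0)
    have h3 := mh.comp (measurable_pi_apply (X := fun _ : Fin 2 => α) 1)
    exact ((h1.sub h2).sub h3).add_const _
  have mq3 : Measurable fun z : Fin 3 → α => q (z 0) (z 1) (z 2) :=
    mq.comp (f := fun z : Fin 3 → α => (z 0, z 1, z 2)) (by fun_prop)
  have mT : Measurable fun z : Fin 3 → α => T (z 0) (z 1) (z 2) := by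
    have m01 := mm.comp (f := fun z : Fin 3 → α => (z 0, z 1)) (by fun_prop)
    have m02 := mm.comp (f := fun z : Fin 3 → α => (z 0, z 2)) (by fun_prop)
    have m12 := mm.comp (f := fun z : Fin 3 → α => (z 1, z 2)) (by fun_prop)
    exact ((((((mq3.sub m01).sub m02).sub m12).add (mh.comp (ez 0))).add
      (mh.comp (ez 1))).add (mh.comp (ez 2))).sub_const _
  have tri : ∀ {a b A B : ℝ}, |a| ≤ A → |b| ≤ B → |a + b| ≤ A + B := fun ha hb =>
    (abs_add_le _ _).trans (add_le_add ha hb)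
  have tri' : ∀ {a b A B : ℝ}, |a| ≤ A → |b| ≤ B → |a - b| ≤ A + B := fun ha hb =>
    (abs_sub _ _).trans (add_le_add ha hb)
  have hC0 : 0 ≤ C := (abs_nonneg _).trans hθC
  have hD0 : 0 ≤ D := (abs_nonneg _).trans hgmD
  have hrb : ∀ x, |r x| ≤ 8 * C + 2 * D := fun x =>
    (tri' (tri' (hhC x) (hg x)) (tri' hθC hgmD)).trans (by linarith)
  have htb : ∀ x y, |t x y| ≤ 8 * C + 2 * D := fun x y =>
    (tri (tri' (tri' (hmC x y) (hhC x)) (hhC y)) hθC).trans (by linarith)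
  have hTb : ∀ x y z, |T x y z| ≤ 8 * C + 2 * D := fun x y z =>
    (tri' (tri (tri (tri (tri' (tri' (tri' (hq x y z) (hmC x y)) (hmC x z)) (hmC y z)) (hhC x))
      (hhC y)) (hhC z)) hθC).trans (by linarith)
  have hr0 : ∫ x, r x ∂μ = 0 := by
    simp only [hr]
    rw [integral_sub (by fun_prop) (by fun_prop), integral_sub Ih Ig, ← hθ, ← hgm]
    simp
  have ht0 : ∀ x, ∫ y, t x y ∂μ = 0 := by
    intro x
    simp only [ht]
    have := Im x
    rw [integral_add (by fun_prop) (by fun_prop), integral_sub (by fun_prop) (by fun_prop),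
      integral_sub (by fun_prop) (by fun_prop), hmx, ← hθ]
    simp
  have hT0 : ∀ x y, ∫ z, T x y z ∂μ = 0 := by
    intro x y
    simp only [hT]
    have i1 := Iq x y
    have i2 := Im x
    have i3 := Im y
    rw [integral_sub (by fun_prop) (by fun_prop), integral_add (by fun_prop) (by fun_prop),
      integral_add (by fun_prop) (by fun_prop), integral_add (by fun_prop) (by fun_prop),
      integral_sub (by fun_prop) (by fun_prop), integral_sub (by fun_prop) (by fun_prop),
      integral_sub (by fun_prop) (by fun_prop), hqx, hmx, hmx, ← hθ]
    simp
    ring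
  have htsymm : ∀ x y, t y x = t x y := fun x y => by simp only [ht]; rw [hmsymm]; ring
  have hTs1 : ∀ x y z, T x z y = T x y z := fun x y z => by
    simp only [hT]; rw [hs2, hmsymm y z]; ring
  have hTs2 : ∀ x y z, T z y x = T x y z := fun x y z => by
    simp only [hT]; rw [hs1 y z x, hs2 y x z, hs1 x y z, hmsymm y z, hmsymm x z, hmsymm x y]; ring
  have dt : Degenerate μ fun z : Fin 2 → α => t (z 0) (z 1) := by
    intro z a
    fin_cases a
    · simp only [Fin.zero_eta, Function.update_self, ne_eq, one_ne_zero, not_false_eq_true,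
        Function.update_of_ne]
      simp_rw [htsymm (z 1)]
      exact ht0 (z 1)
    · simpa using ht0 (z 0)
  have dT : Degenerate μ fun z : Fin 3 → α => T (z 0) (z 1) (z 2) := by
    have u : ∀ (z : Fin 3 → α) (a : Fin 3) (y : α), Function.update z a y a = y := fun z a y =>
      Function.update_self _ _ _
    have u' : ∀ (z : Fin 3 → α) (a b : Fin 3) (y : α), b ≠ a → Function.update z a y b = z b :=
      fun z a b y hb => Function.update_of_ne hb _ _
    intro z a
    fin_cases a
    · refine Eq.trans (integral_congr_ae (Filter.Eventually.of_forall fun y => ?_))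
        (hT0 (z 2) (z 1))
      show T (Function.update z 0 y 0) (Function.update z 0 y 1) (Function.update z 0 y 2) = _
      rw [u, u' z 0 1 y (by decide), u' z 0 2 y (by decide), hTs2]
    · refine Eq.trans (integral_congr_ae (Filter.Eventually.of_forall fun y => ?_))
        (hT0 (z 0) (z 2))
      show T (Function.update z 1 y 0) (Function.update z 1 y 1) (Function.update z 1 y 2) = _
      rw [u, u' z 1 0 y (by decide), u' z 1 2 y (by decide), hTs1]
    · refine Eq.trans (integral_congr_ae (Filter.Eventually.of_forall fun y => ?_))
        (hT0 (z 0) (z 1))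
      show T (Function.update z 2 y 0) (Function.update z 2 y 1) (Function.update z 2 y 2) = _
      rw [u, u' z 2 0 y (by decide), u' z 2 1 y (by decide)]
  -- the decomposition
  have hdec : ∀ x : Fin n → α, uStat (fun z : Fin 3 → α => q (z 0) (z 1) (z 2)) x - θ -
      3 * ((∑ i, (g (x i) - gm)) / n) =
        uStat (fun z : Fin 3 → α => T (z 0) (z 1) (z 2)) x +
        (3 * uStat (fun z : Fin 2 → α => t (z 0) (z 1)) x +
          3 * uStat (fun z : Fin 1 → α => r (z 0)) x) := by
    intro x
    have e0 : (fun z : Fin 3 → α => q (z 0) (z 1) (z 2)) = fun z : Fin 3 → α =>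
        T (z 0) (z 1) (z 2) + ((∑ a : Fin 3, t (z (omitEmb a 0)) (z (omitEmb a 1))) +
          ((∑ a : Fin 3, (r (z a) + (g (z a) - gm))) + θ)) := by
      ext z
      rw [Fin.sum_univ_three, Fin.sum_univ_three]
      change _ = T (z 0) (z 1) (z 2) + ((t (z 1) (z 2) + t (z 0) (z 2) + t (z 0) (z 1)) + _)
      simp only [hT, ht, hr]
      ring
    have e1 : ∀ a : Fin 3, uStat (fun z : Fin 3 → α => r (z a) + (g (z a) - gm)) x =
        uStat (fun z : Fin 1 → α => r (z 0)) x + (∑ i, (g (x i) - gm)) / n := by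
      intro a
      refine (uStat_comp hn (by norm_num) (pointEmb a)
        (fun z => r (z 0) + (g (z 0) - gm)) x).trans ?_
      rw [uStat_add (fun z : Fin 1 → α => r (z 0)) (fun z => g (z 0) - gm)]
      congr 1
      rw [uStat_one]
    have e2 : ∀ a : Fin 3, uStat (fun z : Fin 3 → α => t (z (omitEmb a 0)) (z (omitEmb a 1))) x =
        uStat (fun z : Fin 2 → α => t (z 0) (z 1)) x := fun a =>
      uStat_comp hn (by norm_num) (omitEmb a) (fun z => t (z 0) (z 1)) x
    rw [e0, uStat_add, uStat_add (fun z : Fin 3 → α =>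
        ∑ a : Fin 3, t (z (omitEmb a 0)) (z (omitEmb a 1))),
      uStat_add (fun z : Fin 3 → α => ∑ a : Fin 3, (r (z a) + (g (z a) - gm))), uStat_sum,
      uStat_sum, uStat_const hn]
    simp_rw [e1, e2]
    simp only [Finset.sum_const, Finset.card_univ, Fintype.card_fin, nsmul_eq_mul,
      Nat.cast_ofNat]
    ring
  simp_rw [hdec]
  refine (integral_uStat_add_sq_le hn mt mT mr htb hTb hrb dt dT hr0).trans ?_
  have hr2 : ∫ x, r x ^ 2 ∂μ ≤ ∫ x, (h x - g x) ^ 2 ∂μ := by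
    have := integral_sub_integral_sq_le (μ := μ) (mh.sub mg) (C := C + D)
      (fun x => (abs_sub _ _).trans (add_le_add (hhC x) (hg x)))
    simp only [Pi.sub_apply] at this
    rwa [integral_sub Ih Ig] at this
  have hB := integral_sq_add_integral_sq_le (h := fun x => h x - 2 / 3 * θ) mt mT
    (mh.sub_const _) (C := 8 * C + 2 * D) htb hTb
    (fun x => (tri' (hhC x) (abs_mul _ _).le).trans (by
      rw [abs_of_pos (by norm_num : (0 : ℝ) < 2 / 3)]; linarith)) dt dT
  have hBe : ∀ z : Fin 3 → α, T (z 0) (z 1) (z 2) +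
      (∑ a : Fin 3, t (z (omitEmb a 0)) (z (omitEmb a 1)) + ∑ a : Fin 3, (h (z a) - 2 / 3 * θ)) =
        q (z 0) (z 1) (z 2) := by
    intro z
    rw [Fin.sum_univ_three, Fin.sum_univ_three]
    change T (z 0) (z 1) (z 2) + ((t (z 1) (z 2) + t (z 0) (z 2) + t (z 0) (z 1)) + _) = _
    simp only [hT, ht]
    ring
  simp_rw [hBe] at hB
  have hnR : (3 : ℝ) ≤ n := by exact_mod_cast hn
  have hpos : (0 : ℝ) < n * (n - 1) := by nlinarith
  exact add_le_add (mul_le_mul_of_nonneg_left hr2 (by positivity))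
    (mul_le_mul_of_nonneg_left hB (by positivity))

end Hoeffding

end GaussianCopula

end

/-! ### Rank correlations as U-statistics -/

noncomputable section

namespace GaussianCopula

variable {n d : ℕ}

/-- The kernel of Kendall's tau. -/
def tauKernel (j k : Fin d) (x y : Fin d → ℝ) : ℝ :=
  Real.sign (x j - y j) * Real.sign (x k - y k)

/-- The kernel of Spearman's rho, not symmetrised. -/
def rhoTriple (j k : Fin d) (x y z : Fin d → ℝ) : ℝ :=
  Real.sign (x j - y j) * Real.sign (x k - z k)

/-- The symmetrised kernel of Spearman's rho: three times the mean of `rhoTriple` over the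
permutations of the arguments. -/
def rhoKernel (j k : Fin d) (x y z : Fin d → ℝ) : ℝ :=
  (rhoTriple j k x y z + rhoTriple j k x z y + rhoTriple j k y x z + rhoTriple j k y z x +
    rhoTriple j k z x y + rhoTriple j k z y x) / 2

theorem sign_sub_comm (a b : ℝ) : Real.sign (b - a) = -Real.sign (a - b) := by
  rw [← Real.sign_neg, neg_sub]

theorem tauKernel_symm (j k : Fin d) (x y : Fin d → ℝ) : tauKernel j k y x = tauKernel j k x y := by
  unfold tauKernel
  rw [sign_sub_comm (x j), sign_sub_comm (x k)]; ring

theorem rhoKernel_symm_left (j k : Fin d) (x y z : Fin d → ℝ) :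
    rhoKernel j k y x z = rhoKernel j k x y z := by
  unfold rhoKernel; ring

theorem rhoKernel_symm_right (j k : Fin d) (x y z : Fin d → ℝ) :
    rhoKernel j k x z y = rhoKernel j k x y z := by
  unfold rhoKernel; ring

theorem rhoTriple_diag (j k : Fin d) (x y : Fin d → ℝ) : rhoTriple j k x y y = tauKernel j k x y :=
  rfl

theorem abs_tauKernel_le (j k : Fin d) (x y : Fin d → ℝ) : |tauKernel j k x y| ≤ 1 :=
  abs_sign_mul_sign_le_one _ _

theorem abs_rhoTriple_le (j k : Fin d) (x y z : Fin d → ℝ) : |rhoTriple j k x y z| ≤ 1 :=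
  abs_sign_mul_sign_le_one _ _

theorem abs_rhoKernel_le (j k : Fin d) (x y z : Fin d → ℝ) : |rhoKernel j k x y z| ≤ 3 := by
  have h : ∀ x y z, -1 ≤ rhoTriple j k x y z ∧ rhoTriple j k x y z ≤ 1 := fun x y z =>
    abs_le.1 (abs_rhoTriple_le j k x y z)
  unfold rhoKernel
  rw [abs_le]
  constructor <;>
    linarith [(h x y z).1, (h x z y).1, (h y x z).1, (h y z x).1, (h z x y).1, (h z y x).1,
      (h x y z).2, (h x z y).2, (h y x z).2, (h y z x).2, (h z x y).2, (h z y x).2]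

theorem measurable_tauKernel (j k : Fin d) :
    Measurable fun p : (Fin d → ℝ) × (Fin d → ℝ) => tauKernel j k p.1 p.2 :=
  measurable_sign_mul_sign (by fun_prop) (by fun_prop)

theorem measurable_rhoTriple {α : Type*} [MeasurableSpace α] (j k : Fin d)
    {f g h : α → Fin d → ℝ} (hf : Measurable f) (hg : Measurable g) (hh : Measurable h) :
    Measurable fun p => rhoTriple j k (f p) (g p) (h p) :=
  measurable_sign_mul_sign (by fun_prop) (by fun_prop)

theorem measurable_rhoKernel (j k : Fin d) :
    Measurable fun p : (Fin d → ℝ) × (Fin d → ℝ) × (Fin d → ℝ) =>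
      rhoKernel j k p.1 p.2.1 p.2.2 := by
  unfold rhoKernel
  have h1 : Measurable fun p : (Fin d → ℝ) × (Fin d → ℝ) × (Fin d → ℝ) => p.1 := measurable_fst
  have h2 : Measurable fun p : (Fin d → ℝ) × (Fin d → ℝ) × (Fin d → ℝ) => p.2.1 := by fun_prop
  have h3 : Measurable fun p : (Fin d → ℝ) × (Fin d → ℝ) × (Fin d → ℝ) => p.2.2 := by fun_prop
  exact ((((((measurable_rhoTriple j k h1 h2 h3).add (measurable_rhoTriple j k h1 h3 h2)).add
    (measurable_rhoTriple j k h2 h1 h3)).add (measurable_rhoTriple j k h2 h3 h1)).add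
    (measurable_rhoTriple j k h3 h1 h2)).add (measurable_rhoTriple j k h3 h2 h1)).div_const 2

/-- The signs of the differences of three distinct numbers: the middle one is not isolated. -/
theorem sign_three {x y z : ℝ} (hxy : x ≠ y) (hxz : x ≠ z) (hyz : y ≠ z) :
    (Real.sign (x - y) = 1 ∨ Real.sign (x - y) = -1) ∧
    (Real.sign (y - z) = 1 ∨ Real.sign (y - z) = -1) ∧
    (Real.sign (x - z) = Real.sign (x - y) ∨ Real.sign (x - z) = Real.sign (y - z)) := by
  rcases lt_or_gt_of_ne hxy with h1 | h1 <;> rcases lt_or_gt_of_ne hyz with h2 | h2 <;>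
    rcases lt_or_gt_of_ne hxz with h3 | h3 <;>
    first
    | (exfalso; linarith)
    | simp [Real.sign_of_neg, Real.sign_of_pos, h1, h2, h3]

theorem rhoKernel_eq_signs (j k : Fin d) (x y z : Fin d → ℝ) :
    rhoKernel j k x y z =
      (Real.sign (x j - y j) * Real.sign (x k - z k) + Real.sign (x j - z j) * Real.sign (x k - y k)
      - Real.sign (x j - y j) * Real.sign (y k - z k)
      - Real.sign (y j - z j) * Real.sign (x k - y k)
      + Real.sign (x j - z j) * Real.sign (y k - z k)
      + Real.sign (y j - z j) * Real.sign (x k - z k)) / 2 := by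
  unfold rhoKernel rhoTriple
  rw [sign_sub_comm (x j) (y j), sign_sub_comm (x k) (y k), sign_sub_comm (x j) (z j),
    sign_sub_comm (x k) (z k), sign_sub_comm (y j) (z j), sign_sub_comm (y k) (z k)]
  ring

theorem rhoKernel_sq_eq_one (j k : Fin d) {x y z : Fin d → ℝ} (hj1 : x j ≠ y j) (hj2 : x j ≠ z j)
    (hj3 : y j ≠ z j) (hk1 : x k ≠ y k) (hk2 : x k ≠ z k) (hk3 : y k ≠ z k) :
    rhoKernel j k x y z ^ 2 = 1 := by
  rw [rhoKernel_eq_signs]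
  obtain ⟨a1, a2, a3⟩ := sign_three hj1 hj2 hj3
  obtain ⟨b1, b2, b3⟩ := sign_three hk1 hk2 hk3
  rcases a3 with a3 | a3 <;> rcases b3 with b3 | b3 <;> rw [a3, b3] <;>
    rcases a1 with a1 | a1 <;> rcases a2 with a2 | a2 <;> rcases b1 with b1 | b1 <;>
    rcases b2 with b2 | b2 <;> rw [a1, a2, b1, b2] <;> norm_num

theorem rhoKernel_self (j : Fin d) {x y z : Fin d → ℝ} (hj1 : x j ≠ y j) (hj2 : x j ≠ z j)
    (hj3 : y j ≠ z j) : rhoKernel j j x y z = 1 := by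
  rw [rhoKernel_eq_signs]
  obtain ⟨a1, a2, a3⟩ := sign_three hj1 hj2 hj3
  rcases a3 with a3 | a3 <;> rw [a3] <;>
    rcases a1 with a1 | a1 <;> rcases a2 with a2 | a2 <;> rw [a1, a2] <;> norm_num

theorem tauKernel_self (j : Fin d) {x y : Fin d → ℝ} (h : x j ≠ y j) : tauKernel j j x y = 1 := by
  unfold tauKernel
  rcases Real.sign_apply_eq_of_ne_zero _ (sub_ne_zero.2 h) with h | h <;> rw [h] <;> norm_num

theorem sum_embedding_two (F : Fin n → Fin n → ℝ) (h : ∀ i, F i i = 0) :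
    ∑ e : Fin 2 ↪ Fin n, F (e 0) (e 1) = ∑ i, ∑ l, F i l := by
  classical
  rw [← Fintype.sum_prod_type' (f := F)]
  rw [← Finset.sum_filter_add_sum_filter_not Finset.univ (fun p : Fin n × Fin n => p.1 ≠ p.2),
    Finset.sum_eq_zero (s := Finset.univ.filter fun p : Fin n × Fin n => ¬ p.1 ≠ p.2), add_zero]
  · refine Finset.sum_nbij (fun e : Fin 2 ↪ Fin n => (e 0, e 1)) (fun e _ => ?_)
      (fun e _ e' _ hee => ?_) (fun p hp => ?_) (fun e _ => rfl)
    · simp only [Finset.mem_filter, Finset.mem_univ, true_and]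
      exact fun h => absurd (e.injective h) (by decide)
    · ext a
      simp only [Prod.mk.injEq] at hee
      fin_cases a
      · exact congrArg Fin.val hee.1
      · exact congrArg Fin.val hee.2
    · simp only [Finset.coe_filter, Finset.mem_univ, true_and, Set.mem_ofPred_eq] at hp
      have hinj : Function.Injective ![p.1, p.2] := by
        intro a b hab
        fin_cases a <;> fin_cases b <;> simp_all
      exact ⟨⟨![p.1, p.2], hinj⟩, by simp, by simp⟩
  · intro p hp
    simp only [ne_eq, not_not, Finset.mem_filter, Finset.mem_univ, true_and] at hp
    rw [hp]; exact h _

theorem sum_embedding_three (F : Fin n → Fin n → Fin n → ℝ) (h1 : ∀ i l, F i i l = 0)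
    (h2 : ∀ i l, F i l i = 0) :
    ∑ i, ∑ l, ∑ m, F i l m = ∑ e : Fin 3 ↪ Fin n, F (e 0) (e 1) (e 2) + ∑ i, ∑ l, F i l l := by
  classical
  have e1 : ∀ i l m, F i l m =
      (if i ≠ l ∧ i ≠ m ∧ l ≠ m then F i l m else 0) + if m = l then F i l l else 0 := by
    intro i l m
    by_cases hil : i = l
    · subst hil; simp [h1]
    by_cases him : i = m
    · subst him
      simp only [h2, ne_eq, not_true_eq_false, false_and, and_false, ite_self, zero_add]
      rw [if_neg hil]
    by_cases hlm : l = m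
    · subst hlm; simp
    · rw [if_pos ⟨hil, him, hlm⟩, if_neg (Ne.symm hlm), add_zero]
  conv_lhs => enter [2, i, 2, l, 2, m]; rw [e1]
  simp only [Finset.sum_add_distrib, Finset.sum_ite_eq', Finset.mem_univ, if_true]
  congr 1
  have e2 : ∑ i, ∑ l, ∑ m, (if i ≠ l ∧ i ≠ m ∧ l ≠ m then F i l m else 0) =
      ∑ p : Fin n × Fin n × Fin n,
        if p.1 ≠ p.2.1 ∧ p.1 ≠ p.2.2 ∧ p.2.1 ≠ p.2.2 then F p.1 p.2.1 p.2.2 else 0 := by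
    rw [Fintype.sum_prod_type]
    refine Finset.sum_congr rfl fun i _ => ?_
    rw [Fintype.sum_prod_type]
  rw [e2, ← Finset.sum_filter]
  symm
  refine Finset.sum_nbij (fun e : Fin 3 ↪ Fin n => (e 0, e 1, e 2)) (fun e _ => ?_)
    (fun e _ e' _ hee => ?_) (fun p hp => ?_) (fun e _ => rfl)
  · simp only [Finset.mem_filter, Finset.mem_univ, true_and]
    exact ⟨fun h => absurd (e.injective h) (by decide), fun h => absurd (e.injective h) (by decide),
      fun h => absurd (e.injective h) (by decide)⟩
  · ext a
    simp only [Prod.mk.injEq] at hee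
    fin_cases a
    · exact congrArg Fin.val hee.1
    · exact congrArg Fin.val hee.2.1
    · exact congrArg Fin.val hee.2.2
  · simp only [Finset.coe_filter, Finset.mem_univ, true_and, Set.mem_ofPred_eq] at hp
    obtain ⟨p1, p2, p3⟩ := p
    obtain ⟨q1, q2, q3⟩ := hp
    simp only at q1 q2 q3
    have hinj : Function.Injective ![p1, p2, p3] := by
      intro a b hab
      fin_cases a <;> fin_cases b <;> simp [q1, q2, q3, q1.symm, q2.symm, q3.symm] at hab ⊢
    exact ⟨⟨![p1, p2, p3], hinj⟩, by simp, by simp⟩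

theorem card_embedding_two : (Fintype.card (Fin 2 ↪ Fin n) : ℝ) = n * (n - 1) := by
  rw [Fintype.card_embedding_eq, Fintype.card_fin, Fintype.card_fin]
  rcases n with _ | n
  · simp
  · rw [Nat.succ_descFactorial_succ, Nat.descFactorial_one]; push_cast; ring

theorem card_embedding_three : (Fintype.card (Fin 3 ↪ Fin n) : ℝ) = n * (n - 1) * (n - 2) := by
  rw [Fintype.card_embedding_eq, Fintype.card_fin, Fintype.card_fin]
  rcases n with _ | _ | n
  · simp
  · simp
  · rw [Nat.succ_descFactorial_succ, Nat.succ_descFactorial_succ, Nat.descFactorial_one]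
    push_cast; ring

theorem tauKernel_diag (j k : Fin d) (x : Fin d → ℝ) : tauKernel j k x x = 0 := by
  simp [tauKernel]

theorem sum_tauKernel (y : Fin n → Fin d → ℝ) (j k : Fin d) :
    ∑ i, ∑ l, tauKernel j k (y i) (y l) =
      n * (n - 1) * uStat (fun z : Fin 2 → Fin d → ℝ => tauKernel j k (z 0) (z 1)) y := by
  rw [← sum_embedding_two (fun i l => tauKernel j k (y i) (y l)) fun i => tauKernel_diag j k _,
    uStat, card_embedding_two]
  rcases eq_or_ne ((n : ℝ) * (n - 1)) 0 with h | h
  · rw [h, zero_mul]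
    rw [← card_embedding_two, Nat.cast_eq_zero, Fintype.card_eq_zero_iff] at h
    exact Fintype.sum_empty _
  · rw [mul_div_cancel₀ _ h]

theorem tauHat_eq_uStat (hn : 2 ≤ n) (y : Fin n → Fin d → ℝ) (j k : Fin d) :
    tauHat y j k = uStat (fun z : Fin 2 → Fin d → ℝ => tauKernel j k (z 0) (z 1)) y := by
  have hn' : (2 : ℝ) ≤ n := by exact_mod_cast hn
  have h := sum_tauKernel y j k
  have h2 : ∑ i, ∑ l, tauKernel j k (y i) (y l) =
      2 * ∑ i, ∑ l ∈ Finset.Ioi i, tauKernel j k (y i) (y l) := by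
    have e : ∀ i l, tauKernel j k (y i) (y l) =
        (if i < l then tauKernel j k (y i) (y l) else 0) +
          if l < i then tauKernel j k (y l) (y i) else 0 := by
      intro i l
      rcases lt_trichotomy i l with h | h | h
      · rw [if_pos h, if_neg h.asymm, add_zero]
      · subst h; simp [tauKernel_diag]
      · rw [if_neg h.asymm, if_pos h, zero_add, tauKernel_symm]
    conv_lhs => enter [2, i, 2, l]; rw [e]
    simp only [Finset.sum_add_distrib]
    rw [Finset.sum_comm (f := fun i l => if l < i then tauKernel j k (y l) (y i) else 0), two_mul]
    simp_rw [← Finset.sum_filter, Finset.filter_lt_eq_Ioi]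
  rw [h2] at h
  have hne : (n : ℝ) * (n - 1) ≠ 0 := by
    have : 0 < (n : ℝ) * (n - 1) := by nlinarith
    exact this.ne'
  simp only [tauHat, Matrix.of_apply]
  change 2 / ((n : ℝ) * (n - 1)) * ∑ i, ∑ l ∈ Finset.Ioi i, tauKernel j k (y i) (y l) = _
  rw [div_mul_eq_mul_div, h, mul_div_cancel_left₀ _ hne]

/-- In the absence of ties, a centred rank is half a sum of signs of differences. -/
theorem centredRank_eq {y : Fin n → Fin d → ℝ} {j : Fin d}
    (hy : Function.Injective fun i => y i j) (i : Fin n) :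
    centredRank y i j = (∑ l, Real.sign (y i j - y l j)) / 2 := by
  classical
  have e : ∀ l : Fin n, (if y l j ≤ y i j then (1 : ℝ) else 0) =
      1 / 2 + Real.sign (y i j - y l j) / 2 + if l = i then 1 / 2 else 0 := by
    intro l
    by_cases hl : l = i
    · subst hl; simp; norm_num
    · rw [if_neg hl]
      have hne : y l j ≠ y i j := fun h => hl (hy h)
      rcases lt_or_gt_of_ne hne with h | h
      · rw [if_pos h.le, Real.sign_of_pos (sub_pos.2 h)]; norm_num
      · rw [if_neg (not_le.2 h), Real.sign_of_neg (sub_neg.2 h)]; norm_num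
  have hr : (rank y i j : ℝ) = n / 2 + (∑ l, Real.sign (y i j - y l j)) / 2 + 1 / 2 := by
    rw [rank, Finset.card_filter]
    push_cast
    simp_rw [e, Finset.sum_add_distrib, Finset.sum_ite_eq', ← Finset.sum_div]
    simp [div_eq_mul_inv]
  rw [centredRank, hr]
  ring

theorem uStat_rhoKernel (hn : 3 ≤ n) (y : Fin n → Fin d → ℝ) (j k : Fin d) :
    uStat (fun z : Fin 3 → Fin d → ℝ => rhoKernel j k (z 0) (z 1) (z 2)) y =
      3 * uStat (fun z : Fin 3 → Fin d → ℝ => rhoTriple j k (z 0) (z 1) (z 2)) y := by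
  have hp : ∀ ι : Fin 3 ↪ Fin 3,
      uStat (fun z : Fin 3 → Fin d → ℝ => rhoTriple j k (z (ι 0)) (z (ι 1)) (z (ι 2))) y =
        uStat (fun z : Fin 3 → Fin d → ℝ => rhoTriple j k (z 0) (z 1) (z 2)) y := fun ι =>
    uStat_comp hn le_rfl ι (fun z => rhoTriple j k (z 0) (z 1) (z 2)) y
  have p1 := hp ⟨![0, 2, 1], by decide⟩
  have p2 := hp ⟨![1, 0, 2], by decide⟩
  have p3 := hp ⟨![1, 2, 0], by decide⟩
  have p4 := hp ⟨![2, 0, 1], by decide⟩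
  have p5 := hp ⟨![2, 1, 0], by decide⟩
  simp only [Function.Embedding.coeFn_mk, Matrix.cons_val_zero, Matrix.cons_val_one,
    Matrix.cons_val] at p1 p2 p3 p4 p5
  simp only [rhoKernel, div_eq_inv_mul]
  rw [uStat_const_mul, uStat_add, uStat_add, uStat_add, uStat_add, uStat_add, p1, p2, p3, p4, p5]
  ring

/-- Products of centred ranks are sums over triples of observations; the triples of three distinct
observations give the U-statistic of order three, those with a repetition give Kendall's tau. -/
theorem sum_centredRank_mul {y : Fin n → Fin d → ℝ} {j k : Fin d}
    (hj : Function.Injective fun i => y i j) (hk : Function.Injective fun i => y i k) :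
    ∑ i, centredRank y i j * centredRank y i k =
      (n * (n - 1) * (n - 2) / 3 *
          uStat (fun z : Fin 3 → Fin d → ℝ => rhoKernel j k (z 0) (z 1) (z 2)) y +
        n * (n - 1) * uStat (fun z : Fin 2 → Fin d → ℝ => tauKernel j k (z 0) (z 1)) y) / 4 := by
  have h1 : ∑ i, centredRank y i j * centredRank y i k =
      (∑ i, ∑ l, ∑ m, rhoTriple j k (y i) (y l) (y m)) / 4 := by
    rw [Finset.sum_div]
    refine Finset.sum_congr rfl fun i _ => ?_
    rw [centredRank_eq hj, centredRank_eq hk, div_mul_div_comm, Finset.sum_mul_sum]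
    norm_num [rhoTriple]
  have h3 : ∑ e : Fin 3 ↪ Fin n, rhoTriple j k (y (e 0)) (y (e 1)) (y (e 2)) =
      n * (n - 1) * (n - 2) / 3 *
        uStat (fun z : Fin 3 → Fin d → ℝ => rhoKernel j k (z 0) (z 1) (z 2)) y := by
    rcases le_or_gt 3 n with hn | hn
    · have hc := card_embedding_pos hn
      rw [card_embedding_three] at hc
      rw [uStat_rhoKernel hn, uStat, card_embedding_three, div_mul_eq_mul_div, mul_div_assoc,
        mul_div_cancel_left₀ _ (by norm_num : (3 : ℝ) ≠ 0), mul_div_cancel₀ _ hc.ne']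
    · have h0 : Fintype.card (Fin 3 ↪ Fin n) = 0 := by
        rw [Fintype.card_embedding_eq, Fintype.card_fin, Fintype.card_fin,
          Nat.descFactorial_eq_zero_iff_lt]
        exact hn
      have := Fintype.card_eq_zero_iff.1 h0
      rw [← card_embedding_three, h0]
      simp
  rw [h1, sum_embedding_three (fun i l m => rhoTriple j k (y i) (y l) (y m))
    (fun i l => by simp [rhoTriple]) (fun i l => by simp [rhoTriple]), h3]
  simp_rw [rhoTriple_diag]
  rw [sum_tauKernel]

/-- In the absence of ties, Spearman's rho is a convex combination of a U-statistic of order three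
and Kendall's tau. -/
theorem rhoHat_eq (hn : 2 ≤ n) {y : Fin n → Fin d → ℝ} {j k : Fin d}
    (hj : Function.Injective fun i => y i j) (hk : Function.Injective fun i => y i k) :
    rhoHat y j k = ((n - 2) / (n + 1)) *
        uStat (fun z : Fin 3 → Fin d → ℝ => rhoKernel j k (z 0) (z 1) (z 2)) y +
      3 / (n + 1) * tauHat y j k := by
  have hn' : (2 : ℝ) ≤ n := by exact_mod_cast hn
  have hD : ∀ {j : Fin d}, (Function.Injective fun i => y i j) →
      ∑ i, centredRank y i j ^ 2 = n * (n - 1) * (n + 1) / 12 := by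
    intro j hj
    simp_rw [sq]
    rw [sum_centredRank_mul hj hj]
    have hu2 : uStat (fun z : Fin 2 → Fin d → ℝ => tauKernel j j (z 0) (z 1)) y = 1 := by
      rw [← uStat_const hn 1 y, uStat, uStat]
      congr 1
      refine Finset.sum_congr rfl fun e _ => tauKernel_self j fun h => ?_
      exact absurd (e.injective (hj h)) (by decide)
    have hu3 : (n : ℝ) * (n - 1) * (n - 2) / 3 *
        uStat (fun z : Fin 3 → Fin d → ℝ => rhoKernel j j (z 0) (z 1) (z 2)) y =
          n * (n - 1) * (n - 2) / 3 := by
      rcases Nat.lt_or_ge 2 n with hn3 | hn3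
      · have : uStat (fun z : Fin 3 → Fin d → ℝ => rhoKernel j j (z 0) (z 1) (z 2)) y = 1 := by
          rw [← uStat_const (show 3 ≤ n from hn3) 1 y, uStat, uStat]
          congr 1
          refine Finset.sum_congr rfl fun e _ => rhoKernel_self j (fun h => ?_) (fun h => ?_)
            fun h => ?_
          all_goals exact absurd (e.injective (hj h)) (by decide)
        rw [this, mul_one]
      · have : n = 2 := le_antisymm hn3 hn
        subst this
        norm_num
    rw [hu2, hu3]
    ring
  have hpos : 0 < (n : ℝ) * (n - 1) * (n + 1) / 12 := by
    have : 0 < (n : ℝ) * (n - 1) := by nlinarith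
    positivity
  simp only [rhoHat, Matrix.of_apply]
  rw [hD hj, hD hk, Real.sqrt_mul_self hpos.le, sum_centredRank_mul hj hk, tauHat_eq_uStat hn]
  have h1 : (n : ℝ) ≠ 0 := by linarith
  have h2 : (n : ℝ) - 1 ≠ 0 := by linarith
  field_simp
  ring

end GaussianCopula

end

/-! ### Moments of the rank correlations -/

noncomputable section

namespace GaussianCopula

section Moments

variable {α : Type*} [MeasurableSpace α] {μ : Measure α} [IsProbabilityMeasure μ] {n k : ℕ}

theorem integral_pi_two {F : α → α → ℝ} (mF : Measurable fun p : α × α => F p.1 p.2) {C : ℝ}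
    (hF : ∀ x y, |F x y| ≤ C) :
    ∫ z, F (z 0) (z 1) ∂(Measure.pi fun _ : Fin 2 => μ) = ∫ x, ∫ y, F x y ∂μ ∂μ := by
  have m2 : Measurable fun z : Fin 2 → α => F (z 0) (z 1) :=
    mF.comp (f := fun z : Fin 2 → α => (z 0, z 1)) (by fun_prop)
  rw [integral_pi_succ μ m2 fun z => hF _ _]
  congr 1
  ext x
  exact integral_pi_one (f := fun y => F x y) (mF.comp (f := fun y => (x, y)) (by fun_prop))

theorem integral_pi_three {F : α → α → α → ℝ}
    (mF : Measurable fun p : α × α × α => F p.1 p.2.1 p.2.2) {C : ℝ}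
    (hF : ∀ x y z, |F x y z| ≤ C) :
    ∫ z, F (z 0) (z 1) (z 2) ∂(Measure.pi fun _ : Fin 3 => μ) =
      ∫ x, ∫ y, ∫ z, F x y z ∂μ ∂μ ∂μ := by
  have m3 : Measurable fun z : Fin 3 → α => F (z 0) (z 1) (z 2) :=
    mF.comp (f := fun z : Fin 3 → α => (z 0, z 1, z 2)) (by fun_prop)
  rw [integral_pi_succ μ m3 fun z => hF _ _ _]
  congr 1
  ext x
  exact integral_pi_two (F := fun y z => F x y z)
    (mF.comp (f := fun p : α × α => (x, p.1, p.2)) (by fun_prop)) (hF x)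

/-- Second and fourth moments of a centred kernel with values in `[-1, 1]`. -/
theorem integral_sub_mean_pow_le {q : α → ℝ} (mq : Measurable q) {C : ℝ} (hq : ∀ z, |q z| ≤ C)
    (hq1 : ∀ᵐ z ∂μ, q z ^ 2 ≤ 1) {θ : ℝ} (hθ : ∫ z, q z ∂μ = θ) :
    ∫ z, (q z - θ) ^ 2 ∂μ ≤ 1 - θ ^ 2 ∧
      ∫ z, (q z - θ) ^ 4 ∂μ ≤ (1 - θ ^ 2) * (1 + 3 * θ ^ 2) := by
  have Iq : Integrable q μ := integrable_of_bounded mq hq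
  have Ip : ∀ p : ℕ, Integrable (fun z => (q z - θ) ^ p) μ := fun p =>
    integrable_of_bounded ((mq.sub_const θ).pow_const p) (C := (C + |θ|) ^ p) fun z => by
      rw [abs_pow]
      exact pow_le_pow_left₀ (abs_nonneg _) ((abs_sub _ _).trans (add_le_add_left (hq z) _)) p
  constructor
  · calc ∫ z, (q z - θ) ^ 2 ∂μ ≤ ∫ z, (1 + θ ^ 2 - 2 * θ * q z) ∂μ := by
          refine integral_mono_ae (Ip 2) ((integrable_const _).sub (Iq.const_mul _)) ?_
          filter_upwards [hq1] with z hz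
          nlinarith
      _ = 1 - θ ^ 2 := by
          rw [integral_sub (by fun_prop) (by fun_prop), integral_const_mul, hθ]
          simp; ring
  · calc ∫ z, (q z - θ) ^ 4 ∂μ ≤
        ∫ z, ((1 + θ ^ 2) ^ 2 + 4 * θ ^ 2 - 4 * θ * (1 + θ ^ 2) * q z) ∂μ := by
          refine integral_mono_ae (Ip 4) ((integrable_const _).sub (Iq.const_mul _)) ?_
          filter_upwards [hq1] with z hz
          have h1 : (q z - θ) ^ 2 ≤ 1 + θ ^ 2 - 2 * θ * q z := by nlinarith
          have h2 : ((q z - θ) ^ 2) ^ 2 ≤ (1 + θ ^ 2 - 2 * θ * q z) ^ 2 :=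
            pow_le_pow_left₀ (sq_nonneg _) h1 2
          nlinarith [mul_le_mul_of_nonneg_left hz (sq_nonneg (2 * θ))]
      _ = _ := by
          rw [integral_sub (by fun_prop) (by fun_prop), integral_const_mul, hθ]
          simp; ring

/-- Moments of a U-statistic with kernel of modulus at most one, via averages of `m` independent
blocks. -/
theorem integral_uStat_sub_mean_pow_le {m : ℕ} (hm : 0 < m) (hmk : m * k ≤ n)
    {q : (Fin k → α) → ℝ} (mq : Measurable q) {C : ℝ} (hq : ∀ z, |q z| ≤ C)
    (hq1 : ∀ᵐ z ∂(Measure.pi fun _ : Fin k => μ), q z ^ 2 ≤ 1) {θ : ℝ}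
    (hθ : ∫ z, q z ∂(Measure.pi fun _ : Fin k => μ) = θ) :
    ∫ x : Fin n → α, (uStat q x - θ) ^ 2 ∂(Measure.pi fun _ : Fin n => μ) ≤ (1 - θ ^ 2) / m ∧
    ∫ x : Fin n → α, (uStat q x - θ) ^ 4 ∂(Measure.pi fun _ : Fin n => μ) ≤
      (1 - θ ^ 2) * (1 + 3 * θ ^ 2 + 3 * (m - 1) * (1 - θ ^ 2)) / m ^ 3 := by
  have hmR : (0 : ℝ) < m := by exact_mod_cast hm
  have hm1 : (1 : ℝ) ≤ m := by exact_mod_cast hm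
  obtain ⟨h2, h4⟩ := integral_sub_mean_pow_le mq hq hq1 hθ
  have hbd : ∀ z, |q z - θ| ≤ C + |θ| := fun z => (abs_sub _ _).trans (add_le_add_left (hq z) _)
  have h0 : ∫ z, (q z - θ) ∂(Measure.pi fun _ : Fin k => μ) = 0 := by
    have Iq : Integrable q (Measure.pi fun _ : Fin k => μ) := integrable_of_bounded mq hq
    rw [integral_sub Iq (integrable_const _), hθ]
    simp
  obtain ⟨-, s2, s4⟩ := integral_sum_pow (mq.sub_const θ) hbd h0 m
  have b2 := integral_uStat_sub_pow_le (μ := μ) hm hmk mq hq θ (p := 2) (by decide)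
  have b4 := integral_uStat_sub_pow_le (μ := μ) hm hmk mq hq θ (p := 4) (by decide)
  rw [s2] at b2
  rw [s4] at b4
  have hv0 : 0 ≤ ∫ z, (q z - θ) ^ 2 ∂(Measure.pi fun _ : Fin k => μ) :=
    integral_nonneg fun z => sq_nonneg _
  constructor
  · refine b2.trans ?_
    rw [div_le_div_iff₀ (by positivity) hmR]
    nlinarith [mul_le_mul_of_nonneg_left h2 (by positivity : (0 : ℝ) ≤ (m : ℝ) ^ 2)]
  · refine b4.trans ?_
    have hsq : (∫ z, (q z - θ) ^ 2 ∂(Measure.pi fun _ : Fin k => μ)) ^ 2 ≤ (1 - θ ^ 2) ^ 2 :=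
      pow_le_pow_left₀ hv0 h2 2
    calc _ ≤ (m * ((1 - θ ^ 2) * (1 + 3 * θ ^ 2)) + 3 * m * (m - 1) * (1 - θ ^ 2) ^ 2) /
          (m : ℝ) ^ 4 := by
          have : (0 : ℝ) ≤ 3 * m * (m - 1) := mul_nonneg (by positivity) (by linarith)
          gcongr
      _ = _ := by field_simp

end Moments

namespace IsCorrelationMatrix

variable {n d : ℕ} {S : Matrix (Fin d) (Fin d) ℝ}

/-- Almost surely the sample has no ties. -/
theorem ae_injective (hS : IsCorrelationMatrix S) (n : ℕ) :
    ∀ᵐ x ∂(Measure.pi fun _ : Fin n => normalLaw S), ∀ j, Function.Injective fun i => x i j := by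
  have key : ∀ (j : Fin d) (i l : Fin n), i ≠ l →
      ∀ᵐ x ∂(Measure.pi fun _ : Fin n => normalLaw S), x i j ≠ x l j := by
    intro j i l hil
    have hmp := measurePreserving_update (μ := normalLaw S) i
    have hms : MeasurableSet {x : Fin n → Fin d → ℝ | x i j ≠ x l j} :=
      (measurableSet_eq_fun (by fun_prop) (by fun_prop)).compl
    rw [← hmp.map_eq, ae_map_iff hmp.measurable.aemeasurable hms]
    refine (Measure.ae_prod_iff_ae_ae (p := fun p : (Fin n → Fin d → ℝ) × (Fin d → ℝ) =>
      Function.update p.1 i p.2 i j ≠ Function.update p.1 i p.2 l j) (hmp.measurable hms)).2 ?_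
    refine Filter.Eventually.of_forall fun x => ?_
    filter_upwards [hS.ae_ne j (x l j)] with y hy
    simpa [Function.update_of_ne hil.symm] using hy
  simp only [Function.Injective, ae_all_iff]
  intro j i l
  by_cases hil : i = l
  · exact Filter.Eventually.of_forall fun x _ => hil
  · filter_upwards [key j i l hil] with x hx h
    exact absurd h hx

theorem integral_tauKernel (S : Matrix (Fin d) (Fin d) ℝ) (j k : Fin d) :
    ∫ x, ∫ y, tauKernel j k x y ∂(normalLaw S) ∂(normalLaw S) = popTau (normalLaw S) j k := by
  simp only [popTau, Matrix.of_apply]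
  rw [integral_prod]
  · rfl
  · exact integrable_of_bounded (measurable_tauKernel j k) fun p => abs_tauKernel_le j k _ _

theorem measurable_rhoTriple_pi (j k : Fin d) (a b c : Fin 3) :
    Measurable fun z : Fin 3 → Fin d → ℝ => rhoTriple j k (z a) (z b) (z c) :=
  measurable_rhoTriple j k (measurable_pi_apply a) (measurable_pi_apply b) (measurable_pi_apply c)

theorem integral_rhoKernel (S : Matrix (Fin d) (Fin d) ℝ) (j k : Fin d) :
    ∫ x, ∫ y, ∫ z, rhoKernel j k x y z ∂(normalLaw S) ∂(normalLaw S) ∂(normalLaw S) =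
      popRho (normalLaw S) j k := by
  rw [← integral_pi_three (measurable_rhoKernel j k) (abs_rhoKernel_le j k)]
  set π := Measure.pi fun _ : Fin 3 => normalLaw S with hπ
  have m0 := measurable_rhoTriple_pi j k 0 1 2
  have hp : ∀ ι : Fin 3 ↪ Fin 3, ∫ z, rhoTriple j k (z (ι 0)) (z (ι 1)) (z (ι 2)) ∂π =
      ∫ z, rhoTriple j k (z 0) (z 1) (z 2) ∂π := fun ι => integral_comp_embedding ι m0
  have p1 := hp ⟨![0, 2, 1], by decide⟩
  have p2 := hp ⟨![1, 0, 2], by decide⟩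
  have p3 := hp ⟨![1, 2, 0], by decide⟩
  have p4 := hp ⟨![2, 0, 1], by decide⟩
  have p5 := hp ⟨![2, 1, 0], by decide⟩
  simp only [Function.Embedding.coeFn_mk, Matrix.cons_val_zero, Matrix.cons_val_one,
    Matrix.cons_val] at p1 p2 p3 p4 p5
  have I : ∀ a b c : Fin 3, Integrable (fun z : Fin 3 → Fin d → ℝ =>
      rhoTriple j k (z a) (z b) (z c)) π := fun a b c =>
    integrable_of_bounded (measurable_rhoTriple_pi j k a b c) fun z => abs_rhoTriple_le j k _ _ _
  have i0 := I 0 1 2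
  have i1 := I 0 2 1
  have i2 := I 1 0 2
  have i3 := I 1 2 0
  have i4 := I 2 0 1
  have i5 := I 2 1 0
  simp only [rhoKernel]
  rw [integral_div, integral_add (by fun_prop) i5, integral_add (by fun_prop) i4,
    integral_add (by fun_prop) i3, integral_add (by fun_prop) i2, integral_add i0 i1, p1, p2, p3,
    p4, p5]
  have e : ∫ z, rhoTriple j k (z 0) (z 1) (z 2) ∂π = ∫ p : (Fin d → ℝ) × (Fin d → ℝ) × (Fin d → ℝ),
      rhoTriple j k p.1 p.2.1 p.2.2
        ∂((normalLaw S).prod ((normalLaw S).prod (normalLaw S))) := by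
    have mT : Measurable fun p : (Fin d → ℝ) × (Fin d → ℝ) × (Fin d → ℝ) =>
        rhoTriple j k p.1 p.2.1 p.2.2 :=
      measurable_rhoTriple j k measurable_fst (by fun_prop) (by fun_prop)
    rw [integral_pi_three mT (abs_rhoTriple_le j k), integral_prod]
    · congr 1
      ext x
      rw [integral_prod]
      exact integrable_of_bounded
        (measurable_rhoTriple j k measurable_const measurable_fst measurable_snd)
        fun p => abs_rhoTriple_le j k _ _ _
    · exact integrable_of_bounded mT fun p => abs_rhoTriple_le j k _ _ _
  rw [e]
  simp only [popRho, Matrix.of_apply, rhoTriple]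
  ring

/-- The first projection of the kernel of Kendall's tau. -/
theorem abs_integral_tauKernel_sub_le (hS : IsCorrelationMatrix S) (j k : Fin d)
    (x : Fin d → ℝ) :
    |∫ y, tauKernel j k x y ∂(normalLaw S) - gaussSign (x j) * gaussSign (x k)| ≤ |S j k| :=
  hS.abs_integral_sign_mul_sign_sub_le j k (x j) (x k)

/-- The first projection of the kernel of Spearman's rho. -/
theorem abs_integral_rhoKernel_sub_le (hS : IsCorrelationMatrix S) (j k : Fin d)
    (x : Fin d → ℝ) :
    |(∫ y, ∫ z, rhoKernel j k x y z ∂(normalLaw S) ∂(normalLaw S)) -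
      gaussSign (x j) * gaussSign (x k)| ≤ |S j k| := by
  set μ := normalLaw S with hμ
  have mx : Measurable fun _ : (Fin d → ℝ) × (Fin d → ℝ) => x := measurable_const
  have mf : Measurable fun p : (Fin d → ℝ) × (Fin d → ℝ) => p.1 := measurable_fst
  have ms : Measurable fun p : (Fin d → ℝ) × (Fin d → ℝ) => p.2 := measurable_snd
  have I : ∀ {f g h : (Fin d → ℝ) × (Fin d → ℝ) → Fin d → ℝ}, Measurable f → Measurable g →
      Measurable h → Integrable (fun p => rhoTriple j k (f p) (g p) (h p)) (μ.prod μ) :=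
    fun hf hg hh => integrable_of_bounded (measurable_rhoTriple j k hf hg hh)
      fun p => abs_rhoTriple_le j k _ _ _
  have i0 := I mx mf ms
  have i1 := I mx ms mf
  have i2 := I mf mx ms
  have i3 := I mf ms mx
  have i4 := I ms mx mf
  have i5 := I ms mf mx
  have hK : ∫ y, ∫ z, rhoKernel j k x y z ∂μ ∂μ =
      ∫ p, rhoKernel j k x p.1 p.2 ∂(μ.prod μ) := by
    rw [integral_prod]
    exact integrable_of_bounded ((measurable_rhoKernel j k).comp
      (f := fun p : (Fin d → ℝ) × (Fin d → ℝ) => (x, p.1, p.2)) (by fun_prop))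
      fun p => abs_rhoKernel_le j k _ _ _
  set A := ∫ y, Real.sign (x j - y j) * gaussSign (y k) ∂μ with hA
  set A' := ∫ y, Real.sign (x k - y k) * gaussSign (y j) ∂μ with hA'
  have v0 : ∫ p, rhoTriple j k x p.1 p.2 ∂(μ.prod μ) = gaussSign (x j) * gaussSign (x k) := by
    rw [← hS.integral_sign_sub j (x j), ← hS.integral_sign_sub k (x k), ← integral_prod_mul]
    rfl
  have v2 : ∫ p, rhoTriple j k p.1 x p.2 ∂(μ.prod μ) = -A := by
    rw [integral_prod _ i2, hA, ← integral_neg]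
    congr 1
    ext y
    simp only [rhoTriple]
    rw [integral_const_mul, hS.integral_sign_sub, sign_sub_comm, neg_mul]
  have v3 : ∫ p, rhoTriple j k p.1 p.2 x ∂(μ.prod μ) = -A' := by
    rw [integral_prod _ i3, hA', ← integral_neg]
    congr 1
    ext y
    simp only [rhoTriple]
    rw [integral_mul_const, hS.integral_sign_sub, sign_sub_comm (x k), mul_comm, neg_mul]
  have v1 : ∫ p, rhoTriple j k x p.2 p.1 ∂(μ.prod μ) = gaussSign (x j) * gaussSign (x k) := by
    rw [← v0, ← integral_prod_swap]; rfl
  have v4 : ∫ p, rhoTriple j k p.2 x p.1 ∂(μ.prod μ) = -A := by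
    rw [← v2, ← integral_prod_swap]; rfl
  have v5 : ∫ p, rhoTriple j k p.2 p.1 x ∂(μ.prod μ) = -A' := by
    rw [← v3, ← integral_prod_swap]; rfl
  have e : ∫ p, rhoKernel j k x p.1 p.2 ∂(μ.prod μ) =
      gaussSign (x j) * gaussSign (x k) - A - A' := by
    simp only [rhoKernel]
    rw [integral_div, integral_add (by fun_prop) i5, integral_add (by fun_prop) i4,
      integral_add (by fun_prop) i3, integral_add (by fun_prop) i2, integral_add i0 i1, v0, v1, v2,
      v3, v4, v5]
    ring
  have b1 := hS.abs_integral_sign_mul_gaussSign_le j k (x j)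
  have b2 := hS.abs_integral_sign_mul_gaussSign_le k j (x k)
  rw [hS.apply_symm j k] at b2
  rw [hK, e]
  calc |gaussSign (x j) * gaussSign (x k) - A - A' - gaussSign (x j) * gaussSign (x k)| =
      |A + A'| := by rw [← abs_neg]; congr 1; ring
    _ ≤ |A| + |A'| := abs_add_le _ _
    _ ≤ |S j k| := by linarith

theorem measurable_tauKernel_pi (j k : Fin d) :
    Measurable fun z : Fin 2 → Fin d → ℝ => tauKernel j k (z 0) (z 1) :=
  (measurable_tauKernel j k).comp (f := fun z : Fin 2 → Fin d → ℝ => (z 0, z 1)) (by fun_prop)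

theorem measurable_rhoKernel_pi (j k : Fin d) :
    Measurable fun z : Fin 3 → Fin d → ℝ => rhoKernel j k (z 0) (z 1) (z 2) :=
  (measurable_rhoKernel j k).comp (f := fun z : Fin 3 → Fin d → ℝ => (z 0, z 1, z 2))
    (by fun_prop)

theorem tauKernel_sq_le (j k : Fin d) (x y : Fin d → ℝ) : tauKernel j k x y ^ 2 ≤ 1 :=
  (sq_le_one_iff_abs_le_one _).2 (abs_tauKernel_le j k x y)

/-- The symmetrised kernel of Spearman's rho is a sign except for ties. -/
theorem ae_rhoKernel_sq_le (hS : IsCorrelationMatrix S) (j k : Fin d) :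
    ∀ᵐ z ∂(Measure.pi fun _ : Fin 3 => normalLaw S), rhoKernel j k (z 0) (z 1) (z 2) ^ 2 ≤ 1 := by
  filter_upwards [hS.ae_injective 3] with z hz
  have h : ∀ (j : Fin d) {a b : Fin 3}, a ≠ b → z a j ≠ z b j := fun j a b hab h => hab (hz j h)
  exact (rhoKernel_sq_eq_one j k (h j (by decide)) (h j (by decide)) (h j (by decide))
    (h k (by decide)) (h k (by decide)) (h k (by decide))).le

/-- Kendall's tau minus twice the projected covariance: the first projection of the kernel is
approximated up to `|S j k|`, and the kernel has modulus at most one. -/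
theorem integral_tauHat_remainder_le (hS : IsCorrelationMatrix S) (hn : 2 ≤ n) (j k : Fin d) :
    ∫ x : Fin n → Fin d → ℝ, (tauHat x j k - popTau (normalLaw S) j k -
        2 * signCov (normalLaw S) x j k) ^ 2 ∂(Measure.pi fun _ : Fin n => normalLaw S) ≤
      4 / n * S j k ^ 2 + 2 / (n * (n - 1)) := by
  have h := integral_uStat_two_sub_sq_le (μ := normalLaw S) hn (measurable_tauKernel j k)
    (abs_tauKernel_le j k) (tauKernel_symm j k) (measurable_gaussSign_mul j k)
    (fun x => abs_gaussSign_mul_le_one (x j) (x k))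
  rw [integral_tauKernel] at h
  simp_rw [tauHat_eq_uStat hn]
  refine h.trans ?_
  have hn' : (2 : ℝ) ≤ n := by exact_mod_cast hn
  have hpos : (0 : ℝ) < n * (n - 1) := by nlinarith
  have mh : Measurable fun x : Fin d → ℝ => ∫ y, tauKernel j k x y ∂(normalLaw S) :=
    measurable_integral_right (measurable_tauKernel j k)
  have h1 : ∫ x, ((∫ y, tauKernel j k x y ∂(normalLaw S)) - gaussSign (x j) * gaussSign (x k)) ^ 2
      ∂(normalLaw S) ≤ S j k ^ 2 := by
    refine (le_abs_self _).trans (abs_integral_le_of_abs_le fun x => ?_)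
    rw [abs_pow, ← sq_abs (S j k)]
    exact pow_le_pow_left₀ (abs_nonneg _) (hS.abs_integral_tauKernel_sub_le j k x) 2
  have h2 : ∫ z, tauKernel j k (z 0) (z 1) ^ 2 ∂(Measure.pi fun _ : Fin 2 => normalLaw S) ≤ 1 := by
    refine (le_abs_self _).trans (abs_integral_le_of_abs_le fun z => ?_)
    rw [abs_of_nonneg (sq_nonneg _)]
    exact tauKernel_sq_le j k _ _
  calc _ ≤ 4 / (n : ℝ) * S j k ^ 2 + 2 / (n * (n - 1)) * 1 := by gcongr
    _ = _ := by rw [mul_one]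

/-- The U-statistic of order three of Spearman's rho minus three times the projected covariance. -/
theorem integral_rhoU_remainder_le (hS : IsCorrelationMatrix S) (hn : 3 ≤ n) (j k : Fin d) :
    ∫ x : Fin n → Fin d → ℝ,
        (uStat (fun z : Fin 3 → Fin d → ℝ => rhoKernel j k (z 0) (z 1) (z 2)) x -
          popRho (normalLaw S) j k - 3 * signCov (normalLaw S) x j k) ^ 2
        ∂(Measure.pi fun _ : Fin n => normalLaw S) ≤
      9 / n * S j k ^ 2 + 6 / (n * (n - 1)) := by
  have h := integral_uStat_three_sub_sq_le (μ := normalLaw S) hn (measurable_rhoKernel j k)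
    (abs_rhoKernel_le j k) (rhoKernel_symm_left j k) (rhoKernel_symm_right j k)
    (measurable_gaussSign_mul j k) (fun x => abs_gaussSign_mul_le_one (x j) (x k))
  rw [integral_rhoKernel] at h
  refine h.trans ?_
  have hn' : (3 : ℝ) ≤ n := by exact_mod_cast hn
  have hpos : (0 : ℝ) < n * (n - 1) := by nlinarith
  have h1 : ∫ x, ((∫ y, ∫ z, rhoKernel j k x y z ∂(normalLaw S) ∂(normalLaw S)) -
      gaussSign (x j) * gaussSign (x k)) ^ 2 ∂(normalLaw S) ≤ S j k ^ 2 := by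
    refine (le_abs_self _).trans (abs_integral_le_of_abs_le fun x => ?_)
    rw [abs_pow, ← sq_abs (S j k)]
    exact pow_le_pow_left₀ (abs_nonneg _) (hS.abs_integral_rhoKernel_sub_le j k x) 2
  have h2 : ∫ z, rhoKernel j k (z 0) (z 1) (z 2) ^ 2
      ∂(Measure.pi fun _ : Fin 3 => normalLaw S) ≤ 1 := by
    calc _ ≤ ∫ _ : Fin 3 → Fin d → ℝ, (1 : ℝ) ∂(Measure.pi fun _ : Fin 3 => normalLaw S) :=
          integral_mono_ae (integrable_of_bounded ((measurable_rhoKernel_pi j k).pow_const 2)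
            fun z => sq_of_abs_le (abs_rhoKernel_le j k _ _ _)) (integrable_const _)
            (hS.ae_rhoKernel_sq_le j k)
      _ = 1 := by simp
  calc _ ≤ 9 / (n : ℝ) * S j k ^ 2 + 6 / (n * (n - 1)) * 1 := by gcongr
    _ = _ := by rw [mul_one]

theorem integral_tauHat_sub_pow_le (hn : 2 ≤ n) (S : Matrix (Fin d) (Fin d) ℝ) (j k : Fin d)
    {m : ℕ} (hm : 0 < m) (hmn : m * 2 ≤ n) {θ : ℝ} (hθ : popTau (normalLaw S) j k = θ) :
    ∫ x : Fin n → Fin d → ℝ, (tauHat x j k - θ) ^ 2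
        ∂(Measure.pi fun _ : Fin n => normalLaw S) ≤ (1 - θ ^ 2) / m ∧
    ∫ x : Fin n → Fin d → ℝ, (tauHat x j k - θ) ^ 4
        ∂(Measure.pi fun _ : Fin n => normalLaw S) ≤
      (1 - θ ^ 2) * (1 + 3 * θ ^ 2 + 3 * (m - 1) * (1 - θ ^ 2)) / m ^ 3 := by
  simp_rw [tauHat_eq_uStat hn]
  refine integral_uStat_sub_mean_pow_le hm hmn (measurable_tauKernel_pi j k)
    (fun z => abs_tauKernel_le j k _ _)
    (Filter.Eventually.of_forall fun z => tauKernel_sq_le j k _ _) ?_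
  rw [integral_pi_two (measurable_tauKernel j k) (abs_tauKernel_le j k), integral_tauKernel, hθ]

theorem integral_rhoU_sub_pow_le (hS : IsCorrelationMatrix S) (j k : Fin d)
    {m : ℕ} (hm : 0 < m) (hmn : m * 3 ≤ n) {θ : ℝ} (hθ : popRho (normalLaw S) j k = θ) :
    ∫ x : Fin n → Fin d → ℝ,
        (uStat (fun z : Fin 3 → Fin d → ℝ => rhoKernel j k (z 0) (z 1) (z 2)) x - θ) ^ 2
        ∂(Measure.pi fun _ : Fin n => normalLaw S) ≤ (1 - θ ^ 2) / m ∧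
    ∫ x : Fin n → Fin d → ℝ,
        (uStat (fun z : Fin 3 → Fin d → ℝ => rhoKernel j k (z 0) (z 1) (z 2)) x - θ) ^ 4
        ∂(Measure.pi fun _ : Fin n => normalLaw S) ≤
      (1 - θ ^ 2) * (1 + 3 * θ ^ 2 + 3 * (m - 1) * (1 - θ ^ 2)) / m ^ 3 := by
  refine integral_uStat_sub_mean_pow_le hm hmn (measurable_rhoKernel_pi j k)
    (fun z => abs_rhoKernel_le j k _ _ _) (hS.ae_rhoKernel_sq_le j k) ?_
  rw [integral_pi_three (measurable_rhoKernel j k) (abs_rhoKernel_le j k), integral_rhoKernel, hθ]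

end IsCorrelationMatrix

end GaussianCopula

end

/-! ### Frobenius bounds for random matrices -/

noncomputable section

namespace GaussianCopula

section RandomMatrix

variable {d : ℕ} {α : Type*} [MeasurableSpace α] {P : Measure α} [IsProbabilityMeasure P]
  {W : α → Matrix (Fin d) (Fin d) ℝ} {C : ℝ}

theorem integrable_specNorm (mW : ∀ j k, Measurable fun ω => W ω j k)
    (hC : ∀ ω j k, |W ω j k| ≤ C) : Integrable (fun ω => specNorm (W ω)) P := by
  refine integrable_of_bounded (measurable_specNorm mW) (C := d * |C|) fun ω => ?_
  rw [abs_of_nonneg (specNorm_nonneg _)]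
  exact specNorm_le_of_forall_abs_le (abs_nonneg C) fun j k => (hC ω j k).trans (le_abs_self C)

/-- The expected spectral norm is bounded by the root mean square of the Frobenius norm. -/
theorem integral_specNorm_le_sqrt (mW : ∀ j k, Measurable fun ω => W ω j k)
    (hC : ∀ ω j k, |W ω j k| ≤ C) {V : Fin d → Fin d → ℝ}
    (hV : ∀ j k, ∫ ω, W ω j k ^ 2 ∂P ≤ V j k) :
    ∫ ω, specNorm (W ω) ∂P ≤ √(∑ j, ∑ k, V j k) := by
  have I1 := integrable_specNorm (P := P) mW hC
  have mS := measurable_specNorm mW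
  have hb : ∀ ω, |specNorm (W ω)| ≤ d * |C| := fun ω => by
    rw [abs_of_nonneg (specNorm_nonneg _)]
    exact specNorm_le_of_forall_abs_le (abs_nonneg C) fun j k => (hC ω j k).trans (le_abs_self C)
  have I2 : Integrable (fun ω => specNorm (W ω) ^ 2) P :=
    integrable_of_bounded (mS.pow_const 2) fun ω => sq_of_abs_le (hb ω)
  have Ijk : ∀ j k, Integrable (fun ω => W ω j k ^ 2) P := fun j k =>
    integrable_of_bounded ((mW j k).pow_const 2) fun ω => sq_of_abs_le (hC ω j k)
  refine Real.le_sqrt_of_sq_le ?_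
  set c := ∫ ω, specNorm (W ω) ∂P with hc
  have h0 : 0 ≤ ∫ ω, (specNorm (W ω) - c) ^ 2 ∂P := integral_nonneg fun _ => sq_nonneg _
  have e : ∀ ω, (specNorm (W ω) - c) ^ 2 =
      specNorm (W ω) ^ 2 - 2 * c * specNorm (W ω) + c ^ 2 := fun ω => by ring
  simp_rw [e] at h0
  have I3 : Integrable (fun ω => specNorm (W ω) ^ 2 - 2 * c * specNorm (W ω)) P :=
    I2.sub (I1.const_mul _)
  rw [integral_add I3 (integrable_const _), integral_sub I2 (I1.const_mul _), integral_const_mul,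
    ← hc] at h0
  have h1 : c ^ 2 ≤ ∫ ω, specNorm (W ω) ^ 2 ∂P := by
    simp only [integral_const, probReal_univ, one_smul] at h0
    nlinarith
  refine h1.trans ?_
  calc ∫ ω, specNorm (W ω) ^ 2 ∂P ≤ ∫ ω, ∑ j, ∑ k, W ω j k ^ 2 ∂P := by
        refine integral_mono I2 (integrable_finsetSum _ fun j _ =>
          integrable_finsetSum _ fun k _ => Ijk j k) fun ω => ?_
        rw [← frobNorm_sq]
        exact pow_le_pow_left₀ (specNorm_nonneg _) (specNorm_le_frobNorm _) 2
    _ = ∑ j, ∑ k, ∫ ω, W ω j k ^ 2 ∂P := by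
        rw [integral_finsetSum _ fun j _ => integrable_finsetSum _ fun k _ => Ijk j k]
        exact Finset.sum_congr rfl fun j _ => integral_finsetSum _ fun k _ => Ijk j k
    _ ≤ _ := Finset.sum_le_sum fun j _ => Finset.sum_le_sum fun k _ => hV j k

end RandomMatrix

section Statistics

variable {n d : ℕ}

theorem abs_tauHat_le_one (hn : 2 ≤ n) (y : Fin n → Fin d → ℝ) (j k : Fin d) :
    |tauHat y j k| ≤ 1 := by
  rw [tauHat_eq_uStat hn]
  exact abs_uStat_le hn (fun z => abs_tauKernel_le j k _ _) y

theorem measurable_tauHat (hn : 2 ≤ n) (j k : Fin d) :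
    Measurable fun y : Fin n → Fin d → ℝ => tauHat y j k := by
  simp_rw [tauHat_eq_uStat hn]
  exact measurable_uStat (IsCorrelationMatrix.measurable_tauKernel_pi j k)

theorem abs_rhoHat_le_one (y : Fin n → Fin d → ℝ) (j k : Fin d) : |rhoHat y j k| ≤ 1 := by
  rw [rhoHat, Matrix.of_apply, abs_div, abs_of_nonneg (Real.sqrt_nonneg _)]
  exact div_le_one_of_le₀ (Real.abs_le_sqrt (Finset.sum_mul_sq_le_sq_mul_sq _ _ _))
    (Real.sqrt_nonneg _)

theorem measurable_centredRank (i : Fin n) (j : Fin d) :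
    Measurable fun y : Fin n → Fin d → ℝ => centredRank y i j := by
  refine Measurable.sub_const ?_ _
  have : ∀ y : Fin n → Fin d → ℝ, (rank y i j : ℝ) = ∑ l, if y l j ≤ y i j then (1 : ℝ) else 0 := by
    intro y
    rw [rank, Finset.card_filter]
    push_cast
    rfl
  simp_rw [this]
  exact Finset.measurable_sum _ fun l _ => Measurable.ite
    (measurableSet_le (by fun_prop) (by fun_prop)) measurable_const measurable_const

theorem measurable_rhoHat (j k : Fin d) :
    Measurable fun y : Fin n → Fin d → ℝ => rhoHat y j k := by
  have h : ∀ i (j : Fin d), Measurable fun y : Fin n → Fin d → ℝ => centredRank y i j :=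
    measurable_centredRank
  simp only [rhoHat, Matrix.of_apply]
  fun_prop

theorem abs_popTau_le_one (μ : Measure (Fin d → ℝ)) [IsProbabilityMeasure μ] (j k : Fin d) :
    |popTau μ j k| ≤ 1 :=
  abs_integral_le_of_abs_le fun _ => abs_sign_mul_sign_le_one _ _

theorem abs_popRho_le (μ : Measure (Fin d → ℝ)) [IsProbabilityMeasure μ] (j k : Fin d) :
    |popRho μ j k| ≤ 3 := by
  rw [popRho, Matrix.of_apply, abs_mul, abs_of_pos (by norm_num : (0 : ℝ) < 3)]
  have : |∫ p : (Fin d → ℝ) × (Fin d → ℝ) × (Fin d → ℝ),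
      Real.sign (p.1 j - p.2.1 j) * Real.sign (p.1 k - p.2.2 k) ∂(μ.prod (μ.prod μ))| ≤ 1 :=
    abs_integral_le_of_abs_le fun _ => abs_sign_mul_sign_le_one _ _
  linarith

end Statistics

/-- Kendall's tau and Spearman's rho of a Gaussian pair differ by at most a third of the
correlation. -/
theorem abs_arcsin_sub_arcsin_half_le {x : ℝ} (hx : |x| ≤ 1) :
    |2 / Real.pi * Real.arcsin x - 3 * (2 / Real.pi * Real.arcsin (x / 2))| ≤ |x| / 3 := by
  have hpi := Real.pi_pos
  have main : ∀ y : ℝ, 0 ≤ y → y ≤ 1 →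
      |2 / Real.pi * Real.arcsin y - 3 * (2 / Real.pi * Real.arcsin (y / 2))| ≤ y / 3 := by
    intro y h0 h1
    have hanti : AntitoneOn (fun x => 3 * Real.arcsin (x / 2) - Real.arcsin x - x / 2)
        (Set.Icc 0 1) := by
      have hd : ∀ x ∈ interior (Set.Icc (0 : ℝ) 1), HasDerivAt
          (fun x => 3 * Real.arcsin (x / 2) - Real.arcsin x - x / 2)
          (3 * (1 / √(1 - (x / 2) ^ 2) * (1 / 2)) - 1 / √(1 - x ^ 2) - 1 / 2) x := by
        intro x hx
        rw [interior_Icc] at hx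
        have d1 := Real.hasDerivAt_arcsin (x := x) (by linarith [hx.1]) (by linarith [hx.2])
        have d2 := Real.hasDerivAt_arcsin (x := x / 2) (by linarith [hx.1]) (by linarith [hx.2])
        exact ((d2.comp x ((hasDerivAt_id x).div_const 2)).const_mul 3).sub d1
          |>.sub ((hasDerivAt_id x).div_const 2)
      refine antitoneOn_of_deriv_nonpos (convex_Icc 0 1) (by fun_prop)
        (fun x hx => (hd x hx).differentiableAt.differentiableWithinAt) ?_
      · intro x hx
        rw [(hd x hx).deriv]
        rw [interior_Icc] at hx
        have hx2 : x ^ 2 < 1 := by nlinarith [hx.1, hx.2]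
        set q := √(1 - x ^ 2) with hq
        set p := √(1 - (x / 2) ^ 2) with hp
        have hqpos : 0 < q := Real.sqrt_pos.2 (by linarith)
        have hppos : 0 < p := Real.sqrt_pos.2 (by nlinarith)
        have hq2 : q ^ 2 = 1 - x ^ 2 := Real.sq_sqrt (by linarith)
        have hp2 : p ^ 2 = 1 - (x / 2) ^ 2 := Real.sq_sqrt (by nlinarith)
        have hq1 : q ≤ 1 := by nlinarith [sq_nonneg x]
        have hkey : 3 * q ≤ (2 + q) * p := by
          refine (sq_le_sq₀ (by positivity) (by positivity)).1 ?_
          have : ((2 + q) * p) ^ 2 - (3 * q) ^ 2 =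
              (1 - q) * (12 + 24 * q - 5 * q ^ 2 - q ^ 3) / 4 := by
            have : p ^ 2 = (3 + q ^ 2) / 4 := by rw [hp2, hq2]; ring
            rw [mul_pow, this]; ring
          have h5 : 0 ≤ 12 + 24 * q - 5 * q ^ 2 - q ^ 3 := by nlinarith [sq_nonneg q]
          have := mul_nonneg (sub_nonneg.2 hq1) h5
          linarith
        have : 3 * (1 / p * (1 / 2)) - 1 / q - 1 / 2 = (3 * q - (2 + q) * p) / (2 * p * q) := by
          field_simp
          ring
        rw [this]
        exact div_nonpos_of_nonpos_of_nonneg (by linarith) (by positivity)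
    have hu := hanti (Set.left_mem_Icc.2 zero_le_one) ⟨h0, h1⟩ h0
    simp only [zero_div, Real.arcsin_zero, mul_zero, sub_zero] at hu
    have hl1 := two_div_pi_mul_arcsin_le h0 h1
    have hl2 : y / 2 ≤ Real.arcsin (y / 2) :=
      (Real.le_arcsin_iff_sin_le' ⟨by linarith, by linarith [Real.pi_gt_three]⟩).2
        (Real.sin_le (by linarith))
    have hp3 := Real.pi_gt_three
    have hp4 := Real.pi_lt_d2
    have hmul : 2 / Real.pi * Real.pi = 2 := by field_simp
    rw [abs_le]
    constructor
    · have : 2 / Real.pi * (3 * Real.arcsin (y / 2) - Real.arcsin y) ≤ 2 / Real.pi * (y / 2) := by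
        gcongr; linarith
      have h6 : 2 / Real.pi * (y / 2) ≤ y / 3 := by
        rw [div_mul_eq_mul_div, div_le_iff₀ hpi]; nlinarith
      linarith
    · have : 2 / Real.pi * (y / 2) ≤ 2 / Real.pi * Real.arcsin (y / 2) := by gcongr
      have h6 : y * (2 / 9) ≤ 2 / Real.pi * (y / 2) := by
        rw [div_mul_eq_mul_div, le_div_iff₀ hpi]; nlinarith
      linarith
  rcases le_total 0 x with h | h
  · rw [abs_of_nonneg h] at hx ⊢
    exact main x h hx
  · rw [abs_of_nonpos h] at hx ⊢
    have := main (-x) (by linarith) hx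
    rw [neg_div, Real.arcsin_neg, Real.arcsin_neg, ← abs_neg] at this
    convert this using 2
    ring

namespace IsCorrelationMatrix

variable {n d : ℕ} {S : Matrix (Fin d) (Fin d) ℝ}

theorem abs_popTau_sub_popRho_le (hS : IsCorrelationMatrix S) (j k : Fin d) :
    |popTau (normalLaw S) j k - popRho (normalLaw S) j k| ≤ |S j k| / 3 := by
  rw [hS.popTau_normalLaw, hS.popRho_normalLaw]
  exact abs_arcsin_sub_arcsin_half_le (hS.abs_apply_le_one j k)

theorem specNorm_popTau_sub_popRho_le (hS : IsCorrelationMatrix S) :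
    specNorm (popTau (normalLaw S) - popRho (normalLaw S)) ≤ frobNorm S / 3 := by
  refine (specNorm_le_frobNorm _).trans ?_
  refine (sq_le_sq₀ (frobNorm_nonneg _) (div_nonneg (frobNorm_nonneg S) (by norm_num))).1 ?_
  rw [div_pow, frobNorm_sq, frobNorm_sq, Finset.sum_div]
  refine Finset.sum_le_sum fun j _ => ?_
  rw [Finset.sum_div]
  refine Finset.sum_le_sum fun k _ => ?_
  rw [← sq_abs, ← sq_abs (S j k), ← div_pow]
  exact pow_le_pow_left₀ (abs_nonneg _) (hS.abs_popTau_sub_popRho_le j k) 2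

end IsCorrelationMatrix

end GaussianCopula

end

/-! ### Spectral error of the rank correlation matrices -/

noncomputable section

namespace GaussianCopula

namespace IsCorrelationMatrix

variable {n d : ℕ} {S : Matrix (Fin d) (Fin d) ℝ}

theorem sum_sum_mul_sq_add (a b : ℝ) (S : Matrix (Fin d) (Fin d) ℝ) :
    ∑ j, ∑ k, (a * S j k ^ 2 + b) = a * frobNorm S ^ 2 + b * d ^ 2 := by
  simp only [frobNorm_sq, Finset.sum_add_distrib, Finset.mul_sum, Finset.sum_const,
    Finset.card_univ, Fintype.card_fin, nsmul_eq_mul]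
  ring

/-- A bound for random matrices with bounded entries that is only useful for two observations. -/
theorem integral_specNorm_le_of_two (hS : IsCorrelationMatrix S)
    {W : (Fin 2 → Fin d → ℝ) → Matrix (Fin d) (Fin d) ℝ} (hW : ∀ x j k, |W x j k| ≤ 4) :
    ∫ x, specNorm (W x) ∂(Measure.pi fun _ : Fin 2 => normalLaw S) ≤
      8 * specNorm S * (√(((d : ℝ) + 1) / (3 * (2 : ℕ))) + ((d : ℝ) + 1) / (2 : ℕ)) := by
  rcases Nat.eq_zero_or_pos d with rfl | hd
  · simp_rw [specNorm_eq_zero_of_dim_zero]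
    simp
  have hs := hS.one_le_specNorm ⟨0, hd⟩
  have h1 : ∫ x, specNorm (W x) ∂(Measure.pi fun _ : Fin 2 => normalLaw S) ≤ d * 4 := by
    refine (le_abs_self _).trans (abs_integral_le_of_abs_le fun x => ?_)
    rw [abs_of_nonneg (specNorm_nonneg _)]
    exact specNorm_le_of_forall_abs_le (by norm_num) (hW x)
  have h2 := Real.sqrt_nonneg (((d : ℝ) + 1) / (3 * (2 : ℕ)))
  have h3 : (0 : ℝ) ≤ d := Nat.cast_nonneg d
  refine h1.trans ?_
  calc (d : ℝ) * 4 ≤ 8 * 1 * (0 + (d + 1) / (2 : ℕ)) := by push_cast; linarith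
    _ ≤ _ := by gcongr

/-- Kendall's matrix is twice the projected covariance, bounded in spectral norm, plus a remainder,
bounded in Frobenius norm. -/
theorem integral_specNorm_tauHat_sub_le (hS : IsCorrelationMatrix S) (hn : 2 ≤ n) :
    ∫ x : Fin n → Fin d → ℝ, specNorm (tauHat x - popTau (normalLaw S))
        ∂(Measure.pi fun _ : Fin n => normalLaw S) ≤
      √(2 * (d : ℝ) * max ((d : ℝ) - 2 * (n : ℝ)) 0 / ((n : ℝ) * ((n : ℝ) - 1)) +
          4 * (2 / Real.pi + 1) ^ 2 * frobNorm S ^ 2 / (n : ℝ)) +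
        10 * specNorm S * (√(((d : ℝ) + 1) / (3 * (n : ℝ))) + ((d : ℝ) + 1) / (n : ℝ)) := by
  -- the comparison `4 d n ≤ 6.24 d (n - 1)` of the square roots below needs three observations
  rcases hn.eq_or_lt with rfl | hn3
  · refine (hS.integral_specNorm_le_of_two fun x j k => ?_).trans ?_
    · rw [Matrix.sub_apply]
      have h1 := abs_sub (tauHat x j k) (popTau (normalLaw S) j k)
      linarith [abs_tauHat_le_one le_rfl x j k, abs_popTau_le_one (normalLaw S) j k]
    · refine le_add_of_nonneg_of_le (Real.sqrt_nonneg _) ?_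
      have := specNorm_nonneg S
      gcongr
      norm_num
  have hn' : (3 : ℝ) ≤ n := by exact_mod_cast hn3
  set μ := Measure.pi fun _ : Fin n => normalLaw S with hμ
  set D : (Fin n → Fin d → ℝ) → Matrix (Fin d) (Fin d) ℝ := fun x =>
    tauHat x - popTau (normalLaw S) - (2 : ℝ) • signCov (normalLaw S) x with hD
  have hDe : ∀ x j k, D x j k =
      tauHat x j k - popTau (normalLaw S) j k - 2 * signCov (normalLaw S) x j k := fun x j k => by
    simp [hD]
  have mD : ∀ j k, Measurable fun x => D x j k := fun j k => by
    simp_rw [hDe]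
    exact ((measurable_tauHat hn j k).sub_const _).sub
      ((measurable_signCov (normalLaw S) j k).const_mul _)
  have bD : ∀ x j k, |D x j k| ≤ 6 := fun x j k => by
    rw [hDe]
    have h1 := abs_le.1 (abs_tauHat_le_one hn x j k)
    have h2 := abs_le.1 (abs_popTau_le_one (normalLaw S) j k)
    have h3 := abs_le.1 (abs_signCov_le (normalLaw S) x j k)
    rw [abs_le]
    constructor <;> linarith
  have hDint : ∫ x, specNorm (D x) ∂μ ≤ √(∑ j, ∑ k, (4 / n * S j k ^ 2 + 2 / (n * (n - 1)))) :=
    integral_specNorm_le_sqrt mD bD fun j k => by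
      simp_rw [hDe]; exact hS.integral_tauHat_remainder_le hn j k
  rw [sum_sum_mul_sq_add] at hDint
  have hW := hS.integral_specNorm_signCov_le (n := n) (by omega)
  have hsplit : ∫ x : Fin n → Fin d → ℝ, specNorm (tauHat x - popTau (normalLaw S)) ∂μ ≤
      2 * (∫ x, specNorm (signCov (normalLaw S) x) ∂μ) + ∫ x, specNorm (D x) ∂μ := by
    have IW : Integrable (fun x => specNorm (signCov (n := n) (normalLaw S) x)) μ :=
      integrable_specNorm (measurable_signCov _) (abs_signCov_le _)
    have ID : Integrable (fun x => specNorm (D x)) μ := integrable_specNorm mD bD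
    rw [← integral_const_mul, ← integral_add (IW.const_mul 2) ID]
    refine integral_mono_of_nonneg (Filter.Eventually.of_forall fun _ => specNorm_nonneg _)
      ((IW.const_mul 2).add ID) (Filter.Eventually.of_forall fun x => ?_)
    have e : tauHat x - popTau (normalLaw S) = (2 : ℝ) • signCov (normalLaw S) x + D x := by
      simp [hD]
    beta_reduce
    rw [e]
    refine (specNorm_add_le _ _).trans ?_
    rw [specNorm_smul, abs_of_pos (by norm_num)]
  have hF := hS.card_le_frobNorm_sq
  have hd0 : (0 : ℝ) ≤ d := Nat.cast_nonneg d
  have hc : 2.56 ≤ (2 / Real.pi + 1) ^ 2 := by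
    have : 0.6 ≤ 2 / Real.pi := by
      rw [le_div_iff₀ Real.pi_pos]; linarith [Real.pi_lt_d2]
    nlinarith
  have hsqrt : 4 / n * frobNorm S ^ 2 + 2 / (n * (n - 1)) * d ^ 2 ≤
      2 * (d : ℝ) * max ((d : ℝ) - 2 * (n : ℝ)) 0 / ((n : ℝ) * ((n : ℝ) - 1)) +
          4 * (2 / Real.pi + 1) ^ 2 * frobNorm S ^ 2 / (n : ℝ) := by
    have hmax := le_max_left ((d : ℝ) - 2 * n) 0
    have hn1 : (0 : ℝ) < n - 1 := by linarith
    have hn0 : (0 : ℝ) < n := by linarith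
    have e1 : 4 / n * frobNorm S ^ 2 + 2 / (n * (n - 1)) * d ^ 2 =
        (4 * frobNorm S ^ 2 * (n - 1) + 2 * d ^ 2) / (n * (n - 1)) := by field_simp
    have e2 : 2 * (d : ℝ) * max ((d : ℝ) - 2 * (n : ℝ)) 0 / ((n : ℝ) * ((n : ℝ) - 1)) +
        4 * (2 / Real.pi + 1) ^ 2 * frobNorm S ^ 2 / (n : ℝ) =
        (2 * d * max ((d : ℝ) - 2 * (n : ℝ)) 0 + 4 * (2 / Real.pi + 1) ^ 2 * frobNorm S ^ 2 *
          (n - 1)) / (n * (n - 1)) := by field_simp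
    rw [e1, e2]
    refine div_le_div_of_nonneg_right ?_ (by positivity)
    have h1 : 2 * (d : ℝ) * (d - 2 * n) ≤ 2 * d * max ((d : ℝ) - 2 * (n : ℝ)) 0 := by gcongr
    have h2 : 4 * 2.56 * (frobNorm S ^ 2 * (n - 1)) ≤
        4 * (2 / Real.pi + 1) ^ 2 * (frobNorm S ^ 2 * (n - 1)) := by
      have : 0 ≤ frobNorm S ^ 2 * ((n : ℝ) - 1) := by positivity
      gcongr
    have h3 : d * ((n : ℝ) - 1) ≤ frobNorm S ^ 2 * (n - 1) := by gcongr
    nlinarith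
  have := Real.sqrt_le_sqrt hsqrt
  linarith

/-- Spearman's matrix is a convex combination of a U-statistic of order three and Kendall's tau,
with population values that differ by at most `|S j k| / 3`; the term `frobNorm S / n` is this bias.
-/
theorem integral_specNorm_rhoHat_sub_le (hS : IsCorrelationMatrix S) (hn : 2 ≤ n) :
    ∫ x : Fin n → Fin d → ℝ, specNorm (rhoHat x - popRho (normalLaw S))
        ∂(Measure.pi fun _ : Fin n => normalLaw S) ≤
      √(6 * (d : ℝ) * ((d : ℝ) - 2 * (n : ℝ)) / ((n : ℝ) * ((n : ℝ) - 1)) +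
          9 * (1 + √8 / Real.pi) ^ 2 * frobNorm S ^ 2 / (n : ℝ)) +
        15 * specNorm S * (√(((d : ℝ) + 1) / (3 * (n : ℝ))) + ((d : ℝ) + 1) / (n : ℝ)) +
        frobNorm S / (n : ℝ) := by
  -- for two observations there is no U-statistic of order three
  rcases hn.eq_or_lt with rfl | hn3
  · refine (hS.integral_specNorm_le_of_two fun x j k => ?_).trans ?_
    · rw [Matrix.sub_apply]
      have h1 := abs_sub (rhoHat x j k) (popRho (normalLaw S) j k)
      linarith [abs_rhoHat_le_one x j k, abs_popRho_le (normalLaw S) j k]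
    · refine le_add_of_le_of_nonneg (le_add_of_nonneg_of_le (Real.sqrt_nonneg _) ?_)
        (div_nonneg (frobNorm_nonneg S) (Nat.cast_nonneg _))
      have := specNorm_nonneg S
      gcongr
      norm_num
  have hn' : (3 : ℝ) ≤ n := by exact_mod_cast hn3
  set μ := Measure.pi fun _ : Fin n => normalLaw S with hμ
  set U : Fin d → Fin d → (Fin n → Fin d → ℝ) → ℝ := fun j k =>
    uStat (fun z : Fin 3 → Fin d → ℝ => rhoKernel j k (z 0) (z 1) (z 2)) with hU
  set T := popTau (normalLaw S) with hT
  set R := popRho (normalLaw S) with hR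
  set W : (Fin n → Fin d → ℝ) → Matrix (Fin d) (Fin d) ℝ := signCov (normalLaw S) with hWdef
  set p : ℝ := ((n : ℝ) - 2) / (n + 1) with hp
  set q : ℝ := 3 / ((n : ℝ) + 1) with hq
  have hn1 : (0 : ℝ) < n + 1 := by linarith
  have hp0 : 0 ≤ p := div_nonneg (by linarith) hn1.le
  have hq0 : 0 ≤ q := by positivity
  have hpq : p + q = 1 := by rw [hp, hq]; field_simp; ring
  set D : (Fin n → Fin d → ℝ) → Matrix (Fin d) (Fin d) ℝ := fun x => Matrix.of fun j k =>
    p * (U j k x - R j k - 3 * W x j k) + q * (tauHat x j k - T j k - 2 * W x j k) with hD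
  have mU : ∀ j k, Measurable (U j k) := fun j k => measurable_uStat (measurable_rhoKernel_pi j k)
  have mW : ∀ j k, Measurable fun x => W x j k := measurable_signCov (normalLaw S)
  have bU : ∀ x j k, |U j k x| ≤ 3 := fun x j k =>
    abs_uStat_le hn3 (fun z => abs_rhoKernel_le j k _ _ _) x
  have b1 : ∀ x j k, |U j k x - R j k - 3 * W x j k| ≤ 12 := fun x j k => by
    have h1 := abs_le.1 (bU x j k)
    have h2 := abs_le.1 (abs_popRho_le (normalLaw S) j k)
    have h3 := abs_le.1 (abs_signCov_le (normalLaw S) x j k)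
    rw [abs_le]
    constructor <;> linarith
  have b2 : ∀ x j k, |tauHat x j k - T j k - 2 * W x j k| ≤ 6 := fun x j k => by
    have h1 := abs_le.1 (abs_tauHat_le_one hn x j k)
    have h2 := abs_le.1 (abs_popTau_le_one (normalLaw S) j k)
    have h3 := abs_le.1 (abs_signCov_le (normalLaw S) x j k)
    rw [abs_le]
    constructor <;> linarith
  have m1 : ∀ j k, Measurable fun x => U j k x - R j k - 3 * W x j k := fun j k =>
    ((mU j k).sub_const _).sub ((mW j k).const_mul _)
  have m2 : ∀ j k, Measurable fun x : Fin n → Fin d → ℝ =>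
      tauHat x j k - T j k - 2 * W x j k := fun j k =>
    ((measurable_tauHat hn j k).sub_const _).sub ((mW j k).const_mul _)
  have mD : ∀ j k, Measurable fun x => D x j k := fun j k =>
    ((m1 j k).const_mul p).add ((m2 j k).const_mul q)
  have bD : ∀ x j k, |D x j k| ≤ 12 := fun x j k => by
    have h1 := abs_le.1 (b1 x j k)
    have h2 := abs_le.1 (b2 x j k)
    simp only [hD, Matrix.of_apply]
    rw [abs_le]
    constructor <;> nlinarith
  have hV : ∀ j k, ∫ x, D x j k ^ 2 ∂μ ≤ 9 / n * S j k ^ 2 + 6 / (n * (n - 1)) := fun j k => by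
    have hn1' : (0 : ℝ) < n * (n - 1) := mul_pos (by linarith) (by linarith)
    have i1 : Integrable (fun x => (U j k x - R j k - 3 * W x j k) ^ 2) μ :=
      integrable_of_bounded ((m1 j k).pow_const 2) fun x => sq_of_abs_le (b1 x j k)
    have i2 : Integrable (fun x : Fin n → Fin d → ℝ =>
        (tauHat x j k - T j k - 2 * W x j k) ^ 2) μ :=
      integrable_of_bounded ((m2 j k).pow_const 2) fun x => sq_of_abs_le (b2 x j k)
    calc ∫ x, D x j k ^ 2 ∂μ ≤ ∫ x, (p * (U j k x - R j k - 3 * W x j k) ^ 2 +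
          q * (tauHat x j k - T j k - 2 * W x j k) ^ 2) ∂μ := by
          refine integral_mono_of_nonneg (Filter.Eventually.of_forall fun _ => sq_nonneg _)
            ((i1.const_mul p).add (i2.const_mul q)) (Filter.Eventually.of_forall fun x => ?_)
          simp only [hD, Matrix.of_apply]
          set a := U j k x - R j k - 3 * W x j k
          set b := tauHat x j k - T j k - 2 * W x j k
          have : p * a ^ 2 + q * b ^ 2 - (p * a + q * b) ^ 2 = p * q * (a - b) ^ 2 := by
            rw [show q = 1 - p by linarith]; ring
          nlinarith [mul_nonneg (mul_nonneg hp0 hq0) (sq_nonneg (a - b))]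
      _ = p * (∫ x, (U j k x - R j k - 3 * W x j k) ^ 2 ∂μ) +
          q * ∫ x, (tauHat x j k - T j k - 2 * W x j k) ^ 2 ∂μ := by
          rw [integral_add (i1.const_mul p) (i2.const_mul q), integral_const_mul,
            integral_const_mul]
      _ ≤ p * (9 / n * S j k ^ 2 + 6 / (n * (n - 1))) +
          q * (4 / n * S j k ^ 2 + 2 / (n * (n - 1))) := by
          gcongr
          · exact hS.integral_rhoU_remainder_le hn3 j k
          · exact hS.integral_tauHat_remainder_le hn j k
      _ ≤ p * (9 / n * S j k ^ 2 + 6 / (n * (n - 1))) +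
          q * (9 / n * S j k ^ 2 + 6 / (n * (n - 1))) := by
          gcongr <;> norm_num
      _ = _ := by rw [← add_mul, hpq, one_mul]
  have hDint := integral_specNorm_le_sqrt (P := μ) mD bD hV
  rw [sum_sum_mul_sq_add] at hDint
  have hWi := hS.integral_specNorm_signCov_le (n := n) (by omega)
  have hsplit : ∫ x : Fin n → Fin d → ℝ, specNorm (rhoHat x - R) ∂μ ≤
      3 * (∫ x, specNorm (W x) ∂μ) + (∫ x, specNorm (D x) ∂μ) + frobNorm S / n := by
    have IW : Integrable (fun x => specNorm (W x)) μ :=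
      integrable_specNorm mW (abs_signCov_le _)
    have ID : Integrable (fun x => specNorm (D x)) μ := integrable_specNorm mD bD
    have e : (∫ x, (3 * specNorm (W x) + specNorm (D x) + frobNorm S / n) ∂μ) =
        3 * (∫ x, specNorm (W x) ∂μ) + (∫ x, specNorm (D x) ∂μ) + frobNorm S / n := by
      rw [integral_add (f := fun x => 3 * specNorm (W x) + specNorm (D x))
        (g := fun _ => frobNorm S / n)
        ((IW.const_mul 3).add ID) (integrable_const _),
        integral_add (IW.const_mul 3) ID, integral_const_mul]
      simp
    rw [← e]
    refine integral_mono_of_nonneg (Filter.Eventually.of_forall fun _ => specNorm_nonneg _)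
      (((IW.const_mul 3).add ID).add (integrable_const _)) ?_
    filter_upwards [hS.ae_injective n] with x hx
    have e : rhoHat x - R = ((3 * p + 2 * q) • W x + D x) + q • (T - R) := by
      ext j k
      simp only [Matrix.sub_apply, Matrix.add_apply, Matrix.smul_apply, smul_eq_mul, hD,
        Matrix.of_apply, rhoHat_eq hn (hx j) (hx k)]
      rw [← hp, ← hq]
      have : R j k = (p + q) * R j k := by rw [hpq, one_mul]
      rw [this]
      simp only [hU]
      ring_nf
      rw [show q = 1 - p by linarith]
      ring
    rw [e]
    refine (specNorm_add_le _ _).trans (add_le_add ((specNorm_add_le _ _).trans ?_) ?_)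
    · rw [specNorm_smul, abs_of_nonneg (by positivity)]
      have := specNorm_nonneg (W x)
      gcongr
      linarith
    · rw [specNorm_smul, abs_of_nonneg hq0]
      have h1 : specNorm (T - R) ≤ frobNorm S / 3 := hS.specNorm_popTau_sub_popRho_le
      have hF := frobNorm_nonneg S
      calc q * specNorm (T - R) ≤ q * (frobNorm S / 3) := by gcongr
        _ = frobNorm S / (n + 1) := by rw [hq]; field_simp
        _ ≤ frobNorm S / n := by gcongr; linarith
  have hF := hS.card_le_frobNorm_sq
  have hd0 : (0 : ℝ) ≤ d := Nat.cast_nonneg d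
  have hc : 3.24 ≤ (1 + √8 / Real.pi) ^ 2 := by
    have h8 : 2.8 ≤ √8 := Real.le_sqrt_of_sq_le (by norm_num)
    have : 0.8 ≤ √8 / Real.pi := by
      rw [le_div_iff₀ Real.pi_pos]; linarith [Real.pi_lt_d2]
    nlinarith
  have hsqrt : 9 / n * frobNorm S ^ 2 + 6 / (n * (n - 1)) * d ^ 2 ≤
      6 * (d : ℝ) * ((d : ℝ) - 2 * (n : ℝ)) / ((n : ℝ) * ((n : ℝ) - 1)) +
          9 * (1 + √8 / Real.pi) ^ 2 * frobNorm S ^ 2 / (n : ℝ) := by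
    have hn1 : (0 : ℝ) < n - 1 := by linarith
    have hn0 : (0 : ℝ) < n := by linarith
    have e1 : 9 / n * frobNorm S ^ 2 + 6 / (n * (n - 1)) * d ^ 2 =
        (9 * frobNorm S ^ 2 * (n - 1) + 6 * d ^ 2) / (n * (n - 1)) := by field_simp
    have e2 : 6 * (d : ℝ) * ((d : ℝ) - 2 * (n : ℝ)) / ((n : ℝ) * ((n : ℝ) - 1)) +
        9 * (1 + √8 / Real.pi) ^ 2 * frobNorm S ^ 2 / (n : ℝ) =
        (6 * d * (d - 2 * n) + 9 * (1 + √8 / Real.pi) ^ 2 * frobNorm S ^ 2 *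
          (n - 1)) / (n * (n - 1)) := by field_simp
    rw [e1, e2]
    refine div_le_div_of_nonneg_right ?_ (by positivity)
    have h2 : 9 * 3.24 * (frobNorm S ^ 2 * (n - 1)) ≤
        9 * (1 + √8 / Real.pi) ^ 2 * (frobNorm S ^ 2 * (n - 1)) := by
      have : 0 ≤ frobNorm S ^ 2 * ((n : ℝ) - 1) := by positivity
      gcongr
    have h3 : d * ((n : ℝ) - 1) ≤ frobNorm S ^ 2 * (n - 1) := by gcongr
    nlinarith
  have := Real.sqrt_le_sqrt hsqrt
  linarith

end IsCorrelationMatrix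

end GaussianCopula

end

/-! ### Linearisation of the sine -/

noncomputable section

namespace GaussianCopula

/-- The error `x - sin x` of the linearisation of the sine. -/
def sinDefect (x : ℝ) : ℝ := x - Real.sin x

theorem sinDefect_neg (x : ℝ) : sinDefect (-x) = -sinDefect x := by
  simp [sinDefect]; ring

theorem measurable_sinDefect : Measurable sinDefect := by
  unfold sinDefect; fun_prop

theorem abs_sinDefect_sub_le (a b : ℝ) : |sinDefect b - sinDefect a| ≤ 2 * |b - a| := by
  have h := Real.abs_sin_sub_sin_le b a
  have h2 := abs_sub (b - a) (Real.sin b - Real.sin a)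
  rw [show sinDefect b - sinDefect a = b - a - (Real.sin b - Real.sin a) by
    simp only [sinDefect]; ring]
  linarith

theorem one_sub_cos_le_sq_mul_cos {x : ℝ} (hx : |x| ≤ Real.pi / 2) :
    1 - Real.cos x ≤ x ^ 2 / 2 * Real.cos (x / 3) := by
  set c := Real.cos (x / 3) with hc
  have hx3 : |x / 3| ≤ Real.pi / 3 := by
    rw [abs_div, abs_of_pos (by norm_num : (0 : ℝ) < 3)]
    linarith [Real.pi_pos]
  have hc2 : 1 / 2 ≤ c := by
    rw [hc, ← Real.cos_abs, ← Real.cos_pi_div_three]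
    exact Real.cos_le_cos_of_nonneg_of_le_pi (abs_nonneg _) (by linarith [Real.pi_pos]) hx3
  have hc1 : c ≤ 1 := Real.cos_le_one _
  have e1 : Real.cos x = 4 * c ^ 3 - 3 * c := by
    rw [hc, ← Real.cos_three_mul]; congr 1; ring
  -- `2 sin² (x / 6) = 1 - c` compares `x²` with `c`
  have e2 : 1 - c ≤ x ^ 2 / 18 := by
    have h := Real.one_sub_sq_div_two_le_cos (x := x / 3)
    rw [← hc] at h
    linarith [h, show (x / 3) ^ 2 / 2 = x ^ 2 / 18 by ring]
  rw [e1]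
  nlinarith [mul_nonneg (sub_nonneg.2 hc1) (by linarith : 0 ≤ 4 * c - 1),
    mul_nonneg (mul_nonneg (sub_nonneg.2 hc1) (by linarith : 0 ≤ 4 * c - 1)) (sub_nonneg.2 hc1),
    mul_le_mul_of_nonneg_right e2 (by linarith : 0 ≤ c)]

theorem sinDefect_le_sq_mul_sin {x : ℝ} (h0 : 0 ≤ x) (hx : x ≤ Real.pi / 2) :
    sinDefect x ≤ x ^ 2 / 2 * Real.sin (x / 3) := by
  have hd : ∀ y ∈ interior (Set.Icc 0 (Real.pi / 2)),
      HasDerivAt (fun y => y ^ 2 / 2 * Real.sin (y / 3) - (y - Real.sin y))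
      ((2 * y ^ 1 / 2 * Real.sin (y / 3) + y ^ 2 / 2 * (Real.cos (y / 3) * (1 / 3))) -
        (1 - Real.cos y)) y := by
    intro y _
    have h1 := ((hasDerivAt_id y).div_const 3).sin
    have h2 := (hasDerivAt_pow 2 y).div_const 2
    exact (h2.mul h1).sub ((hasDerivAt_id y).sub (Real.hasDerivAt_sin y))
  have hmono : MonotoneOn (fun y => y ^ 2 / 2 * Real.sin (y / 3) - (y - Real.sin y))
      (Set.Icc 0 (Real.pi / 2)) := by
    refine monotoneOn_of_deriv_nonneg (convex_Icc _ _) (by fun_prop)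
      (fun y hy => (hd y hy).differentiableAt.differentiableWithinAt) fun y hy => ?_
    rw [(hd y hy).deriv]
    rw [interior_Icc] at hy
    have h1 := one_sub_cos_le_sq_mul_cos (x := y) (by rw [abs_of_pos hy.1]; exact hy.2.le)
    have h2 : y / 3 * Real.cos (y / 3) ≤ Real.sin (y / 3) := by
      have hcos : 0 < Real.cos (y / 3) := Real.cos_pos_of_mem_Ioo
        ⟨by linarith [hy.1, Real.pi_pos], by linarith [hy.1, hy.2]⟩
      have := Real.le_tan (x := y / 3) (by linarith [hy.1]) (by linarith [hy.1, hy.2])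
      rwa [Real.tan_eq_sin_div_cos, le_div_iff₀ hcos] at this
    have h3 := mul_le_mul_of_nonneg_left h2 hy.1.le
    nlinarith
  have := hmono (Set.left_mem_Icc.2 (by positivity)) ⟨h0, hx⟩ h0
  simp only [Real.sin_zero, sub_self, zero_div, mul_zero] at this
  rw [sinDefect]
  linarith

/-- Second-order expansion of `sinDefect` at `a`, where the Lagrange remainder of `sin` is bounded
by the value at the centre of mass `a + (b - a) / 3` of the weight `1 - u`, `0 ≤ u ≤ 1`. -/
theorem sinDefect_sub_le_of_le {a b β : ℝ} (ha : 0 ≤ a) (hab : a ≤ b) (hb : b ≤ β)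
    (hβ : β ≤ Real.pi / 2) :
    sinDefect b - sinDefect a ≤ (1 - Real.cos a) * (b - a) +
      Real.sin (a + (β - a) / 3) / 2 * (b - a) ^ 2 := by
  have hc := Real.cos_nonneg_of_mem_Icc (x := a) ⟨by linarith [Real.pi_pos], by linarith⟩
  have hs := Real.sin_nonneg_of_nonneg_of_le_pi (x := a) ha (by linarith [Real.pi_pos])
  set δ := b - a with hδ
  have hδ0 : 0 ≤ δ := by linarith
  have h1 := one_sub_cos_le_sq_mul_cos (x := δ) (by rw [abs_of_nonneg hδ0]; linarith)
  have h2 := sinDefect_le_sq_mul_sin hδ0 (by linarith)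
  have e : Real.sin b = Real.sin a * Real.cos δ + Real.cos a * Real.sin δ := by
    rw [← Real.sin_add]; congr 1; ring
  have h3 : Real.sin (a + δ / 3) ≤ Real.sin (a + (β - a) / 3) :=
    Real.sin_le_sin_of_le_of_le_pi_div_two (by linarith [Real.pi_pos]) (by linarith) (by linarith)
  rw [Real.sin_add] at h3
  have h4 := mul_le_mul_of_nonneg_left h3 (by positivity : 0 ≤ δ ^ 2 / 2)
  have h5 := mul_le_mul_of_nonneg_left h1 hs
  have h6 := mul_le_mul_of_nonneg_left h2 hc
  simp only [sinDefect] at h6 ⊢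
  rw [e]
  nlinarith

theorem sinDefect_sub_le_of_abs_le {a b : ℝ} (hb : -a ≤ b) (hba : b ≤ a) (ha : a ≤ Real.pi / 2) :
    sinDefect a - sinDefect b ≤ (1 - Real.cos a) * (a - b) := by
  have hmono : MonotoneOn (fun y => Real.sin y - Real.cos a * y) (Set.Icc (-a) a) := by
    have hd : ∀ y, HasDerivAt (fun y => Real.sin y - Real.cos a * y)
        (Real.cos y - Real.cos a * 1) y := fun y =>
      (Real.hasDerivAt_sin y).sub ((hasDerivAt_id y).const_mul _)
    refine monotoneOn_of_deriv_nonneg (convex_Icc _ _) (by fun_prop)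
      (fun y _ => (hd y).differentiableAt.differentiableWithinAt) fun y hy => ?_
    rw [(hd y).deriv, mul_one, sub_nonneg, ← Real.cos_abs y]
    rw [interior_Icc] at hy
    exact Real.cos_le_cos_of_nonneg_of_le_pi (abs_nonneg _) (by linarith [Real.pi_pos])
      (abs_le.2 ⟨hy.1.le, hy.2.le⟩)
  have := hmono ⟨hb, hba⟩ (Set.right_mem_Icc.2 (by linarith)) hba
  simp only [sinDefect] at this ⊢
  linarith

theorem abs_sinDefect_sub_le_of_nonneg {a b β : ℝ} (ha : 0 ≤ a) (haβ : a ≤ β) (hb : |b| ≤ β)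
    (hβ : β ≤ Real.pi / 2) :
    |sinDefect b - sinDefect a| ≤ (1 - Real.cos a) * |b - a| +
      Real.sin (a + (β - a) / 3) / 2 * (b - a) ^ 2 := by
  have hb' := abs_le.1 hb
  have hA : 0 ≤ 1 - Real.cos a := sub_nonneg.2 (Real.cos_le_one a)
  have hB : 0 ≤ Real.sin (a + (β - a) / 3) / 2 := div_nonneg
    (Real.sin_nonneg_of_nonneg_of_le_pi (by linarith) (by linarith [Real.pi_pos])) (by norm_num)
  have hmono : Monotone sinDefect := fun x y hxy => by
    have := (abs_le.1 (Real.abs_sin_sub_sin_le y x)).2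
    rw [abs_of_nonneg (by linarith)] at this
    simp only [sinDefect]
    linarith
  rcases le_total a b with hab | hab
  · rw [abs_of_nonneg (sub_nonneg.2 (hmono hab)), abs_of_nonneg (sub_nonneg.2 hab)]
    exact sinDefect_sub_le_of_le ha hab hb'.2 hβ
  · rw [abs_of_nonpos (sub_nonpos.2 (hmono hab)), abs_of_nonpos (sub_nonpos.2 hab), neg_sub,
      neg_sub]
    rcases le_total (-a) b with h | h
    · have h1 := sinDefect_sub_le_of_abs_le h hab (haβ.trans hβ)
      have h2 := mul_nonneg hB (sq_nonneg (b - a))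
      linarith
    · have h1 := sinDefect_sub_le_of_abs_le le_rfl (by linarith) (haβ.trans hβ)
      have h2 := sinDefect_sub_le_of_le ha (by linarith : a ≤ -b) (by linarith) hβ
      rw [sinDefect_neg] at h1 h2
      have h3 : Real.sin (a + (β - a) / 3) / 2 * (-b - a) ^ 2 ≤
          Real.sin (a + (β - a) / 3) / 2 * (b - a) ^ 2 := by
        refine mul_le_mul_of_nonneg_left ?_ hB
        nlinarith
      linarith

/-- The second-order expansion of `sinDefect` at `a`, for arguments of modulus at most `β`; the
second derivative `sin` is evaluated at the centre of mass of the remainder weight. -/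
theorem abs_sinDefect_sub_le_quadratic {a b β : ℝ} (haβ : |a| ≤ β) (hb : |b| ≤ β)
    (hβ : β ≤ Real.pi / 2) :
    |sinDefect b - sinDefect a| ≤ (1 - Real.cos a) * |b - a| +
      Real.sin (|a| + (β - |a|) / 3) / 2 * (b - a) ^ 2 := by
  rcases le_total 0 a with h | h
  · rw [abs_of_nonneg h] at haβ ⊢
    exact abs_sinDefect_sub_le_of_nonneg h haβ hb hβ
  · rw [abs_of_nonpos h] at haβ ⊢
    have := abs_sinDefect_sub_le_of_nonneg (b := -b) (by linarith) haβ (by rwa [abs_neg]) hβ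
    rw [sinDefect_neg, sinDefect_neg, Real.cos_neg, ← abs_neg, ← abs_neg (-b - -a),
      ← neg_sq (-b - -a)] at this
    convert this using 3 <;> ring_nf

theorem mul_sin_le_sin_mul {u y : ℝ} (hu0 : 0 ≤ u) (hu1 : u ≤ 1) (hy0 : 0 ≤ y)
    (hy : y ≤ Real.pi) : u * Real.sin y ≤ Real.sin (u * y) := by
  have := strictConcaveOn_sin_Icc.concaveOn.2 (Set.left_mem_Icc.2 Real.pi_pos.le) ⟨hy0, hy⟩
    (sub_nonneg.2 hu1) hu0 (by ring)
  simpa using this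

theorem sin_pi_div_two_mul_ge {t : ℝ} (h0 : 0 ≤ t) (h1 : t ≤ 1) :
    t * (3 - t ^ 2) / 2 ≤ Real.sin (Real.pi / 2 * t) := by
  -- `sin (π t / 2) = 3 s - 4 s³` with `s = sin (π t / 6) ≥ t / 2`
  set s := Real.sin (t * (Real.pi / 6)) with hs
  have hst : t * (1 / 2) ≤ s := by
    rw [hs, ← Real.sin_pi_div_six]
    exact mul_sin_le_sin_mul h0 h1 (by positivity) (by linarith [Real.pi_pos])
  have hs1 : s ≤ 1 / 2 := by
    rw [hs, ← Real.sin_pi_div_six]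
    have := Real.pi_pos
    exact Real.sin_le_sin_of_le_of_le_pi_div_two (by nlinarith) (by linarith) (by nlinarith)
  have e : Real.sin (Real.pi / 2 * t) = 3 * s - 4 * s ^ 3 := by
    rw [hs, ← Real.sin_three_mul]; congr 1; ring
  rw [e]
  nlinarith [mul_nonneg (sub_nonneg.2 hst)
    (by nlinarith : 0 ≤ 3 - 4 * (s ^ 2 + s * (t / 2) + t ^ 2 / 4))]

/-- The second-order coefficient at `a = π t / 2` for the range `[-π / 2, π / 2]`. -/
theorem sin_centre_le {t : ℝ} (h0 : 0 ≤ t) (h1 : t ≤ 1) :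
    Real.sin (Real.pi / 2 * t + (Real.pi / 2 - Real.pi / 2 * t) / 3) ≤ (1 + 2 * t - t ^ 2) / 2 := by
  -- with `u = 1 - t` the left side is `cos (π u / 3) = 1 - 2 sin² (π u / 6)`
  have h := mul_sin_le_sin_mul (u := 1 - t) (y := Real.pi / 6) (by linarith) (by linarith)
    (by positivity) (by linarith [Real.pi_pos])
  rw [Real.sin_pi_div_six] at h
  have e : Real.sin (Real.pi / 2 * t + (Real.pi / 2 - Real.pi / 2 * t) / 3) =
      1 - 2 * Real.sin ((1 - t) * (Real.pi / 6)) ^ 2 := by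
    rw [← Real.cos_pi_div_two_sub, ← Real.cos_two_mul_eq_one_sub]
    congr 1; ring
  rw [e]
  nlinarith

end GaussianCopula

end

/-! ### Sine transform of Kendall's tau -/

noncomputable section

namespace GaussianCopula

/-- Minkowski's inequality for a linear plus a quadratic term. -/
theorem integral_sq_le_of_abs_le_quadratic {α : Type*} [MeasurableSpace α] {P : Measure α}
    [IsProbabilityMeasure P] {G X : α → ℝ} {A B C e₂ e₄ : ℝ} (mX : Measurable X)
    (hX : ∀ ω, |X ω| ≤ C) (hA : 0 ≤ A) (hB : 0 ≤ B) (he₂ : 0 ≤ e₂) (he₄ : 0 ≤ e₄)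
    (hG : ∀ᵐ ω ∂P, |G ω| ≤ A * |X ω| + B * X ω ^ 2) (h2 : ∫ ω, X ω ^ 2 ∂P ≤ e₂ ^ 2)
    (h4 : ∫ ω, X ω ^ 4 ∂P ≤ e₄ ^ 2) : ∫ ω, G ω ^ 2 ∂P ≤ (A * e₂ + B * e₄) ^ 2 := by
  have hp : ∀ (p : ℕ) ω, |(|X ω|) ^ p| ≤ C ^ p := fun p ω => by
    rw [abs_of_nonneg (by positivity)]
    exact pow_le_pow_left₀ (abs_nonneg _) (hX ω) p
  have I : ∀ p : ℕ, Integrable (fun ω => |X ω| ^ p) P := fun p =>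
    integrable_of_bounded (by fun_prop) (hp p)
  have e2 : ∀ ω, X ω ^ 2 = |X ω| ^ 2 := fun ω => (sq_abs _).symm
  have e4 : ∀ ω, X ω ^ 4 = |X ω| ^ 4 := fun ω => ((even_two_mul 2).pow_abs (X ω)).symm
  simp_rw [e4] at h4
  simp_rw [e2] at h2 hG
  set M2 := ∫ ω, |X ω| ^ 2 ∂P with hM2
  set M3 := ∫ ω, |X ω| ^ 3 ∂P with hM3
  set M4 := ∫ ω, |X ω| ^ 4 ∂P with hM4
  have expand : ∀ a b : ℝ, ∫ ω, (a * |X ω| + b * |X ω| ^ 2) ^ 2 ∂P =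
      a ^ 2 * M2 + 2 * a * b * M3 + b ^ 2 * M4 := by
    intro a b
    have e : ∀ ω, (a * |X ω| + b * |X ω| ^ 2) ^ 2 =
        a ^ 2 * |X ω| ^ 2 + 2 * a * b * |X ω| ^ 3 + b ^ 2 * |X ω| ^ 4 := fun ω => by ring
    have I23 : Integrable (fun ω => a ^ 2 * |X ω| ^ 2 + 2 * a * b * |X ω| ^ 3) P :=
      ((I 2).const_mul _).add ((I 3).const_mul _)
    simp_rw [e]
    rw [integral_add I23 ((I 4).const_mul _), integral_add ((I 2).const_mul _) ((I 3).const_mul _),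
      integral_const_mul, integral_const_mul, integral_const_mul]
  have hM40 : 0 ≤ M4 := integral_nonneg fun _ => by positivity
  have hCS : M3 ≤ e₂ * e₄ := by
    have h := discrim_le_zero (a := M2) (b := -2 * M3) (c := M4) fun s => by
      have h0 : 0 ≤ ∫ ω, (s * |X ω| + -1 * |X ω| ^ 2) ^ 2 ∂P := integral_nonneg fun _ => sq_nonneg _
      rw [expand] at h0
      linarith
    rw [discrim] at h
    have h5 : M2 * M4 ≤ e₂ ^ 2 * e₄ ^ 2 := by gcongr
    refine (le_abs_self _).trans (abs_le_of_sq_le_sq ?_ (mul_nonneg he₂ he₄))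
    linarith [show (e₂ * e₄) ^ 2 = e₂ ^ 2 * e₄ ^ 2 by ring, show (-2 * M3) ^ 2 = 4 * M3 ^ 2 by ring]
  calc ∫ ω, G ω ^ 2 ∂P ≤ ∫ ω, (A * |X ω| + B * |X ω| ^ 2) ^ 2 ∂P := by
        refine integral_mono_of_nonneg (Filter.Eventually.of_forall fun _ => sq_nonneg _) ?_ ?_
        · refine integrable_of_bounded (by fun_prop) (C := (A * C + B * C ^ 2) ^ 2) fun ω => ?_
          have h1 := hX ω
          exact sq_of_abs_le (by rw [abs_of_nonneg (by positivity)]; gcongr)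
        · filter_upwards [hG] with ω hω
          rw [← sq_abs]
          exact pow_le_pow_left₀ (abs_nonneg _) hω 2
    _ = A ^ 2 * M2 + 2 * A * B * M3 + B ^ 2 * M4 := expand A B
    _ ≤ A ^ 2 * e₂ ^ 2 + 2 * A * B * (e₂ * e₄) + B ^ 2 * e₄ ^ 2 := by gcongr
    _ = _ := by ring

theorem abs_le_mul_abs_sin {x : ℝ} (hx : |x| ≤ Real.pi / 2) : |x| ≤ Real.pi / 2 * |Real.sin x| := by
  have h := Real.mul_le_sin (abs_nonneg x) hx
  rw [Real.abs_sin_eq_sin_abs_of_abs_le_pi (by linarith [Real.pi_pos])]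
  have := mul_le_mul_of_nonneg_left h (by positivity : 0 ≤ Real.pi / 2)
  rwa [show Real.pi / 2 * (2 / Real.pi * |x|) = |x| by field_simp] at this

theorem abs_sinDefect_le {x : ℝ} (hx : |x| ≤ Real.pi / 2) :
    |sinDefect x| ≤ (1 - 2 / Real.pi) * |x| := by
  have main : ∀ y : ℝ, 0 ≤ y → y ≤ Real.pi / 2 → |sinDefect y| ≤ (1 - 2 / Real.pi) * y := by
    intro y h0 h1
    have h2 := Real.mul_le_sin h0 h1
    have h3 := Real.sin_le h0
    rw [sinDefect, abs_of_nonneg (by linarith)]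
    linarith
  rcases le_total 0 x with h | h
  · rw [abs_of_nonneg h] at hx ⊢
    exact main x h hx
  · rw [abs_of_nonpos h] at hx ⊢
    have := main (-x) (by linarith) hx
    rwa [sinDefect_neg, abs_neg] at this

/-- A bound `√3 Q / m` of the square root of the fourth moment of a mean of `m` signs, and the
polynomial inequality it satisfies. -/
theorem exists_fourth_moment_bound {t : ℝ} (h0 : 0 ≤ t) (h1 : t ≤ 1) {m : ℝ} (hm : 2 ≤ m) :
    ∃ Q, 0 ≤ Q ∧
      (1 - t ^ 2) * (1 + 3 * t ^ 2 + 3 * (m - 1) * (1 - t ^ 2)) ≤ 3 * Q ^ 2 * m ∧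
      2.7208 * ((1 + 2 * t - t ^ 2) / 4 * Q - 1 / 4) ≤
        1.4142 * (0.7071 * (t * (3 - t ^ 2) / 2) - 1.234 * t ^ 2 * (1 - t ^ 2 / 2)) := by
  have ht2 : 0 ≤ 1 - t ^ 2 := by nlinarith
  rcases le_total (3 * t ^ 2) 1 with h | h
  · refine ⟨1 - t ^ 2, ht2, ?_, ?_⟩
    · linarith [mul_nonneg ht2 (sub_nonneg.2 h)]
    · have h2 : 0 ≤ t * (0.139 - 0.385 * t + 0.86 * t ^ 2) :=
        mul_nonneg h0 (by nlinarith [sq_nonneg (t - 0.2238)])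
      linarith [pow_nonneg h0 2, pow_nonneg h0 3, pow_nonneg h0 4]
  · have ht : 0.577 ≤ t := by
      refine (sq_le_sq₀ (by norm_num) h0).1 ?_
      norm_num
      linarith
    refine ⟨(1 - t ^ 2) / 2 + 1 / 3, by linarith, ?_, ?_⟩
    · have hQ : 2 / 3 * (1 - t ^ 2) ≤ ((1 - t ^ 2) / 2 + 1 / 3) ^ 2 := by
        nlinarith [sq_nonneg ((1 - t ^ 2) / 2 - 1 / 3)]
      have h5 := mul_nonneg ht2 (mul_nonneg (sub_nonneg.2 h) (sub_nonneg.2 hm))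
      linarith [mul_le_mul_of_nonneg_right hQ (by linarith : 0 ≤ m)]
    · have hBh : (1 + 2 * t - t ^ 2) / 4 ≤ 1 / 2 := by nlinarith [sq_nonneg (1 - t)]
      have h6 : (1 + 2 * t - t ^ 2) / 4 * ((1 - t ^ 2) / 2 + 1 / 3) ≤
          1 / 2 * ((1 - t ^ 2) / 2 + 1 / 3) :=
        mul_le_mul_of_nonneg_right hBh (by linarith)
      have h7 : 0.5 * (t - 0.577) ≤ 0.8725 * t ^ 2 - 0.5 * t := by
        nlinarith [sq_nonneg (t - 0.573)]
      have h8 : 0.33 * (0.5 * (t - 0.577)) ≤ t ^ 2 * (0.8725 * t ^ 2 - 0.5 * t) := by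
        refine mul_le_mul (by linarith) h7 (by linarith) (sq_nonneg t)
      have h9 : 0 ≤ (1 - t) * (t - 0.577) := mul_nonneg (sub_nonneg.2 h1) (sub_nonneg.2 ht)
      linarith [pow_nonneg h0 3, pow_nonneg h0 4]

/-- The remainder of the sine transform of Kendall's tau for at least four observations: `√((1 -
t²)/m)` and the second root bound the `L²` and squared `L⁴` norms of the estimation error of a
tau equal to `t`. -/
theorem tau_remainder_le {t : ℝ} (h0 : 0 ≤ t) (h1 : t ≤ 1) {m : ℝ} (hm : 2 ≤ m) :
    (1 - Real.cos (Real.pi / 2 * t)) * (Real.pi / 2) * √((1 - t ^ 2) / m) +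
      (1 + 2 * t - t ^ 2) / 4 * (Real.pi / 2) ^ 2 *
        √((1 - t ^ 2) * (1 + 3 * t ^ 2 + 3 * (m - 1) * (1 - t ^ 2)) / m ^ 3) ≤
    Real.pi / 2 / √(2 * m) * Real.sin (Real.pi / 2 * t) + Real.pi ^ 2 * √3 / 8 / (2 * m) := by
  have hpi := Real.pi_pos
  have hm0 : 0 < m := by linarith
  set r := √m with hr
  have hr0 : 0 < r := Real.sqrt_pos.2 hm0
  have hr2 : r ^ 2 = m := Real.sq_sqrt hm0.le
  have hr1 : 1.4142 ≤ r := Real.le_sqrt_of_sq_le (by norm_num at hm ⊢; linarith)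
  have ht2 : 0 ≤ 1 - t ^ 2 := by nlinarith
  set B := (1 + 2 * t - t ^ 2) / 4 with hB
  have hB0 : 0 ≤ B := by rw [hB]; nlinarith
  set A := 1 - Real.cos (Real.pi / 2 * t) with hA
  have hA0 : 0 ≤ A := sub_nonneg.2 (Real.cos_le_one _)
  have hA1 : A ≤ 1.234 * t ^ 2 := by
    have h := Real.one_sub_sq_div_two_le_cos (x := Real.pi / 2 * t)
    have hpi2 : Real.pi ^ 2 ≤ 3.1416 ^ 2 := pow_le_pow_left₀ hpi.le Real.pi_lt_d4.le 2
    have := mul_le_mul_of_nonneg_right hpi2 (sq_nonneg t)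
    nlinarith
  have hρ := sin_pi_div_two_mul_ge h0 h1
  set ρ := Real.sin (Real.pi / 2 * t) with hρdef
  have hs2 : √2 * √2 = 2 := Real.mul_self_sqrt (by norm_num)
  have hs2' : 1.4142 ≤ √2 := Real.le_sqrt_of_sq_le (by norm_num)
  have hs2'' : √2 ≤ 1.41422 := Real.sqrt_le_iff.2 ⟨by norm_num, by norm_num⟩
  set Z := ρ / √2 - A * (1 - t ^ 2 / 2) with hZ
  set Z₀ := 0.7071 * (t * (3 - t ^ 2) / 2) - 1.234 * t ^ 2 * (1 - t ^ 2 / 2) with hZ₀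
  have hZ₀0 : 0 ≤ Z₀ := by
    have : Z₀ = t * (1.06065 - 0.35355 * t ^ 2 - 1.234 * t + 0.617 * t ^ 3) := by rw [hZ₀]; ring
    rw [this]
    refine mul_nonneg h0 ?_
    nlinarith [mul_nonneg (mul_nonneg h0 h0) (sub_nonneg.2 h1), mul_nonneg h0 (sub_nonneg.2 h1),
      mul_nonneg h0 (sq_nonneg (1 - t))]
  have hZZ : Z₀ ≤ Z := by
    have e : ρ / √2 = ρ * (√2 / 2) := by
      rw [div_eq_iff (by positivity), mul_assoc, div_mul_eq_mul_div, hs2]; ring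
    have hρ0 : 0 ≤ t * (3 - t ^ 2) / 2 := by
      have : 0 ≤ t * (3 - t ^ 2) := mul_nonneg h0 (by linarith)
      linarith
    have h3 : 0.7071 * (t * (3 - t ^ 2) / 2) ≤ ρ / √2 := by
      rw [e]
      have : 0.7071 ≤ √2 / 2 := by linarith
      nlinarith
    have h4 : A * (1 - t ^ 2 / 2) ≤ 1.234 * t ^ 2 * (1 - t ^ 2 / 2) :=
      mul_le_mul_of_nonneg_right hA1 (by linarith)
    linarith
  obtain ⟨Q, hQ0, hQ4, hQZ⟩ := exists_fourth_moment_bound h0 h1 hm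
  rw [← hB, ← hZ₀] at hQZ
  have hκ0 : 0 ≤ Real.pi / 2 * √3 := by positivity
  have hκ : Real.pi / 2 * √3 ≤ 2.7208 := by
    have h3 : √3 ≤ 1.73206 := Real.sqrt_le_iff.2 ⟨by norm_num, by norm_num⟩
    calc Real.pi / 2 * √3 ≤ 3.1416 / 2 * 1.73206 := by
          gcongr; exact Real.pi_lt_d4.le
      _ ≤ 2.7208 := by norm_num
  have hfin : Real.pi / 2 * √3 * (B * Q - 1 / 4) ≤ Z * r := by
    have hZr : 1.4142 * Z₀ ≤ Z * r := by
      rw [mul_comm]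
      exact mul_le_mul hZZ hr1 (by norm_num) (hZ₀0.trans hZZ)
    rcases le_total 0 (B * Q - 1 / 4) with h | h
    · exact (mul_le_mul_of_nonneg_right hκ h).trans (hQZ.trans hZr)
    · exact (mul_nonpos_of_nonneg_of_nonpos hκ0 h).trans (mul_nonneg (hZ₀0.trans hZZ) hr0.le)
  have hb1 : √((1 - t ^ 2) / m) ≤ (1 - t ^ 2 / 2) / r := by
    rw [Real.sqrt_div ht2]
    gcongr
    exact Real.sqrt_le_iff.2 ⟨by linarith, by nlinarith [sq_nonneg (t ^ 2)]⟩
  have hb2 : √((1 - t ^ 2) * (1 + 3 * t ^ 2 + 3 * (m - 1) * (1 - t ^ 2)) / m ^ 3) ≤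
      √3 * Q / r ^ 2 := by
    refine Real.sqrt_le_iff.2 ⟨by positivity, ?_⟩
    rw [div_pow, mul_pow, Real.sq_sqrt (by norm_num), hr2, div_le_div_iff₀ (by positivity)
      (by positivity)]
    nlinarith [mul_le_mul_of_nonneg_right hQ4 (by positivity : 0 ≤ m ^ 2)]
  have e1 : √(2 * m) = √2 * r := Real.sqrt_mul (by norm_num) m
  rw [e1, ← hr2]
  rw [← hr2] at hb1 hb2
  calc _ ≤ A * (Real.pi / 2) * ((1 - t ^ 2 / 2) / r) +
        B * (Real.pi / 2) ^ 2 * (√3 * Q / r ^ 2) := by gcongr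
    _ = Real.pi / 2 / r ^ 2 * (A * (1 - t ^ 2 / 2) * r + Real.pi / 2 * √3 * (B * Q)) := by
        field_simp
    _ ≤ Real.pi / 2 / r ^ 2 * (ρ / √2 * r + Real.pi / 2 * √3 * (1 / 4)) := by
        gcongr _ * ?_
        rw [hZ] at hfin
        linarith
    _ = _ := by field_simp; ring

namespace IsCorrelationMatrix

variable {n d : ℕ} {S : Matrix (Fin d) (Fin d) ℝ}

theorem pi_div_two_mul_popTau (hS : IsCorrelationMatrix S) (j k : Fin d) :
    Real.pi / 2 * popTau (normalLaw S) j k = Real.arcsin (S j k) := by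
  rw [hS.popTau_normalLaw]
  field_simp

/-- Sheppard's formula solved for the correlation. -/
theorem abs_apply_eq_sin_popTau (hS : IsCorrelationMatrix S) (j k : Fin d) :
    |S j k| = Real.sin (Real.pi / 2 * |popTau (normalLaw S) j k|) := by
  have h := abs_le.1 (hS.abs_apply_le_one j k)
  have e : Real.pi / 2 * |popTau (normalLaw S) j k| = |Real.arcsin (S j k)| := by
    rw [← hS.pi_div_two_mul_popTau, abs_mul,
      abs_of_pos (by positivity : (0 : ℝ) < Real.pi / 2)]
  rw [e, ← Real.abs_sin_eq_sin_abs_of_abs_le_pi, Real.sin_arcsin h.1 h.2]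
  have := abs_le.2 ⟨Real.neg_pi_div_two_le_arcsin (S j k), Real.arcsin_le_pi_div_two (S j k)⟩
  linarith [Real.pi_pos]

/-- The mean square error of linearising `sin` at Kendall's tau: second-order expansion, with second
and fourth moments from `n / 2` independent pairs. -/
theorem integral_sinDefect_tauHat_sub_le (hS : IsCorrelationMatrix S) (hn : 2 ≤ n) (j k : Fin d) :
    ∫ x : Fin n → Fin d → ℝ, (sinDefect (Real.pi / 2 * tauHat x j k) -
        sinDefect (Real.pi / 2 * popTau (normalLaw S) j k)) ^ 2
        ∂(Measure.pi fun _ : Fin n => normalLaw S) ≤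
      (Real.pi / 2 / √((2 * (n / 2) : ℕ) : ℝ) * |S j k| +
        Real.pi ^ 2 * √3 / 8 / ((2 * (n / 2) : ℕ) : ℝ)) ^ 2 := by
  have hpi := Real.pi_pos
  have ha : ∀ u : ℝ, |u| ≤ 1 → |Real.pi / 2 * u| ≤ Real.pi / 2 := fun u hu => by
    rw [abs_mul, abs_of_pos (by positivity : (0 : ℝ) < Real.pi / 2)]
    exact mul_le_of_le_one_right (by positivity) hu
  have hT := abs_popTau_le_one (normalLaw S) j k
  obtain ⟨m, hm⟩ : ∃ m, m = n / 2 := ⟨_, rfl⟩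
  have hm1 : 1 ≤ m := by omega
  rw [← hm]
  push_cast
  rcases hm1.eq_or_lt with rfl | hm2
  · -- up to three observations a pointwise bound suffices
    refine (le_abs_self _).trans (abs_integral_le_of_abs_le fun x => sq_of_abs_le ?_)
    have h1 := abs_sinDefect_le (ha _ (abs_tauHat_le_one hn x j k))
    have h2 := abs_sinDefect_le (ha _ hT)
    have h3 := abs_le_mul_abs_sin (ha _ hT)
    have h4 := ha _ (abs_tauHat_le_one hn x j k)
    have hle := abs_le.1 (hS.abs_apply_le_one j k)
    have e : |Real.sin (Real.pi / 2 * popTau (normalLaw S) j k)| = |S j k| := by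
      rw [hS.pi_div_two_mul_popTau, Real.sin_arcsin hle.1 hle.2]
    rw [e] at h3
    have hc : 0 ≤ 1 - 2 / Real.pi := by
      rw [sub_nonneg, div_le_one hpi]; linarith [Real.pi_gt_three]
    have h5 := abs_sub (sinDefect (Real.pi / 2 * tauHat x j k))
      (sinDefect (Real.pi / 2 * popTau (normalLaw S) j k))
    have h6 := mul_le_mul_of_nonneg_left h4 hc
    have h7 := mul_le_mul_of_nonneg_left h3 hc
    have e2 : (1 - 2 / Real.pi) * (Real.pi / 2) = Real.pi / 2 - 1 := by field_simp
    rw [← mul_assoc, e2] at h7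
    rw [e2] at h6
    have hs : √(2 * ((1 : ℕ) : ℝ)) ≤ 1.5 := Real.sqrt_le_iff.2 ⟨by norm_num, by norm_num⟩
    have hs0 : 0 < √(2 * ((1 : ℕ) : ℝ)) := Real.sqrt_pos.2 (by norm_num)
    have h8 : Real.pi / 2 - 1 ≤ Real.pi / 2 / √(2 * ((1 : ℕ) : ℝ)) := by
      rw [le_div_iff₀ hs0]
      nlinarith [Real.pi_gt_three, Real.pi_lt_d2]
    have h9 : Real.pi / 2 - 1 ≤ Real.pi ^ 2 * √3 / 8 / (2 * ((1 : ℕ) : ℝ)) := by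
      have h3 : 1.7 ≤ √3 := Real.le_sqrt_of_sq_le (by norm_num)
      have : Real.pi ^ 2 * 1.7 ≤ Real.pi ^ 2 * √3 := by gcongr
      push_cast
      nlinarith [Real.pi_gt_three, Real.pi_lt_d2]
    have h10 := mul_le_mul_of_nonneg_right h8 (abs_nonneg (S j k))
    push_cast at h9 h10 ⊢
    linarith
  · obtain ⟨v2, v4⟩ := integral_tauHat_sub_pow_le (m := m) hn S j k (by omega) (by omega) rfl
    set τ := popTau (normalLaw S) j k with hτ
    set t := |τ| with ht
    have ht0 : 0 ≤ t := abs_nonneg _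
    have hmR : (2 : ℝ) ≤ m := by exact_mod_cast hm2
    have hm0 : (0 : ℝ) < m := by linarith
    rw [← sq_abs τ, ← ht] at v2 v4
    have hq : 0 ≤ 1 - t ^ 2 := by nlinarith
    have hr : 0 ≤ (1 - t ^ 2) * (1 + 3 * t ^ 2 + 3 * (m - 1) * (1 - t ^ 2)) / m ^ 3 := by
      have : 0 ≤ (m : ℝ) - 1 := by linarith
      positivity
    have hcos : 0 ≤ 1 - Real.cos (Real.pi / 2 * t) := sub_nonneg.2 (Real.cos_le_one _)
    have hB : 0 ≤ (1 + 2 * t - t ^ 2) / 4 := by nlinarith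
    have hb : ∀ x : Fin n → Fin d → ℝ, |tauHat x j k - τ| ≤ 2 := fun x => by
      have h1 := abs_sub (tauHat x j k) τ
      linarith [abs_tauHat_le_one hn x j k]
    have key := integral_sq_le_of_abs_le_quadratic (P := Measure.pi fun _ : Fin n => normalLaw S)
      (G := fun x => sinDefect (Real.pi / 2 * tauHat x j k) - sinDefect (Real.pi / 2 * τ))
      (X := fun x => tauHat x j k - τ)
      (A := (1 - Real.cos (Real.pi / 2 * t)) * (Real.pi / 2))
      (B := (1 + 2 * t - t ^ 2) / 4 * (Real.pi / 2) ^ 2)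
      ((measurable_tauHat hn j k).sub_const τ) hb (by positivity) (by positivity)
      (Real.sqrt_nonneg ((1 - t ^ 2) / m)) (Real.sqrt_nonneg _) ?_
      (v2.trans_eq (Real.sq_sqrt (by positivity)).symm) (v4.trans_eq (Real.sq_sqrt hr).symm)
    · refine key.trans (pow_le_pow_left₀ (by positivity) ?_ 2)
      have := tau_remainder_le ht0 hT hmR
      rwa [ht, hτ, ← hS.abs_apply_eq_sin_popTau j k] at this
    · refine Filter.Eventually.of_forall fun x => ?_
      have h := abs_sinDefect_sub_le_quadratic (a := Real.pi / 2 * τ)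
        (b := Real.pi / 2 * tauHat x j k) (ha _ hT) (ha _ (abs_tauHat_le_one hn x j k)) le_rfl
      have e : |Real.pi / 2 * τ| = Real.pi / 2 * t := by
        rw [abs_mul, abs_of_pos (by positivity : (0 : ℝ) < Real.pi / 2)]
      have h2 := sin_centre_le ht0 hT
      rw [← mul_sub, abs_mul, abs_of_pos (by positivity : (0 : ℝ) < Real.pi / 2), mul_pow,
        ← Real.cos_abs, e] at h
      have h3 := mul_le_mul_of_nonneg_right h2
        (by positivity : 0 ≤ (Real.pi / 2) ^ 2 * (tauHat x j k - τ) ^ 2 / 2)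
      refine h.trans ?_
      linarith

theorem popTau_self (hS : IsCorrelationMatrix S) (j : Fin d) : popTau (normalLaw S) j j = 1 := by
  rw [hS.popTau_normalLaw, hS.diag_eq_one, Real.arcsin_one]
  field_simp

/-- On the diagonal there is no fluctuation: the sample value of Kendall's tau is almost surely one.
-/
theorem integral_sinDefect_tauHat_sub_self_le (hS : IsCorrelationMatrix S) (hn : 2 ≤ n)
    (j : Fin d) : ∫ x : Fin n → Fin d → ℝ, (sinDefect (Real.pi / 2 * tauHat x j j) -
        sinDefect (Real.pi / 2 * popTau (normalLaw S) j j)) ^ 2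
        ∂(Measure.pi fun _ : Fin n => normalLaw S) ≤ 0 := by
  obtain ⟨v2, v4⟩ := integral_tauHat_sub_pow_le (m := 1) hn S j j one_pos (by omega)
    (hS.popTau_self j)
  rw [hS.popTau_self j]
  have hb : ∀ x : Fin n → Fin d → ℝ, |tauHat x j j - 1| ≤ 2 := fun x => by
    have h1 := abs_le.1 (abs_tauHat_le_one hn x j j)
    rw [abs_le]
    constructor <;> linarith
  have key := integral_sq_le_of_abs_le_quadratic (P := Measure.pi fun _ : Fin n => normalLaw S)
    (G := fun x => sinDefect (Real.pi / 2 * tauHat x j j) - sinDefect (Real.pi / 2 * 1))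
    (X := fun x => tauHat x j j - 1) (A := 2 * (Real.pi / 2)) (B := 0) (e₂ := 0) (e₄ := 0)
    ((measurable_tauHat hn j j).sub_const 1) hb (by positivity) le_rfl le_rfl le_rfl
    (Filter.Eventually.of_forall fun x => ?_) (by simpa using v2) (by simpa using v4)
  · simpa using key
  · have h := abs_sinDefect_sub_le (Real.pi / 2 * 1) (Real.pi / 2 * tauHat x j j)
    rw [← mul_sub, abs_mul, abs_of_pos (by positivity : (0 : ℝ) < Real.pi / 2)] at h
    linarith

end IsCorrelationMatrix

end GaussianCopula

end

/-! ### Sine transform of Spearman's rho -/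

noncomputable section

namespace GaussianCopula

/-- The remainder of the sine transform of Spearman's rho. -/
theorem rho_remainder_le {ρ a : ℝ} (h0 : 0 ≤ ρ) (h1 : ρ ≤ 1) (ha : |a| ≤ Real.pi / 6 * ρ) {m : ℝ}
    (hm : 1 ≤ m) :
    (1 - Real.cos a) * (Real.pi / 6) * (1 / √m) +
      Real.sin (|a| + (Real.pi / 6 - |a|) / 3) / 2 * (Real.pi / 6) ^ 2 *
        (√3 * (1 - 0.188 * ρ ^ 2) / m) ≤
    Real.pi / 18 / √(3 * m) * ρ + Real.pi ^ 2 * √3 / 72 / (3 * m) := by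
  have hpi := Real.pi_pos
  have hm0 : 0 < m := by linarith
  set r := √m with hr
  have hr0 : 0 < r := Real.sqrt_pos.2 hm0
  have hr2 : r ^ 2 = m := Real.sq_sqrt hm0.le
  have hr1 : 1 ≤ r := Real.one_le_sqrt.2 hm
  set A := 1 - Real.cos a with hA
  set B := Real.sin (|a| + (Real.pi / 6 - |a|) / 3) with hB
  have hpi2 : Real.pi ^ 2 ≤ 3.1416 ^ 2 := pow_le_pow_left₀ hpi.le Real.pi_lt_d4.le 2
  have hA1 : A ≤ 0.1371 * ρ ^ 2 := by
    have h := Real.one_sub_sq_div_two_le_cos (x := a)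
    have h2 := pow_le_pow_left₀ (abs_nonneg a) ha 2
    rw [sq_abs] at h2
    have := mul_le_mul_of_nonneg_right hpi2 (sq_nonneg ρ)
    nlinarith
  have hB1 : B ≤ 0.17454 * (1 + 2 * ρ) := by
    have h := Real.sin_le (x := |a| + (Real.pi / 6 - |a|) / 3) (by linarith [abs_nonneg a])
    have h2 : Real.pi * (1 + 2 * ρ) ≤ 3.1416 * (1 + 2 * ρ) := by
      have := Real.pi_lt_d4.le
      gcongr
    linarith
  have hs3 : √3 * √3 = 3 := Real.mul_self_sqrt (by norm_num)
  have hs3' : 1.732 ≤ √3 := Real.le_sqrt_of_sq_le (by norm_num)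
  have hs3'' : √3 ≤ 1.7321 := Real.sqrt_le_iff.2 ⟨by norm_num, by norm_num⟩
  set Z := ρ * (√3 / 9) - A with hZ
  have hZ0 : 0.1924 * ρ - 0.1371 * ρ ^ 2 ≤ Z := by
    have : 0.1924 * ρ ≤ ρ * (√3 / 9) := by nlinarith
    linarith
  have hZ0' : 0 ≤ 0.1924 * ρ - 0.1371 * ρ ^ 2 := by nlinarith
  have hw : 0 ≤ 1 - 0.188 * ρ ^ 2 := by nlinarith
  have hX : B * (1 - 0.188 * ρ ^ 2) / 2 - 1 / 6 ≤
      0.08727 * (1 + 2 * ρ) * (1 - 0.188 * ρ ^ 2) - 1 / 6 := by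
    have := mul_le_mul_of_nonneg_right hB1 hw
    linarith
  have hκ0 : 0 ≤ Real.pi / 6 * √3 := by positivity
  have hκ : Real.pi / 6 * √3 ≤ 0.907 := by
    calc Real.pi / 6 * √3 ≤ 3.1416 / 6 * 1.7321 := by
          gcongr; exact Real.pi_lt_d4.le
      _ ≤ 0.907 := by norm_num
  have hfin : Real.pi / 6 * √3 * (B * (1 - 0.188 * ρ ^ 2) / 2 - 1 / 6) ≤ Z * r := by
    have hZr : 0.1924 * ρ - 0.1371 * ρ ^ 2 ≤ Z * r := by
      have := mul_le_mul hZ0 hr1 zero_le_one (hZ0'.trans hZ0)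
      linarith
    rcases le_total 0 (B * (1 - 0.188 * ρ ^ 2) / 2 - 1 / 6) with h | h
    · refine (mul_le_mul_of_nonneg_right hκ h).trans (le_trans ?_ hZr)
      have h3 := mul_nonneg h0 (sub_nonneg.2 h1)
      have h4 := mul_nonneg h3 h0
      nlinarith
    · exact (mul_nonpos_of_nonneg_of_nonpos hκ0 h).trans (hZ0'.trans hZr)
  have e1 : √(3 * m) = √3 * r := Real.sqrt_mul (by norm_num) m
  have e2 : Real.pi / 18 / (√3 * r) * ρ = Real.pi / 6 / r * (ρ * (√3 / 9)) := by
    have : (1 : ℝ) / √3 = √3 / 3 := by rw [div_eq_div_iff (by positivity) (by norm_num)]; linarith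
    calc Real.pi / 18 / (√3 * r) * ρ = Real.pi / 18 / r * ρ * (1 / √3) := by field_simp
      _ = _ := by rw [this]; ring
  rw [e1, e2, ← hr2]
  calc _ = Real.pi / 6 / r ^ 2 * (A * r + Real.pi / 6 * √3 * (B * (1 - 0.188 * ρ ^ 2) / 2)) := by
        field_simp
    _ ≤ Real.pi / 6 / r ^ 2 * (ρ * (√3 / 9) * r + Real.pi / 6 * √3 * (1 / 6)) := by
        gcongr _ * ?_
        rw [hZ] at hfin
        linarith
    _ = _ := by field_simp; ring

/-- Fourth moment of an average of `m` signs of mean `θ`, with `|θ|` at least `2 ρ / π`. -/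
theorem fourth_moment_le {θ ρ : ℝ} (hθ : |θ| ≤ 1) (hρ0 : 0 ≤ ρ)
    (hρ : 2 / Real.pi * ρ ≤ |θ|) {m : ℝ} (hm : 1 ≤ m) :
    (1 - θ ^ 2) * (1 + 3 * θ ^ 2 + 3 * (m - 1) * (1 - θ ^ 2)) / m ^ 3 ≤
      (√3 * (1 - 0.188 * ρ ^ 2) / m) ^ 2 := by
  have hm0 : 0 < m := by linarith
  have h2 : 0.636 ≤ 2 / Real.pi := by
    rw [le_div_iff₀ Real.pi_pos]; linarith [Real.pi_lt_d4]
  have h3 : (0.636 * ρ) ^ 2 ≤ θ ^ 2 := by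
    rw [← sq_abs θ]
    exact pow_le_pow_left₀ (by positivity) ((mul_le_mul_of_nonneg_right h2 hρ0).trans hρ) 2
  have h4 : θ ^ 2 ≤ 1 := (sq_le_one_iff_abs_le_one θ).2 hθ
  have e : (√3 * (1 - 0.188 * ρ ^ 2) / m) ^ 2 = 3 * (1 - 0.188 * ρ ^ 2) ^ 2 * m / m ^ 3 := by
    rw [div_pow, mul_pow, Real.sq_sqrt (by norm_num)]
    field_simp
  rw [e]
  refine div_le_div_of_nonneg_right ?_ (by positivity)
  set x := θ ^ 2 with hx
  have hx0 : 0 ≤ x := sq_nonneg θ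
  have h5 : 1 - 0.93 * x ≤ (1 - 0.188 * ρ ^ 2) ^ 2 := by nlinarith
  have h6 : (1 - x) * (1 + 3 * x + 3 * (m - 1) * (1 - x)) ≤ 3 * (1 - 0.93 * x) * m := by
    -- affine in `m`: the cases `m = 1` and the slope
    have h7 : (1 - x) * (1 + 3 * x) ≤ 3 * (1 - 0.93 * x) := by nlinarith [sq_nonneg (x - 0.8)]
    have h8 : 3 * (1 - x) * (1 - x) ≤ 3 * (1 - 0.93 * x) := by nlinarith
    have h9 := mul_le_mul_of_nonneg_right h8 (sub_nonneg.2 hm)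
    linarith
  refine h6.trans ?_
  gcongr

namespace IsCorrelationMatrix

variable {n d : ℕ} {S : Matrix (Fin d) (Fin d) ℝ}

theorem mul_abs_apply_le_abs_popTau (hS : IsCorrelationMatrix S) (j k : Fin d) :
    2 / Real.pi * |S j k| ≤ |popTau (normalLaw S) j k| := by
  have h := abs_le.1 (hS.abs_apply_le_one j k)
  have h2 := Real.abs_sin_le_abs (x := Real.arcsin (S j k))
  rw [Real.sin_arcsin h.1 h.2] at h2
  rw [hS.popTau_normalLaw, abs_mul, abs_of_pos (div_pos two_pos Real.pi_pos)]
  have := Real.pi_pos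
  gcongr

theorem mul_abs_apply_le_abs_popRho (hS : IsCorrelationMatrix S) (j k : Fin d) :
    2 / Real.pi * |S j k| ≤ |popRho (normalLaw S) j k| := by
  have h := abs_le.1 (hS.abs_apply_le_one j k)
  have h2 := Real.abs_sin_le_abs (x := Real.arcsin (S j k / 2))
  rw [Real.sin_arcsin (by linarith [h.1]) (by linarith [h.2]), abs_div,
    abs_of_pos (two_pos : (0 : ℝ) < 2)] at h2
  rw [hS.popRho_normalLaw, abs_mul, abs_mul, abs_of_pos (div_pos two_pos Real.pi_pos),
    abs_of_pos (by norm_num : (0 : ℝ) < 3)]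
  have h3 := mul_le_mul_of_nonneg_left h2 (div_pos two_pos Real.pi_pos).le
  have h4 : 0 ≤ 2 / Real.pi * |S j k| := mul_nonneg (div_pos two_pos Real.pi_pos).le (abs_nonneg _)
  linarith

theorem abs_popTau_le_abs_apply (hS : IsCorrelationMatrix S) (j k : Fin d) :
    |popTau (normalLaw S) j k| ≤ |S j k| := by
  have h := hS.abs_apply_eq_sin_popTau j k
  have h1 := abs_popTau_le_one (normalLaw S) j k
  have h2 := Real.mul_le_sin (x := Real.pi / 2 * |popTau (normalLaw S) j k|) (by positivity)
    (mul_le_of_le_one_right (by positivity) h1)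
  rw [← h] at h2
  rwa [show 2 / Real.pi * (Real.pi / 2 * |popTau (normalLaw S) j k|) =
    |popTau (normalLaw S) j k| by field_simp] at h2

theorem pi_div_six_mul_popRho (hS : IsCorrelationMatrix S) (j k : Fin d) :
    Real.pi / 6 * popRho (normalLaw S) j k = Real.arcsin (S j k / 2) := by
  rw [hS.popRho_normalLaw]
  field_simp
  ring

theorem abs_popRho_le_abs_apply (hS : IsCorrelationMatrix S) (j k : Fin d) :
    |popRho (normalLaw S) j k| ≤ |S j k| := by
  have main : ∀ y : ℝ, 0 ≤ y → y ≤ 1 → 3 * (2 / Real.pi * Real.arcsin (y / 2)) ≤ y := by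
    intro y h0 h1
    have h3 := arcsin_le_of_le_sin (α := Real.pi / 6) (y := y / 2) (by positivity)
      (by linarith [Real.pi_pos]) (by linarith) (by rw [Real.sin_pi_div_six]; linarith)
    rw [Real.sin_pi_div_six] at h3
    calc 3 * (2 / Real.pi * Real.arcsin (y / 2))
        = 12 / Real.pi * (1 / 2 * Real.arcsin (y / 2)) := by ring
      _ ≤ 12 / Real.pi * (Real.pi / 6 * (y / 2)) := by
          have := Real.pi_pos
          gcongr
      _ = y := by field_simp; ring
  have h := hS.abs_apply_le_one j k
  rw [hS.popRho_normalLaw]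
  rcases le_total 0 (S j k) with h0 | h0
  · rw [abs_of_nonneg h0] at h ⊢
    rw [abs_of_nonneg]
    · exact main _ h0 h
    · have := Real.arcsin_nonneg.2 (by linarith : 0 ≤ S j k / 2)
      have := Real.pi_pos
      positivity
  · rw [abs_of_nonpos h0] at h ⊢
    have h2 := main _ (by linarith : 0 ≤ -S j k) h
    rw [neg_div, Real.arcsin_neg] at h2
    rw [abs_of_nonpos]
    · linarith
    · have h3 := Real.arcsin_nonpos.2 (by linarith : S j k / 2 ≤ 0)
      have := mul_nonpos_of_nonneg_of_nonpos (div_pos two_pos Real.pi_pos).le h3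
      linarith

theorem popRho_self (hS : IsCorrelationMatrix S) (j : Fin d) : popRho (normalLaw S) j j = 1 := by
  have h := hS.pi_div_six_mul_popRho j j
  have e : Real.arcsin (1 / 2) = Real.pi / 6 := by
    rw [← Real.sin_pi_div_six]
    exact Real.arcsin_sin (by linarith [Real.pi_pos]) (by linarith [Real.pi_pos])
  rw [hS.diag_eq_one, e] at h
  have := Real.pi_pos
  field_simp at h
  linarith

/-- The mean of `rhoHat` in the Gaussian model. -/
def meanRho (n : ℕ) (S : Matrix (Fin d) (Fin d) ℝ) (j k : Fin d) : ℝ :=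
  ((n : ℝ) - 2) / (n + 1) * popRho (normalLaw S) j k + 3 / (n + 1) * popTau (normalLaw S) j k

theorem abs_meanRho_le (hS : IsCorrelationMatrix S) (hn : 2 ≤ n) (j k : Fin d) :
    |meanRho n S j k| ≤ |S j k| := by
  have hn' : (2 : ℝ) ≤ n := by exact_mod_cast hn
  have hp : 0 ≤ ((n : ℝ) - 2) / (n + 1) := div_nonneg (by linarith) (by linarith)
  have hq : 0 ≤ 3 / ((n : ℝ) + 1) := by positivity
  have hpq : ((n : ℝ) - 2) / (n + 1) + 3 / (n + 1) = 1 := by field_simp; ring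
  calc |meanRho n S j k| ≤ |((n : ℝ) - 2) / (n + 1) * popRho (normalLaw S) j k| +
        |3 / ((n : ℝ) + 1) * popTau (normalLaw S) j k| := abs_add_le _ _
    _ ≤ ((n : ℝ) - 2) / (n + 1) * |S j k| + 3 / (n + 1) * |S j k| := by
        rw [abs_mul, abs_mul, abs_of_nonneg hp, abs_of_nonneg hq]
        have h1 := hS.abs_popRho_le_abs_apply j k
        have h2 := hS.abs_popTau_le_abs_apply j k
        gcongr
    _ = |S j k| := by rw [← add_mul, hpq, one_mul]

/-- The bias of Spearman's rho. -/
theorem abs_meanRho_sub_popRho_le (hS : IsCorrelationMatrix S) (hn : 2 ≤ n) (j k : Fin d) :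
    |meanRho n S j k - popRho (normalLaw S) j k| ≤ |S j k| / n := by
  have hn' : (2 : ℝ) ≤ n := by exact_mod_cast hn
  have e : meanRho n S j k - popRho (normalLaw S) j k =
      3 / (n + 1) * (popTau (normalLaw S) j k - popRho (normalLaw S) j k) := by
    rw [meanRho]; field_simp; ring
  have h := hS.abs_popTau_sub_popRho_le j k
  have hq : 0 ≤ 3 / ((n : ℝ) + 1) := by positivity
  rw [e, abs_mul, abs_of_nonneg hq]
  calc _ ≤ 3 / ((n : ℝ) + 1) * (|S j k| / 3) := by gcongr
    _ = |S j k| / (n + 1) := by field_simp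
    _ ≤ |S j k| / n := by gcongr; linarith

/-- Second and fourth moments of the fluctuation of `rhoHat`, a convex combination of two
U-statistics: common bounds `v`, `w` for their moments, with `m` blocks of three observations, are
bounds for those of `rhoHat`. -/
theorem integral_rhoHat_sub_pow_le (hS : IsCorrelationMatrix S) (hn : 3 ≤ n) (j k : Fin d) {v w : ℝ}
    {m : ℕ} (hm : 0 < m) (hmn : m * 3 ≤ n)
    (hv : ∀ θ, θ = popRho (normalLaw S) j k ∨ θ = popTau (normalLaw S) j k →
      (1 - θ ^ 2) / m ≤ v)
    (hw : ∀ θ, θ = popRho (normalLaw S) j k ∨ θ = popTau (normalLaw S) j k →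
      (1 - θ ^ 2) * (1 + 3 * θ ^ 2 + 3 * (m - 1) * (1 - θ ^ 2)) / m ^ 3 ≤ w) :
    ∫ x : Fin n → Fin d → ℝ, (rhoHat x j k - meanRho n S j k) ^ 2
        ∂(Measure.pi fun _ : Fin n => normalLaw S) ≤ v ∧
    ∫ x : Fin n → Fin d → ℝ, (rhoHat x j k - meanRho n S j k) ^ 4
        ∂(Measure.pi fun _ : Fin n => normalLaw S) ≤ w := by
  have hn2 : 2 ≤ n := by omega
  have hn' : (3 : ℝ) ≤ n := by exact_mod_cast hn
  set p : ℝ := ((n : ℝ) - 2) / (n + 1) with hp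
  set q : ℝ := 3 / ((n : ℝ) + 1) with hq
  have hn1 : (0 : ℝ) < n + 1 := by linarith
  have hp0 : 0 ≤ p := div_nonneg (by linarith) hn1.le
  have hq0 : 0 ≤ q := by positivity
  have hpq : p + q = 1 := by rw [hp, hq]; field_simp; ring
  set U : (Fin n → Fin d → ℝ) → ℝ :=
    uStat (fun z : Fin 3 → Fin d → ℝ => rhoKernel j k (z 0) (z 1) (z 2)) with hU
  set R := popRho (normalLaw S) j k with hR
  set T := popTau (normalLaw S) j k with hT
  have mU : Measurable U := measurable_uStat (measurable_rhoKernel_pi j k)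
  have bU : ∀ x, |U x - R| ≤ 6 := fun x => by
    have h1 : |U x| ≤ 3 := abs_uStat_le hn (fun z => abs_rhoKernel_le j k _ _ _) x
    have h2 := abs_popRho_le (normalLaw S) j k
    linarith [abs_sub (U x) R]
  have bT : ∀ x : Fin n → Fin d → ℝ, |tauHat x j k - T| ≤ 2 := fun x => by
    have h1 := abs_tauHat_le_one hn2 x j k
    have h2 := abs_popTau_le_one (normalLaw S) j k
    linarith [abs_sub (tauHat x j k) T]
  obtain ⟨u2, u4⟩ := hS.integral_rhoU_sub_pow_le (n := n) j k hm hmn rfl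
  obtain ⟨t2, t4⟩ := integral_tauHat_sub_pow_le hn2 S j k hm (by omega) rfl
  -- both even powers are convex
  have gen : ∀ e : ℕ, Even e → ∀ c : ℝ, ∫ x, (U x - R) ^ e
        ∂(Measure.pi fun _ : Fin n => normalLaw S) ≤ c →
      ∫ x : Fin n → Fin d → ℝ, (tauHat x j k - T) ^ e
        ∂(Measure.pi fun _ : Fin n => normalLaw S) ≤ c →
      ∫ x : Fin n → Fin d → ℝ, (rhoHat x j k - meanRho n S j k) ^ e
        ∂(Measure.pi fun _ : Fin n => normalLaw S) ≤ c := by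
    intro e he c hc1 hc2
    have I1 : Integrable (fun x => (U x - R) ^ e) (Measure.pi fun _ : Fin n => normalLaw S) :=
      integrable_of_bounded ((mU.sub_const R).pow_const e) (C := 6 ^ e) fun x => by
        rw [abs_pow]; exact pow_le_pow_left₀ (abs_nonneg _) (bU x) e
    have I2 : Integrable (fun x : Fin n → Fin d → ℝ => (tauHat x j k - T) ^ e)
        (Measure.pi fun _ : Fin n => normalLaw S) :=
      integrable_of_bounded (((measurable_tauHat hn2 j k).sub_const T).pow_const e) (C := 2 ^ e)
        fun x => by rw [abs_pow]; exact pow_le_pow_left₀ (abs_nonneg _) (bT x) e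
    calc _ ≤ ∫ x : Fin n → Fin d → ℝ, (p * (U x - R) ^ e + q * (tauHat x j k - T) ^ e)
          ∂(Measure.pi fun _ : Fin n => normalLaw S) := by
          refine integral_mono_of_nonneg (Filter.Eventually.of_forall fun _ => he.pow_nonneg _)
            ((I1.const_mul p).add (I2.const_mul q)) ?_
          filter_upwards [hS.ae_injective n] with x hx
          have e1 : rhoHat x j k - meanRho n S j k = p * (U x - R) + q * (tauHat x j k - T) := by
            rw [rhoHat_eq hn2 (hx j) (hx k), meanRho, ← hp, ← hq]; ring
          rw [e1]
          exact he.convexOn_pow.2 (Set.mem_univ _) (Set.mem_univ _) hp0 hq0 hpq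
      _ = p * (∫ x, (U x - R) ^ e ∂(Measure.pi fun _ : Fin n => normalLaw S)) +
          q * ∫ x : Fin n → Fin d → ℝ, (tauHat x j k - T) ^ e
            ∂(Measure.pi fun _ : Fin n => normalLaw S) := by
          rw [integral_add (I1.const_mul p) (I2.const_mul q), integral_const_mul,
            integral_const_mul]
      _ ≤ p * c + q * c := by gcongr
      _ = c := by rw [← add_mul, hpq, one_mul]
  exact ⟨gen 2 even_two v (u2.trans (hv _ (Or.inl rfl))) (t2.trans (hv _ (Or.inr rfl))),
    gen 4 (even_two_mul 2) w (u4.trans (hw _ (Or.inl rfl))) (t4.trans (hw _ (Or.inr rfl)))⟩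

/-- The mean square error of linearising `sin` at the mean of Spearman's rho: second-order
expansion, with second and fourth moments from `n / 3` independent triples. -/
theorem integral_sinDefect_rhoHat_sub_le (hS : IsCorrelationMatrix S) (hn : 3 ≤ n) (j k : Fin d) :
    ∫ x : Fin n → Fin d → ℝ, (sinDefect (Real.pi / 6 * rhoHat x j k) -
        sinDefect (Real.pi / 6 * meanRho n S j k)) ^ 2
        ∂(Measure.pi fun _ : Fin n => normalLaw S) ≤
      (Real.pi / 18 / √((3 * (n / 3) : ℕ) : ℝ) * |S j k| +
        Real.pi ^ 2 * √3 / 72 / ((3 * (n / 3) : ℕ) : ℝ)) ^ 2 := by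
  have hpi := Real.pi_pos
  have ha : ∀ u : ℝ, |u| ≤ 1 → |Real.pi / 6 * u| ≤ Real.pi / 6 := fun u hu => by
    rw [abs_mul, abs_of_pos (by positivity : (0 : ℝ) < Real.pi / 6)]
    exact mul_le_of_le_one_right (by positivity) hu
  obtain ⟨m, hm⟩ : ∃ m, m = n / 3 := ⟨_, rfl⟩
  have hm1 : 1 ≤ m := by omega
  have hmR : (1 : ℝ) ≤ m := by exact_mod_cast hm1
  have hm0 : (0 : ℝ) < m := by linarith
  rw [← hm]
  push_cast
  have hS1 := hS.abs_apply_le_one j k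
  have hR := (hS.abs_popRho_le_abs_apply j k).trans hS1
  have hT := abs_popTau_le_one (normalLaw S) j k
  have hM := hS.abs_meanRho_le (n := n) (by omega) j k
  have hθ : ∀ θ, θ = popRho (normalLaw S) j k ∨ θ = popTau (normalLaw S) j k →
      |θ| ≤ 1 ∧ 2 / Real.pi * |S j k| ≤ |θ| := by
    rintro θ (rfl | rfl)
    · exact ⟨hR, hS.mul_abs_apply_le_abs_popRho j k⟩
    · exact ⟨hT, hS.mul_abs_apply_le_abs_popTau j k⟩
  obtain ⟨v2, v4⟩ := hS.integral_rhoHat_sub_pow_le hn j k (v := (1 / √(m : ℝ)) ^ 2)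
    (w := (√3 * (1 - 0.188 * |S j k| ^ 2) / m) ^ 2) hm1 (by omega)
    (fun θ _ => by
      rw [div_pow, one_pow, Real.sq_sqrt hm0.le]
      gcongr
      linarith [sq_nonneg θ])
    (fun θ h => fourth_moment_le (hθ θ h).1 (abs_nonneg _) (hθ θ h).2 hmR)
  set M := meanRho n S j k with hMdef
  have hw : 0 ≤ 1 - 0.188 * |S j k| ^ 2 := by nlinarith [abs_nonneg (S j k)]
  have hcos : 0 ≤ 1 - Real.cos (Real.pi / 6 * M) := sub_nonneg.2 (Real.cos_le_one _)
  have haM := ha M (hM.trans hS1)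
  have hB : 0 ≤ Real.sin (|Real.pi / 6 * M| + (Real.pi / 6 - |Real.pi / 6 * M|) / 3) :=
    Real.sin_nonneg_of_nonneg_of_le_pi (by linarith [abs_nonneg (Real.pi / 6 * M)]) (by linarith)
  have hb : ∀ x : Fin n → Fin d → ℝ, |rhoHat x j k - M| ≤ 2 := fun x => by
    have h1 := abs_sub (rhoHat x j k) M
    linarith [abs_rhoHat_le_one x j k]
  have key := integral_sq_le_of_abs_le_quadratic (P := Measure.pi fun _ : Fin n => normalLaw S)
    (G := fun x => sinDefect (Real.pi / 6 * rhoHat x j k) - sinDefect (Real.pi / 6 * M))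
    (X := fun x => rhoHat x j k - M)
    (A := (1 - Real.cos (Real.pi / 6 * M)) * (Real.pi / 6))
    (B := Real.sin (|Real.pi / 6 * M| + (Real.pi / 6 - |Real.pi / 6 * M|) / 3) / 2 *
      (Real.pi / 6) ^ 2)
    ((measurable_rhoHat j k).sub_const M) hb (by positivity) (by positivity)
    (by positivity) (by positivity) ?_ v2 v4
  · refine key.trans (pow_le_pow_left₀ (by positivity) ?_ 2)
    refine rho_remainder_le (abs_nonneg _) hS1 ?_ hmR
    rw [abs_mul, abs_of_pos (by positivity : (0 : ℝ) < Real.pi / 6)]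
    gcongr
  · refine Filter.Eventually.of_forall fun x => ?_
    have h := abs_sinDefect_sub_le_quadratic (a := Real.pi / 6 * M)
      (b := Real.pi / 6 * rhoHat x j k) haM (ha _ (abs_rhoHat_le_one x j k)) (by linarith)
    rw [← mul_sub, abs_mul (Real.pi / 6) (rhoHat x j k - M),
      abs_of_pos (by positivity : (0 : ℝ) < Real.pi / 6), mul_pow] at h
    refine h.trans_eq ?_
    ring

/-- On the diagonal there is no fluctuation: the sample value of Spearman's rho is almost surely
one. -/
theorem integral_sinDefect_rhoHat_sub_self_le (hS : IsCorrelationMatrix S) (hn : 3 ≤ n)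
    (j : Fin d) : ∫ x : Fin n → Fin d → ℝ, (sinDefect (Real.pi / 6 * rhoHat x j j) -
        sinDefect (Real.pi / 6 * meanRho n S j j)) ^ 2
        ∂(Measure.pi fun _ : Fin n => normalLaw S) ≤ 0 := by
  have hM := (hS.abs_meanRho_le (n := n) (by omega) j j).trans (hS.abs_apply_le_one j j)
  obtain ⟨v2, v4⟩ := hS.integral_rhoHat_sub_pow_le (n := n) hn j j (m := 1) (v := 0) (w := 0)
    one_pos (by omega) (by simp [hS.popRho_self, hS.popTau_self])
    (by simp [hS.popRho_self, hS.popTau_self])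
  set M := meanRho n S j j with hMdef
  have hb : ∀ x : Fin n → Fin d → ℝ, |rhoHat x j j - M| ≤ 2 := fun x => by
    have h1 := abs_sub (rhoHat x j j) M
    linarith [abs_rhoHat_le_one x j j]
  have hpi := Real.pi_pos
  have key := integral_sq_le_of_abs_le_quadratic (P := Measure.pi fun _ : Fin n => normalLaw S)
    (G := fun x => sinDefect (Real.pi / 6 * rhoHat x j j) - sinDefect (Real.pi / 6 * M))
    (X := fun x => rhoHat x j j - M) (A := 2 * (Real.pi / 6)) (B := 0) (e₂ := 0) (e₄ := 0)
    ((measurable_rhoHat j j).sub_const M) hb (by positivity) le_rfl le_rfl le_rfl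
    (Filter.Eventually.of_forall fun x => ?_) (by simpa using v2) (by simpa using v4)
  · simpa using key
  · have h := abs_sinDefect_sub_le (Real.pi / 6 * M) (Real.pi / 6 * rhoHat x j j)
    rw [← mul_sub, abs_mul, abs_of_pos (by positivity : (0 : ℝ) < Real.pi / 6)] at h
    linarith

end IsCorrelationMatrix

end GaussianCopula

end

/-! ### Spectral error of the correlation estimators -/

noncomputable section

namespace GaussianCopula

variable {n d : ℕ} {S : Matrix (Fin d) (Fin d) ℝ}

/-- Minkowski's inequality in the Frobenius norm, for a matrix of variances that vanish on the
diagonal; this is why only the off-diagonal part `frobNorm S ^ 2 - d` enters. -/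
theorem IsCorrelationMatrix.sqrt_sum_le (hS : IsCorrelationMatrix S) {V : Fin d → Fin d → ℝ}
    {a b : ℝ} (ha : 0 ≤ a) (hb : 0 ≤ b) (hV : ∀ j k, V j k ≤ (a * |S j k| + b) ^ 2)
    (hV0 : ∀ j, V j j ≤ 0) :
    √(∑ j, ∑ k, V j k) ≤ a * √(frobNorm S ^ 2 - d) + b * d := by
  set s : Fin d → Fin d → ℝ := fun j k => if j = k then 0 else |S j k| with hs
  set N := ∑ j, ∑ k, s j k ^ 2 with hN
  have hN0 : 0 ≤ N := Finset.sum_nonneg fun _ _ => Finset.sum_nonneg fun _ _ => sq_nonneg _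
  have hNe : frobNorm S ^ 2 - d = N := by
    have e : ∀ j k, s j k ^ 2 = S j k ^ 2 - if j = k then 1 else 0 := fun j k => by
      simp only [hs]
      split_ifs with h
      · rw [h, hS.diag_eq_one]; norm_num
      · rw [sq_abs, sub_zero]
    simp only [hN, e, frobNorm_sq, Finset.sum_sub_distrib, Finset.sum_ite_eq, Finset.mem_univ,
      if_true, Finset.sum_const, Finset.card_univ, Fintype.card_fin, nsmul_eq_mul, mul_one]
  have hVs : ∀ j k, V j k ≤ (a * s j k + b) ^ 2 := fun j k => by
    simp only [hs]
    split_ifs with h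
    · subst h; exact (hV0 j).trans (sq_nonneg _)
    · exact hV j k
  have hM : ∑ j, ∑ k, s j k ≤ d * √N := by
    have h := Finset.sum_mul_sq_le_sq_mul_sq (Finset.univ : Finset (Fin d × Fin d))
      (fun p => s p.1 p.2) (fun _ => 1)
    rw [Fintype.sum_prod_type, Fintype.sum_prod_type] at h
    simp only [mul_one, one_pow, Finset.sum_const, Finset.card_univ, Fintype.card_prod,
      Fintype.card_fin, nsmul_eq_mul, Nat.cast_mul] at h
    refine (le_abs_self _).trans (abs_le_of_sq_le_sq ?_ (by positivity))
    rw [mul_pow, Real.sq_sqrt hN0]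
    linarith
  rw [hNe]
  refine Real.sqrt_le_iff.2 ⟨by positivity, ?_⟩
  calc ∑ j, ∑ k, V j k ≤ ∑ j, ∑ k, (a * s j k + b) ^ 2 :=
        Finset.sum_le_sum fun j _ => Finset.sum_le_sum fun k _ => hVs j k
    _ = a ^ 2 * N + 2 * a * b * (∑ j, ∑ k, s j k) + b ^ 2 * d ^ 2 := by
        simp only [add_sq, mul_pow, Finset.sum_add_distrib, Finset.mul_sum, hN, Finset.sum_const,
          Finset.card_univ, Fintype.card_fin, nsmul_eq_mul]
        have e : ∀ j k, 2 * (a * s j k) * b = 2 * a * b * s j k := fun j k => by ring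
        simp only [e]
        ring
    _ ≤ a ^ 2 * N + 2 * a * b * (d * √N) + b ^ 2 * d ^ 2 := by gcongr
    _ = (a * √N + b * d) ^ 2 := by
        have := Real.sq_sqrt hN0
        linear_combination (-a ^ 2) * this

namespace IsCorrelationMatrix

/-- The sine transform of Kendall's tau is its linearisation minus the increment of `sinDefect`,
which is bounded in Frobenius norm. -/
theorem integral_specNorm_sigmaTau_sub_le (hS : IsCorrelationMatrix S) (hn : 2 ≤ n) :
    ∫ x : Fin n → Fin d → ℝ, specNorm (sigmaTau x - S)
        ∂(Measure.pi fun _ : Fin n => normalLaw S) ≤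
      Real.pi / 2 * (∫ x : Fin n → Fin d → ℝ, specNorm (tauHat x - popTau (normalLaw S))
        ∂(Measure.pi fun _ : Fin n => normalLaw S)) +
      Real.pi / 2 * √((frobNorm S ^ 2 - (d : ℝ)) / ((2 * (n / 2) : ℕ) : ℝ)) +
      Real.pi ^ 2 * √3 * (d : ℝ) / (8 * ((2 * (n / 2) : ℕ) : ℝ)) := by
  have hpi := Real.pi_pos
  set μ := Measure.pi fun _ : Fin n => normalLaw S with hμ
  set T := popTau (normalLaw S) with hT
  set N : ℝ := ((2 * (n / 2) : ℕ) : ℝ) with hN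
  have hN0 : 0 ≤ N := Nat.cast_nonneg _
  set G : (Fin n → Fin d → ℝ) → Matrix (Fin d) (Fin d) ℝ := fun x => Matrix.of fun j k =>
    sinDefect (Real.pi / 2 * tauHat x j k) - sinDefect (Real.pi / 2 * T j k) with hG
  have mG : ∀ j k, Measurable fun x => G x j k := fun j k =>
    (measurable_sinDefect.comp ((measurable_tauHat hn j k).const_mul _)).sub_const _
  have bτ : ∀ (x : Fin n → Fin d → ℝ) j k, |tauHat x j k - T j k| ≤ 2 := fun x j k => by
    have h1 := abs_sub (tauHat x j k) (T j k)
    linarith [abs_tauHat_le_one hn x j k, abs_popTau_le_one (normalLaw S) j k]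
  have bG : ∀ x j k, |G x j k| ≤ 2 * (Real.pi / 2 * 2) := fun x j k => by
    refine (abs_sinDefect_sub_le _ _).trans ?_
    rw [← mul_sub, abs_mul, abs_of_pos (by positivity : (0 : ℝ) < Real.pi / 2)]
    gcongr
    exact bτ x j k
  have IG : Integrable (fun x => specNorm (G x)) μ := integrable_specNorm mG bG
  have IT : Integrable (fun x : Fin n → Fin d → ℝ => specNorm (tauHat x - T)) μ :=
    integrable_specNorm (fun j k => (measurable_tauHat hn j k).sub_const _) bτ
  have hGint : ∫ x, specNorm (G x) ∂μ ≤
      Real.pi / 2 / √N * √(frobNorm S ^ 2 - d) + Real.pi ^ 2 * √3 / 8 / N * d :=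
    (integral_specNorm_le_sqrt mG bG (V := fun j k => ∫ x, G x j k ^ 2 ∂μ)
      fun j k => le_rfl).trans (hS.sqrt_sum_le (by positivity) (by positivity)
        (hS.integral_sinDefect_tauHat_sub_le hn) (hS.integral_sinDefect_tauHat_sub_self_le hn))
  have hsplit : ∫ x : Fin n → Fin d → ℝ, specNorm (sigmaTau x - S) ∂μ ≤
      Real.pi / 2 * (∫ x : Fin n → Fin d → ℝ, specNorm (tauHat x - T) ∂μ) +
        ∫ x, specNorm (G x) ∂μ := by
    rw [← integral_const_mul, ← integral_add (IT.const_mul _) IG]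
    refine integral_mono_of_nonneg (Filter.Eventually.of_forall fun _ => specNorm_nonneg _)
      ((IT.const_mul _).add IG) (Filter.Eventually.of_forall fun x => ?_)
    have e : sigmaTau x - S = (Real.pi / 2) • (tauHat x - T) + (-1 : ℝ) • G x := by
      ext j k
      have h := abs_le.1 (hS.abs_apply_le_one j k)
      have e1 : S j k = Real.sin (Real.pi / 2 * T j k) := by
        rw [hS.pi_div_two_mul_popTau, Real.sin_arcsin h.1 h.2]
      simp only [sigmaTau, hG, Matrix.sub_apply, Matrix.add_apply, Matrix.smul_apply,
        Matrix.of_apply, smul_eq_mul, sinDefect]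
      rw [e1]
      ring
    beta_reduce
    rw [e]
    refine (specNorm_add_le _ _).trans_eq ?_
    rw [specNorm_smul, specNorm_smul, abs_of_pos (by positivity : (0 : ℝ) < Real.pi / 2), abs_neg,
      abs_one, one_mul]
  refine hsplit.trans ?_
  rw [Real.sqrt_div' _ hN0]
  calc _ ≤ _ + (Real.pi / 2 / √N * √(frobNorm S ^ 2 - d) + Real.pi ^ 2 * √3 / 8 / N * d) := by
        gcongr
    _ = _ := by rw [div_div]; ring

/-- The sine transform of Spearman's rho is its linearisation minus the increment of `sinDefect`.
This increment is split at the mean of the statistic: the fluctuation is bounded by its moments, and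
the bias gives the last term. -/
theorem integral_specNorm_sigmaRho_sub_le (hS : IsCorrelationMatrix S) (hn : 3 ≤ n) :
    ∫ x : Fin n → Fin d → ℝ, specNorm (sigmaRho x - S)
        ∂(Measure.pi fun _ : Fin n => normalLaw S) ≤
      Real.pi / 3 * (∫ x : Fin n → Fin d → ℝ, specNorm (rhoHat x - popRho (normalLaw S))
        ∂(Measure.pi fun _ : Fin n => normalLaw S)) +
      Real.pi / 9 * √((frobNorm S ^ 2 - (d : ℝ)) / ((3 * (n / 3) : ℕ) : ℝ)) +
      Real.pi ^ 2 * √3 * (d : ℝ) / (36 * ((3 * (n / 3) : ℕ) : ℝ)) +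
      2 * Real.pi * frobNorm S / (3 * (n : ℝ)) := by
  have hpi := Real.pi_pos
  set μ := Measure.pi fun _ : Fin n => normalLaw S with hμ
  set R := popRho (normalLaw S) with hR
  set N : ℝ := ((3 * (n / 3) : ℕ) : ℝ) with hN
  have hN0 : 0 ≤ N := Nat.cast_nonneg _
  set G : (Fin n → Fin d → ℝ) → Matrix (Fin d) (Fin d) ℝ := fun x => Matrix.of fun j k =>
    sinDefect (Real.pi / 6 * rhoHat x j k) - sinDefect (Real.pi / 6 * meanRho n S j k) with hG
  set H : Matrix (Fin d) (Fin d) ℝ := Matrix.of fun j k =>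
    sinDefect (Real.pi / 6 * meanRho n S j k) - sinDefect (Real.pi / 6 * R j k) with hH
  have mG : ∀ j k, Measurable fun x => G x j k := fun j k =>
    (measurable_sinDefect.comp ((measurable_rhoHat j k).const_mul _)).sub_const _
  have bG : ∀ x j k, |G x j k| ≤ 2 * (Real.pi / 6 * 2) := fun x j k => by
    refine (abs_sinDefect_sub_le _ _).trans ?_
    rw [← mul_sub, abs_mul, abs_of_pos (by positivity : (0 : ℝ) < Real.pi / 6)]
    have h1 := abs_sub (rhoHat x j k) (meanRho n S j k)
    have h2 := (hS.abs_meanRho_le (n := n) (by omega) j k).trans (hS.abs_apply_le_one j k)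
    have h3 := abs_rhoHat_le_one x j k
    gcongr
    linarith
  have IG : Integrable (fun x => specNorm (G x)) μ := integrable_specNorm mG bG
  have IR : Integrable (fun x : Fin n → Fin d → ℝ => specNorm (rhoHat x - R)) μ :=
    integrable_specNorm (C := 4) (fun j k => (measurable_rhoHat j k).sub_const _) fun x j k => by
      have h1 := abs_sub (rhoHat x j k) (R j k)
      rw [Matrix.sub_apply]
      linarith [abs_rhoHat_le_one x j k, abs_popRho_le (normalLaw S) j k]
  have hGint : ∫ x, specNorm (G x) ∂μ ≤
      Real.pi / 18 / √N * √(frobNorm S ^ 2 - d) + Real.pi ^ 2 * √3 / 72 / N * d :=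
    (integral_specNorm_le_sqrt mG bG (V := fun j k => ∫ x, G x j k ^ 2 ∂μ)
      fun j k => le_rfl).trans (hS.sqrt_sum_le (by positivity) (by positivity)
        (hS.integral_sinDefect_rhoHat_sub_le hn) (hS.integral_sinDefect_rhoHat_sub_self_le hn))
  have hHnorm : specNorm H ≤ Real.pi / 3 / n * frobNorm S := by
    refine (specNorm_le_frobNorm _).trans ((sq_le_sq₀ (frobNorm_nonneg _)
      (mul_nonneg (by positivity) (frobNorm_nonneg S))).1 ?_)
    rw [mul_pow, frobNorm_sq, frobNorm_sq, Finset.mul_sum]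
    refine Finset.sum_le_sum fun j _ => ?_
    rw [Finset.mul_sum]
    refine Finset.sum_le_sum fun k _ => ?_
    rw [← mul_pow, ← sq_abs, ← sq_abs (_ * S j k)]
    refine pow_le_pow_left₀ (abs_nonneg _) ?_ 2
    refine (abs_sinDefect_sub_le _ _).trans ?_
    rw [← mul_sub, abs_mul, abs_mul, abs_of_pos (by positivity : (0 : ℝ) < Real.pi / 6),
      abs_of_nonneg (by positivity : (0 : ℝ) ≤ Real.pi / 3 / n)]
    have h := hS.abs_meanRho_sub_popRho_le (n := n) (by omega) j k
    calc 2 * (Real.pi / 6 * |meanRho n S j k - R j k|) ≤ 2 * (Real.pi / 6 * (|S j k| / n)) := by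
          gcongr
      _ = _ := by ring
  have hsplit : ∫ x : Fin n → Fin d → ℝ, specNorm (sigmaRho x - S) ∂μ ≤
      Real.pi / 3 * (∫ x : Fin n → Fin d → ℝ, specNorm (rhoHat x - R) ∂μ) +
        2 * (∫ x, specNorm (G x) ∂μ) + 2 * specNorm H := by
    have I1 : Integrable (fun x : Fin n → Fin d → ℝ =>
        Real.pi / 3 * specNorm (rhoHat x - R) + 2 * specNorm (G x)) μ :=
      (IR.const_mul _).add (IG.const_mul _)
    have e : ∫ x : Fin n → Fin d → ℝ, (Real.pi / 3 * specNorm (rhoHat x - R) +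
        2 * specNorm (G x) + 2 * specNorm H) ∂μ =
        Real.pi / 3 * (∫ x : Fin n → Fin d → ℝ, specNorm (rhoHat x - R) ∂μ) +
        2 * (∫ x, specNorm (G x) ∂μ) + 2 * specNorm H := by
      rw [integral_add I1 (integrable_const _), integral_add (IR.const_mul _) (IG.const_mul _),
        integral_const_mul, integral_const_mul]
      simp
    rw [← e]
    refine integral_mono_of_nonneg (Filter.Eventually.of_forall fun _ => specNorm_nonneg _)
      (I1.add (integrable_const _)) (Filter.Eventually.of_forall fun x => ?_)
    have e : sigmaRho x - S =
        ((Real.pi / 3) • (rhoHat x - R) + (-2 : ℝ) • G x) + (-2 : ℝ) • H := by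
      ext j k
      have h := abs_le.1 (hS.abs_apply_le_one j k)
      have e1 : S j k = 2 * Real.sin (Real.pi / 6 * R j k) := by
        rw [hS.pi_div_six_mul_popRho, Real.sin_arcsin (by linarith [h.1]) (by linarith [h.2])]
        ring
      simp only [sigmaRho, hG, hH, Matrix.sub_apply, Matrix.add_apply, Matrix.smul_apply,
        Matrix.of_apply, smul_eq_mul, sinDefect]
      rw [e1]
      ring
    beta_reduce
    rw [e]
    refine (specNorm_add_le _ _).trans (add_le_add ((specNorm_add_le _ _).trans_eq ?_) ?_)
    · rw [specNorm_smul, specNorm_smul, abs_of_pos (by positivity : (0 : ℝ) < Real.pi / 3), abs_neg,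
        abs_two]
    · rw [specNorm_smul, abs_neg, abs_two]
  refine hsplit.trans ?_
  rw [Real.sqrt_div' _ hN0]
  calc _ ≤ _ + 2 * (Real.pi / 18 / √N * √(frobNorm S ^ 2 - d) + Real.pi ^ 2 * √3 / 72 / N * d) +
        2 * (Real.pi / 3 / n * frobNorm S) := by
        gcongr
    _ = _ := by
        rw [mul_comm (3 : ℝ) (n : ℝ), mul_comm (36 : ℝ) N, ← div_div, ← div_div]
        ring

end IsCorrelationMatrix

end GaussianCopula

end

/-! ### Reduction to normal marginals -/

noncomputable section

namespace GaussianCopula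

variable {n d : ℕ} {S : Matrix (Fin d) (Fin d) ℝ}

theorem sign_strictMono_sub {g : ℝ → ℝ} (hg : StrictMono g) (a b : ℝ) :
    Real.sign (g a - g b) = Real.sign (a - b) := by
  rcases lt_trichotomy a b with h | rfl | h
  · rw [Real.sign_of_neg (sub_neg.2 h), Real.sign_of_neg (sub_neg.2 (hg h))]
  · simp
  · rw [Real.sign_of_pos (sub_pos.2 h), Real.sign_of_pos (sub_pos.2 (hg h))]

theorem tauHat_comp {f : Fin d → ℝ → ℝ} (hf : ∀ j, StrictMono (f j)) (x : Fin n → Fin d → ℝ) :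
    tauHat (fun i j => f j (x i j)) = tauHat x := by
  ext j k
  simp only [tauHat, Matrix.of_apply, sign_strictMono_sub (hf _)]

theorem rhoHat_comp {f : Fin d → ℝ → ℝ} (hf : ∀ j, StrictMono (f j)) (x : Fin n → Fin d → ℝ) :
    rhoHat (fun i j => f j (x i j)) = rhoHat x := by
  have h : ∀ i j, centredRank (fun i j => f j (x i j)) i j = centredRank x i j := fun i j => by
    simp only [centredRank, rank, (hf j).le_iff_le]
  ext j k
  simp only [rhoHat, Matrix.of_apply, h]

theorem measurable_copula {f : Fin d → ℝ → ℝ} (hf : ∀ j, StrictMono (f j)) :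
    Measurable fun (x : Fin d → ℝ) j => f j (x j) :=
  measurable_pi_lambda _ fun j => (hf j).monotone.measurable.comp (measurable_pi_apply j)

theorem isProbabilityMeasure_copulaLaw {f : Fin d → ℝ → ℝ} (hf : ∀ j, StrictMono (f j)) :
    IsProbabilityMeasure (copulaLaw S f) := by
  rw [copulaLaw_eq_map hf]
  exact Measure.isProbabilityMeasure_map (measurable_copula hf).aemeasurable

theorem popTau_copulaLaw {f : Fin d → ℝ → ℝ} (hf : ∀ j, StrictMono (f j)) :
    popTau (copulaLaw S f) = popTau (normalLaw S) := by
  have mf := measurable_copula hf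
  ext j k
  simp only [popTau, Matrix.of_apply]
  rw [copulaLaw_eq_map hf, Measure.map_prod_map _ _ mf mf, integral_map (mf.prodMap mf).aemeasurable
    (measurable_sign_mul_sign (by fun_prop) (by fun_prop)).aestronglyMeasurable]
  simp only [Prod.map_fst, Prod.map_snd, sign_strictMono_sub (hf _)]

theorem popRho_copulaLaw {f : Fin d → ℝ → ℝ} (hf : ∀ j, StrictMono (f j)) :
    popRho (copulaLaw S f) = popRho (normalLaw S) := by
  have mf := measurable_copula hf
  ext j k
  simp only [popRho, Matrix.of_apply]
  rw [copulaLaw_eq_map hf, Measure.map_prod_map _ _ mf mf,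
    Measure.map_prod_map _ _ mf (mf.prodMap mf),
    integral_map (mf.prodMap (mf.prodMap mf)).aemeasurable
    (measurable_sign_mul_sign (by fun_prop) (by fun_prop)).aestronglyMeasurable]
  simp only [Prod.map_fst, Prod.map_snd, sign_strictMono_sub (hf _)]

namespace IsCopulaSample

variable {Ω : Type*} [MeasurableSpace Ω] {P : Measure Ω}
  {f : Fin d → ℝ → ℝ} {Y : Fin n → Ω → Fin d → ℝ}

theorem aemeasurable (h : IsCopulaSample P S f Y) : AEMeasurable (fun ω i => Y i ω) P :=
  aemeasurable_pi_lambda _ fun i => (h.law i).aemeasurable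

theorem map_eq [IsProbabilityMeasure P] (h : IsCopulaSample P S f Y) :
    P.map (fun ω i => Y i ω) =
      (Measure.pi fun _ : Fin n => normalLaw S).map fun x i j => f j (x i j) := by
  have mf := measurable_copula h.strictMono
  have hp := isProbabilityMeasure_copulaLaw (S := S) h.strictMono
  rw [copulaLaw_eq_map h.strictMono] at hp
  rw [(iIndepFun_iff_map_fun_eq_pi_map fun i => (h.law i).aemeasurable).1 h.indep]
  simp_rw [(h.law _).map_eq, copulaLaw_eq_map h.strictMono]
  exact (Measure.pi_map_pi fun _ => mf.aemeasurable).symm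

/-- The law of a statistic that is invariant under strictly increasing transformations of the
coordinates does not depend on the marginals. -/
theorem integral_eq [IsProbabilityMeasure P] (h : IsCopulaSample P S f Y)
    {φ : (Fin n → Fin d → ℝ) → ℝ} (mφ : Measurable φ)
    (hφ : ∀ x : Fin n → Fin d → ℝ, φ (fun i j => f j (x i j)) = φ x) :
    ∫ ω, φ (fun i => Y i ω) ∂P = ∫ x, φ x ∂(Measure.pi fun _ : Fin n => normalLaw S) := by
  have mf : Measurable fun (x : Fin n → Fin d → ℝ) i j => f j (x i j) :=
    measurable_pi_lambda _ fun i => (measurable_copula h.strictMono).comp (measurable_pi_apply i)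
  rw [← integral_map h.aemeasurable mφ.aestronglyMeasurable, h.map_eq,
    integral_map mf.aemeasurable mφ.aestronglyMeasurable]
  simp_rw [hφ]

theorem integrable_specNorm [IsProbabilityMeasure P] (h : IsCopulaSample P S f Y)
    {W : (Fin n → Fin d → ℝ) → Matrix (Fin d) (Fin d) ℝ} (mW : ∀ j k, Measurable fun x => W x j k)
    {C : ℝ} (hC : ∀ x j k, |W x j k| ≤ C) :
    Integrable (fun ω => specNorm (W fun i => Y i ω)) P := by
  have hp : IsProbabilityMeasure (P.map fun ω i => Y i ω) :=
    Measure.isProbabilityMeasure_map h.aemeasurable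
  exact (GaussianCopula.integrable_specNorm (P := P.map fun ω i => Y i ω) mW hC).comp_aemeasurable
    h.aemeasurable

end IsCopulaSample

section Rates

variable {s F : ℝ}

/-- The dimensional rate dominates the covariance term. -/
theorem rate_le (hd : 1 ≤ d) (hn : 2 ≤ n) :
    √(((d : ℝ) + 1) / (3 * (n : ℝ))) + ((d : ℝ) + 1) / (n : ℝ) ≤
      2 * (√((d : ℝ) / n) + (d : ℝ) / n) := by
  have hd' : (1 : ℝ) ≤ d := by exact_mod_cast hd
  have hn' : (0 : ℝ) < n := by have : 0 < n := by omega
                               exact_mod_cast this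
  have h1 : √(((d : ℝ) + 1) / (3 * (n : ℝ))) ≤ √((d : ℝ) / n) := by
    refine Real.sqrt_le_sqrt ?_
    rw [div_le_div_iff₀ (by positivity) hn']
    nlinarith
  have h2 : ((d : ℝ) + 1) / n ≤ 2 * ((d : ℝ) / n) := by
    rw [← mul_div_assoc]
    gcongr
    linarith
  linarith [Real.sqrt_nonneg ((d : ℝ) / n)]

theorem sqrt_le_rate {X A B : ℝ} (hA : 0 ≤ A) (hB : 0 ≤ B)
    (h : X ≤ A ^ 2 + B ^ 2) : √X ≤ A + B :=
  Real.sqrt_le_iff.2 ⟨by positivity, by nlinarith [mul_nonneg hA hB]⟩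

theorem tau_bound_le_rate (hd : 1 ≤ d) (hn : 2 ≤ n) (hs : 1 ≤ s) (hF : F ^ 2 ≤ d * s) :
    √(2 * (d : ℝ) * max ((d : ℝ) - 2 * (n : ℝ)) 0 / ((n : ℝ) * ((n : ℝ) - 1)) +
        4 * (2 / Real.pi + 1) ^ 2 * F ^ 2 / (n : ℝ)) +
      10 * s * (√(((d : ℝ) + 1) / (3 * (n : ℝ))) + ((d : ℝ) + 1) / (n : ℝ)) ≤
    24 * s * (√((d : ℝ) / n) + (d : ℝ) / n) := by
  have hn' : (2 : ℝ) ≤ n := by exact_mod_cast hn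
  have hr := mul_le_mul_of_nonneg_left (rate_le hd hn) (by linarith : 0 ≤ 10 * s)
  set u := √((d : ℝ) / n) with hu
  have hu0 : 0 ≤ u := Real.sqrt_nonneg _
  have hu2 : (d : ℝ) / n = u ^ 2 := (Real.sq_sqrt (by positivity)).symm
  have hd0 : (0 : ℝ) ≤ d := Nat.cast_nonneg d
  have hc : (2 / Real.pi + 1) ^ 2 ≤ 2 ^ 2 := by
    have : 2 / Real.pi ≤ 1 := by rw [div_le_one Real.pi_pos]; linarith [Real.pi_gt_three]
    have := Real.pi_pos
    gcongr
    linarith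
  have h1 : 2 * (d : ℝ) * max ((d : ℝ) - 2 * (n : ℝ)) 0 / ((n : ℝ) * ((n : ℝ) - 1)) ≤
      (2 * u ^ 2) ^ 2 := by
    rw [← hu2, mul_pow, div_pow, div_le_iff₀ (by nlinarith)]
    have hm : max ((d : ℝ) - 2 * (n : ℝ)) 0 ≤ d := max_le (by linarith) hd0
    have e : 2 ^ 2 * ((d : ℝ) ^ 2 / n ^ 2) * (n * (n - 1)) = 4 * d ^ 2 * (n - 1) / n := by
      field_simp
      ring
    rw [e, le_div_iff₀ (by linarith)]
    calc 2 * (d : ℝ) * max ((d : ℝ) - 2 * (n : ℝ)) 0 * n ≤ 2 * d * d * n := by gcongr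
      _ ≤ 4 * d ^ 2 * (n - 1) := by nlinarith [mul_nonneg hd0 hd0]
  have h2 : 4 * (2 / Real.pi + 1) ^ 2 * F ^ 2 / (n : ℝ) ≤ (4 * s * u) ^ 2 := by
    calc 4 * (2 / Real.pi + 1) ^ 2 * F ^ 2 / (n : ℝ) ≤ 4 * 2 ^ 2 * (d * s) / n := by gcongr
      _ = 16 * s * (d / n) := by ring
      _ ≤ 16 * (s * s) * (d / n) := by gcongr; nlinarith
      _ = _ := by rw [hu2]; ring
  have h3 := sqrt_le_rate (by positivity) (by positivity) (add_le_add h1 h2)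
  rw [hu2] at hr ⊢
  nlinarith [mul_nonneg (sub_nonneg.2 hs) (sq_nonneg u)]

theorem rho_bound_le_rate (hd : 1 ≤ d) (hn : 2 ≤ n) (hs : 1 ≤ s) (hF0 : 0 ≤ F)
    (hF : F ^ 2 ≤ d * s) :
    √(6 * (d : ℝ) * ((d : ℝ) - 2 * (n : ℝ)) / ((n : ℝ) * ((n : ℝ) - 1)) +
        9 * (1 + √8 / Real.pi) ^ 2 * F ^ 2 / (n : ℝ)) +
      15 * s * (√(((d : ℝ) + 1) / (3 * (n : ℝ))) + ((d : ℝ) + 1) / (n : ℝ)) + F / (n : ℝ) ≤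
    37 * s * (√((d : ℝ) / n) + (d : ℝ) / n) ∧ F / n ≤ s * √((d : ℝ) / n) := by
  have hn' : (2 : ℝ) ≤ n := by exact_mod_cast hn
  have hr := mul_le_mul_of_nonneg_left (rate_le hd hn) (by linarith : 0 ≤ 15 * s)
  set u := √((d : ℝ) / n) with hu
  have hu0 : 0 ≤ u := Real.sqrt_nonneg _
  have hu2 : (d : ℝ) / n = u ^ 2 := (Real.sq_sqrt (by positivity)).symm
  have hd0 : (0 : ℝ) ≤ d := Nat.cast_nonneg d
  have hc : (1 + √8 / Real.pi) ^ 2 ≤ 2 ^ 2 := by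
    have h8 : √8 ≤ 3 := Real.sqrt_le_iff.2 ⟨by norm_num, by norm_num⟩
    have : √8 / Real.pi ≤ 1 := by rw [div_le_one Real.pi_pos]; linarith [Real.pi_gt_three]
    have := Real.pi_pos
    gcongr
    linarith
  have h1 : 6 * (d : ℝ) * ((d : ℝ) - 2 * (n : ℝ)) / ((n : ℝ) * ((n : ℝ) - 1)) ≤
      (4 * u ^ 2) ^ 2 := by
    rw [← hu2, mul_pow, div_pow, div_le_iff₀ (by nlinarith)]
    have e : 4 ^ 2 * ((d : ℝ) ^ 2 / n ^ 2) * (n * (n - 1)) = 16 * d ^ 2 * (n - 1) / n := by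
      field_simp
      ring
    rw [e, le_div_iff₀ (by linarith)]
    calc 6 * (d : ℝ) * ((d : ℝ) - 2 * (n : ℝ)) * n ≤ 6 * d * d * n := by gcongr; linarith
      _ ≤ 16 * d ^ 2 * (n - 1) := by nlinarith [mul_nonneg hd0 hd0]
  have h2 : 9 * (1 + √8 / Real.pi) ^ 2 * F ^ 2 / (n : ℝ) ≤ (6 * s * u) ^ 2 := by
    calc 9 * (1 + √8 / Real.pi) ^ 2 * F ^ 2 / (n : ℝ) ≤ 9 * 2 ^ 2 * (d * s) / n := by gcongr
      _ = 36 * s * (d / n) := by ring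
      _ ≤ 36 * (s * s) * (d / n) := by gcongr; nlinarith
      _ = _ := by rw [hu2]; ring
  have h3 := sqrt_le_rate (by positivity) (by positivity) (add_le_add h1 h2)
  have h4 : F / n ≤ s * u := by
    refine (sq_le_sq₀ (by positivity) (by positivity)).1 ?_
    calc (F / n) ^ 2 = F ^ 2 / n / n := by rw [div_pow]; field_simp
      _ ≤ d * s / n / 1 := by gcongr; linarith
      _ = s * (d / n) := by ring
      _ ≤ (s * s) * (d / n) := by gcongr; nlinarith
      _ = (s * u) ^ 2 := by rw [hu2]; ring
  rw [hu2] at hr ⊢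
  refine ⟨?_, h4⟩
  nlinarith [mul_nonneg (sub_nonneg.2 hs) (sq_nonneg u)]

/-- The terms of the sine transform, where `N` stands for the largest multiple of two or three up to
`n`. -/
theorem sqrt_offDiag_le_rate {N : ℝ} (hn : 2 ≤ n) (hs : 1 ≤ s)
    (hF : F ^ 2 ≤ d * s) (hN : (n : ℝ) ≤ 3 * N) :
    √((F ^ 2 - d) / N) ≤ 2 * s * √((d : ℝ) / n) ∧ (d : ℝ) / N ≤ 3 * (d / n) := by
  have hn' : (2 : ℝ) ≤ n := by exact_mod_cast hn
  have hN0 : 0 < N := by linarith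
  have hd0 : (0 : ℝ) ≤ d := Nat.cast_nonneg d
  have h1 : (d : ℝ) / N ≤ 3 * (d / n) := by
    rw [← mul_div_assoc, div_le_div_iff₀ hN0 (by linarith)]
    nlinarith
  refine ⟨Real.sqrt_le_iff.2 ⟨by positivity, ?_⟩, h1⟩
  rw [mul_pow, Real.sq_sqrt (by positivity)]
  calc (F ^ 2 - d) / N ≤ d * s / N := by gcongr; linarith
    _ = s * (d / N) := by ring
    _ ≤ s * (3 * (d / n)) := by gcongr
    _ ≤ (2 * s) ^ 2 * (d / n) := by
        have : 0 ≤ (d : ℝ) / n := by positivity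
        nlinarith [mul_nonneg (by nlinarith : 0 ≤ 4 * s ^ 2 - 3 * s) this]

end Rates

end GaussianCopula

end

/-! ### Integrability and the rate of convergence -/

noncomputable section

namespace GaussianCopula

variable {n d : ℕ} {S : Matrix (Fin d) (Fin d) ℝ}

theorem abs_sigmaTau_le_one (y : Fin n → Fin d → ℝ) (j k : Fin d) : |sigmaTau y j k| ≤ 1 :=
  Real.abs_sin_le_one _

theorem abs_sigmaRho_le_two (y : Fin n → Fin d → ℝ) (j k : Fin d) : |sigmaRho y j k| ≤ 2 := by
  rw [sigmaRho, Matrix.of_apply, abs_mul, abs_two]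
  linarith [Real.abs_sin_le_one (Real.pi / 6 * rhoHat y j k)]

theorem measurable_sigmaTau (hn : 2 ≤ n) (j k : Fin d) :
    Measurable fun y : Fin n → Fin d → ℝ => sigmaTau y j k :=
  Real.measurable_sin.comp ((measurable_tauHat hn j k).const_mul _)

theorem measurable_sigmaRho (j k : Fin d) :
    Measurable fun y : Fin n → Fin d → ℝ => sigmaRho y j k :=
  (Real.measurable_sin.comp ((measurable_rhoHat j k).const_mul _)).const_mul 2

namespace IsCopulaSample

variable {Ω : Type*} [MeasurableSpace Ω] {P : Measure Ω} [IsProbabilityMeasure P]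
  {f : Fin d → ℝ → ℝ} {Y : Fin n → Ω → Fin d → ℝ}

theorem integrable_errTau (h : IsCopulaSample P S f Y) (hn : 2 ≤ n) :
    Integrable (fun ω => errTau (copulaLaw S f) (fun i => Y i ω)) P := by
  have hp := isProbabilityMeasure_copulaLaw (S := S) h.strictMono
  refine h.integrable_specNorm (W := fun y => tauHat y - popTau (copulaLaw S f)) (C := 2)
    (fun j k => (measurable_tauHat hn j k).sub_const _) fun y j k => ?_
  rw [Matrix.sub_apply]
  linarith [abs_sub (tauHat y j k) (popTau (copulaLaw S f) j k), abs_tauHat_le_one hn y j k,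
    abs_popTau_le_one (copulaLaw S f) j k]

theorem integrable_errRho (h : IsCopulaSample P S f Y) :
    Integrable (fun ω => errRho (copulaLaw S f) (fun i => Y i ω)) P := by
  have hp := isProbabilityMeasure_copulaLaw (S := S) h.strictMono
  refine h.integrable_specNorm (W := fun y => rhoHat y - popRho (copulaLaw S f)) (C := 4)
    (fun j k => (measurable_rhoHat j k).sub_const _) fun y j k => ?_
  rw [Matrix.sub_apply]
  linarith [abs_sub (rhoHat y j k) (popRho (copulaLaw S f) j k), abs_rhoHat_le_one y j k,
    abs_popRho_le (copulaLaw S f) j k]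

theorem integrable_errSigmaTau (h : IsCopulaSample P S f Y) (hn : 2 ≤ n) :
    Integrable (fun ω => errSigmaTau S (fun i => Y i ω)) P := by
  refine h.integrable_specNorm (W := fun y => sigmaTau y - S) (C := 2)
    (fun j k => (measurable_sigmaTau hn j k).sub_const _) fun y j k => ?_
  rw [Matrix.sub_apply]
  linarith [abs_sub (sigmaTau y j k) (S j k), abs_sigmaTau_le_one y j k,
    h.corr.abs_apply_le_one j k]

theorem integrable_errSigmaRho (h : IsCopulaSample P S f Y) :
    Integrable (fun ω => errSigmaRho S (fun i => Y i ω)) P := by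
  refine h.integrable_specNorm (W := fun y => sigmaRho y - S) (C := 3)
    (fun j k => (measurable_sigmaRho j k).sub_const _) fun y j k => ?_
  rw [Matrix.sub_apply]
  linarith [abs_sub (sigmaRho y j k) (S j k), abs_sigmaRho_le_two y j k,
    h.corr.abs_apply_le_one j k]

theorem integral_errTau (h : IsCopulaSample P S f Y) (hn : 2 ≤ n) :
    ∫ ω, errTau (copulaLaw S f) (fun i => Y i ω) ∂P =
      ∫ x : Fin n → Fin d → ℝ, specNorm (tauHat x - popTau (normalLaw S))
        ∂(Measure.pi fun _ : Fin n => normalLaw S) := by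
  simp only [errTau, popTau_copulaLaw h.strictMono]
  exact h.integral_eq (φ := fun x => specNorm (tauHat x - popTau (normalLaw S)))
    (measurable_specNorm fun j k => (measurable_tauHat hn j k).sub_const _)
    fun x => by rw [tauHat_comp h.strictMono]

theorem integral_errRho (h : IsCopulaSample P S f Y) :
    ∫ ω, errRho (copulaLaw S f) (fun i => Y i ω) ∂P =
      ∫ x : Fin n → Fin d → ℝ, specNorm (rhoHat x - popRho (normalLaw S))
        ∂(Measure.pi fun _ : Fin n => normalLaw S) := by
  simp only [errRho, popRho_copulaLaw h.strictMono]
  exact h.integral_eq (φ := fun x => specNorm (rhoHat x - popRho (normalLaw S)))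
    (measurable_specNorm fun j k => (measurable_rhoHat j k).sub_const _)
    fun x => by rw [rhoHat_comp h.strictMono]

theorem integral_errSigmaTau (h : IsCopulaSample P S f Y) (hn : 2 ≤ n) :
    ∫ ω, errSigmaTau S (fun i => Y i ω) ∂P =
      ∫ x : Fin n → Fin d → ℝ, specNorm (sigmaTau x - S)
        ∂(Measure.pi fun _ : Fin n => normalLaw S) :=
  h.integral_eq (φ := fun x => specNorm (sigmaTau x - S))
    (measurable_specNorm fun j k => (measurable_sigmaTau hn j k).sub_const _)
    fun x => by simp only [sigmaTau, tauHat_comp h.strictMono]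

theorem integral_errSigmaRho (h : IsCopulaSample P S f Y) :
    ∫ ω, errSigmaRho S (fun i => Y i ω) ∂P =
      ∫ x : Fin n → Fin d → ℝ, specNorm (sigmaRho x - S)
        ∂(Measure.pi fun _ : Fin n => normalLaw S) :=
  h.integral_eq (φ := fun x => specNorm (sigmaRho x - S))
    (measurable_specNorm fun j k => (measurable_sigmaRho j k).sub_const _)
    fun x => by simp only [sigmaRho, rhoHat_comp h.strictMono]

end IsCopulaSample

namespace IsCorrelationMatrix

theorem integral_specNorm_tauHat_sub_le_rate (hS : IsCorrelationMatrix S) (hn : 2 ≤ n)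
    (hd : 1 ≤ d) :
    ∫ x : Fin n → Fin d → ℝ, specNorm (tauHat x - popTau (normalLaw S))
        ∂(Measure.pi fun _ : Fin n => normalLaw S) ≤
      24 * specNorm S * (√((d : ℝ) / n) + (d : ℝ) / n) :=
  (hS.integral_specNorm_tauHat_sub_le hn).trans
    (tau_bound_le_rate hd hn (hS.one_le_specNorm ⟨0, hd⟩) hS.frobNorm_sq_le)

theorem integral_specNorm_rhoHat_sub_le_rate (hS : IsCorrelationMatrix S) (hn : 2 ≤ n)
    (hd : 1 ≤ d) :
    ∫ x : Fin n → Fin d → ℝ, specNorm (rhoHat x - popRho (normalLaw S))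
        ∂(Measure.pi fun _ : Fin n => normalLaw S) ≤
      37 * specNorm S * (√((d : ℝ) / n) + (d : ℝ) / n) :=
  (hS.integral_specNorm_rhoHat_sub_le hn).trans
    (rho_bound_le_rate hd hn (hS.one_le_specNorm ⟨0, hd⟩) (frobNorm_nonneg S)
      hS.frobNorm_sq_le).1

theorem integral_specNorm_sigmaTau_sub_le_rate (hS : IsCorrelationMatrix S) (hn : 2 ≤ n)
    (hd : 1 ≤ d) :
    ∫ x : Fin n → Fin d → ℝ, specNorm (sigmaTau x - S)
        ∂(Measure.pi fun _ : Fin n => normalLaw S) ≤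
      49 * specNorm S * (√((d : ℝ) / n) + (d : ℝ) / n) := by
  have hs := hS.one_le_specNorm ⟨0, hd⟩
  have h := hS.integral_specNorm_sigmaTau_sub_le hn
  have hT := hS.integral_specNorm_tauHat_sub_le_rate hn hd
  have hN : (n : ℝ) ≤ 3 * ((2 * (n / 2) : ℕ) : ℝ) := by
    exact_mod_cast (by omega : n ≤ 3 * (2 * (n / 2)))
  generalize ((2 * (n / 2) : ℕ) : ℝ) = N at h hN
  obtain ⟨h1, h2⟩ := sqrt_offDiag_le_rate hn hs hS.frobNorm_sq_le hN
  refine h.trans ?_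
  have hE : 0 ≤ ∫ x : Fin n → Fin d → ℝ, specNorm (tauHat x - popTau (normalLaw S))
      ∂(Measure.pi fun _ : Fin n => normalLaw S) := integral_nonneg fun _ => specNorm_nonneg _
  have hdN : 0 ≤ (d : ℝ) / N := by
    refine div_nonneg (Nat.cast_nonneg d) ?_
    have : (0 : ℝ) ≤ n := Nat.cast_nonneg n
    linarith
  generalize ∫ x : Fin n → Fin d → ℝ, specNorm (tauHat x - popTau (normalLaw S))
    ∂(Measure.pi fun _ : Fin n => normalLaw S) = E at hT hE ⊢
  set u := √((d : ℝ) / n) with hu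
  have hu0 : 0 ≤ u := Real.sqrt_nonneg _
  have hv0 : 0 ≤ (d : ℝ) / n := by positivity
  set v := (d : ℝ) / n with hv
  have hp : Real.pi / 2 ≤ 1.6 := by linarith [Real.pi_lt_d2]
  have hp2 : Real.pi ^ 2 * √3 / 8 ≤ 3 := by
    have h3 : √3 ≤ 1.8 := Real.sqrt_le_iff.2 ⟨by norm_num, by norm_num⟩
    have : Real.pi ^ 2 * √3 ≤ 3.15 ^ 2 * 1.8 := by
      have := Real.pi_pos
      gcongr
      exact Real.pi_lt_d2.le
    linarith
  have hsu : 0 ≤ specNorm S * u := by positivity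
  have hsv : v ≤ specNorm S * v := le_mul_of_one_le_left hv0 hs
  calc _ = Real.pi / 2 * E + Real.pi / 2 * √((frobNorm S ^ 2 - (d : ℝ)) / N) +
      Real.pi ^ 2 * √3 / 8 * ((d : ℝ) / N) := by ring
    _ ≤ 1.6 * (24 * specNorm S * (u + v)) + 1.6 * (2 * specNorm S * u) + 3 * (3 * v) := by
        have : 0 ≤ 24 * specNorm S * (u + v) := by positivity
        gcongr
    _ ≤ _ := by linarith

theorem integral_specNorm_sigmaRho_sub_le_rate (hS : IsCorrelationMatrix S) (hn : 2 ≤ n)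
    (hd : 1 ≤ d) :
    ∫ x : Fin n → Fin d → ℝ, specNorm (sigmaRho x - S)
        ∂(Measure.pi fun _ : Fin n => normalLaw S) ≤
      49 * specNorm S * (√((d : ℝ) / n) + (d : ℝ) / n) := by
  have hs := hS.one_le_specNorm ⟨0, hd⟩
  have hF := (rho_bound_le_rate hd hn hs (frobNorm_nonneg S) hS.frobNorm_sq_le).2
  rcases hn.eq_or_lt with rfl | hn3
  · refine (hS.integral_specNorm_le_of_two fun x j k => ?_).trans
      ((mul_le_mul_of_nonneg_left (rate_le hd le_rfl) (by linarith)).trans ?_)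
    · rw [Matrix.sub_apply]
      linarith [abs_sub (sigmaRho x j k) (S j k), abs_sigmaRho_le_two x j k,
        hS.abs_apply_le_one j k]
    · have : 0 ≤ specNorm S * (√((d : ℝ) / (2 : ℕ)) + (d : ℝ) / (2 : ℕ)) := by positivity
      linarith
  have h := hS.integral_specNorm_sigmaRho_sub_le hn3
  have hT := hS.integral_specNorm_rhoHat_sub_le_rate hn hd
  have hN : (n : ℝ) ≤ 3 * ((3 * (n / 3) : ℕ) : ℝ) := by
    exact_mod_cast (by omega : n ≤ 3 * (3 * (n / 3)))
  generalize ((3 * (n / 3) : ℕ) : ℝ) = N at h hN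
  obtain ⟨h1, h2⟩ := sqrt_offDiag_le_rate hn hs hS.frobNorm_sq_le hN
  refine h.trans ?_
  have hE : 0 ≤ ∫ x : Fin n → Fin d → ℝ, specNorm (rhoHat x - popRho (normalLaw S))
      ∂(Measure.pi fun _ : Fin n => normalLaw S) := integral_nonneg fun _ => specNorm_nonneg _
  have hdN : 0 ≤ (d : ℝ) / N := by
    refine div_nonneg (Nat.cast_nonneg d) ?_
    have : (0 : ℝ) ≤ n := Nat.cast_nonneg n
    linarith
  generalize ∫ x : Fin n → Fin d → ℝ, specNorm (rhoHat x - popRho (normalLaw S))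
    ∂(Measure.pi fun _ : Fin n => normalLaw S) = E at hT hE ⊢
  set u := √((d : ℝ) / n) with hu
  have hu0 : 0 ≤ u := Real.sqrt_nonneg _
  have hv0 : 0 ≤ (d : ℝ) / n := by positivity
  set v := (d : ℝ) / n with hv
  have hp : Real.pi / 3 ≤ 1.05 := by linarith [Real.pi_lt_d2]
  have hp2 : Real.pi ^ 2 * √3 / 36 ≤ 1 := by
    have h3 : √3 ≤ 1.8 := Real.sqrt_le_iff.2 ⟨by norm_num, by norm_num⟩
    have : Real.pi ^ 2 * √3 ≤ 3.15 ^ 2 * 1.8 := by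
      have := Real.pi_pos
      gcongr
      exact Real.pi_lt_d2.le
    linarith
  have hsu : 0 ≤ specNorm S * u := by positivity
  have hsv : v ≤ specNorm S * v := le_mul_of_one_le_left hv0 hs
  calc _ = Real.pi / 3 * E + Real.pi / 3 / 3 * √((frobNorm S ^ 2 - (d : ℝ)) / N) +
      Real.pi ^ 2 * √3 / 36 * ((d : ℝ) / N) + 2 * (Real.pi / 3) * (frobNorm S / n) := by ring
    _ ≤ 1.05 * (37 * specNorm S * (u + v)) + 1.05 / 3 * (2 * specNorm S * u) + 1 * (3 * v) +
        2 * 1.05 * (specNorm S * u) := by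
        have h0 : 0 ≤ 37 * specNorm S * (u + v) := by positivity
        have h3 : 0 ≤ frobNorm S / n := div_nonneg (frobNorm_nonneg S) (Nat.cast_nonneg n)
        gcongr
    _ ≤ _ := by linarith

end IsCorrelationMatrix

end GaussianCopula

end

theorem mainTheorem2 :
    ∃ C₀ : ℝ, 0 < C₀ ∧
      ∀ (n d : ℕ) (Ω : Type*) [MeasurableSpace Ω] (P : Measure Ω) [IsProbabilityMeasure P]
        (S : Matrix (Fin d) (Fin d) ℝ) (f : Fin d → ℝ → ℝ) (Y : Fin n → Ω → Fin d → ℝ),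
        2 ≤ n → GaussianCopula.IsCopulaSample P S f Y →
        -- the four spectral errors are integrable
        (Integrable (fun ω => GaussianCopula.errTau (GaussianCopula.copulaLaw S f)
            (fun i => Y i ω)) P ∧
          Integrable (fun ω => GaussianCopula.errRho (GaussianCopula.copulaLaw S f)
            (fun i => Y i ω)) P ∧
          Integrable (fun ω => GaussianCopula.errSigmaTau S (fun i => Y i ω)) P ∧
          Integrable (fun ω => GaussianCopula.errSigmaRho S (fun i => Y i ω)) P) ∧
        -- the bound with the numerical constant, for the tau estimator
        ((∫ ω, GaussianCopula.errSigmaTau S (fun i => Y i ω) ∂P) +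
            (∫ ω, GaussianCopula.errTau (GaussianCopula.copulaLaw S f) (fun i => Y i ω) ∂P) +
            (∫ ω, GaussianCopula.errRho (GaussianCopula.copulaLaw S f) (fun i => Y i ω) ∂P) ≤
          C₀ * GaussianCopula.specNorm S * (√((d : ℝ) / n) + (d : ℝ) / n)) ∧
        -- the bound with the numerical constant, for the rho estimator
        ((∫ ω, GaussianCopula.errSigmaRho S (fun i => Y i ω) ∂P) +
            (∫ ω, GaussianCopula.errTau (GaussianCopula.copulaLaw S f) (fun i => Y i ω) ∂P) +
            (∫ ω, GaussianCopula.errRho (GaussianCopula.copulaLaw S f) (fun i => Y i ω) ∂P) ≤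
          C₀ * GaussianCopula.specNorm S * (√((d : ℝ) / n) + (d : ℝ) / n)) ∧
        -- explicit bounds for Kendall's tau
        ((∫ ω, GaussianCopula.errTau (GaussianCopula.copulaLaw S f) (fun i => Y i ω) ∂P) ≤
          √(2 * (d : ℝ) * max ((d : ℝ) - 2 * (n : ℝ)) 0 / ((n : ℝ) * ((n : ℝ) - 1)) +
              4 * (2 / Real.pi + 1) ^ 2 * GaussianCopula.frobNorm S ^ 2 / (n : ℝ)) +
            10 * GaussianCopula.specNorm S *
              (√(((d : ℝ) + 1) / (3 * (n : ℝ))) + ((d : ℝ) + 1) / (n : ℝ))) ∧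
        ((∫ ω, GaussianCopula.errSigmaTau S (fun i => Y i ω) ∂P) ≤
          Real.pi / 2 *
              (∫ ω, GaussianCopula.errTau (GaussianCopula.copulaLaw S f) (fun i => Y i ω) ∂P) +
            Real.pi / 2 *
              √((GaussianCopula.frobNorm S ^ 2 - (d : ℝ)) / ((2 * (n / 2) : ℕ) : ℝ)) +
            Real.pi ^ 2 * √3 * (d : ℝ) / (8 * ((2 * (n / 2) : ℕ) : ℝ))) ∧
        -- explicit bounds for Spearman's rho
        ((∫ ω, GaussianCopula.errRho (GaussianCopula.copulaLaw S f) (fun i => Y i ω) ∂P) ≤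
          √(6 * (d : ℝ) * ((d : ℝ) - 2 * (n : ℝ)) / ((n : ℝ) * ((n : ℝ) - 1)) +
              9 * (1 + √8 / Real.pi) ^ 2 * GaussianCopula.frobNorm S ^ 2 / (n : ℝ)) +
            15 * GaussianCopula.specNorm S *
              (√(((d : ℝ) + 1) / (3 * (n : ℝ))) + ((d : ℝ) + 1) / (n : ℝ)) +
            GaussianCopula.frobNorm S / (n : ℝ)) ∧
        (3 ≤ n →
          (∫ ω, GaussianCopula.errSigmaRho S (fun i => Y i ω) ∂P) ≤
            Real.pi / 3 *
                (∫ ω, GaussianCopula.errRho (GaussianCopula.copulaLaw S f) (fun i => Y i ω) ∂P) +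
              Real.pi / 9 *
                √((GaussianCopula.frobNorm S ^ 2 - (d : ℝ)) / ((3 * (n / 3) : ℕ) : ℝ)) +
              Real.pi ^ 2 * √3 * (d : ℝ) / (36 * ((3 * (n / 3) : ℕ) : ℝ)) +
              2 * Real.pi * GaussianCopula.frobNorm S / (3 * (n : ℝ))) := by
  refine ⟨110, by norm_num, ?_⟩
  intro n d Ω _ P _ S f Y hn h
  have hS := h.corr
  refine ⟨⟨h.integrable_errTau hn, h.integrable_errRho, h.integrable_errSigmaTau hn,
    h.integrable_errSigmaRho⟩, ?_⟩
  rw [h.integral_errTau hn, h.integral_errRho, h.integral_errSigmaTau hn, h.integral_errSigmaRho]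
  refine ⟨?_, ?_, hS.integral_specNorm_tauHat_sub_le hn, hS.integral_specNorm_sigmaTau_sub_le hn,
    hS.integral_specNorm_rhoHat_sub_le hn, hS.integral_specNorm_sigmaRho_sub_le⟩
  · rcases Nat.eq_zero_or_pos d with rfl | hd
    · simp [GaussianCopula.specNorm_eq_zero_of_dim_zero]
    · linarith [hS.integral_specNorm_tauHat_sub_le_rate hn hd,
        hS.integral_specNorm_rhoHat_sub_le_rate hn hd,
        hS.integral_specNorm_sigmaTau_sub_le_rate hn hd]
  · rcases Nat.eq_zero_or_pos d with rfl | hd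
    · simp [GaussianCopula.specNorm_eq_zero_of_dim_zero]
    · linarith [hS.integral_specNorm_tauHat_sub_le_rate hn hd,
        hS.integral_specNorm_rhoHat_sub_le_rate hn hd,
        hS.integral_specNorm_sigmaRho_sub_le_rate hn hd]
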